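/- **Conventions.** Let $q\ge 2$, $\epsilon=(-1)^q$, and let $\Lambda$ be a ring with $1$ and an involution $a\mapsto\bar a$ which is *weakly finite* ($\Lambda^n\cong\Lambda^n\oplus K$ implies $K=0$). Modules are left modules; $M^*=\mathrm{Hom}_\Lambda(M,\Lambda)$ with $(a\varphi)(x)=\varphi(x)\bar a$, and $M^{**}=M$ for f.g. free $M$. For $\theta\colon G\to G^*$, $\theta^*$ is the map $\theta^*(x)(y)=\overline{\theta(y)(x)}$. **Preformations.** Let $Q_{-\epsilon}(\Lambda)=\Lambda/\{b+\epsilon\bar b\}$. A *regular $\epsilon$-quadratic split preformation* $z=(F\xleftarrow{\gamma}G\xrightarrow{\mu}F^*,\bar\theta)$ consists of f.g. free modules $F,G$, homomorphisms $\gamma,\mu$ and a map $\bar\theta\colon G\to Q_{-\epsilon}(\Lambda)$ such that $(G,\gamma^*\mu,\bar\theta)$ is a $(-\epsilon)$-quadratic form, i.e. $\lambda=\gamma^*\mu$ is $(-\epsilon)$-symmetric, $\bar\theta(x+y)-\bar\theta(x)-\bar\theta(y)=[\lambda(x)(y)]$, $\bar\theta(x)-\epsilon\overline{\bar\theta(x)}=\lambda(x)(x)$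 and $\bar\theta(ax)=a\bar\theta(x)\bar a$. A *representative* of $\bar\theta$ is a $\theta\colon G\to G^*$ with $\theta-\epsilon\theta^*=\gamma^*\mu$ and $[\theta(x)(x)]=\bar\theta(x)$. $z$ is *elementary* if there is a f.g. free submodule $j\colon U\hookrightarrow G$ with $j^*\gamma^*\mu j=0$, $\bar\theta j=0$, such that $\gamma j,\mu j$ are injective with images $U_0\subset F$, $U_1\subset F^*$ direct summands and $F^*/U_1\to U_0^*$, $f\mapsto f|U_0$, is an isomorphism. For a map $\theta\colon K\to K^*$, $K$ f.g. free, put $\partial(K,\theta)=(K\xleftarrow{1}K\xrightarrow{\theta-\epsilon\theta^*}K^*,[\theta])$. The set $l_{2q+2}(\Lambda)$ is the set of classes $[z]$ of regular $\epsilon$-quadratic split preformations, where $z$ and $z'$ are identified if $z\oplus\partial H\cong z'\oplus\partial H'$ for some hyperbolic forms $H=(L\oplus L^*,\left(\begin{smallmatrix}0&1\\0&0\end{smallmatrix}\right))$, $H'$ on f.g. free $L,L'$; here an isomorphism consists of isomorphisms $\alpha\colon F\to F'$, $\beta\colon G\to G'$ with $\alpha\gamma=\gamma'\beta$, $\alpha^{-*}\mu=\mu'\beta$,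 $\bar\theta=\bar\theta'\beta$. The class $[z]$ is *elementary* if it contains an elementary preformation. **Quadratic complexes and pairs.** A *complex* is a bounded $\mathbb Z$-graded chain complex of f.g. free $\Lambda$-modules; $C^r=C_r^*$, and $C^{n-*}$ is $(C^{n-*})_r=C^{n-r}$ with $d=(-1)^rd_C^*$; $\mathrm{cone}(f\colon C\to D)_r=D_r\oplus C_{r-1}$ with $d=\left(\begin{smallmatrix}d&(-1)^{r-1}f\\0&d\end{smallmatrix}\right)$. A chain equivalence is a chain map with a chain homotopy inverse. Let $T\colon\mathrm{Hom}(C^p,C_r)\to\mathrm{Hom}(C^r,C_p)$, $\psi\mapsto(-1)^{pr}\psi^*$. For a family $\psi=\{\psi_s\colon C^{n-r-s}\to C_r\mid r\in\mathbb Z,s\ge0\}$ of degree $n$ put $$(d_\%\psi)_s=d\psi_s+(-1)^r\psi_sd^*+(-1)^{n-s-1}(\psi_{s+1}+(-1)^{s+1}T\psi_{s+1})\colon C^{n-1-r-s}\to C_r.$$ $(C,\psi)$ is an *$n$-dimensional quadratic complex* if $d_\%\psi=0$. An *$(n+1)$-dimensional quadratic pair* $(f\colon C\to D,(\delta\psi,\psi))$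 is a chain map with families $\psi$ (degree $n$), $\delta\psi$ (degree $n+1$) such that $d_\%\psi=0$ and $d_\%(\delta\psi)+(-1)^nf\psi f^*=0$. It is *Poincaré* if $\left(\begin{smallmatrix}(1+T)\delta\psi_0\\(-1)^{n+1-r}(1+T)\psi_0f^*\end{smallmatrix}\right)\colon D^{n+1-r}\to\mathrm{cone}(f)_r$ is a chain equivalence $D^{n+1-*}\to\mathrm{cone}(f)$. The *union* of quadratic pairs $(f\colon C\to D,(\delta\psi,-\psi))$ and $(f'\colon C\to D',(\delta\psi',\psi))$ of dimension $n+1$ is the $(n+1)$-dimensional quadratic complex $(D\cup_CD',\delta\psi\cup_\psi\delta\psi')$ with $(D\cup_CD')_r=D_r\oplus C_{r-1}\oplus D'_r$, $$d=\begin{pmatrix}d&(-1)^{r-1}f&0\\0&d&0\\0&(-1)^{r-1}f'&d\end{pmatrix},\qquad(\delta\psi\cup_\psi\delta\psi')_s=\begin{pmatrix}\delta\psi_s&0&0\\(-1)^{n-r}\psi_sf^*&(-1)^{n-r-s+1}T\psi_{s+1}&0\\0&(-1)^sf'\psi_s&\delta\psi'_s\end{pmatrix}.$$ For two pairs $c=(f\colon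 C\to D,(\delta\psi,\psi))$, $c'=(f'\colon C\to D',(\delta\psi',\psi))$ with the same boundary, $c\cup-c'$ is the union of $c$ and $-c'=(f',(-\delta\psi',-\psi))$. Two Poincaré pairs $c,c'$ of dimension $n+1$ with the same boundary $(C,\psi)$ are *cobordant rel$\partial$* if $c'\cup-c$ is the boundary of an $(n+2)$-dimensional quadratic Poincaré pair. Let $c,c'$ be Poincaré pairs as above, of dimension $n+1$. An $(n+2)$-dimensional quadratic Poincaré pair $d=(g\colon D\cup_CD'\to E,(\delta\omega,\omega))$ with boundary $c\cup-c'$ is an *algebraic h-cobordism* (between $c$ and $c'$) if the restrictions $j_0\colon D\to E$ and $j_1\colon D'\to E$ of $g$ are chain equivalences. **The pair $x$.** Let $z$ be a regular $\epsilon$-quadratic split preformation and $\theta$ a representative of $\bar\theta$. Let $(N,\zeta)$ and $(N',\zeta')$ be the $(2q+1)$-dimensional quadratic complexes, non-zero only in degrees $q+1,q$, $$N:\ d=\mu^*\colon N_{q+1}=F\to N_q=G^*,\quad\zeta_0=\gamma\colon N^q=G\to N_{q+1},\quad\zeta_1=\epsilon\theta\colon N^q\to N_q,$$ $$N':\ d=\gamma^*\colon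 N'_{q+1}=F^*\to N'_q=G^*,\quad\zeta'_0=\epsilon\mu\colon N'^q=G\to N'_{q+1},\quad\zeta'_1=-\epsilon\theta\colon N'^q\to N'_q,$$ all other components being $0$. The *thickening* of an $n$-dimensional quadratic complex $(N,\zeta)$ is the pair $((0\ 1)\colon\partial N\to N^{n-*},(0,\partial\zeta))$ with $\partial N_r=N_{r+1}\oplus N^{n-r}$, $d=\left(\begin{smallmatrix}d&(-1)^r(1+T)\zeta_0\\0&(-1)^rd^*\end{smallmatrix}\right)$, $\partial\zeta_0=\left(\begin{smallmatrix}0&0\\1&0\end{smallmatrix}\right)$ and $\partial\zeta_s=\left(\begin{smallmatrix}(-1)^{n-r-s-1}T\zeta_{s-1}&0\\0&0\end{smallmatrix}\right)$ for $s>0$. Let $c=(f\colon C=\partial N\to D=N^{2q+1-*},(0,\psi))$ be the thickening of $(N,\zeta)$, let $f'\colon\partial N'\to D'=N'^{2q+1-*}$ be the map of the thickening of $(N',\zeta')$, and let $h\colon\partial N\to\partial N'$ be the chain isomorphism $h_{q+1}=1_G$, $h_q=\left(\begin{smallmatrix}0&\epsilon\\1&0\end{smallmatrix}\right)\colon F\oplus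 F^*\to F^*\oplus F$, $h_{q-1}=1_{G^*}$. Put $c''=(f'h\colon C\to D',(0,\psi))$ and $(\partial E,\omega)=c''\cup-c$, so $\partial E_r=D'_r\oplus C_{r-1}\oplus D_r$. Let $E$ be $G$ concentrated in degree $q+1$ and $$x=(g\colon\partial E\to E,(0,\omega)),\qquad g=(1\ \ 0\ \ 0\ \ {-1})\colon\partial E_{q+1}=G\oplus(F\oplus F^*)\oplus G\to E_{q+1}=G.$$ (All these are quadratic complexes and pairs as indicated.) **Theorem 2.9.** Let $z$ be a regular $\epsilon$-quadratic split preformation, $\theta$ an arbitrary representative of $\bar\theta$, and $x$ the $(2q+2)$-dimensional quadratic pair above. Then $x$ is a quadratic Poincaré pair, and: 1. if $z$ is elementary, then $x$ is cobordant rel$\partial$ to an algebraic h-cobordism (between $c''$ and $c$); 2. if $x$ is cobordant rel$\partial$ to an algebraic h-cobordism (between $c''$ and $c$), then $[z]\in l_{2q+2}(\Lambda)$ is elementary. -/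

import Mathlib

set_option linter.unusedSectionVars false

noncomputable section

namespace AlgSurgery

universe u

section Duality

variable {Λ : Type u} [Ring Λ] [StarRing Λ]

/-- The dual `M^* = Hom_Λ(M, Λ)` of a left `Λ`-module, as a *left* `Λ`-module:
`(a • φ)(x) = φ(x) * star a`. -/
def StarDual (Λ : Type u) [Ring Λ] [StarRing Λ] (M : Type u) [AddCommGroup M] [Module Λ M] : Type u := M →ₗ[Λ] Λ

namespace StarDual

variable {M : Type u} [AddCommGroup M] [Module Λ M]

instance : AddCommGroup (StarDual Λ M) := inferInstanceAs (AddCommGroup (M →ₗ[Λ] Λ))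

instance : FunLike (StarDual Λ M) M Λ := inferInstanceAs (FunLike (M →ₗ[Λ] Λ) M Λ)

instance : LinearMapClass (StarDual Λ M) Λ M Λ :=
  inferInstanceAs (LinearMapClass (M →ₗ[Λ] Λ) Λ M Λ)

@[ext] theorem ext {φ χ : StarDual Λ M} (h : ∀ x, φ x = χ x) : φ = χ := DFunLike.ext _ _ h

@[simp] theorem add_apply (φ χ : StarDual Λ M) (x : M) : (φ + χ) x = φ x + χ x := rfl

@[simp] theorem zero_apply (x : M) : (0 : StarDual Λ M) x = 0 := rfl

@[simp] theorem neg_apply (φ : StarDual Λ M) (x : M) : (-φ) x = -φ x := rfl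

@[simp] theorem sub_apply (φ χ : StarDual Λ M) (x : M) : (φ - χ) x = φ x - χ x := rfl

@[simp] theorem units_smul_apply (e : ℤˣ) (φ : StarDual Λ M) (x : M) : (e • φ) x = e • φ x := by
  rcases Int.units_eq_one_or e with rfl | rfl <;> simp

theorem sum_apply {ι : Type*} (s : Finset ι) (φ : ι → StarDual Λ M) (x : M) :
    (∑ i ∈ s, φ i) x = ∑ i ∈ s, φ i x :=
  LinearMap.sum_apply s (fun i => (show M →ₗ[Λ] Λ from φ i)) x

instance : Module Λ (StarDual Λ M) where
  smul a φ :=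
    { toFun := fun x => φ x * star a
      map_add' := fun x y => by rw [map_add, add_mul]
      map_smul' := fun b x => by
        rw [map_smul, smul_eq_mul, RingHom.id_apply, smul_eq_mul, mul_assoc] }
  one_smul φ := ext fun x => show φ x * star 1 = φ x by simp
  mul_smul a b φ := ext fun x => show φ x * star (a * b) = φ x * star b * star a by
    rw [star_mul, mul_assoc]
  smul_zero a := ext fun x => show (0 : Λ) * star a = 0 by simp
  smul_add a φ χ := ext fun x => show (φ x + χ x) * star a = φ x * star a + χ x * star a by
    rw [add_mul]
  add_smul a b φ := ext fun x => show φ x * star (a + b) = φ x * star a + φ x * star b by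
    rw [star_add, mul_add]
  zero_smul φ := ext fun x => show φ x * star 0 = 0 by simp

@[simp] theorem smul_apply (a : Λ) (φ : StarDual Λ M) (x : M) : (a • φ) x = φ x * star a := rfl

end StarDual

section

variable {M N P : Type u} [AddCommGroup M] [Module Λ M] [AddCommGroup N] [Module Λ N]
  [AddCommGroup P] [Module Λ P]

/-- The dual `f^* : N^* → M^*` of a map `f : M → N`. -/
def dualMap (f : M →ₗ[Λ] N) : StarDual Λ N →ₗ[Λ] StarDual Λ M where
  toFun φ := LinearMap.comp (show N →ₗ[Λ] Λ from φ) f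
  map_add' _ _ := rfl
  map_smul' _ _ := rfl

@[simp] theorem dualMap_apply (f : M →ₗ[Λ] N) (φ : StarDual Λ N) (x : M) :
    dualMap f φ x = φ (f x) := rfl

/-- The canonical homomorphism `M → M^{**}`, `x ↦ (φ ↦ star (φ x))`. -/
def evalDual (M : Type u) [AddCommGroup M] [Module Λ M] :
    M →ₗ[Λ] StarDual Λ (StarDual Λ M) where
  toFun x :=
    (show StarDual Λ M →ₗ[Λ] Λ from
      { toFun := fun φ => star (φ x)
        map_add' := fun φ χ => by simp
        map_smul' := fun a φ => by simp })
  map_add' x y := StarDual.ext fun φ => show star (φ (x + y)) = star (φ x) + star (φ y) by simp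
  map_smul' a x := StarDual.ext fun φ => show star (φ (a • x)) = star (φ x) * star a by
    simp

@[simp] theorem evalDual_apply (x : M) (φ : StarDual Λ M) :
    evalDual M x φ = star (φ x) := rfl

/-- The coordinate functionals of a basis, as elements of the dual. -/
def coordDual {ι : Type*} (b : Module.Basis ι Λ M) (i : ι) : StarDual Λ M := b.coord i

theorem coordDual_apply {ι : Type*} (b : Module.Basis ι Λ M) (i : ι) (x : M) :
    coordDual b i x = b.repr x i := rfl

theorem sum_coordDual {ι : Type*} [Fintype ι] (b : Module.Basis ι Λ M) (φ : StarDual Λ M) :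
    ∑ i, star (φ (b i)) • coordDual b i = φ := by
  refine StarDual.ext fun x => ?_
  conv_rhs => rw [← b.sum_repr x]
  simp only [StarDual.sum_apply, StarDual.smul_apply, coordDual_apply, star_star, map_sum,
    map_smul, smul_eq_mul]

/-- The dual of a module with a finite basis is free: `φ ↦ (star (φ (b i)))_i`. -/
def dualEquivFun {ι : Type*} [Fintype ι] (b : Module.Basis ι Λ M) :
    StarDual Λ M ≃ₗ[Λ] (ι → Λ) where
  toFun φ i := star (φ (b i))
  map_add' φ χ := by ext; simp
  map_smul' a φ := by ext; simp
  invFun c := ∑ i, c i • coordDual b i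
  left_inv φ := sum_coordDual b φ
  right_inv c := by
    classical
    funext j
    simp [StarDual.sum_apply, coordDual_apply, Finsupp.single_apply]

instance [Module.Free Λ M] [Module.Finite Λ M] : Module.Free Λ (StarDual Λ M) :=
  Module.Free.of_equiv (dualEquivFun (Module.Free.chooseBasis Λ M)).symm

instance [Module.Free Λ M] [Module.Finite Λ M] : Module.Finite Λ (StarDual Λ M) :=
  Module.Finite.equiv (dualEquivFun (Module.Free.chooseBasis Λ M)).symm

theorem evalDual_bijective [Module.Free Λ M] [Module.Finite Λ M] :
    Function.Bijective (evalDual (Λ := Λ) M) := by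
  let b := Module.Free.chooseBasis Λ M
  constructor
  · intro x y h
    refine b.repr.injective (Finsupp.ext fun i => ?_)
    have := DFunLike.congr_fun h (coordDual b i)
    simpa [coordDual_apply] using this
  · intro Ψ
    refine ⟨∑ i, star (Ψ (coordDual b i)) • b i, StarDual.ext fun φ => ?_⟩
    conv_rhs => rw [← sum_coordDual b φ]
    rw [evalDual_apply, map_sum, map_sum, star_sum]
    simp only [map_smul, smul_eq_mul, star_mul, star_star]

/-- The identification `M^{**} ≅ M` for a f.g. free module `M`. -/
def undual (M : Type u) [AddCommGroup M] [Module Λ M] [Module.Free Λ M] [Module.Finite Λ M] :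
    StarDual Λ (StarDual Λ M) ≃ₗ[Λ] M :=
  (LinearEquiv.ofBijective (evalDual M) evalDual_bijective).symm

theorem apply_undual [Module.Free Λ M] [Module.Finite Λ M] (Ψ : StarDual Λ (StarDual Λ M))
    (φ : StarDual Λ M) : φ (undual M Ψ) = star (Ψ φ) := by
  obtain ⟨x, rfl⟩ := (evalDual_bijective (Λ := Λ) (M := M)).2 Ψ
  have : undual M (evalDual (Λ := Λ) M x) = x :=
    (LinearEquiv.ofBijective (evalDual M) evalDual_bijective).symm_apply_apply x
  rw [this, evalDual_apply, star_star]

theorem undual_evalDual [Module.Free Λ M] [Module.Finite Λ M] (x : M) :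
    undual M (evalDual (Λ := Λ) M x) = x :=
  (LinearEquiv.ofBijective (evalDual M) evalDual_bijective).symm_apply_apply x

/-- Elements of a f.g. free module are separated by the dual. -/
theorem ext_dual [Module.Free Λ M] [Module.Finite Λ M] {x y : M}
    (h : ∀ φ : StarDual Λ M, φ x = φ y) : x = y :=
  evalDual_bijective.1 (StarDual.ext fun φ : StarDual Λ M => by
    rw [evalDual_apply, evalDual_apply, h φ])

/-- The adjoint `f^* : N → M^*` of `f : M → N^*`, where `N` is viewed inside `N^{**}`:
`(f^* y)(x) = star (f x y)`. -/
def adj (f : M →ₗ[Λ] StarDual Λ N) : N →ₗ[Λ] StarDual Λ M :=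
  dualMap f ∘ₗ evalDual N

@[simp] theorem adj_apply (f : M →ₗ[Λ] StarDual Λ N) (y : N) (x : M) :
    adj f y x = star (f x y) := rfl

/-- The adjoint `f^* : N^* → M` of `f : M^* → N`, for `M` f.g. free. -/
def coadj [Module.Free Λ M] [Module.Finite Λ M] (f : StarDual Λ M →ₗ[Λ] N) :
    StarDual Λ N →ₗ[Λ] M :=
  (undual M).toLinearMap ∘ₗ dualMap f

theorem apply_coadj [Module.Free Λ M] [Module.Finite Λ M] (f : StarDual Λ M →ₗ[Λ] N)
    (α : StarDual Λ N) (β : StarDual Λ M) : β (coadj f α) = star (α (f β)) := by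
  simp [coadj, apply_undual]

end

end Duality

section Preformations

variable {Λ : Type u} [Ring Λ] [StarRing Λ]

theorem star_units_smul (e : ℤˣ) (b : Λ) : star (e • b) = e • star b := by
  rcases Int.units_eq_one_or e with rfl | rfl <;> simp

/-- The homomorphism `1 - T_e : Λ → Λ`, `b ↦ b - e * star b`, for `e = ± 1`. -/
def oneSubT (Λ : Type u) [Ring Λ] [StarRing Λ] (e : ℤˣ) : Λ →+ Λ where
  toFun b := b - e • star b
  map_zero' := by simp
  map_add' a b := by rw [star_add, smul_add]; abel

/-- `Q_e(Λ) = Λ / {b - e * star b}`. -/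
def QuadQuot (Λ : Type u) [Ring Λ] [StarRing Λ] (e : ℤˣ) : Type u := Λ ⧸ (oneSubT Λ e).range

namespace QuadQuot

variable (e : ℤˣ)

instance : AddCommGroup (QuadQuot Λ e) :=
  inferInstanceAs (AddCommGroup (Λ ⧸ (oneSubT Λ e).range))

/-- The class of an element of `Λ` in `Q_e(Λ)`. -/
def mk : Λ →+ QuadQuot Λ e := QuotientAddGroup.mk' (oneSubT Λ e).range

/-- The symmetrization `Q_e(Λ) → Λ`, `[b] ↦ b + e * star b`. -/
def symm : QuadQuot Λ e →+ Λ :=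
  QuotientAddGroup.lift (oneSubT Λ e).range
    { toFun := fun b => b + e • star b
      map_zero' := by simp
      map_add' := fun a b => by rw [star_add, smul_add]; abel }
    (by
      rintro _ ⟨b, rfl⟩
      rcases Int.units_eq_one_or e with rfl | rfl <;> (simp [oneSubT]; try abel))

/-- The action `[b] ↦ [a * b * star a]` of `a ∈ Λ` on `Q_e(Λ)`. -/
def conj (a : Λ) : QuadQuot Λ e →+ QuadQuot Λ e :=
  QuotientAddGroup.map (oneSubT Λ e).range (oneSubT Λ e).range
    { toFun := fun b => a * b * star a
      map_zero' := by simp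
      map_add' := fun b c => by rw [mul_add, add_mul] }
    (by
      rintro _ ⟨b, rfl⟩
      refine ⟨a * b * star a, ?_⟩
      rcases Int.units_eq_one_or e with rfl | rfl <;>
        simp [oneSubT, mul_sub, sub_mul, mul_add, add_mul, mul_assoc])

@[simp] theorem symm_mk (b : Λ) : symm e (mk e b) = b + e • star b := rfl

@[simp] theorem conj_mk (a b : Λ) : conj e a (mk e b) = mk e (a * b * star a) := rfl

theorem mk_smul_star (b : Λ) : mk e (e • star b) = mk e b := by
  have h : mk e (b - e • star b) = 0 :=
    (QuotientAddGroup.eq_zero_iff _).2 ⟨b, rfl⟩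
  rw [map_sub] at h
  exact (sub_eq_zero.1 h).symm

end QuadQuot

/-- `(M, lam, ν)` is an `e`-quadratic form (`e = ± 1`): `lam : M → M^*` is `e`-symmetric and
`ν : M → Q_e(Λ)` is a quadratic refinement of it. Here `lam x y` is the pairing
`lam(x, y) = lam(x)(y)`. -/
structure IsQuadraticForm (e : ℤˣ) {M : Type u} [AddCommGroup M] [Module Λ M]
    (lam : M →ₗ[Λ] StarDual Λ M) (ν : M → QuadQuot Λ e) : Prop where
  symm : ∀ x y, lam x y = e • star (lam y x)
  map_add : ∀ x y, ν (x + y) - ν x - ν y = QuadQuot.mk e (lam x y)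
  symm_apply : ∀ x, QuadQuot.symm e (ν x) = lam x x
  map_smul : ∀ (a : Λ) x, ν (a • x) = QuadQuot.conj e a (ν x)

/-- A map `θ : M → M^*` gives the `e`-quadratic form `(M, θ + T_e θ, x ↦ [θ(x)(x)])`, where
`T_e θ = e • θ^*`. -/
theorem isQuadraticForm_of_map (e : ℤˣ) {M : Type u} [AddCommGroup M] [Module Λ M]
    (θ : M →ₗ[Λ] StarDual Λ M) :
    IsQuadraticForm e (θ + e • adj θ) (fun x => QuadQuot.mk e (θ x x)) where
  symm x y := by
    rcases Int.units_eq_one_or e with rfl | rfl <;> simp [add_comm]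
  map_add x y := by
    have h := QuadQuot.mk_smul_star e (θ y x)
    simp only [_root_.map_add, StarDual.add_apply, LinearMap.add_apply, LinearMap.smul_apply,
      StarDual.units_smul_apply, adj_apply, h]
    abel
  symm_apply x := by simp
  map_smul a x := by simp [mul_assoc]

/-- A regular `ε`-quadratic split preformation `(F ← G → F^*, θ̄)`: f.g. free left modules
`F`, `G`, maps `γ : G → F`, `μ : G → F^*`, and a map `quad = θ̄ : G → Q_{-ε}(Λ)` such that
`(G, γ^* μ, θ̄)` is a `(-ε)`-quadratic form. -/
structure RegSplitPreformation (Λ : Type u) [Ring Λ] [StarRing Λ] (ε : ℤˣ) where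
  /-- the module `F` -/
  F : Type u
  /-- the module `G` -/
  G : Type u
  [addCommGroupF : AddCommGroup F]
  [moduleF : Module Λ F]
  [freeF : Module.Free Λ F]
  [finiteF : Module.Finite Λ F]
  [addCommGroupG : AddCommGroup G]
  [moduleG : Module Λ G]
  [freeG : Module.Free Λ G]
  [finiteG : Module.Finite Λ G]
  /-- the map `γ : G → F` -/
  γ : G →ₗ[Λ] F
  /-- the map `μ : G → F^*` -/
  μ : G →ₗ[Λ] StarDual Λ F
  /-- the quadratic refinement `θ̄ : G → Q_{-ε}(Λ)` -/
  quad : G → QuadQuot Λ (-ε)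
  isQuadraticForm : IsQuadraticForm (-ε) (dualMap γ ∘ₗ μ) quad

attribute [instance] RegSplitPreformation.addCommGroupF RegSplitPreformation.moduleF
  RegSplitPreformation.freeF RegSplitPreformation.finiteF RegSplitPreformation.addCommGroupG
  RegSplitPreformation.moduleG RegSplitPreformation.freeG RegSplitPreformation.finiteG

namespace RegSplitPreformation

variable {ε : ℤˣ}

/-- `θ : G → G^*` represents the class in `Q_{-ε}(G) = coker (1 - T_{-ε})` which corresponds to
the `(-ε)`-quadratic form `(G, γ^* μ, θ̄)`: `θ - ε θ^* = γ^* μ` and `[θ(x)(x)] = θ̄(x)`. -/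
structure IsRepresentative (z : RegSplitPreformation Λ ε) (θ : z.G →ₗ[Λ] StarDual Λ z.G) :
    Prop where
  add_transpose : θ + (-ε) • adj θ = dualMap z.γ ∘ₗ z.μ
  mk_apply : ∀ x, QuadQuot.mk (-ε) (θ x x) = z.quad x

/-- The restriction map `F^* → U₀^*`, `f ↦ f|U₀`, for a submodule `U₀` of `F`. -/
def restrictDual {F : Type u} [AddCommGroup F] [Module Λ F] (U₀ : Submodule Λ F) :
    StarDual Λ F →ₗ[Λ] StarDual Λ U₀ := dualMap U₀.subtype

/-- The f.g. free submodule `U` of `G` is an `h`-lagrangian of `z`. -/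
structure IsHLagrangian (z : RegSplitPreformation Λ ε) (U : Submodule Λ z.G) : Prop where
  free : Module.Free Λ U
  finite : Module.Finite Λ U
  form_eq_zero : ∀ x ∈ U, ∀ y ∈ U, z.μ x (z.γ y) = 0
  quad_eq_zero : ∀ x ∈ U, z.quad x = 0
  injective_γ : Function.Injective (z.γ ∘ₗ U.subtype)
  injective_μ : Function.Injective (z.μ ∘ₗ U.subtype)
  summand_γ : ∃ W, IsCompl (U.map z.γ) W
  summand_μ : ∃ W, IsCompl (U.map z.μ) W
  /-- `F^* / U₁ → U₀^*`, `f ↦ f|U₀` is (well-defined and) an isomorphism. -/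
  quotient_bijective : ∃ h : U.map z.μ ≤ LinearMap.ker (restrictDual (U.map z.γ)),
    Function.Bijective ((U.map z.μ).liftQ (restrictDual (U.map z.γ)) h)

/-- `z` is elementary if it has an `h`-lagrangian. -/
def IsElementary (z : RegSplitPreformation Λ ε) : Prop := ∃ U, z.IsHLagrangian U

/-- The sum `z + z'`. -/
def add (z z' : RegSplitPreformation Λ ε) : RegSplitPreformation Λ ε where
  F := z.F × z'.F
  G := z.G × z'.G
  γ := z.γ.prodMap z'.γ
  μ := (dualMap (LinearMap.fst Λ z.F z'.F) ∘ₗ z.μ).coprod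
    (dualMap (LinearMap.snd Λ z.F z'.F) ∘ₗ z'.μ)
  quad x := z.quad x.1 + z'.quad x.2
  isQuadraticForm :=
    { symm := fun x y => by
        have h := z.isQuadraticForm.symm x.1 y.1
        have h' := z'.isQuadraticForm.symm x.2 y.2
        simp only [LinearMap.comp_apply, dualMap_apply] at h h'
        simp [h, h']
      map_add := fun x y => by
        have h := z.isQuadraticForm.map_add x.1 y.1
        have h' := z'.isQuadraticForm.map_add x.2 y.2
        simp only [LinearMap.comp_apply, dualMap_apply] at h h'
        simp only [LinearMap.comp_apply, dualMap_apply, LinearMap.coprod_apply,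
          StarDual.add_apply, LinearMap.prodMap_apply, LinearMap.fst_apply, LinearMap.snd_apply,
          _root_.map_add, ← h, ← h', Prod.fst_add, Prod.snd_add]
        abel
      symm_apply := fun x => by
        have h := z.isQuadraticForm.symm_apply x.1
        have h' := z'.isQuadraticForm.symm_apply x.2
        simp only [LinearMap.comp_apply, dualMap_apply] at h h'
        simp [h, h']
      map_smul := fun a x => by
        simp [z.isQuadraticForm.map_smul, z'.isQuadraticForm.map_smul] }

/-- The boundary `∂(K, θ) = (K ←1- K -(θ - ε θ^*)→ K^*, θ)` of the `(-ε)`-quadratic form given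
by `θ : K → K^*`. -/
def boundary (ε : ℤˣ) {K : Type u} [AddCommGroup K] [Module Λ K] [Module.Free Λ K]
    [Module.Finite Λ K] (θ : K →ₗ[Λ] StarDual Λ K) : RegSplitPreformation Λ ε where
  F := K
  G := K
  γ := LinearMap.id
  μ := θ + (-ε) • adj θ
  quad x := QuadQuot.mk (-ε) (θ x x)
  isQuadraticForm := isQuadraticForm_of_map (-ε) θ

/-- The map `(0 1; 0 0) : L ⊕ L^* → (L ⊕ L^*)^*` of the quadratic hyperbolic form on `L`, i.e.
`(l, φ) ↦ ((l', φ') ↦ φ(l'))`. -/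
def hyperbolicMap (L : Type u) [AddCommGroup L] [Module Λ L] :
    (L × StarDual Λ L) →ₗ[Λ] StarDual Λ (L × StarDual Λ L) :=
  dualMap (LinearMap.fst Λ L (StarDual Λ L)) ∘ₗ LinearMap.snd Λ L (StarDual Λ L)

/-- A strong isomorphism of regular split preformations. -/
structure StrongIso (z z' : RegSplitPreformation Λ ε) where
  /-- the isomorphism `F ≅ F'` -/
  α : z.F ≃ₗ[Λ] z'.F
  /-- the isomorphism `G ≅ G'` -/
  β : z.G ≃ₗ[Λ] z'.G
  comm_γ : ∀ x, α (z.γ x) = z'.γ (β x)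
  comm_μ : ∀ x, dualMap α.symm.toLinearMap (z.μ x) = z'.μ (β x)
  quad_eq : ∀ x, z.quad x = z'.quad (β x)

/-- Two regular split preformations are stably strongly isomorphic if they become strongly
isomorphic after adding boundaries of quadratic hyperbolic forms (on f.g. free modules). -/
def StablyStronglyIso (z z' : RegSplitPreformation Λ ε) : Prop :=
  ∃ (L L' : Type u) (_ : AddCommGroup L) (_ : AddCommGroup L') (_ : Module Λ L)
    (_ : Module Λ L') (_ : Module.Free Λ L) (_ : Module.Free Λ L') (_ : Module.Finite Λ L)
    (_ : Module.Finite Λ L'),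
    Nonempty (StrongIso (z.add (boundary ε (hyperbolicMap (Λ := Λ) L)))
      (z'.add (boundary ε (hyperbolicMap (Λ := Λ) L'))))

end RegSplitPreformation

/-- (The underlying set of) the monoid `l_{2q+2}(Λ)`, `ε = (-1)^q`: stable strong isomorphism
classes of regular `ε`-quadratic split preformations. -/
def LMonoid (Λ : Type u) [Ring Λ] [StarRing Λ] (ε : ℤˣ) : Type (u + 1) :=
  Quot (RegSplitPreformation.StablyStronglyIso (Λ := Λ) (ε := ε))

/-- The class `[z]` in `l_{2q+2}(Λ)`. -/
def LMonoid.mk {ε : ℤˣ} (z : RegSplitPreformation Λ ε) : LMonoid Λ ε := Quot.mk _ z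

/-- An element of `l_{2q+2}(Λ)` is elementary if it has an elementary representative. -/
def LMonoid.IsElementary {ε : ℤˣ} (a : LMonoid Λ ε) : Prop :=
  ∃ z : RegSplitPreformation Λ ε, LMonoid.mk z = a ∧ z.IsElementary

end Preformations

section Complexes

/-- A finite chain complex of f.g. free left `Λ`-modules, graded by `ℤ` and with only finitely
many non-zero modules. The differential `X i → X j` is given for `j + 1 = i`. -/
structure FreeComplex (Λ : Type u) [Ring Λ] where
  /-- the module in degree `i` -/
  X : ℤ → Type u
  [addCommGroup : ∀ i, AddCommGroup (X i)]
  [module : ∀ i, Module Λ (X i)]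
  [free : ∀ i, Module.Free Λ (X i)]
  [finite : ∀ i, Module.Finite Λ (X i)]
  /-- the differential -/
  d : ∀ i j, j + 1 = i → (X i →ₗ[Λ] X j)
  d_d : ∀ i j k (hij : j + 1 = i) (hjk : k + 1 = j) (x : X i), d j k hjk (d i j hij x) = 0
  bounded : ∃ a b : ℤ, ∀ i, i < a ∨ b < i → Subsingleton (X i)

attribute [instance] FreeComplex.addCommGroup FreeComplex.module FreeComplex.free
  FreeComplex.finite

variable {Λ : Type u} [Ring Λ] [StarRing Λ]

theorem map_units_smul {A B F : Type*} [AddCommGroup A] [AddCommGroup B] [FunLike F A B]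
    [AddMonoidHomClass F A B] (f : F) (e : ℤˣ) (x : A) : f (e • x) = e • f x := by
  rcases Int.units_eq_one_or e with rfl | rfl <;> simp

namespace FreeComplex

/-- The identity map `C_i → C_j` for `i = j`. -/
def idMap (C : FreeComplex Λ) (i j : ℤ) (h : i = j) : C.X i →ₗ[Λ] C.X j := h ▸ LinearMap.id

end FreeComplex

/-- A chain map. -/
@[ext] structure ChainMap (C D : FreeComplex Λ) where
  /-- the component in degree `i` -/
  f : ∀ i, C.X i →ₗ[Λ] D.X i
  comm : ∀ i j (h : j + 1 = i) (x : C.X i), D.d i j h (f i x) = f j (C.d i j h x)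

namespace ChainMap

/-- The component `C_i → D_j` of a chain map, for `i = j`. -/
def at' {C D : FreeComplex Λ} (g : ChainMap C D) (i j : ℤ) (h : i = j) : C.X i →ₗ[Λ] D.X j :=
  D.idMap i j h ∘ₗ g.f i

theorem d_at' {C D : FreeComplex Λ} (g : ChainMap C D) (i i' j k : ℤ) (h : i = j)
    (hjk : k + 1 = j) (hi : i' + 1 = i) (h' : i' = k) (x : C.X i) :
    D.d j k hjk (g.at' i j h x) = g.at' i' k h' (C.d i i' hi x) := by
  subst h h'
  exact g.comm i i' hjk x

/-- The composite `g' g`. -/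
def comp {C D E : FreeComplex Λ} (g' : ChainMap D E) (g : ChainMap C D) : ChainMap C E where
  f i := g'.f i ∘ₗ g.f i
  comm i j h x := by simp [g'.comm i j h, g.comm i j h]

end ChainMap

/-- A family of maps `f_i : C_i → D_i` commutes with the differentials. -/
def IsChainMap (C D : FreeComplex Λ) (f : ∀ i, C.X i →ₗ[Λ] D.X i) : Prop :=
  ∀ i j (h : j + 1 = i), D.d i j h ∘ₗ f i = f j ∘ₗ C.d i j h

/-- Two families of maps `f_i, f'_i : C_i → D_i` are chain homotopic: there are
`k : C_{i-1} → D_i` with `f'_i - f_i = d k + k d`. -/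
def ChainHomotopic {C D : FreeComplex Λ} (f f' : ∀ i, C.X i →ₗ[Λ] D.X i) : Prop :=
  ∃ k : ∀ i j, i + 1 = j → (C.X i →ₗ[Λ] D.X j),
    ∀ (h i j : ℤ) (hi : h + 1 = i) (ij : i + 1 = j),
      f' i - f i = D.d j i ij ∘ₗ k i j ij + k h i hi ∘ₗ C.d i h hi

/-- A family of maps `f_i : C_i → D_i` is a chain equivalence: it is a chain map and has a chain
homotopy inverse. -/
def IsChainEquivalence (C D : FreeComplex Λ) (f : ∀ i, C.X i →ₗ[Λ] D.X i) : Prop :=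
  IsChainMap C D f ∧ ∃ g : ∀ i, D.X i →ₗ[Λ] C.X i, IsChainMap D C g ∧
    ChainHomotopic (fun i => g i ∘ₗ f i) (fun _ => LinearMap.id) ∧
    ChainHomotopic (fun i => f i ∘ₗ g i) (fun _ => LinearMap.id)

namespace FreeComplex

/-- The complex `C^{n-*}`: `(C^{n-*})_r = (C_{n-r})^*`, with differential `(-1)^r d_C^*`. -/
def dual (C : FreeComplex Λ) (n : ℤ) : FreeComplex Λ where
  X r := StarDual Λ (C.X (n - r))
  d i j h := i.negOnePow • dualMap (C.d (n - j) (n - i) (by omega))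
  d_d i j k hij hjk φ := by
    refine StarDual.ext fun x => ?_
    simp [C.d_d]
  bounded := by
    obtain ⟨a, b, h⟩ := C.bounded
    refine ⟨n - b, n - a, fun i hi => ?_⟩
    have := h (n - i) (by omega)
    refine ⟨fun φ χ => StarDual.ext fun x => ?_⟩
    rw [Subsingleton.elim x 0, map_zero, map_zero]

/-- The mapping cone of a chain map `f : C → D`: `cone(f)_r = D_r ⊕ C_{r-1}`, with differential
`(d_D, (-1)^{r-1} f; 0, d_C)`. -/
def cone {C D : FreeComplex Λ} (f : ChainMap C D) : FreeComplex Λ where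
  X r := D.X r × C.X (r - 1)
  d i j h := LinearMap.prod
    (D.d i j h ∘ₗ LinearMap.fst Λ _ _ +
      (i - 1).negOnePow • (f.at' (i - 1) j (by omega) ∘ₗ LinearMap.snd Λ _ _))
    (C.d (i - 1) (j - 1) (by omega) ∘ₗ LinearMap.snd Λ _ _)
  d_d i j k hij hjk x := by
    obtain ⟨x, y⟩ := x
    have hs : (i - 1).negOnePow = -(j - 1).negOnePow := by
      rw [← Int.negOnePow_succ]; congr 1; omega
    have h1 := f.d_at' (i - 1) (j - 1) j k (by omega) hjk (by omega) (by omega) y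
    change (D.d j k hjk (D.d i j hij x + (i - 1).negOnePow • f.at' (i - 1) j (by omega) y) +
      (j - 1).negOnePow • f.at' (j - 1) k (by omega) (C.d (i - 1) (j - 1) (by omega) y),
      C.d (j - 1) (k - 1) (by omega) (C.d (i - 1) (j - 1) (by omega) y)) = 0
    rw [map_add, D.d_d, C.d_d, map_units_smul, h1, hs, Units.neg_smul, zero_add, neg_add_cancel]
    rfl
  bounded := by
    obtain ⟨a, b, h⟩ := C.bounded
    obtain ⟨a', b', h'⟩ := D.bounded
    refine ⟨min (a + 1) a', max (b + 1) b', fun i hi => ?_⟩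
    have := h (i - 1) (by omega)
    have := h' i (by omega)
    infer_instance

end FreeComplex

/-- A collection `ψ = {ψ_s : C^{n-r-s} → C_r | r ∈ ℤ, s ≥ 0}`, i.e. an element of `W_%(C)_n`;
the component `ψ_s : C^p → C_r` is given for `p + r + s = n`. -/
def QStruct (C : FreeComplex Λ) (n : ℤ) : Type u :=
  ∀ (s : ℕ) (p r : ℤ), p + r + s = n → (StarDual Λ (C.X p) →ₗ[Λ] C.X r)

namespace QStruct

variable {C : FreeComplex Λ} {n : ℤ}

instance : Zero (QStruct C n) := ⟨fun _ _ _ _ => 0⟩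

instance : Neg (QStruct C n) := ⟨fun ψ s p r h => -ψ s p r h⟩

/-- The component `(T ψ)_s : C^p → C_r` of the image of `ψ` under the duality involution
`T : Hom(C^r, C_p) → Hom(C^p, C_r)`, `ψ ↦ (-1)^{pr} ψ^*`. -/
def T (ψ : QStruct C n) (s : ℕ) (p r : ℤ) (h : p + r + s = n) :
    StarDual Λ (C.X p) →ₗ[Λ] C.X r :=
  (p * r).negOnePow • coadj (ψ s r p (by omega))

/-- The differential `d_% : W_%(C)_n → W_%(C)_{n-1}`, for `m = n - 1`:
`(d_% ψ)_s = d ψ_s + (-1)^r ψ_s d^* + (-1)^{n-s-1} (ψ_{s+1} + (-1)^{s+1} T ψ_{s+1})`. -/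
def diff (ψ : QStruct C n) (m : ℤ) (hm : m + 1 = n) : QStruct C m := fun s p r h =>
  C.d (r + 1) r rfl ∘ₗ ψ s p (r + 1) (by omega)
    + r.negOnePow • (ψ s (p + 1) r (by omega) ∘ₗ dualMap (C.d (p + 1) p rfl))
    + (n - s - 1).negOnePow • (ψ (s + 1) p r (by push_cast; omega)
        + ((s : ℤ) + 1).negOnePow • ψ.T (s + 1) p r (by push_cast; omega))

/-- `ψ` is a cycle, i.e. `(C, ψ)` is an `n`-dimensional quadratic complex. -/
def IsCycle (ψ : QStruct C n) : Prop := ψ.diff (n - 1) (by omega) = 0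

/-- `f ψ f^*`. -/
def push {D : FreeComplex Λ} (f : ChainMap C D) (ψ : QStruct C n) : QStruct D n :=
  fun s p r h => f.f r ∘ₗ ψ s p r h ∘ₗ dualMap (f.f p)

/-- `(1 + T) ψ_0 : C^p → C_r`, for `p + r = n`. -/
def symm₀ (ψ : QStruct C n) (p r : ℤ) (h : p + r = n) : StarDual Λ (C.X p) →ₗ[Λ] C.X r :=
  ψ 0 p r (by simpa using h) + ψ.T 0 p r (by simpa using h)

theorem apply_symm₀ (ψ : QStruct C n) (p r : ℤ) (h : p + r = n) (α : StarDual Λ (C.X p))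
    (β : StarDual Λ (C.X r)) : β (ψ.symm₀ p r h α) =
      β (ψ 0 p r (by simpa using h) α) + (p * r).negOnePow • star (α (ψ 0 r p (by simp; omega) β)) := by
  simp [symm₀, T, apply_coadj]

theorem apply_T (ψ : QStruct C n) (s : ℕ) (p r : ℤ) (h : p + r + s = n)
    (α : StarDual Λ (C.X p)) (β : StarDual Λ (C.X r)) :
    β (ψ.T s p r h α) = (p * r).negOnePow • star (α (ψ s r p (by omega) β)) := by
  simp [T, apply_coadj]

theorem apply_diff (ψ : QStruct C n) (m : ℤ) (hm : m + 1 = n) (s : ℕ) (p r p' r' : ℤ)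
    (h : p + r + s = m) (hp : p + 1 = p') (hr : r + 1 = r')
    (α : StarDual Λ (C.X p)) (β : StarDual Λ (C.X r)) :
    β (ψ.diff m hm s p r h α) = β (C.d r' r hr (ψ s p r' (by omega) α))
      + r.negOnePow • β (ψ s p' r (by omega) (dualMap (C.d p' p hp) α))
      + (n - s - 1).negOnePow • (β (ψ (s + 1) p r (by push_cast; omega) α)
        + ((s : ℤ) + 1).negOnePow • (p * r).negOnePow •
          star (α (ψ (s + 1) r p (by push_cast; omega) β))) := by
  subst hp hr
  rw [← apply_T _ _ _ _ (by push_cast; omega)]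
  simp [diff]

theorem IsCycle.apply_eq_zero {ψ : QStruct C n} (hψ : ψ.IsCycle) (s : ℕ) (p r p' r' : ℤ)
    (h : p + r + s = n - 1) (hp : p + 1 = p') (hr : r + 1 = r')
    (α : StarDual Λ (C.X p)) (β : StarDual Λ (C.X r)) :
    β (C.d r' r hr (ψ s p r' (by omega) α))
      + r.negOnePow • β (ψ s p' r (by omega) (dualMap (C.d p' p hp) α))
      + (n - s - 1).negOnePow • (β (ψ (s + 1) p r (by push_cast; omega) α)
        + ((s : ℤ) + 1).negOnePow • (p * r).negOnePow •
          star (α (ψ (s + 1) r p (by push_cast; omega) β))) = 0 := by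
  rw [← apply_diff ψ (n - 1) (by omega) s p r p' r' h hp hr, show ψ.diff (n - 1) _ = 0 from hψ]
  exact map_zero β

theorem diff_zero (m : ℤ) (hm : m + 1 = n) : (0 : QStruct C n).diff m hm = 0 := by
  funext s p r h
  refine LinearMap.ext fun α => ext_dual (Λ := Λ) fun β => ?_
  rw [apply_diff _ _ _ _ _ _ _ _ _ rfl rfl]
  change β (C.d (r + 1) r rfl 0) + r.negOnePow • β 0 + (n - s - 1).negOnePow •
    (β 0 + ((s : ℤ) + 1).negOnePow • (p * r).negOnePow • star (α 0)) = β 0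
  simp

theorem diff_neg (ψ : QStruct C n) (m : ℤ) (hm : m + 1 = n) : (-ψ).diff m hm = -ψ.diff m hm := by
  funext s p r h
  refine LinearMap.ext fun α => ext_dual (Λ := Λ) fun β => ?_
  change _ = β (-(ψ.diff m hm s p r h α))
  rw [map_neg, apply_diff _ _ _ _ _ _ _ _ _ rfl rfl, apply_diff _ _ _ _ _ _ _ _ _ rfl rfl]
  change β (C.d (r + 1) r rfl (-(ψ s p (r + 1) _ α))) + r.negOnePow • β (-(ψ s (p + 1) r _ _))
    + (n - s - 1).negOnePow • (β (-(ψ (s + 1) p r _ α)) + ((s : ℤ) + 1).negOnePow •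
      (p * r).negOnePow • star (α (-(ψ (s + 1) r p _ β)))) = _
  simp only [map_neg, star_neg, smul_neg, smul_add]
  abel

theorem IsCycle.neg {ψ : QStruct C n} (hψ : ψ.IsCycle) : (-ψ).IsCycle := by
  rw [IsCycle, diff_neg, show ψ.diff (n - 1) _ = 0 from hψ]
  funext s p r h
  exact neg_zero

/-- For a cycle `ψ`, `(1 + T) ψ_0` is a chain map `C^{n-*} → C`. -/
theorem IsCycle.d_symm₀ {ψ : QStruct C n} (hψ : ψ.IsCycle) (p r : ℤ) (h : p + r + 1 = n)
    (r' p' : ℤ) (hr : r + 1 = r') (hp : p + 1 = p') (α : StarDual Λ (C.X p)) :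
    C.d r' r hr (ψ.symm₀ p r' (by omega) α) =
      r'.negOnePow • ψ.symm₀ p' r (by omega) (dualMap (C.d p' p hp) α) := by
  subst hr hp
  refine ext_dual (Λ := Λ) fun β => ?_
  have h1 := hψ.apply_eq_zero 0 p r _ _ (by simp; omega) rfl rfl α β
  have h2 := congrArg star (hψ.apply_eq_zero 0 r p _ _ (by simp; omega) rfl rfl β α)
  have h3 := ψ.apply_symm₀ p (r + 1) (by omega) α (dualMap (C.d (r + 1) r rfl) β)
  have h4 := ψ.apply_symm₀ (p + 1) r (by omega) (dualMap (C.d (p + 1) p rfl) α) β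
  rw [dualMap_apply] at h3
  rw [h3, map_units_smul, h4]
  simp only [star_add, star_units_smul, star_zero, star_star] at h2
  rw [dualMap_apply]
  simp only [mul_add, add_mul, mul_one, one_mul, Int.negOnePow_add, Int.negOnePow_one,
    mul_comm r p, Nat.cast_zero, zero_add] at h1 h2 ⊢
  generalize (p * r).negOnePow = e at *
  generalize p.negOnePow = e₁ at *
  generalize r.negOnePow = e₂ at *
  generalize (n - 0 - 1).negOnePow = e₃ at *
  have key := congrArg₂ (· + e • ·) h1 h2
  simp only [smul_zero, add_zero] at key
  rw [← sub_eq_zero, ← key]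
  rcases Int.units_eq_one_or e with rfl | rfl <;> rcases Int.units_eq_one_or e₁ with rfl | rfl <;>
    rcases Int.units_eq_one_or e₂ with rfl | rfl <;>
    rcases Int.units_eq_one_or e₃ with rfl | rfl <;>
    simp only [Units.neg_smul, one_smul, mul_neg, mul_one, neg_neg, smul_neg] <;> abel

end QStruct


end Complexes

section Pairs

variable {Λ : Type u} [Ring Λ] [StarRing Λ]

/-- An `(n+1)`-dimensional quadratic pair `(f : C → D, (δψ, ψ))` with boundary `(C, ψ)`:
`(δψ, ψ)` is a cycle in `W_%(f)_{n+1}`. -/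
structure QuadPair (C : FreeComplex Λ) (n : ℤ) (ψ : QStruct C n) where
  /-- the complex `D` -/
  D : FreeComplex Λ
  /-- the chain map `f : C → D` -/
  f : ChainMap C D
  /-- the collection `δψ` -/
  δψ : QStruct D (n + 1)
  isCycle : ψ.IsCycle
  isCycle_rel : ∀ s p r h,
    δψ.diff n rfl s p r h + n.negOnePow • QStruct.push f ψ s p r h = 0

namespace QuadPair

variable {C : FreeComplex Λ} {n : ℤ} {ψ : QStruct C n}

/-- The duality map `D^{n+1-*} → cone(f)`, with components
`((1 + T) δψ_0, (-1)^{n+1-r} (1 + T) ψ_0 f^*) : D^{n+1-r} → D_r ⊕ C_{r-1}`. -/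
def dualityMap (c : QuadPair C n ψ) (r : ℤ) :
    (c.D.dual (n + 1)).X r →ₗ[Λ] (FreeComplex.cone c.f).X r :=
  LinearMap.prod
    (c.δψ.symm₀ (n + 1 - r) r (by omega))
    ((n + 1 - r).negOnePow •
      (ψ.symm₀ (n + 1 - r) (r - 1) (by omega) ∘ₗ dualMap (c.f.f (n + 1 - r))))

/-- A quadratic pair is Poincaré if its duality map is a chain equivalence. -/
def IsPoincare (c : QuadPair C n ψ) : Prop :=
  IsChainEquivalence (c.D.dual (n + 1)) (FreeComplex.cone c.f) c.dualityMap

end QuadPair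

/-! ### The thickening of a quadratic complex -/

section Boundary

variable {C : FreeComplex Λ} {m : ℤ} {ψ : QStruct C (m + 1)}

/-- The boundary `∂C` of an `(m+1)`-dimensional quadratic complex `(C, ψ)`:
`∂C_r = C_{r+1} ⊕ C^{m+1-r}`, with differential
`(d_C, (-1)^r (1 + T) ψ_0; 0, (-1)^r d_C^*)`. -/
def bdryComplex (hψ : ψ.IsCycle) : FreeComplex Λ where
  X r := C.X (r + 1) × StarDual Λ (C.X (m + 1 - r))
  d i j h := LinearMap.prod
    (C.d (i + 1) (j + 1) (by omega) ∘ₗ LinearMap.fst Λ _ _ +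
      i.negOnePow • (ψ.symm₀ (m + 1 - i) (j + 1) (by omega) ∘ₗ LinearMap.snd Λ _ _))
    (i.negOnePow • (dualMap (C.d (m + 1 - j) (m + 1 - i) (by omega)) ∘ₗ LinearMap.snd Λ _ _))
  d_d i j k hij hjk x := by
    obtain ⟨x, φ⟩ := x
    have hs : i.negOnePow = -j.negOnePow := by rw [← hij, Int.negOnePow_succ]
    have h1 := hψ.d_symm₀ (m + 1 - i) (k + 1) (by omega) (j + 1) (m + 1 - j) (by omega) (by omega) φ
    have h2 : dualMap (C.d (m + 1 - k) (m + 1 - j) (by omega))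
        (dualMap (C.d (m + 1 - j) (m + 1 - i) (by omega)) φ) = 0 :=
      StarDual.ext fun y => by simp [C.d_d]
    change (C.d (j + 1) (k + 1) (by omega) (C.d (i + 1) (j + 1) (by omega) x +
          i.negOnePow • ψ.symm₀ (m + 1 - i) (j + 1) (by omega) φ) +
        j.negOnePow • ψ.symm₀ (m + 1 - j) (k + 1) (by omega)
          (i.negOnePow • dualMap (C.d (m + 1 - j) (m + 1 - i) (by omega)) φ),
      j.negOnePow • dualMap (C.d (m + 1 - k) (m + 1 - j) (by omega))
        (i.negOnePow • dualMap (C.d (m + 1 - j) (m + 1 - i) (by omega)) φ)) = 0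
    rw [map_add, C.d_d, map_units_smul, map_units_smul, map_units_smul, h1, h2, hs,
      Int.negOnePow_succ]
    simp
  bounded := by
    obtain ⟨a, b, h⟩ := C.bounded
    refine ⟨min (a - 1) (m + 1 - b), max (b - 1) (m + 1 - a), fun i hi => ?_⟩
    have := h (i + 1) (by omega)
    have := h (m + 1 - i) (by omega)
    have : Subsingleton (StarDual Λ (C.X (m + 1 - i))) :=
      ⟨fun φ χ => StarDual.ext fun x => by rw [Subsingleton.elim x 0, map_zero, map_zero]⟩
    infer_instance

/-- The inclusion `C_{r+1} → ∂C_r`. -/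
def bdryInl (hψ : ψ.IsCycle) (r : ℤ) : C.X (r + 1) →ₗ[Λ] (bdryComplex hψ).X r :=
  LinearMap.inl Λ (C.X (r + 1)) (StarDual Λ (C.X (m + 1 - r)))

/-- The inclusion `C^{m+1-r} → ∂C_r`. -/
def bdryInr (hψ : ψ.IsCycle) (r : ℤ) :
    StarDual Λ (C.X (m + 1 - r)) →ₗ[Λ] (bdryComplex hψ).X r :=
  LinearMap.inr Λ (C.X (r + 1)) (StarDual Λ (C.X (m + 1 - r)))

/-- The quadratic structure `∂ψ` on the boundary: `∂ψ_0 = (0, 0; 1, 0)` and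
`∂ψ_s = ((-1)^{m-r-s} T ψ_{s-1}, 0; 0, 0)` for `s > 0`, as maps
`∂C^{m-r-s} = C^{m-r-s+1} ⊕ C_{r+s+1} → ∂C_r = C_{r+1} ⊕ C^{m+1-r}`. -/
def bdryStruct (hψ : ψ.IsCycle) : QStruct (bdryComplex hψ) m
  | 0, p, r, h =>
    bdryInr hψ r ∘ₗ dualMap (bdryInl hψ p ∘ₗ C.idMap (m + 1 - r) (p + 1) (by simp at h; omega))
  | s + 1, p, r, h =>
    bdryInl hψ r ∘ₗ
      ((m - r - (s + 1)).negOnePow • ψ.T s (p + 1) (r + 1) (by push_cast at h; omega)) ∘ₗ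
      dualMap (bdryInl hψ p)

/-- The chain map `(0, 1) : ∂C → C^{m+1-*}`. -/
def thickeningMap (hψ : ψ.IsCycle) : ChainMap (bdryComplex hψ) (C.dual (m + 1)) where
  f r := LinearMap.snd Λ (C.X (r + 1)) (StarDual Λ (C.X (m + 1 - r)))
  comm _ _ _ _ := rfl

theorem d_bdryInl (hψ : ψ.IsCycle) (i j : ℤ) (h : j + 1 = i) (x : C.X (i + 1)) :
    (bdryComplex hψ).d i j h (bdryInl hψ i x) =
      bdryInl hψ j (C.d (i + 1) (j + 1) (by omega) x) := by
  change (C.d (i + 1) (j + 1) (by omega) x + i.negOnePow • ψ.symm₀ (m + 1 - i) (j + 1) (by omega) 0,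
    i.negOnePow • dualMap (C.d (m + 1 - j) (m + 1 - i) (by omega)) 0) = (_, 0)
  simp

theorem d_bdryInr (hψ : ψ.IsCycle) (i j : ℤ) (h : j + 1 = i) (φ : StarDual Λ (C.X (m + 1 - i))) :
    (bdryComplex hψ).d i j h (bdryInr hψ i φ) =
      i.negOnePow • (bdryInl hψ j (ψ.symm₀ (m + 1 - i) (j + 1) (by omega) φ) +
        bdryInr hψ j (dualMap (C.d (m + 1 - j) (m + 1 - i) (by omega)) φ)) := by
  rw [smul_add, ← map_units_smul (bdryInl hψ j), ← map_units_smul (bdryInr hψ j)]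
  change (C.d (i + 1) (j + 1) (by omega) 0 + i.negOnePow • ψ.symm₀ (m + 1 - i) (j + 1) (by omega) φ,
    i.negOnePow • dualMap (C.d (m + 1 - j) (m + 1 - i) (by omega)) φ) = ((_, 0) + (0, _) : _ × _)
  rw [map_zero, zero_add]
  exact Prod.ext (add_zero _).symm (zero_add _).symm

theorem QStruct.symm₀_idMap (ψ : QStruct C m) (p p' r : ℤ) (h : p + r = m) (hp : p' = p)
    (α : StarDual Λ (C.X p)) :
    ψ.symm₀ p' r (by omega) (dualMap (C.idMap p' p hp) α) = ψ.symm₀ p r h α := by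
  subst hp; rfl

theorem d_idMap (C : FreeComplex Λ) (i i' j j' : ℤ) (hi : i = i') (hj : j = j') (h : j + 1 = i)
    (x : C.X i) : C.idMap j j' hj (C.d i j h x) = C.d i' j' (by omega) (C.idMap i i' hi x) := by
  subst hi hj; rfl

theorem isCycle_bdryStruct (hψ : ψ.IsCycle) : (bdryStruct hψ).IsCycle := by
  funext s p r h
  refine LinearMap.ext fun A => ext_dual (Λ := Λ) fun B => ?_
  refine ((bdryStruct hψ).apply_diff (m - 1) (by omega) s p r _ _ h rfl rfl A B).trans (Eq.trans ?_
    (map_zero B).symm)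
  have hAd : dualMap (bdryInl hψ (p + 1)) (dualMap ((bdryComplex hψ).d (p + 1) p rfl) A) =
      dualMap (C.d (p + 1 + 1) (p + 1) rfl) (dualMap (bdryInl hψ p) A) :=
    StarDual.ext fun x => by simp [d_bdryInl]
  have hA : ∀ x, A (bdryInl hψ p x) = dualMap (bdryInl hψ p) A x := fun _ => rfl
  have hB : ∀ x, B (bdryInl hψ r x) = dualMap (bdryInl hψ r) B x := fun _ => rfl
  cases s with
  | zero =>
    have hm : m = p + r + 1 := by push_cast at h; omega
    have hAid : dualMap (C.d (m + 1 - r) (m + 1 - (r + 1)) (by omega))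
        (dualMap (bdryInl hψ p ∘ₗ C.idMap (m + 1 - (r + 1)) (p + 1) (by omega)) A) =
        dualMap (bdryInl hψ (p + 1) ∘ₗ C.idMap (m + 1 - r) (p + 1 + 1) (by omega))
          (dualMap ((bdryComplex hψ).d (p + 1) p rfl) A) :=
      StarDual.ext fun x => by
        simp only [dualMap_apply, LinearMap.comp_apply, d_bdryInl]
        rw [d_idMap C _ (p + 1 + 1) _ (p + 1) (by omega) (by omega)]
    have hs : ψ.symm₀ (m + 1 - (r + 1)) (r + 1) (by omega)
          (dualMap (bdryInl hψ p ∘ₗ C.idMap (m + 1 - (r + 1)) (p + 1) (by omega)) A) =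
        ψ.symm₀ (p + 1) (r + 1) (by omega) (dualMap (bdryInl hψ p) A) :=
      ψ.symm₀_idMap (p + 1) _ (r + 1) _ (by omega) (dualMap (bdryInl hψ p) A)
    simp only [bdryStruct, LinearMap.comp_apply, LinearMap.smul_apply, map_units_smul, d_bdryInr,
      map_add, hs, hAid, hA, hB, ψ.apply_symm₀, ψ.apply_T, star_units_smul, star_star]
    rw [mul_comm (r + 1) (p + 1)]
    simp only [hm, mul_add, add_mul, mul_one, one_mul, Int.negOnePow_add, Int.negOnePow_sub,
      Int.negOnePow_one, Int.negOnePow_zero, Nat.cast_zero, zero_add]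
    generalize (p * r).negOnePow = e
    generalize p.negOnePow = e₁
    generalize r.negOnePow = e₂
    rcases Int.units_eq_one_or e with rfl | rfl <;>
      rcases Int.units_eq_one_or e₁ with rfl | rfl <;>
      rcases Int.units_eq_one_or e₂ with rfl | rfl <;>
      simp only [Units.neg_smul, one_smul, mul_neg, mul_one, neg_neg, smul_neg] <;> abel
  | succ s =>
    have hm : m = p + r + s + 1 + 1 := by push_cast at h; omega
    have key := congrArg star (hψ.apply_eq_zero s (r + 1) (p + 1) _ _ (by push_cast at h; omega) rfl rfl
      (dualMap (bdryInl hψ r) B) (dualMap (bdryInl hψ p) A))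
    simp only [bdryStruct, LinearMap.comp_apply, LinearMap.smul_apply, map_units_smul, hAd,
      d_bdryInl, hA, hB]
    generalize dualMap (bdryInl hψ p) A = A₁ at *
    generalize dualMap (bdryInl hψ r) B = B₁ at *
    have hd : ∀ x, B₁ (C.d (r + 1 + 1) (r + 1) rfl x) =
      dualMap (C.d (r + 1 + 1) (r + 1) rfl) B₁ x := fun _ => rfl
    rw [hd]
    simp only [ψ.apply_T, star_add, star_units_smul, star_star, star_zero, dualMap_apply] at key ⊢
    rw [mul_comm (r + 1) (p + 1)] at *
    simp only [hm, mul_add, add_mul, mul_one, one_mul, Int.negOnePow_add, Int.negOnePow_sub,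
      Int.negOnePow_one, Nat.cast_add, Nat.cast_one] at key ⊢
    generalize (p * r).negOnePow = e at *
    generalize p.negOnePow = e₁ at *
    generalize r.negOnePow = e₂ at *
    generalize (s : ℤ).negOnePow = e₃ at *
    have key' := congrArg (fun t => (-(e * e₂)) • t) key
    simp only [smul_zero] at key'
    rw [← key']
    rcases Int.units_eq_one_or e with rfl | rfl <;>
      rcases Int.units_eq_one_or e₁ with rfl | rfl <;>
      rcases Int.units_eq_one_or e₂ with rfl | rfl <;>
      rcases Int.units_eq_one_or e₃ with rfl | rfl <;>
      simp only [Units.neg_smul, one_smul, mul_neg, mul_one, neg_neg, smul_neg] <;> abel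

/-- The thickening `((0, 1) : ∂C → C^{m+1-*}, (0, ∂ψ))` of an `(m+1)`-dimensional quadratic
complex `(C, ψ)`. -/
def thickening (hψ : ψ.IsCycle) : QuadPair (bdryComplex hψ) m (bdryStruct hψ) where
  D := C.dual (m + 1)
  f := thickeningMap hψ
  δψ := 0
  isCycle := isCycle_bdryStruct hψ
  isCycle_rel s p r h := by
    rw [QStruct.diff_zero]
    refine LinearMap.ext fun φ => ?_
    cases s with
    | zero =>
      change (0 : StarDual Λ (C.X (m + 1 - r))) + m.negOnePow •
        dualMap (C.idMap (m + 1 - r) (p + 1) (by simp at h; omega)) (dualMap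
          (LinearMap.snd Λ (C.X (p + 1)) (StarDual Λ (C.X (m + 1 - p))) ∘ₗ
            LinearMap.inl Λ (C.X (p + 1)) (StarDual Λ (C.X (m + 1 - p)))) φ) = 0
      refine StarDual.ext fun x => ?_
      rw [LinearMap.snd_comp_inl, zero_add]
      exact (StarDual.units_smul_apply _ _ _).trans
        ((congrArg (m.negOnePow • ·) (map_zero φ)).trans (smul_zero _))
    | succ s =>
      change (0 : StarDual Λ (C.X (m + 1 - r))) + m.negOnePow •
        (0 : StarDual Λ (C.X (m + 1 - r))) = 0
      simp

end Boundary

/-! ### The union of two quadratic pairs with common boundary -/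

section Union

variable {C D₁ D₂ : FreeComplex Λ} {n : ℤ}

/-- The complex `D₁ ∪_C D₂`: `D₁_r ⊕ C_{r-1} ⊕ D₂_r` in degree `r`, with differential
`(d, (-1)^{r-1} f₁, 0; 0, d, 0; 0, (-1)^{r-1} f₂, d)`. -/
def unionComplex (f₁ : ChainMap C D₁) (f₂ : ChainMap C D₂) : FreeComplex Λ where
  X r := D₁.X r × C.X (r - 1) × D₂.X r
  d i j h :=
    LinearMap.prod
      (D₁.d i j h ∘ₗ LinearMap.fst Λ _ _ + (i - 1).negOnePow •
        (f₁.at' (i - 1) j (by omega) ∘ₗ LinearMap.fst Λ _ _ ∘ₗ LinearMap.snd Λ _ _))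
      (LinearMap.prod
        (C.d (i - 1) (j - 1) (by omega) ∘ₗ LinearMap.fst Λ _ _ ∘ₗ LinearMap.snd Λ _ _)
        ((i - 1).negOnePow •
            (f₂.at' (i - 1) j (by omega) ∘ₗ LinearMap.fst Λ _ _ ∘ₗ LinearMap.snd Λ _ _) +
          D₂.d i j h ∘ₗ LinearMap.snd Λ _ _ ∘ₗ LinearMap.snd Λ _ _))
  d_d i j k hij hjk x := by
    obtain ⟨x, y, w⟩ := x
    have hs : (i - 1).negOnePow = -(j - 1).negOnePow := by
      rw [← Int.negOnePow_succ]; congr 1; omega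
    have h1 := f₁.d_at' (i - 1) (j - 1) j k (by omega) hjk (by omega) (by omega) y
    have h2 := f₂.d_at' (i - 1) (j - 1) j k (by omega) hjk (by omega) (by omega) y
    change (D₁.d j k hjk (D₁.d i j hij x + (i - 1).negOnePow • f₁.at' (i - 1) j (by omega) y) +
        (j - 1).negOnePow • f₁.at' (j - 1) k (by omega) (C.d (i - 1) (j - 1) (by omega) y),
      C.d (j - 1) (k - 1) (by omega) (C.d (i - 1) (j - 1) (by omega) y),
      (j - 1).negOnePow • f₂.at' (j - 1) k (by omega) (C.d (i - 1) (j - 1) (by omega) y) +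
        D₂.d j k hjk ((i - 1).negOnePow • f₂.at' (i - 1) j (by omega) y + D₂.d i j hij w)) = 0
    rw [map_add, map_add, D₁.d_d, D₂.d_d, C.d_d, map_units_smul, map_units_smul, h1, h2, hs,
      Units.neg_smul, zero_add, neg_add_cancel, Units.neg_smul, add_zero, add_neg_cancel]
    rfl
  bounded := by
    obtain ⟨a, b, h⟩ := C.bounded
    obtain ⟨a₁, b₁, h₁⟩ := D₁.bounded
    obtain ⟨a₂, b₂, h₂⟩ := D₂.bounded
    refine ⟨min (a + 1) (min a₁ a₂), max (b + 1) (max b₁ b₂), fun i hi => ?_⟩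
    have := h (i - 1) (by omega)
    have := h₁ i (by omega)
    have := h₂ i (by omega)
    infer_instance

variable (f₁ : ChainMap C D₁) (f₂ : ChainMap C D₂)

/-- The inclusion `D₁_r → (D₁ ∪_C D₂)_r`. -/
def unionIn₁ (r : ℤ) : D₁.X r →ₗ[Λ] (unionComplex f₁ f₂).X r :=
  LinearMap.inl Λ (D₁.X r) (C.X (r - 1) × D₂.X r)

/-- The inclusion `C_{r-1} → (D₁ ∪_C D₂)_r`. -/
def unionIn₂ (r : ℤ) : C.X (r - 1) →ₗ[Λ] (unionComplex f₁ f₂).X r :=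
  LinearMap.inr Λ (D₁.X r) (C.X (r - 1) × D₂.X r) ∘ₗ LinearMap.inl Λ (C.X (r - 1)) (D₂.X r)

/-- The inclusion `D₂_r → (D₁ ∪_C D₂)_r`. -/
def unionIn₃ (r : ℤ) : D₂.X r →ₗ[Λ] (unionComplex f₁ f₂).X r :=
  LinearMap.inr Λ (D₁.X r) (C.X (r - 1) × D₂.X r) ∘ₗ LinearMap.inr Λ (C.X (r - 1)) (D₂.X r)

/-- The quadratic structure `δ₁ ∪_ψ δ₂` on `D₁ ∪_C D₂` for quadratic pairs
`(f₁ : C → D₁, (δ₁, -ψ))` and `(f₂ : C → D₂, (δ₂, ψ))`: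
`(δ₁_s, 0, 0; (-1)^{n-r} ψ_s f₁^*, (-1)^{n-r-s+1} T ψ_{s+1}, 0; 0, (-1)^s f₂ ψ_s, δ₂_s)` as a map
`D₁^p ⊕ C^{p-1} ⊕ D₂^p → D₁_r ⊕ C_{r-1} ⊕ D₂_r` with `p = n + 1 - r - s`. -/
def unionStruct (δ₁ : QStruct D₁ (n + 1)) (δ₂ : QStruct D₂ (n + 1)) (ψ : QStruct C n) :
    QStruct (unionComplex f₁ f₂) (n + 1) := fun s p r h =>
  unionIn₁ f₁ f₂ r ∘ₗ δ₁ s p r h ∘ₗ dualMap (unionIn₁ f₁ f₂ p)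
  + unionIn₂ f₁ f₂ r ∘ₗ
      ((n - r).negOnePow •
          (ψ s p (r - 1) (by omega) ∘ₗ dualMap (f₁.f p) ∘ₗ dualMap (unionIn₁ f₁ f₂ p))
        + (n - r - s + 1).negOnePow •
          (ψ.T (s + 1) (p - 1) (r - 1) (by push_cast; omega) ∘ₗ dualMap (unionIn₂ f₁ f₂ p)))
  + unionIn₃ f₁ f₂ r ∘ₗ
      ((s : ℤ).negOnePow •
          (f₂.f r ∘ₗ ψ s (p - 1) r (by omega) ∘ₗ dualMap (unionIn₂ f₁ f₂ p))
        + δ₂ s p r h ∘ₗ dualMap (unionIn₃ f₁ f₂ p))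

theorem apply_unionStruct (δ₁ : QStruct D₁ (n + 1)) (δ₂ : QStruct D₂ (n + 1)) (ψ : QStruct C n)
    (s : ℕ) (p r : ℤ) (h : p + r + s = n + 1) (A : StarDual Λ ((unionComplex f₁ f₂).X p))
    (B : StarDual Λ ((unionComplex f₁ f₂).X r)) :
    B (unionStruct f₁ f₂ δ₁ δ₂ ψ s p r h A) =
      dualMap (unionIn₁ f₁ f₂ r) B (δ₁ s p r h (dualMap (unionIn₁ f₁ f₂ p) A))
      + ((n - r).negOnePow • dualMap (unionIn₂ f₁ f₂ r) B (ψ s p (r - 1) (by omega)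
            (dualMap (f₁.f p) (dualMap (unionIn₁ f₁ f₂ p) A)))
        + (n - r - s + 1).negOnePow • ((p - 1) * (r - 1)).negOnePow •
          star (dualMap (unionIn₂ f₁ f₂ p) A
            (ψ (s + 1) (r - 1) (p - 1) (by push_cast; omega) (dualMap (unionIn₂ f₁ f₂ r) B))))
      + ((s : ℤ).negOnePow • dualMap (f₂.f r) (dualMap (unionIn₃ f₁ f₂ r) B)
            (ψ s (p - 1) r (by omega) (dualMap (unionIn₂ f₁ f₂ p) A))
        + dualMap (unionIn₃ f₁ f₂ r) B (δ₂ s p r h (dualMap (unionIn₃ f₁ f₂ p) A))) := by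
  rw [← ψ.apply_T (s + 1) (p - 1) (r - 1) (by push_cast; omega)]
  simp [unionStruct]

theorem d_unionIn₁ (i j : ℤ) (h : j + 1 = i) (x : D₁.X i) :
    (unionComplex f₁ f₂).d i j h (unionIn₁ f₁ f₂ i x) = unionIn₁ f₁ f₂ j (D₁.d i j h x) := by
  change (D₁.d i j h x + (i - 1).negOnePow • f₁.at' (i - 1) j (by omega) 0,
    C.d (i - 1) (j - 1) (by omega) 0,
    (i - 1).negOnePow • f₂.at' (i - 1) j (by omega) 0 + D₂.d i j h 0) = (_, 0, 0)
  simp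

theorem d_unionIn₂ (i j : ℤ) (h : j + 1 = i) (x : C.X (i - 1)) :
    (unionComplex f₁ f₂).d i j h (unionIn₂ f₁ f₂ i x) =
      (i - 1).negOnePow • unionIn₁ f₁ f₂ j (f₁.at' (i - 1) j (by omega) x)
        + unionIn₂ f₁ f₂ j (C.d (i - 1) (j - 1) (by omega) x)
        + (i - 1).negOnePow • unionIn₃ f₁ f₂ j (f₂.at' (i - 1) j (by omega) x) := by
  rw [← map_units_smul (unionIn₁ f₁ f₂ j), ← map_units_smul (unionIn₃ f₁ f₂ j)]
  change (D₁.d i j h 0 + (i - 1).negOnePow • f₁.at' (i - 1) j (by omega) x,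
    C.d (i - 1) (j - 1) (by omega) x,
    (i - 1).negOnePow • f₂.at' (i - 1) j (by omega) x + D₂.d i j h 0) =
      (_ + 0 + 0, 0 + _ + 0, 0 + 0 + _)
  simp only [map_zero, add_zero, zero_add]
  rfl

theorem d_unionIn₃ (i j : ℤ) (h : j + 1 = i) (x : D₂.X i) :
    (unionComplex f₁ f₂).d i j h (unionIn₃ f₁ f₂ i x) = unionIn₃ f₁ f₂ j (D₂.d i j h x) := by
  change (D₁.d i j h 0 + (i - 1).negOnePow • f₁.at' (i - 1) j (by omega) 0,
    C.d (i - 1) (j - 1) (by omega) 0,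
    (i - 1).negOnePow • f₂.at' (i - 1) j (by omega) 0 + D₂.d i j h x) = (0, 0, _)
  simp

theorem apply_at_apply {D : FreeComplex Λ} (f : ChainMap C D) (ψ : QStruct C n) (s : ℕ)
    (p r r' : ℤ) (h : p + r' + s = n) (hr : r' = r) (α : StarDual Λ (C.X p))
    (β : StarDual Λ (D.X r)) :
    β (f.at' r' r hr (ψ s p r' h α)) =
      dualMap (f.f r) β (ψ s p r (by omega) α) := by
  subst hr; rfl

theorem dual_d_unionIn₁ (i j : ℤ) (h : j + 1 = i) (A : StarDual Λ ((unionComplex f₁ f₂).X j)) :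
    dualMap (unionIn₁ f₁ f₂ i) (dualMap ((unionComplex f₁ f₂).d i j h) A) =
      dualMap (D₁.d i j h) (dualMap (unionIn₁ f₁ f₂ j) A) :=
  StarDual.ext fun x => by simp [d_unionIn₁]

theorem dual_d_unionIn₂ (i j : ℤ) (h : j + 1 = i) (A : StarDual Λ ((unionComplex f₁ f₂).X j)) :
    dualMap (unionIn₂ f₁ f₂ i) (dualMap ((unionComplex f₁ f₂).d i j h) A) =
      (i - 1).negOnePow • dualMap (f₁.at' (i - 1) j (by omega)) (dualMap (unionIn₁ f₁ f₂ j) A)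
        + dualMap (C.d (i - 1) (j - 1) (by omega)) (dualMap (unionIn₂ f₁ f₂ j) A)
        + (i - 1).negOnePow •
            dualMap (f₂.at' (i - 1) j (by omega)) (dualMap (unionIn₃ f₁ f₂ j) A) :=
  StarDual.ext fun x => by simp [d_unionIn₂]

theorem dual_d_unionIn₃ (i j : ℤ) (h : j + 1 = i) (A : StarDual Λ ((unionComplex f₁ f₂).X j)) :
    dualMap (unionIn₃ f₁ f₂ i) (dualMap ((unionComplex f₁ f₂).d i j h) A) =
      dualMap (D₂.d i j h) (dualMap (unionIn₃ f₁ f₂ j) A) :=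
  StarDual.ext fun x => by simp [d_unionIn₃]

theorem dual_at_apply {D : FreeComplex Λ} (f : ChainMap C D) (ψ : QStruct C n) (s : ℕ)
    (p r r' : ℤ) (h : p + r' + s = n) (hr : r' = r) (α : StarDual Λ (C.X p))
    (β : StarDual Λ (D.X r)) :
    dualMap (f.at' r' r hr) β (ψ s p r' h α) =
      dualMap (f.f r) β (ψ s p r (by omega) α) := by
  subst hr; rfl

theorem apply_dual_at {D : FreeComplex Λ} (f : ChainMap C D) (ψ : QStruct C n) (s : ℕ)
    (p p' r : ℤ) (h : p' + r + s = n) (hp : p' = p) (α : StarDual Λ (D.X p)) :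
    ψ s p' r h (dualMap (f.at' p' p hp) α) = ψ s p r (by omega) (dualMap (f.f p) α) := by
  subst hp; rfl

theorem dual_d_f {D : FreeComplex Λ} (f : ChainMap C D) (i j : ℤ) (h : j + 1 = i)
    (α : StarDual Λ (D.X j)) :
    dualMap (f.f i) (dualMap (D.d i j h) α) = dualMap (C.d i j h) (dualMap (f.f j) α) :=
  StarDual.ext fun x => by simp [f.comm i j h]

/-- If `(f₁, (δ₁, -ψ))` and `(f₂, (δ₂, ψ))` are quadratic pairs then `δ₁ ∪_ψ δ₂` is a cycle. -/
theorem isCycle_unionStruct (δ₁ : QStruct D₁ (n + 1)) (δ₂ : QStruct D₂ (n + 1)) (ψ : QStruct C n)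
    (hψ : ψ.IsCycle)
    (h₁ : ∀ s p r h, δ₁.diff n rfl s p r h = n.negOnePow • QStruct.push f₁ ψ s p r h)
    (h₂ : ∀ s p r h, δ₂.diff n rfl s p r h + n.negOnePow • QStruct.push f₂ ψ s p r h = 0) :
    (unionStruct f₁ f₂ δ₁ δ₂ ψ).IsCycle := by
  funext s p r h
  have hn : n = p + r + s := by omega
  refine LinearMap.ext fun A => ext_dual (Λ := Λ) fun B => ?_
  refine ((unionStruct f₁ f₂ δ₁ δ₂ ψ).apply_diff (n + 1 - 1) (by omega) s p r _ _ h rfl rfl A B).trans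
    (Eq.trans ?_ (map_zero B).symm)
  have hd : ∀ x, B ((unionComplex f₁ f₂).d (r + 1) r rfl x) =
      dualMap ((unionComplex f₁ f₂).d (r + 1) r rfl) B x := fun _ => rfl
  rw [hd]
  have k₁ := congrArg (dualMap (unionIn₁ f₁ f₂ r) B)
    (LinearMap.congr_fun (h₁ s p r (by omega)) (dualMap (unionIn₁ f₁ f₂ p) A))
  have k₃ := congrArg (dualMap (unionIn₃ f₁ f₂ r) B)
    (LinearMap.congr_fun (h₂ s p r (by omega)) (dualMap (unionIn₃ f₁ f₂ p) A))
  simp only [LinearMap.add_apply, LinearMap.smul_apply, map_add, map_units_smul,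
    LinearMap.zero_apply, map_zero] at k₁ k₃
  rw [δ₁.apply_diff n rfl s p r _ _ (by omega) rfl rfl] at k₁
  rw [δ₂.apply_diff n rfl s p r _ _ (by omega) rfl rfl] at k₃
  have hp1 : ∀ {D : FreeComplex Λ} (f : ChainMap C D) (α : StarDual Λ (D.X p))
      (β : StarDual Λ (D.X r)), β (QStruct.push f ψ s p r (by omega) α) =
        dualMap (f.f r) β (ψ s p r (by omega) (dualMap (f.f p) α)) := fun _ _ _ => rfl
  rw [hp1] at k₁ k₃
  have hdC : ∀ (i j : ℤ) (h : j + 1 = i) (β : StarDual Λ (C.X j)) (x), β (C.d i j h x) =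
      dualMap (C.d i j h) β x := fun _ _ _ _ _ => rfl
  have hd1 : ∀ (i j : ℤ) (h : j + 1 = i) (β : StarDual Λ (D₁.X j)) (x), β (D₁.d i j h x) =
      dualMap (D₁.d i j h) β x := fun _ _ _ _ _ => rfl
  have hd2 : ∀ (i j : ℤ) (h : j + 1 = i) (β : StarDual Λ (D₂.X j)) (x), β (D₂.d i j h x) =
      dualMap (D₂.d i j h) β x := fun _ _ _ _ _ => rfl
  have k21 := hψ.apply_eq_zero s p (r - 1) (p + 1) (r + 1 - 1) (by omega) rfl (by omega)
    (dualMap (f₁.f p) (dualMap (unionIn₁ f₁ f₂ p) A)) (dualMap (unionIn₂ f₁ f₂ r) B)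
  have k32 := hψ.apply_eq_zero s (p - 1) r (p + 1 - 1) (r + 1) (by omega) (by omega) rfl
    (dualMap (unionIn₂ f₁ f₂ p) A) (dualMap (f₂.f r) (dualMap (unionIn₃ f₁ f₂ r) B))
  have k22 := congrArg star (hψ.apply_eq_zero (s + 1) (r - 1) (p - 1) (r + 1 - 1) (p + 1 - 1)
    (by push_cast; omega) (by omega) (by omega)
    (dualMap (unionIn₂ f₁ f₂ r) B) (dualMap (unionIn₂ f₁ f₂ p) A))
  simp only [apply_unionStruct, star_add, star_units_smul, star_star, dual_d_unionIn₁,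
    dual_d_unionIn₂, dual_d_unionIn₃, map_add, map_units_smul, StarDual.add_apply,
    StarDual.units_smul_apply, dual_at_apply, apply_dual_at, dual_d_f, hdC, hd1, hd2, star_zero] at k₁ k₃ k21 k32 k22 ⊢
  generalize dualMap (unionIn₁ f₁ f₂ p) A = A₁ at *
  generalize dualMap (unionIn₂ f₁ f₂ p) A = A₂ at *
  generalize dualMap (unionIn₃ f₁ f₂ p) A = A₃ at *
  generalize dualMap (unionIn₁ f₁ f₂ r) B = B₁ at *
  generalize dualMap (unionIn₂ f₁ f₂ r) B = B₂ at *
  generalize dualMap (unionIn₃ f₁ f₂ r) B = B₃ at *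
  clear hdC hd1 hd2 hp1 hd
  simp only [hn, Nat.cast_add, mul_add, add_mul, mul_sub, sub_mul, mul_one, one_mul, Nat.cast_one,
    mul_comm r p, Int.negOnePow_add, Int.negOnePow_sub, Int.negOnePow_one] at k₁ k₃ k21 k32 k22 ⊢
  generalize (p * r).negOnePow = e at *
  generalize p.negOnePow = e₁ at *
  generalize r.negOnePow = e₂ at *
  generalize (s : ℤ).negOnePow = e₃ at *
  have key := congrArg₂ (· + ·) (sub_eq_zero.2 k₁) (congrArg₂ (· + ·) k₃ (congrArg₂ (· + ·)
    (congrArg ((-(e₁ * e₃)) • ·) k21) (congrArg₂ (· + ·) (congrArg (e₃ • ·) k32)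
      (congrArg ((-(e₂ * e)) • ·) k22))))
  simp only [smul_zero, add_zero] at key
  rw [← key]
  clear key k₁ k₃ k21 k32 k22
  rcases Int.units_eq_one_or e with rfl | rfl <;>
    rcases Int.units_eq_one_or e₁ with rfl | rfl <;>
    rcases Int.units_eq_one_or e₂ with rfl | rfl <;>
    rcases Int.units_eq_one_or e₃ with rfl | rfl <;>
    simp only [Units.neg_smul, one_smul, mul_neg, mul_one, neg_neg, smul_neg] <;> abel
end Union

/-! ### Glueing, cobordism and algebraic h-cobordism -/

namespace QuadPair

variable {C : FreeComplex Λ} {n : ℤ} {ψ : QStruct C n}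

/-- The complex `D ∪_C D'` of `c ∪ -c'`, for `c = (f : C → D, (δψ, ψ))` and
`c' = (f' : C → D', (δψ', ψ))`. -/
def gluedComplex (c c' : QuadPair C n ψ) : FreeComplex Λ := unionComplex c.f c'.f

/-- The quadratic structure `δψ ∪_ψ -δψ'` of `c ∪ -c'`: the union of `(f, (δψ, -(-ψ)))` and
`(f', (-δψ', -ψ))`. -/
def gluedStruct (c c' : QuadPair C n ψ) : QStruct (c.gluedComplex c') (n + 1) :=
  unionStruct c.f c'.f c.δψ (-c'.δψ) (-ψ)

theorem isCycle_gluedStruct (c c' : QuadPair C n ψ) : (c.gluedStruct c').IsCycle := by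
  refine isCycle_unionStruct _ _ _ _ _ c.isCycle.neg (fun s p r h => ?_) (fun s p r h => ?_)
  · rw [eq_neg_of_add_eq_zero_left (c.isCycle_rel s p r h)]
    refine LinearMap.ext fun α => ?_
    change -(n.negOnePow • c.f.f r (ψ s p r h (dualMap (c.f.f p) α))) =
      n.negOnePow • c.f.f r (-(ψ s p r h (dualMap (c.f.f p) α)))
    rw [map_neg, smul_neg]
  · rw [QStruct.diff_neg]
    refine LinearMap.ext fun α => ?_
    have h1 := LinearMap.congr_fun (c'.isCycle_rel s p r h) α
    change c'.δψ.diff n rfl s p r h α +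
      n.negOnePow • c'.f.f r (ψ s p r h (dualMap (c'.f.f p) α)) = 0 at h1
    change -(c'.δψ.diff n rfl s p r h α) +
      n.negOnePow • c'.f.f r (-(ψ s p r h (dualMap (c'.f.f p) α))) = 0
    rw [map_neg, smul_neg, ← neg_add, h1, neg_zero]

/-- Two `(n+1)`-dimensional quadratic Poincaré pairs `c = (f : C → D, (δψ, ψ))` and
`c' = (f' : C → D', (δψ', ψ))` are cobordant rel∂: there is an `(n+2)`-dimensional quadratic
Poincaré pair `(D' ∪_C D → E, (δω, δψ' ∪_ψ -δψ))`. -/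
def CobordantRelBoundary (c c' : QuadPair C n ψ) : Prop :=
  c.IsPoincare ∧ c'.IsPoincare ∧
    ∃ e : QuadPair (c'.gluedComplex c) (n + 1) (c'.gluedStruct c), e.IsPoincare

/-- The restriction `j_0 : D → E` of `g` for a pair `d = (g : D ∪_C D' → E, …)`. -/
def endLeft {c c' : QuadPair C n ψ} (d : QuadPair (c.gluedComplex c') (n + 1) (c.gluedStruct c'))
    (r : ℤ) : c.D.X r →ₗ[Λ] d.D.X r := d.f.f r ∘ₗ unionIn₁ c.f c'.f r

/-- The restriction `j_1 : D' → E` of `g` for a pair `d = (g : D ∪_C D' → E, …)`. -/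
def endRight {c c' : QuadPair C n ψ} (d : QuadPair (c.gluedComplex c') (n + 1) (c.gluedStruct c'))
    (r : ℤ) : c'.D.X r →ₗ[Λ] d.D.X r := d.f.f r ∘ₗ unionIn₃ c.f c'.f r

/-- The pair `d = (g : D ∪_C D' → E, (δω, δψ ∪_ψ -δψ'))` is an algebraic h-cobordism (between
`c` and `c'`): `c`, `c'`, `d` are Poincaré and `j_0 : D → E`, `j_1 : D' → E` are chain
equivalences. -/
structure IsAlgebraicHCobordism {c c' : QuadPair C n ψ}
    (d : QuadPair (c.gluedComplex c') (n + 1) (c.gluedStruct c')) : Prop where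
  isPoincare_left : c.IsPoincare
  isPoincare_right : c'.IsPoincare
  isPoincare : d.IsPoincare
  equiv_left : IsChainEquivalence c.D d.D (endLeft d)
  equiv_right : IsChainEquivalence c'.D d.D (endRight d)

/-- The pair `x`, whose boundary is `c ∪ -c'`, is cobordant rel∂ to an algebraic h-cobordism
(between `c` and `c'`). -/
def IsCobordantToHCobordism {c c' : QuadPair C n ψ}
    (x : QuadPair (c.gluedComplex c') (n + 1) (c.gluedStruct c')) : Prop :=
  ∃ x' : QuadPair (c.gluedComplex c') (n + 1) (c.gluedStruct c'),
    IsAlgebraicHCobordism x' ∧ CobordantRelBoundary x x'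

end QuadPair

end Pairs
section Construction

variable {Λ : Type u} [Ring Λ] [StarRing Λ]

/-! ### Complexes concentrated in one or two degrees -/

/-- The module in degree `r` of the graded module which is `M` in degree `k` and zero in all
other degrees. -/
abbrev Conc (k : ℤ) (M : Type u) (r : ℤ) : Type u := PLift (r = k) → M

namespace Conc

variable {k : ℤ} {M : Type u} [AddCommGroup M] [Module Λ M]

theorem subsingleton {r : ℤ} (h : r ≠ k) : Subsingleton (Conc k M r) :=
  ⟨fun _ _ => funext fun i => absurd i.down h⟩

/-- The map `M → Conc k M r`: the identity for `r = k`. -/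
def of (k : ℤ) (M : Type u) [AddCommGroup M] [Module Λ M] (r : ℤ) : M →ₗ[Λ] Conc k M r :=
  LinearMap.pi fun _ => LinearMap.id

/-- The map `Conc k M r → M`: the identity for `r = k`, zero otherwise. -/
def out (k : ℤ) (M : Type u) [AddCommGroup M] [Module Λ M] (r : ℤ) : Conc k M r →ₗ[Λ] M :=
  if h : r = k then LinearMap.proj ⟨h⟩ else 0

theorem of_eq_zero {r : ℤ} (h : r ≠ k) (x : M) : of (Λ := Λ) k M r x = 0 :=
  (subsingleton h).elim _ _

theorem out_of {r : ℤ} (h : r = k) (x : M) : out (Λ := Λ) k M r (of (Λ := Λ) k M r x) = x := by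
  simp [out, of, h]

theorem out_eq_zero {r : ℤ} (h : r ≠ k) (x : Conc k M r) : out (Λ := Λ) k M r x = 0 := by
  simp [out, h]

theorem of_out {r : ℤ} (x : Conc k M r) : of (Λ := Λ) k M r (out (Λ := Λ) k M r x) = x := by
  funext i
  simp [out, of, i.down]

end Conc

namespace FreeComplex

/-- The complex which is `M` in degree `k` and zero elsewhere. -/
def single (k : ℤ) (M : Type u) [AddCommGroup M] [Module Λ M] [Module.Free Λ M]
    [Module.Finite Λ M] : FreeComplex Λ where
  X r := Conc k M r
  d _ _ _ := 0
  d_d _ _ _ _ _ _ := rfl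
  bounded := ⟨k, k, fun _ h => Conc.subsingleton (by omega)⟩

variable {A B : Type u} [AddCommGroup A] [Module Λ A] [Module.Free Λ A] [Module.Finite Λ A]
  [AddCommGroup B] [Module Λ B] [Module.Free Λ B] [Module.Finite Λ B]

/-- The complex `A → B`, with `A` in degree `q + 1`, `B` in degree `q` and differential `δ`. -/
def twoTerm (q : ℤ) (δ : A →ₗ[Λ] B) : FreeComplex Λ where
  X r := Conc (q + 1) A r × Conc q B r
  d i j h := LinearMap.inr Λ (Conc (q + 1) A j) (Conc q B j) ∘ₗ Conc.of q B j ∘ₗ δ ∘ₗ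
    Conc.out (q + 1) A i ∘ₗ LinearMap.fst Λ (Conc (q + 1) A i) (Conc q B i)
  d_d i j k hij hjk x := by simp
  bounded := ⟨q, q + 1, fun i h => by
    have := Conc.subsingleton (k := q + 1) (M := A) (r := i) (by omega)
    have := Conc.subsingleton (k := q) (M := B) (r := i) (by omega)
    infer_instance⟩

variable (q : ℤ) (δ : A →ₗ[Λ] B)

/-- The inclusion of `A` (zero unless `r = q + 1`). -/
def inA (r : ℤ) : A →ₗ[Λ] (twoTerm q δ).X r :=
  LinearMap.inl Λ (Conc (q + 1) A r) (Conc q B r) ∘ₗ Conc.of (q + 1) A r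

/-- The inclusion of `B` (zero unless `r = q`). -/
def inB (r : ℤ) : B →ₗ[Λ] (twoTerm q δ).X r :=
  LinearMap.inr Λ (Conc (q + 1) A r) (Conc q B r) ∘ₗ Conc.of q B r

/-- The projection to `A` (zero unless `r = q + 1`). -/
def outA (r : ℤ) : (twoTerm q δ).X r →ₗ[Λ] A :=
  Conc.out (q + 1) A r ∘ₗ LinearMap.fst Λ (Conc (q + 1) A r) (Conc q B r)

/-- The projection to `B` (zero unless `r = q`). -/
def outB (r : ℤ) : (twoTerm q δ).X r →ₗ[Λ] B :=
  Conc.out q B r ∘ₗ LinearMap.snd Λ (Conc (q + 1) A r) (Conc q B r)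

variable {q} {δ}

theorem inA_eq_zero {r : ℤ} (h : r ≠ q + 1) (a : A) : inA q δ r a = 0 := by
  change (Conc.of (Λ := Λ) (q + 1) A r a, 0) = (0, 0)
  rw [Conc.of_eq_zero h]

theorem inB_eq_zero {r : ℤ} (h : r ≠ q) (b : B) : inB q δ r b = 0 := by
  change (0, Conc.of (Λ := Λ) q B r b) = (0, 0)
  rw [Conc.of_eq_zero h]

theorem outA_eq_zero {r : ℤ} (h : r ≠ q + 1) (x : (twoTerm q δ).X r) : outA q δ r x = 0 :=
  Conc.out_eq_zero h _

theorem outB_eq_zero {r : ℤ} (h : r ≠ q) (x : (twoTerm q δ).X r) : outB q δ r x = 0 :=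
  Conc.out_eq_zero h _

theorem outA_inA {r : ℤ} (h : r = q + 1) (a : A) : outA q δ r (inA q δ r a) = a :=
  Conc.out_of h a

theorem outB_inB {r : ℤ} (h : r = q) (b : B) : outB q δ r (inB q δ r b) = b :=
  Conc.out_of h b

@[simp] theorem outA_inB {r : ℤ} (b : B) : outA q δ r (inB q δ r b) = 0 :=
  map_zero (Conc.out (Λ := Λ) (q + 1) A r)

@[simp] theorem outB_inA {r : ℤ} (a : A) : outB q δ r (inA q δ r a) = 0 :=
  map_zero (Conc.out (Λ := Λ) q B r)

theorem inB_outB_inB {A' : Type u} [AddCommGroup A'] [Module Λ A'] [Module.Free Λ A']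
    [Module.Finite Λ A'] (δ' : A' →ₗ[Λ] B) {r : ℤ} (b : B) :
    inB q δ' r (outB q δ r (inB q δ r b)) = inB q δ' r b := by
  by_cases h : r = q
  · rw [outB_inB h]
  · rw [inB_eq_zero h, inB_eq_zero h]

theorem inA_add_inB {r : ℤ} (x : (twoTerm q δ).X r) :
    inA q δ r (outA q δ r x) + inB q δ r (outB q δ r x) = x := by
  change (Conc.of (Λ := Λ) (q + 1) A r (Conc.out (Λ := Λ) (q + 1) A r x.1) + 0,
    0 + Conc.of (Λ := Λ) q B r (Conc.out (Λ := Λ) q B r x.2)) = x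
  rw [Conc.of_out, Conc.of_out, add_zero, zero_add]
  rfl

theorem d_twoTerm (i j : ℤ) (h : j + 1 = i) (x : (twoTerm q δ).X i) :
    (twoTerm q δ).d i j h x = inB q δ j (δ (outA q δ i x)) := rfl

theorem d_inA (i j : ℤ) (h : j + 1 = i) (a : A) :
    (twoTerm q δ).d i j h (inA q δ i a) = inB q δ j (δ a) := by
  rw [d_twoTerm]
  by_cases hi : i = q + 1
  · rw [outA_inA hi]
  · rw [inB_eq_zero (by omega), inB_eq_zero (by omega)]

@[simp] theorem d_inB (i j : ℤ) (h : j + 1 = i) (b : B) :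
    (twoTerm q δ).d i j h (inB q δ i b) = 0 := by
  rw [d_twoTerm, outA_inB, map_zero, map_zero]

end FreeComplex

section ShortStruct

open FreeComplex

variable {A G : Type u} [AddCommGroup A] [Module Λ A] [Module.Free Λ A] [Module.Finite Λ A]
  [AddCommGroup G] [Module Λ G] [Module.Free Λ G] [Module.Finite Λ G]
  (q : ℤ) (δ : A →ₗ[Λ] StarDual Λ G) (ζ₀ : G →ₗ[Λ] A) (ζ₁ : G →ₗ[Λ] StarDual Λ G)

/-- For the complex `N = (A → G^*)` with `G^*` in degree `q` (so that `N^q = G`): the collection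
`ζ` whose only non-zero components are `ζ_0 : N^q = G → N_{q+1} = A` and
`ζ_1 : N^q = G → N_q = G^*`. -/
def shortStruct : QStruct (twoTerm q δ) (2 * q + 1)
  | 0, p, r, _ =>
    inA q δ r ∘ₗ ζ₀ ∘ₗ (undual G).toLinearMap ∘ₗ dualMap (inB q δ p)
  | 1, p, r, _ =>
    inB q δ r ∘ₗ ζ₁ ∘ₗ (undual G).toLinearMap ∘ₗ dualMap (inB q δ p)
  | _ + 2, _, _, _ => 0

theorem isCycle_shortStruct (h : ∀ x y, δ (ζ₀ x) y + ζ₁ x y - q.negOnePow • star (ζ₁ y x) = 0) :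
    (shortStruct q δ ζ₀ ζ₁).IsCycle := by
  funext s p r hs
  refine LinearMap.ext fun α => ext_dual (Λ := Λ) fun β => ?_
  refine ((shortStruct q δ ζ₀ ζ₁).apply_diff (2 * q + 1 - 1) (by omega) s p r _ _ hs rfl rfl
    α β).trans (Eq.trans ?_ (map_zero β).symm)
  have h0 : dualMap (inB q δ (p + 1)) (dualMap ((twoTerm q δ).d (p + 1) p rfl) α) = 0 :=
    StarDual.ext fun x => by simp
  match s, hs with
  | 0, hs =>
    simp only [shortStruct, LinearMap.comp_apply, LinearEquiv.coe_coe, h0, map_zero, smul_zero,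
      add_zero, d_inA]
    by_cases hp : p = q
    · have hr : r = q := by push_cast at hs; omega
      subst hp hr
      have e1 : ∀ x, β (inB r δ r x) = star (x (undual G (dualMap (inB r δ r) β))) := fun x => by
        rw [apply_undual, star_star, dualMap_apply]
      have e2 : ∀ x, α (inB r δ r x) = star (x (undual G (dualMap (inB r δ r) α))) := fun x => by
        rw [apply_undual, star_star, dualMap_apply]
      rw [e1, e1, e2]
      have h1 := congrArg star (h (undual G (dualMap (inB r δ r) α))
        (undual G (dualMap (inB r δ r) β)))
      simp only [star_add, star_sub, star_units_smul, star_star, star_zero] at h1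
      rw [star_star, ← h1]
      have e3 : (2 * r + 1 - (0 : ℕ) - 1).negOnePow = 1 := by
        rw [show 2 * r + 1 - ((0 : ℕ) : ℤ) - 1 = r + r by push_cast; ring]
        exact Int.negOnePow_even _ ⟨r, rfl⟩
      have e4 : (r * r).negOnePow = r.negOnePow := Int.negOnePow_mul_self r
      rw [e3, e4]
      simp
      abel
    · have hr : r ≠ q := by push_cast at hs; omega
      simp [inB_eq_zero hp, inB_eq_zero hr]
  | 1, hs =>
    simp [shortStruct, h0]
  | s + 2, hs =>
    simp [shortStruct]

end ShortStruct

namespace RegSplitPreformation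

open FreeComplex

variable {q : ℕ} (z : RegSplitPreformation Λ ((-1) ^ q)) (θ : z.G →ₗ[Λ] StarDual Λ z.G)

theorem negOnePow_eq (q : ℕ) : (q : ℤ).negOnePow = (-1) ^ q := by
  simp [Int.negOnePow]

/-- The complex `N`: `μ^* : N_{q+1} = F → N_q = G^*`. -/
abbrev complexN : FreeComplex Λ := twoTerm (q : ℤ) (adj z.μ)

/-- The structure on `N`: `ζ_0 = γ : N^q = G → N_{q+1} = F`, `ζ_1 = ε θ : N^q = G → N_q = G^*`. -/
def structN : QStruct z.complexN (2 * q + 1) :=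
  shortStruct (q : ℤ) (adj z.μ) z.γ (((-1) ^ q : ℤˣ) • θ)

/-- The complex `N'`: `γ^* : N'_{q+1} = F^* → N'_q = G^*`. -/
abbrev complexN' : FreeComplex Λ := twoTerm (q : ℤ) (dualMap z.γ)

/-- The structure on `N'`: `ζ'_0 = ε μ : N'^q = G → N'_{q+1} = F^*`,
`ζ'_1 = - ε θ : N'^q = G → N'_q = G^*`. -/
def structN' : QStruct z.complexN' (2 * q + 1) :=
  shortStruct (q : ℤ) (dualMap z.γ) (((-1) ^ q : ℤˣ) • z.μ) (-(((-1) ^ q : ℤˣ) • θ))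

variable {z θ}

theorem IsRepresentative.apply_eq (hθ : z.IsRepresentative θ) (x y : z.G) :
    θ x y - ((-1) ^ q : ℤˣ) • star (θ y x) = z.μ x (z.γ y) := by
  have h := DFunLike.congr_fun (LinearMap.congr_fun hθ.add_transpose x) y
  simpa [Units.neg_smul, sub_eq_add_neg] using h

theorem isCycle_structN (hθ : z.IsRepresentative θ) : (z.structN θ).IsCycle := by
  refine isCycle_shortStruct _ _ _ _ fun x y => ?_
  have h := congrArg star (hθ.apply_eq y x)
  rw [negOnePow_eq]
  simp only [star_sub, star_units_smul, star_star] at h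
  simp only [adj_apply, ← h, LinearMap.smul_apply, StarDual.units_smul_apply, star_units_smul,
    smul_smul, Int.units_mul_self, one_smul]
  abel

theorem isCycle_structN' (hθ : z.IsRepresentative θ) : (z.structN' θ).IsCycle := by
  refine isCycle_shortStruct _ _ _ _ fun x y => ?_
  have h := hθ.apply_eq x y
  rw [negOnePow_eq]
  simp only [dualMap_apply, LinearMap.smul_apply, LinearMap.neg_apply, StarDual.neg_apply,
    StarDual.units_smul_apply, star_units_smul, star_neg, ← h, smul_sub, smul_neg, smul_smul,
    Int.units_mul_self, one_smul]
  abel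

theorem d_bdryComplex {C : FreeComplex Λ} {m : ℤ} {ψ : QStruct C (m + 1)} (hψ : ψ.IsCycle)
    (i j : ℤ) (h : j + 1 = i) (x : C.X (i + 1)) (φ : StarDual Λ (C.X (m + 1 - i))) :
    (bdryComplex hψ).d i j h (x, φ) =
      (C.d (i + 1) (j + 1) (by omega) x + i.negOnePow • ψ.symm₀ (m + 1 - i) (j + 1) (by omega) φ,
        i.negOnePow • dualMap (C.d (m + 1 - j) (m + 1 - i) (by omega)) φ) := rfl

theorem apply_symm₀_short {A G : Type u} [AddCommGroup A] [Module Λ A] [Module.Free Λ A]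
    [Module.Finite Λ A] [AddCommGroup G] [Module Λ G] [Module.Free Λ G] [Module.Finite Λ G]
    (q : ℤ) (δ : A →ₗ[Λ] StarDual Λ G) (ζ₀ : G →ₗ[Λ] A) (ζ₁ : G →ₗ[Λ] StarDual Λ G)
    (p r : ℤ) (h : p + r = 2 * q + 1) (α : StarDual Λ ((twoTerm q δ).X p))
    (β : StarDual Λ ((twoTerm q δ).X r)) :
    β ((shortStruct q δ ζ₀ ζ₁).symm₀ p r h α) =
      dualMap (inA q δ r) β (ζ₀ (undual G (dualMap (inB q δ p) α))) +
      (p * r).negOnePow • star (dualMap (inA q δ p) α (ζ₀ (undual G (dualMap (inB q δ r) β)))) :=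
  QStruct.apply_symm₀ _ _ _ _ _ _

theorem apply_symm₀_N (p r : ℤ) (h : p + r = 2 * q + 1) (α : StarDual Λ (z.complexN.X p))
    (β : StarDual Λ (z.complexN.X r)) : β ((z.structN θ).symm₀ p r h α) =
      dualMap (inA (q : ℤ) (adj z.μ) r) β (z.γ (undual z.G (dualMap (inB (q : ℤ) (adj z.μ) p) α))) +
      (p * r).negOnePow • star (dualMap (inA (q : ℤ) (adj z.μ) p) α
        (z.γ (undual z.G (dualMap (inB (q : ℤ) (adj z.μ) r) β)))) :=
  apply_symm₀_short _ _ _ _ _ _ _ _ _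

theorem apply_symm₀_N' (p r : ℤ) (h : p + r = 2 * q + 1) (α : StarDual Λ (z.complexN'.X p))
    (β : StarDual Λ (z.complexN'.X r)) : β ((z.structN' θ).symm₀ p r h α) =
      dualMap (inA (q : ℤ) (dualMap z.γ) r) β
        (((-1) ^ q : ℤˣ) • z.μ (undual z.G (dualMap (inB (q : ℤ) (dualMap z.γ) p) α))) +
      (p * r).negOnePow • star (dualMap (inA (q : ℤ) (dualMap z.γ) p) α
        (((-1) ^ q : ℤˣ) • z.μ (undual z.G (dualMap (inB (q : ℤ) (dualMap z.γ) r) β)))) :=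
  apply_symm₀_short _ _ _ _ _ _ _ _ _

/-- The component `∂N_r → ∂N'_r` of `h`. Under `∂N_{q+1} = G = ∂N'_{q+1}`, `∂N_q = F ⊕ F^*`,
`∂N'_q = F^* ⊕ F`, `∂N_{q-1} = G^* = ∂N'_{q-1}` it is `1`, `(0, ε; 1, 0)`, `1` in the degrees
`q + 1`, `q`, `q - 1`. -/
def boundaryMapComponent (hθ : z.IsRepresentative θ) (r : ℤ) :
    (bdryComplex (isCycle_structN hθ)).X r →ₗ[Λ] (bdryComplex (isCycle_structN' hθ)).X r :=
  LinearMap.prod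
    (inA (q : ℤ) (dualMap z.γ) (r + 1) ∘ₗ
        (((-1) ^ q : ℤˣ) • dualMap (inA (q : ℤ) (adj z.μ) (2 * q + 1 - r))) ∘ₗ
        LinearMap.snd Λ (z.complexN.X (r + 1)) (StarDual Λ (z.complexN.X (2 * q + 1 - r)))
      + inB (q : ℤ) (dualMap z.γ) (r + 1) ∘ₗ outB (q : ℤ) (adj z.μ) (r + 1) ∘ₗ
        LinearMap.fst Λ (z.complexN.X (r + 1)) (StarDual Λ (z.complexN.X (2 * q + 1 - r))))
    (dualMap (outA (q : ℤ) (dualMap z.γ) (2 * q + 1 - r)) ∘ₗ evalDual z.F ∘ₗ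
        outA (q : ℤ) (adj z.μ) (r + 1) ∘ₗ
        LinearMap.fst Λ (z.complexN.X (r + 1)) (StarDual Λ (z.complexN.X (2 * q + 1 - r)))
      + dualMap (outB (q : ℤ) (dualMap z.γ) (2 * q + 1 - r)) ∘ₗ
        dualMap (inB (q : ℤ) (adj z.μ) (2 * q + 1 - r)) ∘ₗ
        LinearMap.snd Λ (z.complexN.X (r + 1)) (StarDual Λ (z.complexN.X (2 * q + 1 - r))))

theorem boundaryMapComponent_apply (hθ : z.IsRepresentative θ) (r : ℤ) (x : z.complexN.X (r + 1))
    (Φ : StarDual Λ (z.complexN.X (2 * q + 1 - r))) :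
    boundaryMapComponent hθ r (x, Φ) =
      (inA (q : ℤ) (dualMap z.γ) (r + 1)
          (((-1) ^ q : ℤˣ) • dualMap (inA (q : ℤ) (adj z.μ) (2 * q + 1 - r)) Φ)
        + inB (q : ℤ) (dualMap z.γ) (r + 1) (outB (q : ℤ) (adj z.μ) (r + 1) x),
       dualMap (outA (q : ℤ) (dualMap z.γ) (2 * q + 1 - r))
          (evalDual z.F (outA (q : ℤ) (adj z.μ) (r + 1) x))
        + dualMap (outB (q : ℤ) (dualMap z.γ) (2 * q + 1 - r))
          (dualMap (inB (q : ℤ) (adj z.μ) (2 * q + 1 - r)) Φ)) := rfl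

/-- The isomorphism `h : ∂N → ∂N'`. -/
def boundaryMap (hθ : z.IsRepresentative θ) :
    ChainMap (bdryComplex (isCycle_structN hθ)) (bdryComplex (isCycle_structN' hθ)) where
  f := boundaryMapComponent hθ
  comm i j hij x := by
    obtain ⟨x, Φ⟩ : z.complexN.X (i + 1) × StarDual Λ (z.complexN.X (2 * q + 1 - i)) := x
    rw [boundaryMapComponent_apply, d_bdryComplex]
    refine Eq.trans (d_bdryComplex (isCycle_structN' hθ) i j hij _ _) ?_
    refine Eq.trans ?_ (boundaryMapComponent_apply hθ j _ _).symm
    have hε := negOnePow_eq q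
    have hΦ : 2 * (q : ℤ) + 1 - i ≠ q + 1 → dualMap (inA (q : ℤ) (adj z.μ) (2 * q + 1 - i)) Φ = 0 :=
      fun hi => StarDual.ext fun a => by
        rw [dualMap_apply, inA_eq_zero hi, map_zero, StarDual.zero_apply]
    have hΦ' : 2 * (q : ℤ) + 1 - i ≠ q → dualMap (inB (q : ℤ) (adj z.μ) (2 * q + 1 - i)) Φ = 0 :=
      fun hi => StarDual.ext fun a => by
        rw [dualMap_apply, inB_eq_zero hi, map_zero, StarDual.zero_apply]
    refine Prod.ext ?_ ?_
    · refine ext_dual (Λ := Λ) fun β => ?_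
      change β ((twoTerm (q : ℤ) (dualMap z.γ)).d (i + 1) (j + 1) (by omega)
            (inA (q : ℤ) (dualMap z.γ) (i + 1)
              (((-1) ^ q : ℤˣ) • dualMap (inA (q : ℤ) (adj z.μ) (2 * q + 1 - i)) Φ)
            + inB (q : ℤ) (dualMap z.γ) (i + 1) (outB (q : ℤ) (adj z.μ) (i + 1) x))
          + i.negOnePow • (z.structN' θ).symm₀ (2 * q + 1 - i) (j + 1) (by omega)
            (dualMap (outA (q : ℤ) (dualMap z.γ) (2 * q + 1 - i))
                (evalDual z.F (outA (q : ℤ) (adj z.μ) (i + 1) x))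
              + dualMap (outB (q : ℤ) (dualMap z.γ) (2 * q + 1 - i))
                (dualMap (inB (q : ℤ) (adj z.μ) (2 * q + 1 - i)) Φ)))
        = β (inA (q : ℤ) (dualMap z.γ) (j + 1)
              (((-1) ^ q : ℤˣ) • dualMap (inA (q : ℤ) (adj z.μ) (2 * q + 1 - j))
                (i.negOnePow • dualMap ((twoTerm (q : ℤ) (adj z.μ)).d _ _ (by omega)) Φ))
            + inB (q : ℤ) (dualMap z.γ) (j + 1) (outB (q : ℤ) (adj z.μ) (j + 1)
              ((twoTerm (q : ℤ) (adj z.μ)).d (i + 1) (j + 1) (by omega) x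
                + i.negOnePow • (z.structN θ).symm₀ (2 * q + 1 - i) (j + 1) (by omega) Φ)))
      have e3 : ∀ y, β (inB (q : ℤ) (dualMap z.γ) (j + 1) (outB (q : ℤ) (adj z.μ) (j + 1) y)) =
          dualMap (outB (q : ℤ) (adj z.μ) (j + 1)) (dualMap (inB (q : ℤ) (dualMap z.γ) (j + 1)) β) y :=
        fun _ => rfl
      have e4 : dualMap (inB (q : ℤ) (adj z.μ) (j + 1)) (dualMap (outB (q : ℤ) (adj z.μ) (j + 1))
          (dualMap (inB (q : ℤ) (dualMap z.γ) (j + 1)) β)) =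
          dualMap (inB (q : ℤ) (dualMap z.γ) (j + 1)) β := by
        refine StarDual.ext fun b => ?_
        simp only [dualMap_apply]
        rw [inB_outB_inB]
      have e5 : dualMap (inA (q : ℤ) (adj z.μ) (j + 1)) (dualMap (outB (q : ℤ) (adj z.μ) (j + 1))
          (dualMap (inB (q : ℤ) (dualMap z.γ) (j + 1)) β)) = 0 := by
        refine StarDual.ext fun b => ?_
        simp
      have e6 : dualMap (inB (q : ℤ) (dualMap z.γ) (2 * q + 1 - i))
          (dualMap (outA (q : ℤ) (dualMap z.γ) (2 * q + 1 - i))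
                (evalDual z.F (outA (q : ℤ) (adj z.μ) (i + 1) x))
              + dualMap (outB (q : ℤ) (dualMap z.γ) (2 * q + 1 - i))
                (dualMap (inB (q : ℤ) (adj z.μ) (2 * q + 1 - i)) Φ)) =
          dualMap (inB (q : ℤ) (adj z.μ) (2 * q + 1 - i)) Φ := by
        refine StarDual.ext fun b => ?_
        simp only [dualMap_apply, StarDual.add_apply, outA_inB, map_zero, zero_add]
        rw [inB_outB_inB]
      have e7 : dualMap (inA (q : ℤ) (dualMap z.γ) (2 * q + 1 - i))
          (dualMap (outA (q : ℤ) (dualMap z.γ) (2 * q + 1 - i))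
                (evalDual z.F (outA (q : ℤ) (adj z.μ) (i + 1) x))
              + dualMap (outB (q : ℤ) (dualMap z.γ) (2 * q + 1 - i))
                (dualMap (inB (q : ℤ) (adj z.μ) (2 * q + 1 - i)) Φ)) =
          evalDual z.F (outA (q : ℤ) (adj z.μ) (i + 1) x) := by
        refine StarDual.ext fun b => ?_
        simp only [dualMap_apply, StarDual.add_apply, outB_inA, map_zero, add_zero]
        by_cases hj : 2 * (q : ℤ) + 1 - i = q + 1
        · rw [outA_inA hj]
        · rw [outA_eq_zero (δ := adj z.μ) (by omega), map_zero, StarDual.zero_apply,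
            StarDual.zero_apply]
      have e8 : dualMap (inA (q : ℤ) (adj z.μ) (2 * q + 1 - j))
            (i.negOnePow • dualMap ((twoTerm (q : ℤ) (adj z.μ)).d _ (2 * q + 1 - i) (by omega)) Φ) =
          i.negOnePow • z.μ (undual z.G (dualMap (inB (q : ℤ) (adj z.μ) (2 * q + 1 - i)) Φ)) := by
        refine StarDual.ext fun b => ?_
        have h := apply_undual (dualMap (inB (q : ℤ) (adj z.μ) (2 * q + 1 - i)) Φ) (adj z.μ b)
        rw [adj_apply, dualMap_apply] at h
        have h := star_injective h
        simp only [dualMap_apply, StarDual.units_smul_apply, d_inA]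
        rw [h]
      generalize (dualMap (outA (q : ℤ) (dualMap z.γ) (2 * q + 1 - i))
                (evalDual z.F (outA (q : ℤ) (adj z.μ) (i + 1) x))
              + dualMap (outB (q : ℤ) (dualMap z.γ) (2 * q + 1 - i))
                (dualMap (inB (q : ℤ) (adj z.μ) (2 * q + 1 - i)) Φ)) = Ψ at e6 e7 ⊢
      rw [e8]
      have e9 := apply_symm₀_N' (z := z) (θ := θ) (2 * q + 1 - i) (j + 1) (by omega) Ψ β
      have e10 := apply_symm₀_N (z := z) (θ := θ) (2 * q + 1 - i) (j + 1) (by omega) Φ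
        (dualMap (outB (q : ℤ) (adj z.μ) (j + 1)) (dualMap (inB (q : ℤ) (dualMap z.γ) (j + 1)) β))
      rw [e6, e7] at e9
      rw [e4, e5] at e10
      have e11 := d_twoTerm (q := (q : ℤ)) (δ := adj z.μ) (i + 1) (j + 1) (by omega) x
      have e12 : ∀ w, β (inB (q : ℤ) (dualMap z.γ) (j + 1) w) =
          star (w (undual z.G (dualMap (inB (q : ℤ) (dualMap z.γ) (j + 1)) β))) := fun w => by
        rw [apply_undual, star_star, dualMap_apply]
      have e13 : ∀ w, dualMap (outB (q : ℤ) (adj z.μ) (j + 1))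
          (dualMap (inB (q : ℤ) (dualMap z.γ) (j + 1)) β) (inB (q : ℤ) (adj z.μ) (j + 1) w) =
          β (inB (q : ℤ) (dualMap z.γ) (j + 1) w) := fun w => DFunLike.congr_fun e4 w
      simp only [map_add, map_units_smul, d_inA, d_inB, e3, e11, e13, e9, e10, e12, dualMap_apply,
        adj_apply, evalDual_apply, star_star, star_units_smul, StarDual.zero_apply,
        zero_add, add_zero, smul_add]
      generalize undual z.G (dualMap (inB (q : ℤ) (dualMap z.γ) (j + 1)) β) = b
      generalize undual z.G (dualMap (inB (q : ℤ) (adj z.μ) (2 * q + 1 - i)) Φ) = a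
      by_cases hi : i = q
      · have s1 : i.negOnePow = (-1) ^ q := by rw [hi, hε]
        have s2 : ((2 * (q : ℤ) + 1 - i) * (j + 1)).negOnePow = 1 := by
          rw [hij, hi, show 2 * (q : ℤ) + 1 - q = q + 1 by ring]
          exact Int.negOnePow_even _ (by rw [mul_comm]; exact Int.even_mul_succ_self _)
        rw [s1, s2]
        simp only [one_smul, smul_smul, one_mul, Int.units_mul_self]
        abel
      · have s3 : ∀ w, Φ (inA (q : ℤ) (adj z.μ) (2 * q + 1 - i) w) = 0 := fun w => by
          rw [inA_eq_zero (by omega), map_zero]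
        have s4 : outA (q : ℤ) (adj z.μ) (i + 1) x = 0 := outA_eq_zero (by omega) x
        simp only [s3, s4, map_zero, star_zero, smul_zero, zero_add, add_zero]
        rw [smul_comm]
    · refine StarDual.ext fun y => ?_
      change i.negOnePow • (evalDual z.F (outA (q : ℤ) (adj z.μ) (i + 1) x)
            (outA (q : ℤ) (dualMap z.γ) (2 * q + 1 - i)
              ((twoTerm (q : ℤ) (dualMap z.γ)).d (2 * q + 1 - j) _ (by omega) y))
          + Φ (inB (q : ℤ) (adj z.μ) (2 * q + 1 - i) (outB (q : ℤ) (dualMap z.γ) (2 * q + 1 - i)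
              ((twoTerm (q : ℤ) (dualMap z.γ)).d (2 * q + 1 - j) _ (by omega) y))))
        = evalDual z.F (outA (q : ℤ) (adj z.μ) (j + 1)
              ((twoTerm (q : ℤ) (adj z.μ)).d (i + 1) (j + 1) (by omega) x
                + i.negOnePow • (z.structN θ).symm₀ (2 * q + 1 - i) (j + 1) (by omega) Φ))
              (outA (q : ℤ) (dualMap z.γ) (2 * q + 1 - j) y)
          + i.negOnePow • Φ ((twoTerm (q : ℤ) (adj z.μ)).d _ (2 * q + 1 - i) (by omega)
              (inB (q : ℤ) (adj z.μ) (2 * q + 1 - j) (outB (q : ℤ) (dualMap z.γ) (2 * q + 1 - j) y)))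
      rw [d_inB, map_zero, smul_zero, add_zero, map_add, d_twoTerm, d_twoTerm, outA_inB, outA_inB,
        map_zero, zero_add, zero_add, inB_outB_inB, map_units_smul, map_units_smul,
        StarDual.units_smul_apply, evalDual_apply]
      congr 1
      have e1 := apply_symm₀_N (z := z) (θ := θ) (2 * q + 1 - i) (j + 1) (by omega) Φ
        (dualMap (outA (q : ℤ) (adj z.μ) (j + 1)) (outA (q : ℤ) (dualMap z.γ) (2 * q + 1 - j) y))
      have e2 : dualMap (inB (q : ℤ) (adj z.μ) (j + 1)) (dualMap (outA (q : ℤ) (adj z.μ) (j + 1))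
          (outA (q : ℤ) (dualMap z.γ) (2 * q + 1 - j) y)) = 0 :=
        StarDual.ext fun w => by simp
      rw [e2, map_zero, map_zero, map_zero, star_zero, smul_zero, add_zero, dualMap_apply,
        dualMap_apply, dualMap_apply] at e1
      rw [e1]
      have e3 : ∀ w, Φ (inB (q : ℤ) (adj z.μ) (2 * q + 1 - i) w) =
          star (w (undual z.G (dualMap (inB (q : ℤ) (adj z.μ) (2 * q + 1 - i)) Φ))) := fun w => by
        rw [apply_undual, star_star, dualMap_apply]
      rw [e3, dualMap_apply]
      by_cases hi : j = q
      · rw [outA_inA (by omega)]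
      · rw [hΦ' (by omega)]
        simp

/-- `c = (f : C = ∂N → D = N^{2q+1-*}, (0, ψ))`, the thickening of `(N, ζ)`. -/
def pairC (hθ : z.IsRepresentative θ) :
    QuadPair (bdryComplex (isCycle_structN hθ)) (2 * q) (bdryStruct (isCycle_structN hθ)) :=
  thickening (isCycle_structN hθ)

/-- The chain map `f' h : C = ∂N → ∂N' → D' = N'^{2q+1-*}`, where
`f' : C' = ∂N' → D' = N'^{2q+1-*}` belongs to the thickening of `(N', ζ')`. -/
def mapC'' (hθ : z.IsRepresentative θ) :
    ChainMap (bdryComplex (isCycle_structN hθ)) (z.complexN'.dual (2 * q + 1)) :=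
  (thickening (isCycle_structN' hθ)).f.comp (boundaryMap hθ)

theorem mapC''_inl (hθ : z.IsRepresentative θ) (r : ℤ) (x : z.complexN.X (r + 1)) :
    (mapC'' hθ).f r (bdryInl (isCycle_structN hθ) r x) =
      dualMap (outA (q : ℤ) (dualMap z.γ) (2 * q + 1 - r))
        (evalDual z.F (outA (q : ℤ) (adj z.μ) (r + 1) x)) := by
  change dualMap (outA (q : ℤ) (dualMap z.γ) (2 * q + 1 - r))
        (evalDual z.F (outA (q : ℤ) (adj z.μ) (r + 1) x)) +
    dualMap (outB (q : ℤ) (dualMap z.γ) (2 * q + 1 - r))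
          (dualMap (inB (q : ℤ) (adj z.μ) (2 * q + 1 - r)) 0) = _
  rw [map_zero, map_zero, add_zero]

theorem mapC''_inr (hθ : z.IsRepresentative θ) (r : ℤ)
    (Φ : StarDual Λ (z.complexN.X (2 * q + 1 - r))) :
    (mapC'' hθ).f r (bdryInr (isCycle_structN hθ) r Φ) =
      dualMap (outB (q : ℤ) (dualMap z.γ) (2 * q + 1 - r))
        (dualMap (inB (q : ℤ) (adj z.μ) (2 * q + 1 - r)) Φ) := by
  change dualMap (outA (q : ℤ) (dualMap z.γ) (2 * q + 1 - r))
        (evalDual z.F (outA (q : ℤ) (adj z.μ) (r + 1) 0)) +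
    dualMap (outB (q : ℤ) (dualMap z.γ) (2 * q + 1 - r))
          (dualMap (inB (q : ℤ) (adj z.μ) (2 * q + 1 - r)) Φ) = _
  rw [map_zero, map_zero, map_zero, zero_add]

theorem dualMap_idMap_inB (r p : ℤ) (h : r = p) (b : StarDual Λ z.G) :
    z.complexN.idMap r p h (inB (q : ℤ) (adj z.μ) r b) = inB (q : ℤ) (adj z.μ) p b := by
  subst h; rfl

/-- `(f' h) ψ (f' h)^* = 0`. -/
theorem push_mapC'' (hθ : z.IsRepresentative θ) (s : ℕ) (p r : ℤ) (h : p + r + s = 2 * q) :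
    QStruct.push (mapC'' hθ) (bdryStruct (isCycle_structN hθ)) s p r h = 0 := by
  refine LinearMap.ext fun A => StarDual.ext fun y => ?_
  cases s with
  | zero =>
    change (show StarDual Λ (z.complexN'.X (2 * q + 1 - r)) from
      (mapC'' hθ).f r (bdryInr (isCycle_structN hθ) r (dualMap (bdryInl (isCycle_structN hθ) p ∘ₗ z.complexN.idMap (2 * q + 1 - r) (p + 1)
        (by push_cast at h; omega)) (dualMap ((mapC'' hθ).f p) A)))) y = 0
    rw [mapC''_inr, dualMap_apply, dualMap_apply, dualMap_apply, LinearMap.comp_apply,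
      dualMap_idMap_inB, dualMap_apply, mapC''_inl, outA_inB, map_zero, map_zero]
    exact map_zero A
  | succ s =>
    change (show StarDual Λ (z.complexN'.X (2 * q + 1 - r)) from
      (mapC'' hθ).f r (bdryInl (isCycle_structN hθ) r (((2 * q - r - (s + 1) : ℤ).negOnePow • (z.structN θ).T s (p + 1) (r + 1)
          (by push_cast at h; omega)) (dualMap (bdryInl (isCycle_structN hθ) p)
            (dualMap ((mapC'' hθ).f p) A))))) y = 0
    rw [mapC''_inl, LinearMap.smul_apply, map_units_smul, map_units_smul, map_units_smul,
      StarDual.units_smul_apply, dualMap_apply, evalDual_apply]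
    have e1 := (z.structN θ).apply_T s (p + 1) (r + 1) (by push_cast at h; omega)
      (dualMap (bdryInl (isCycle_structN hθ) p) (dualMap ((mapC'' hθ).f p) A))
      (dualMap (outA (q : ℤ) (adj z.μ) (r + 1)) (outA (q : ℤ) (dualMap z.γ) (2 * q + 1 - r) y))
    rw [dualMap_apply] at e1
    rw [e1]
    have e2 : (z.structN θ s (r + 1) (p + 1) (by push_cast at h; omega))
        (dualMap (outA (q : ℤ) (adj z.μ) (r + 1))
          (outA (q : ℤ) (dualMap z.γ) (2 * q + 1 - r) y)) = 0 := by
      have e3 : dualMap (inB (q : ℤ) (adj z.μ) (r + 1)) (dualMap (outA (q : ℤ) (adj z.μ) (r + 1))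
          (outA (q : ℤ) (dualMap z.γ) (2 * q + 1 - r) y)) = 0 :=
        StarDual.ext fun w => by simp
      match s, h with
      | 0, h => simp [structN, shortStruct, e3]
      | 1, h => simp [structN, shortStruct, e3]
      | s + 2, h => rfl
    rw [e2, map_zero]
    simp

/-- `c'' = (f' h : C → D', (0, ψ))`. (In general the structure on `D'` is `f' χ f'^*` for
`h_% ψ - ψ' = d_% χ`; here `f' χ f'^* = 0`.) -/
def pairC'' (hθ : z.IsRepresentative θ) :
    QuadPair (bdryComplex (isCycle_structN hθ)) (2 * q) (bdryStruct (isCycle_structN hθ)) where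
  D := z.complexN'.dual (2 * q + 1)
  f := mapC'' hθ
  δψ := 0
  isCycle := isCycle_bdryStruct _
  isCycle_rel s p r h := by
    rw [push_mapC'', QStruct.diff_zero, smul_zero]
    exact zero_add _

/-- The component `∂E_r = D'_r ⊕ C_{r-1} ⊕ D_r → E_r` of `g`: it is
`(1, 0, 0, -1) : ∂E_{q+1} = G ⊕ (F ⊕ F^*) ⊕ G → G = E_{q+1}` for `r = q + 1`. -/
def mapXComponent (hθ : z.IsRepresentative θ) (r : ℤ) :
    ((pairC'' hθ).gluedComplex (pairC hθ)).X r →ₗ[Λ] (single (Λ := Λ) (q + 1 : ℤ) z.G).X r :=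
  (Conc.of (q + 1 : ℤ) z.G r : z.G →ₗ[Λ] Conc (q + 1 : ℤ) z.G r) ∘ₗ
    ((undual z.G).toLinearMap ∘ₗ dualMap (inB (q : ℤ) (dualMap z.γ) (2 * q + 1 - r)) ∘ₗ
        LinearMap.fst Λ ((pairC'' hθ).D.X r)
          ((bdryComplex (isCycle_structN hθ)).X (r - 1) × (pairC hθ).D.X r)
      - (undual z.G).toLinearMap ∘ₗ dualMap (inB (q : ℤ) (adj z.μ) (2 * q + 1 - r)) ∘ₗ
        LinearMap.snd Λ ((bdryComplex (isCycle_structN hθ)).X (r - 1)) ((pairC hθ).D.X r) ∘ₗ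
        LinearMap.snd Λ ((pairC'' hθ).D.X r)
          ((bdryComplex (isCycle_structN hθ)).X (r - 1) × (pairC hθ).D.X r))

/-- The chain map `g : ∂E → E`. -/
def mapX (hθ : z.IsRepresentative θ) :
    ChainMap ((pairC'' hθ).gluedComplex (pairC hθ)) (single (Λ := Λ) (q + 1 : ℤ) z.G) where
  f := mapXComponent hθ
  comm i j hij x := by
    refine Eq.trans (show _ = (0 : Conc (q + 1 : ℤ) z.G j) from rfl) (Eq.symm ?_)
    obtain ⟨Φ', c, Φ⟩ : StarDual Λ (z.complexN'.X (2 * q + 1 - i)) ×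
      (bdryComplex (isCycle_structN hθ)).X (i - 1) × StarDual Λ (z.complexN.X (2 * q + 1 - i)) := x
    let P : (pairC'' hθ).D.X j →ₗ[Λ] z.G :=
      (undual z.G).toLinearMap ∘ₗ dualMap (inB (q : ℤ) (dualMap z.γ) (2 * q + 1 - j))
    let Q : (pairC hθ).D.X j →ₗ[Λ] z.G :=
      (undual z.G).toLinearMap ∘ₗ dualMap (inB (q : ℤ) (adj z.μ) (2 * q + 1 - j))
    change Conc.of (Λ := Λ) (q + 1 : ℤ) z.G j
      (P ((pairC'' hθ).D.d i j hij Φ' +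
            (i - 1).negOnePow • (pairC'' hθ).f.at' (i - 1) j (by omega) c) -
        Q ((i - 1).negOnePow • (pairC hθ).f.at' (i - 1) j (by omega) c +
            (pairC hθ).D.d i j hij Φ)) = 0
    have e1 : P ((pairC'' hθ).D.d i j hij Φ') = 0 := by
      refine Eq.trans (congrArg (undual z.G) (StarDual.ext fun w => ?_)) (map_zero (undual z.G))
      change (i.negOnePow • dualMap (z.complexN'.d (2 * q + 1 - j) (2 * q + 1 - i) (by omega)) Φ')
        (inB (q : ℤ) (dualMap z.γ) (2 * q + 1 - j) w) = 0
      rw [StarDual.units_smul_apply, dualMap_apply, d_inB, map_zero, smul_zero]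
    have e2 : Q ((pairC hθ).D.d i j hij Φ) = 0 := by
      refine Eq.trans (congrArg (undual z.G) (StarDual.ext fun w => ?_)) (map_zero (undual z.G))
      change (i.negOnePow • dualMap (z.complexN.d (2 * q + 1 - j) (2 * q + 1 - i) (by omega)) Φ)
        (inB (q : ℤ) (adj z.μ) (2 * q + 1 - j) w) = 0
      rw [StarDual.units_smul_apply, dualMap_apply, d_inB, map_zero, smul_zero]
    have e3 : ∀ (k : ℤ) (hk : k = j) (c : (bdryComplex (isCycle_structN hθ)).X k),
        P ((pairC'' hθ).f.at' k j hk c) = Q ((pairC hθ).f.at' k j hk c) := by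
      rintro k rfl ⟨x, Φ⟩
      refine congrArg (undual z.G) (StarDual.ext fun w => ?_)
      change (dualMap (outA (q : ℤ) (dualMap z.γ) (2 * q + 1 - k))
          (evalDual z.F (outA (q : ℤ) (adj z.μ) (k + 1) x)) +
        dualMap (outB (q : ℤ) (dualMap z.γ) (2 * q + 1 - k))
          (dualMap (inB (q : ℤ) (adj z.μ) (2 * q + 1 - k)) Φ))
            (inB (q : ℤ) (dualMap z.γ) (2 * q + 1 - k) w) =
        Φ (inB (q : ℤ) (adj z.μ) (2 * q + 1 - k) w)
      rw [StarDual.add_apply, dualMap_apply, dualMap_apply, dualMap_apply, outA_inB, map_zero,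
        zero_add, inB_outB_inB]
    rw [map_add, map_add, map_units_smul, map_units_smul, e1, e2, e3, zero_add, add_zero, sub_self,
      map_zero]

/-- The `(2q+2)`-dimensional quadratic pair `x = (g : ∂E → E, (0, ω))` of `z`, for a
representative `θ`: `(∂E, ω) = c'' ∪ -c`, and `E` is `G` concentrated in degree `q + 1`. -/
def pairX (z : RegSplitPreformation Λ ((-1) ^ q)) (θ : z.G →ₗ[Λ] StarDual Λ z.G)
    (hθ : z.IsRepresentative θ) :
    QuadPair ((pairC'' hθ).gluedComplex (pairC hθ)) (2 * q + 1)
      ((pairC'' hθ).gluedStruct (pairC hθ)) where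
  D := single (Λ := Λ) (q + 1 : ℤ) z.G
  f := mapX hθ
  δψ := 0
  isCycle := QuadPair.isCycle_gluedStruct _ _
  isCycle_rel s p r h := by
    have e : QStruct.push (mapX hθ) ((pairC'' hθ).gluedStruct (pairC hθ)) s p r h = 0 := by
      refine LinearMap.ext fun A => ?_
      by_cases hr : r = q + 1
      · have hp : p ≠ q + 1 := by omega
        have hA : A = 0 := StarDual.ext fun w => by
          
          rw [show w = 0 from (Conc.subsingleton hp).elim _ _, map_zero, map_zero]
        rw [hA, map_zero, map_zero]
      · exact (Conc.subsingleton hr).elim _ _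
    rw [e, QStruct.diff_zero, smul_zero]
    exact zero_add _

end RegSplitPreformation

end Construction

end AlgSurgery

end

set_option linter.unusedSectionVars false

noncomputable section

namespace AlgSurgery

universe u

/-! ### Stably free modules and exact complexes -/

section Exactness

variable {Λ : Type u} [Ring Λ]

/-- `P` becomes f.g. free after adding a f.g. free module. -/
def StablyFree (Λ : Type u) [Ring Λ] (P : Type u) [AddCommGroup P] [Module Λ P] : Prop :=
  ∃ (R : Type u) (_ : AddCommGroup R) (_ : Module Λ R), Module.Free Λ R ∧ Module.Finite Λ R ∧
    Module.Free Λ (P × R) ∧ Module.Finite Λ (P × R)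

/-- Two stably free modules become free after adding the same f.g. free module. -/
theorem StablyFree.common {P Q : Type u} [AddCommGroup P] [Module Λ P] [AddCommGroup Q]
    [Module Λ Q] (hP : StablyFree Λ P) (hQ : StablyFree Λ Q) :
    ∃ (R : Type u) (_ : AddCommGroup R) (_ : Module Λ R), Module.Free Λ R ∧ Module.Finite Λ R ∧
      (Module.Free Λ (P × R) ∧ Module.Finite Λ (P × R)) ∧
      (Module.Free Λ (Q × R) ∧ Module.Finite Λ (Q × R)) := by
  obtain ⟨R, _, _, _, _, _, _⟩ := hP
  obtain ⟨S, _, _, _, _, _, _⟩ := hQ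
  let e : ((P × R) × S) ≃ₗ[Λ] P × R × S := LinearEquiv.prodAssoc Λ P R S
  let e' : ((Q × S) × R) ≃ₗ[Λ] Q × R × S :=
    (LinearEquiv.prodAssoc Λ Q S R).trans
      ((LinearEquiv.refl Λ Q).prodCongr (LinearEquiv.prodComm Λ S R))
  exact ⟨R × S, inferInstance, inferInstance, inferInstance, inferInstance,
    ⟨Module.Free.of_equiv e, Module.Finite.equiv e⟩,
    ⟨Module.Free.of_equiv e', Module.Finite.equiv e'⟩⟩

theorem StablyFree.of_equiv {P Q : Type u} [AddCommGroup P] [Module Λ P] [AddCommGroup Q]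
    [Module Λ Q] (hP : StablyFree Λ P) (e : P ≃ₗ[Λ] Q) : StablyFree Λ Q := by
  obtain ⟨R, _, _, _, _, _, _⟩ := hP
  let e' : (P × R) ≃ₗ[Λ] Q × R := e.prodCongr (LinearEquiv.refl Λ R)
  exact ⟨R, inferInstance, inferInstance, inferInstance, inferInstance,
    Module.Free.of_equiv e', Module.Finite.equiv e'⟩

namespace FreeComplex

/-- Exactness of a complex in degree `j`. -/
def ExactAt (C : FreeComplex Λ) (j : ℤ) : Prop :=
  ∀ i k (hij : j + 1 = i) (hjk : k + 1 = j) (x : C.X j), C.d j k hjk x = 0 →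
    ∃ y, C.d i j hij y = x

theorem exists_lift_cycles (C : FreeComplex Λ) (m : ℤ) (hC : ∀ j < m, C.ExactAt j) (i j : ℤ)
    (hij : j + 1 = i) (hj : j < m) :
    ∃ s : C.X j →ₗ[Λ] C.X i, ∀ k (hjk : k + 1 = j) (x : C.X j), C.d j k hjk x = 0 →
      C.d i j hij (s x) = x := by
  obtain ⟨a, b, hab⟩ := C.bounded
  have low : ∀ i j (hij : j + 1 = i), j < a → ∃ s : C.X j →ₗ[Λ] C.X i,
      ∀ k (hjk : k + 1 = j) (x : C.X j), C.d j k hjk x = 0 → C.d i j hij (s x) = x :=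
    fun i j hij h => ⟨0, fun k hjk x _ => (hab j (Or.inl h)).elim _ _⟩
  by_cases hja : j < a
  · exact low i j hij hja
  have key : ∀ j, a - 1 ≤ j → j < m → ∀ i (hij : j + 1 = i), ∃ s : C.X j →ₗ[Λ] C.X i,
      ∀ k (hjk : k + 1 = j) (x : C.X j), C.d j k hjk x = 0 → C.d i j hij (s x) = x := by
    intro j hj
    induction j, hj using Int.leInduction with
    | base => exact fun _ i hij => low i _ hij (by omega)
    | succ k hk ih =>
      intro hm i hij
      obtain ⟨s, hs⟩ := ih (by omega) (k + 1) rfl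
      have hr : ∀ x, x - s (C.d (k + 1) k rfl x) ∈ LinearMap.range (C.d i (k + 1) hij) := by
        intro x
        obtain ⟨y, hy⟩ := hC (k + 1) hm i k hij rfl (x - s (C.d (k + 1) k rfl x)) (by
          rw [map_sub, hs (k - 1) (by omega) _ (C.d_d _ _ _ _ _ _), sub_self])
        exact ⟨y, hy⟩
      let g : C.X (k + 1) →ₗ[Λ] LinearMap.range (C.d i (k + 1) hij) :=
        LinearMap.codRestrict _ (LinearMap.id - s ∘ₗ C.d (k + 1) k rfl) hr
      obtain ⟨t, ht⟩ := Module.projective_lifting_property (C.d i (k + 1) hij).rangeRestrict g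
        (LinearMap.surjective_rangeRestrict _)
      refine ⟨t, fun k' hk' x hx => ?_⟩
      obtain rfl : k' = k := by omega
      have := congrArg Subtype.val (LinearMap.congr_fun ht x)
      change C.d i (k' + 1) hij (t x) = x - s (C.d (k' + 1) k' rfl x) at this
      rw [this, hx, map_zero, sub_zero]
  exact key j (by omega) hj i hij

/-- The image of a differential into the exact range is a direct summand. -/
theorem exists_splitting (C : FreeComplex Λ) (m : ℤ) (hC : ∀ j < m, C.ExactAt j) (i j : ℤ)
    (hij : j + 1 = i) (hj : j < m) :
    ∃ s : C.X j →ₗ[Λ] C.X i, ∀ y, C.d i j hij (s (C.d i j hij y)) = C.d i j hij y := by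
  obtain ⟨s, hs⟩ := C.exists_lift_cycles m hC i j hij hj
  exact ⟨s, fun y => hs (j - 1) (by omega) _ (C.d_d _ _ _ _ _ _)⟩

theorem stablyFree_range (C : FreeComplex Λ) (m : ℤ) (hC : ∀ j < m, C.ExactAt j) (i j : ℤ)
    (hij : j + 1 = i) (hj : j < m) : StablyFree Λ (LinearMap.range (C.d i j hij)) := by
  obtain ⟨a, b, hab⟩ := C.bounded
  have low : ∀ i j (hij : j + 1 = i), j < a → StablyFree Λ (LinearMap.range (C.d i j hij)) := by
    intro i j hij h
    have := hab j (Or.inl h)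
    exact ⟨PUnit, inferInstance, inferInstance, inferInstance, inferInstance,
      Module.Free.of_subsingleton _ _, inferInstance⟩
  by_cases hja : j < a
  · exact low i j hij hja
  have key : ∀ j, a - 1 ≤ j → j < m → ∀ i (hij : j + 1 = i),
      StablyFree Λ (LinearMap.range (C.d i j hij)) := by
    intro j hj
    induction j, hj using Int.leInduction with
    | base => exact fun _ i hij => low i _ hij (by omega)
    | succ k hk ih =>
      intro hm i hij
      obtain ⟨R, _, _, _, _, _, _⟩ := ih (by omega) (k + 1) rfl
      obtain ⟨s, hs⟩ := C.exists_splitting m hC (k + 1) k rfl (by omega)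
      have hr : ∀ x, x - s (C.d (k + 1) k rfl x) ∈ LinearMap.range (C.d i (k + 1) hij) := by
        intro x
        obtain ⟨y, hy⟩ := hC (k + 1) hm i k hij rfl (x - s (C.d (k + 1) k rfl x)) (by
          rw [map_sub, hs, sub_self])
        exact ⟨y, hy⟩
      let e : C.X (k + 1) ≃ₗ[Λ] LinearMap.range (C.d i (k + 1) hij) ×
          LinearMap.range (C.d (k + 1) k rfl) :=
        LinearEquiv.ofLinearMap
          (LinearMap.prod (LinearMap.codRestrict _ (LinearMap.id - s ∘ₗ C.d (k + 1) k rfl) hr)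
            (C.d (k + 1) k rfl).rangeRestrict)
          (LinearMap.coprod (Submodule.subtype _) (s ∘ₗ Submodule.subtype _))
          (by
            refine LinearMap.ext fun p => ?_
            obtain ⟨⟨_, y, rfl⟩, ⟨_, w, rfl⟩⟩ := p
            refine Prod.ext (Subtype.ext ?_) (Subtype.ext ?_)
            · change (C.d i (k + 1) hij y + s (C.d (k + 1) k rfl w)) -
                s (C.d (k + 1) k rfl (C.d i (k + 1) hij y + s (C.d (k + 1) k rfl w))) = _
              rw [map_add, C.d_d, hs, zero_add, add_sub_cancel_right]
              rfl
            · change C.d (k + 1) k rfl (C.d i (k + 1) hij y + s (C.d (k + 1) k rfl w)) = _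
              rw [map_add, C.d_d, hs, zero_add]
              rfl)
          (by
            refine LinearMap.ext fun x => ?_
            change (x - s (C.d (k + 1) k rfl x)) + s (C.d (k + 1) k rfl x) = x
            exact sub_add_cancel _ _)
      let e' : (C.X (k + 1) × R) ≃ₗ[Λ] LinearMap.range (C.d i (k + 1) hij) ×
          LinearMap.range (C.d (k + 1) k rfl) × R :=
        (e.prodCongr (LinearEquiv.refl Λ R)).trans (LinearEquiv.prodAssoc Λ _ _ _)
      exact ⟨_, inferInstance, inferInstance, ‹_›, ‹_›, Module.Free.of_equiv e',
        Module.Finite.equiv e'⟩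
  exact key j (by omega) hj i hij

/-- An exact complex is contractible. -/
theorem exists_contraction (C : FreeComplex Λ) (hC : ∀ j, C.ExactAt j) :
    ∃ h : ∀ i j, i + 1 = j → (C.X i →ₗ[Λ] C.X j),
      ∀ (i j k : ℤ) (hij : j + 1 = i) (hjk : k + 1 = j) (x : C.X j),
        C.d i j hij (h j i hij x) + h k j hjk (C.d j k hjk x) = x := by
  choose s hs using fun (i j : ℤ) (hij : j + 1 = i) =>
    C.exists_lift_cycles (j + 1) (fun j _ => hC j) i j hij (by omega)
  refine ⟨fun i j hij => s j i hij ∘ₗ (LinearMap.id - s i (i - 1) (by omega) ∘ₗ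
    C.d i (i - 1) (by omega)), fun i j k hij hjk x => ?_⟩
  obtain rfl : k = j - 1 := by omega
  have h1 : C.d j (j - 1) hjk (x - s j (j - 1) hjk (C.d j (j - 1) hjk x)) = 0 := by
    rw [map_sub, hs _ _ _ (j - 1 - 1) (by omega) _ (C.d_d _ _ _ _ _ _), sub_self]
  change C.d i j hij (s i j hij (x - s j (j - 1) _ (C.d j (j - 1) _ x))) +
    s j (j - 1) hjk (C.d j (j - 1) hjk x - s (j - 1) (j - 1 - 1) _
      (C.d (j - 1) (j - 1 - 1) _ (C.d j (j - 1) hjk x))) = x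
  rw [hs _ _ _ _ _ _ h1, C.d_d, map_zero, sub_zero, sub_add_cancel]

end FreeComplex

end Exactness

/-! ### Quasi-isomorphisms -/

section QuasiIso

variable {Λ : Type u} [Ring Λ] [StarRing Λ]

/-- A family of maps which is bijective in homology. -/
structure IsQuasiIso (C D : FreeComplex Λ) (f : ∀ i, C.X i →ₗ[Λ] D.X i) : Prop where
  inj : ∀ i j k (hij : j + 1 = i) (hjk : k + 1 = j) (x : C.X j) (y : D.X i),
    C.d j k hjk x = 0 → D.d i j hij y = f j x → ∃ x', C.d i j hij x' = x
  surj : ∀ i j k (hij : j + 1 = i) (hjk : k + 1 = j) (y : D.X j), D.d j k hjk y = 0 →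
    ∃ x y', C.d j k hjk x = 0 ∧ f j x + D.d i j hij y' = y

theorem IsChainEquivalence.isQuasiIso {C D : FreeComplex Λ} {f : ∀ i, C.X i →ₗ[Λ] D.X i}
    (hf : IsChainEquivalence C D f) : IsQuasiIso C D f := by
  obtain ⟨hf, g, hg, ⟨a, ha⟩, ⟨b, hb⟩⟩ := hf
  constructor
  · intro i j k hij hjk x y hx hy
    have h1 := LinearMap.congr_fun (ha k j i hjk hij) x
    have h2 := LinearMap.congr_fun (hg i j hij) y
    simp only [LinearMap.sub_apply, LinearMap.add_apply, LinearMap.comp_apply, LinearMap.id_apply,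
      hx, map_zero, add_zero] at h1 h2
    refine ⟨a j i hij x + g i y, ?_⟩
    rw [map_add, h2, hy, ← h1, sub_add_cancel]
  · intro i j k hij hjk y hy
    have h1 := LinearMap.congr_fun (hb k j i hjk hij) y
    have h2 := LinearMap.congr_fun (hg j k hjk) y
    simp only [LinearMap.sub_apply, LinearMap.add_apply, LinearMap.comp_apply, LinearMap.id_apply,
      hy, map_zero, add_zero] at h1 h2
    exact ⟨g j y, b j i hij y, h2, by rw [← h1, add_sub_cancel]⟩

/-- The chain map underlying a family of maps which commute with the differentials. -/
def IsChainMap.toChainMap {C D : FreeComplex Λ} {f : ∀ i, C.X i →ₗ[Λ] D.X i}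
    (hf : IsChainMap C D f) : ChainMap C D where
  f := f
  comm i j h x := LinearMap.congr_fun (hf i j h) x

namespace FreeComplex

variable {C D : FreeComplex Λ} (f : ChainMap C D)

/-- The inclusion `D_i → cone(f)_i`. -/
def coneInl (i : ℤ) : D.X i →ₗ[Λ] (cone f).X i := LinearMap.inl Λ (D.X i) (C.X (i - 1))

/-- The inclusion `C_p → cone(f)_i`, for `p = i - 1`. -/
def coneInr (i p : ℤ) (h : p + 1 = i) : C.X p →ₗ[Λ] (cone f).X i :=
  LinearMap.inr Λ (D.X i) (C.X (i - 1)) ∘ₗ C.idMap p (i - 1) (by omega)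

/-- The projection `cone(f)_i → D_i`. -/
def coneFst (i : ℤ) : (cone f).X i →ₗ[Λ] D.X i := LinearMap.fst Λ (D.X i) (C.X (i - 1))

/-- The projection `cone(f)_i → C_p`, for `p = i - 1`. -/
def coneSnd (i p : ℤ) (h : p + 1 = i) : (cone f).X i →ₗ[Λ] C.X p :=
  C.idMap (i - 1) p (by omega) ∘ₗ LinearMap.snd Λ (D.X i) (C.X (i - 1))

variable {f}

@[simp] theorem coneFst_inl (i : ℤ) (y : D.X i) : coneFst f i (coneInl f i y) = y := rfl

@[simp] theorem coneFst_inr (i p : ℤ) (h : p + 1 = i) (x : C.X p) :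
    coneFst f i (coneInr f i p h x) = 0 := rfl

@[simp] theorem coneSnd_inl (i p : ℤ) (h : p + 1 = i) (y : D.X i) :
    coneSnd f i p h (coneInl f i y) = 0 := map_zero (C.idMap (i - 1) p (by omega))

@[simp] theorem coneSnd_inr (i p : ℤ) (h : p + 1 = i) (x : C.X p) :
    coneSnd f i p h (coneInr f i p h x) = x := by
  obtain rfl : p = i - 1 := by omega
  rfl

theorem coneInl_add_coneInr (i p : ℤ) (h : p + 1 = i) (w : (cone f).X i) :
    coneInl f i (coneFst f i w) + coneInr f i p h (coneSnd f i p h w) = w := by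
  obtain rfl : p = i - 1 := by omega
  obtain ⟨y, x⟩ : D.X i × C.X (i - 1) := w
  exact Prod.ext (add_zero y) (zero_add x)

theorem d_coneInl (i j : ℤ) (h : j + 1 = i) (y : D.X i) :
    (cone f).d i j h (coneInl f i y) = coneInl f j (D.d i j h y) := by
  refine Prod.ext ?_ ?_
  · change D.d i j h y + (i - 1).negOnePow • f.at' (i - 1) j _ 0 = D.d i j h y
    rw [map_zero, smul_zero, add_zero]
  · exact map_zero (C.d (i - 1) (j - 1) _)

theorem d_coneInr (i j k : ℤ) (hij : j + 1 = i) (hjk : k + 1 = j) (x : C.X j) :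
    (cone f).d i j hij (coneInr f i j hij x) =
      j.negOnePow • coneInl f j (f.f j x) + coneInr f j k hjk (C.d j k hjk x) := by
  obtain rfl : k = j - 1 := by omega
  have gen : ∀ (p : ℤ) (hp : p = j), p.negOnePow • f.at' p j hp (C.idMap j p hp.symm x) =
      j.negOnePow • f.f j x ∧ C.d p (j - 1) (by omega) (C.idMap j p hp.symm x) =
        C.d j (j - 1) hjk x := by
    rintro p rfl
    exact ⟨rfl, rfl⟩
  have hp : i - 1 = j := by omega
  rw [← map_units_smul (coneInl f j)]
  refine Prod.ext ?_ ?_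
  · change D.d i j hij 0 + (i - 1).negOnePow • f.at' (i - 1) j _ (C.idMap j (i - 1) _ x) =
      j.negOnePow • f.f j x + 0
    rw [map_zero, zero_add, add_zero, (gen _ hp).1]
  · change C.d (i - 1) (j - 1) _ (C.idMap j (i - 1) _ x) = 0 + C.d j (j - 1) hjk x
    rw [zero_add, (gen _ hp).2]

end FreeComplex

open FreeComplex in
theorem IsQuasiIso.exactAt_cone {C D : FreeComplex Λ} (f : ChainMap C D)
    (hf : IsQuasiIso C D f.f) (j : ℤ) : (cone f).ExactAt j := by
  intro i k hij hjk w hw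
  rw [← coneInl_add_coneInr j k hjk w] at hw ⊢
  generalize coneFst f j w = y at *
  generalize coneSnd f j k hjk w = c at *
  rw [map_add, d_coneInl, d_coneInr j k (k - 1) hjk (by omega)] at hw
  have h1 := congrArg (coneFst f k) hw
  have h2 := congrArg (coneSnd f k (k - 1) (by omega)) hw
  simp only [map_add, map_units_smul, coneFst_inl, coneFst_inr, coneSnd_inl, coneSnd_inr,
    map_zero, smul_zero, zero_add, add_zero] at h1 h2
  obtain ⟨c', hc'⟩ := hf.inj j k (k - 1) hjk (by omega) c (-k.negOnePow • y) h2 (by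
    rw [map_units_smul, eq_neg_of_add_eq_zero_left h1, smul_neg, smul_smul]
    simp)
  have hs : j.negOnePow = -k.negOnePow := by rw [← hjk, Int.negOnePow_succ]
  obtain ⟨c'', y'', hc'', hy''⟩ := hf.surj i j k hij hjk (y - j.negOnePow • f.f j c') (by
    rw [map_sub, map_units_smul, f.comm j k hjk, hc', eq_neg_of_add_eq_zero_left h1, hs]
    simp)
  refine ⟨coneInl f i y'' + coneInr f i j hij (c' + j.negOnePow • c''), ?_⟩
  rw [map_add, d_coneInl, d_coneInr i j k hij hjk]
  simp only [map_add, map_units_smul, hc'', hc', smul_add, smul_smul, Int.units_mul_self,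
    one_smul, smul_zero, add_zero]
  rw [sub_eq_iff_eq_add.1 hy''.symm]
  simp only [map_add, map_units_smul]
  abel

open FreeComplex in
/-- A quasi-isomorphism between bounded complexes of f.g. free modules is a chain equivalence. -/
theorem IsQuasiIso.isChainEquivalence {C D : FreeComplex Λ} {f : ∀ i, C.X i →ₗ[Λ] D.X i}
    (hf : IsQuasiIso C D f) (hc : IsChainMap C D f) : IsChainEquivalence C D f := by
  obtain ⟨F, rfl⟩ : ∃ F : ChainMap C D, F.f = f := ⟨hc.toChainMap, rfl⟩
  obtain ⟨h, hh⟩ := (cone F).exists_contraction (IsQuasiIso.exactAt_cone F hf)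
  let G : ∀ i, D.X i →ₗ[Λ] C.X i := fun i =>
    coneSnd F (i + 1) i rfl ∘ₗ h i (i + 1) rfl ∘ₗ coneInl F i
  let A : ∀ i j, i + 1 = j → (D.X i →ₗ[Λ] D.X j) := fun i j hij =>
    coneFst F j ∘ₗ h i j hij ∘ₗ coneInl F i
  let B : ∀ i j, i + 1 + 1 = j → (C.X i →ₗ[Λ] D.X j) := fun i j hij =>
    coneFst F j ∘ₗ h (i + 1) j hij ∘ₗ coneInr F (i + 1) i rfl
  let L : ∀ i j, i + 1 = j → (C.X i →ₗ[Λ] C.X j) := fun i j hij =>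
    coneSnd F (j + 1) j rfl ∘ₗ h j (j + 1) rfl ∘ₗ coneInr F j i hij
  have hG : ∀ i j (hij : i + 1 = j) (y : D.X i), h i j hij (coneInl F i y) =
      coneInl F j (A i j hij y) + coneInr F j i hij (G i y) := by
    rintro i _ rfl y
    exact (coneInl_add_coneInr (i + 1) i rfl _).symm
  have hL : ∀ i j k (hij : i + 1 = j) (hjk : j + 1 = k) (x : C.X i),
      h j k hjk (coneInr F j i hij x) =
        coneInl F k (B i k (by omega) x) + coneInr F k j hjk (L i j hij x) := by
    rintro i _ _ rfl rfl x
    exact (coneInl_add_coneInr (i + 1 + 1) (i + 1) rfl _).symm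
  have hD : ∀ i j k (hij : j + 1 = i) (hjk : k + 1 = j) (y : D.X j),
      (D.d i j hij (A j i hij y) + j.negOnePow • F.f j (G j y) + A k j hjk (D.d j k hjk y) = y) ∧
      (C.d j k hjk (G j y) + G k (D.d j k hjk y) = 0) := by
    intro i j k hij hjk y
    have key := hh i j k hij hjk (coneInl F j y)
    rw [d_coneInl, hG, hG, map_add, d_coneInl, d_coneInr i j k hij hjk] at key
    have h1 := congrArg (coneFst F j) key
    have h2 := congrArg (coneSnd F j k hjk) key
    simp only [map_add, map_units_smul, coneFst_inl, coneFst_inr, coneSnd_inl, coneSnd_inr,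
      smul_zero, zero_add, add_zero] at h1 h2
    exact ⟨h1, h2⟩
  have hC : ∀ i j k (hij : j + 1 = i) (hjk : k + 1 = j) (x : C.X j),
      C.d i j hij (L j i hij x) + j.negOnePow • G j (F.f j x) + L k j hjk (C.d j k hjk x) = x := by
    intro i j k hij hjk x
    have key := hh (i + 1) i j rfl hij (coneInr F i j hij x)
    rw [d_coneInr i j k hij hjk, hL j i (i + 1) hij rfl, map_add, map_add, map_units_smul, hG,
      hL k j i hjk hij, d_coneInl, d_coneInr (i + 1) i j rfl hij] at key
    have h2 := congrArg (coneSnd F i j hij) key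
    simp only [map_add, map_units_smul, coneSnd_inl, coneSnd_inr, smul_zero,
      zero_add] at h2
    rw [add_assoc]
    exact h2
  refine ⟨hc, fun i => i.negOnePow • G i, fun i j hij => LinearMap.ext fun y => ?_, ⟨L, ?_⟩, ⟨A, ?_⟩⟩
  · have h2 := (hD (i + 1) i j rfl hij y).2
    have hs : i.negOnePow = -j.negOnePow := by rw [← hij, Int.negOnePow_succ]
    simp only [LinearMap.comp_apply, LinearMap.smul_apply, map_units_smul]
    rw [eq_neg_of_add_eq_zero_left h2, hs]
    simp
  · intro k j i hjk hij
    refine LinearMap.ext fun x => ?_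
    simp only [LinearMap.sub_apply, LinearMap.id_apply, LinearMap.comp_apply, LinearMap.smul_apply,
      LinearMap.add_apply]
    rw [sub_eq_iff_eq_add, add_right_comm]
    exact (hC i j k hij hjk x).symm
  · intro k j i hjk hij
    refine LinearMap.ext fun x => ?_
    simp only [LinearMap.sub_apply, LinearMap.id_apply, LinearMap.comp_apply, LinearMap.smul_apply,
      LinearMap.add_apply, map_units_smul]
    rw [sub_eq_iff_eq_add, add_right_comm]
    exact (hD i j k hij hjk x).1.symm

end QuasiIso

/-! ### Hyperbolic forms and elementary preformations -/

section Hyperbolic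

variable {Λ : Type u} [Ring Λ] [StarRing Λ]

open RegSplitPreformation

theorem star_smul_star (e : ℤˣ) (b : Λ) : e • star (e • star b) = b := by
  rw [star_units_smul, star_star, smul_smul, Int.units_mul_self, one_smul]

/-- The symmetrization `θ + e θ^*`. -/
def symmetrize (e : ℤˣ) {M : Type u} [AddCommGroup M] [Module Λ M]
    (θ : M →ₗ[Λ] StarDual Λ M) : M →ₗ[Λ] StarDual Λ M := θ + e • adj θ

theorem symmetrize_apply (e : ℤˣ) {M : Type u} [AddCommGroup M] [Module Λ M]
    (θ : M →ₗ[Λ] StarDual Λ M) (x y : M) :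
    symmetrize e θ x y = θ x y + e • star (θ y x) := by
  simp [symmetrize]

theorem symmetrize_symm (e : ℤˣ) {M : Type u} [AddCommGroup M] [Module Λ M]
    (θ : M →ₗ[Λ] StarDual Λ M) (x y : M) :
    symmetrize e θ x y = e • star (symmetrize e θ y x) := by
  rw [symmetrize_apply, symmetrize_apply, star_add, smul_add, star_smul_star, add_comm]

theorem mk_add_self (e : ℤˣ) {M : Type u} [AddCommGroup M] [Module Λ M]
    (θ : M →ₗ[Λ] StarDual Λ M) (x y : M) :
    QuadQuot.mk e (θ (x + y) (x + y)) =
      QuadQuot.mk e (θ x x) + QuadQuot.mk e (θ y y) + QuadQuot.mk e (symmetrize e θ x y) := by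
  have h := QuadQuot.mk_smul_star e (θ y x)
  rw [symmetrize_apply]
  simp only [map_add, StarDual.add_apply, LinearMap.add_apply, h]
  abel

/-- A quadratic module which contains a lagrangian `J` (up to its radical) projects isometrically
onto the hyperbolic form on `J`. -/
theorem exists_isometry_hyperbolic (e : ℤˣ) {M J : Type u} [AddCommGroup M] [Module Λ M]
    [AddCommGroup J] [Module Λ J] [Module.Free Λ J] [Module.Finite Λ J]
    (θ : M →ₗ[Λ] StarDual Λ M) (i : J →ₗ[Λ] M)
    (hquad : ∀ j, QuadQuot.mk e (θ (i j) (i j)) = 0)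
    (hform : ∀ j j', symmetrize e θ (i j) (i j') = 0)
    (hperp : ∀ m, (∀ j, symmetrize e θ m (i j) = 0) →
      ∃ j, symmetrize e θ m = symmetrize e θ (i j))
    (hsurj : ∀ ξ : StarDual Λ J, ∃ m, dualMap i (symmetrize e θ m) = ξ)
    (hrad : ∀ m, symmetrize e θ m = 0 → QuadQuot.mk e (θ m m) = 0) :
    ∃ π : M →ₗ[Λ] J × StarDual Λ J, Function.Surjective π ∧
      (∀ m m', symmetrize e (hyperbolicMap J) (π m) (π m') = symmetrize e θ m m') ∧
      ∀ m, QuadQuot.mk e (hyperbolicMap (Λ := Λ) J (π m) (π m)) = QuadQuot.mk e (θ m m) := by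
  obtain ⟨σ₀, hσ₀⟩ := Module.projective_lifting_property (dualMap i ∘ₗ symmetrize e θ)
    (LinearMap.id : StarDual Λ J →ₗ[Λ] StarDual Λ J) hsurj
  have hσ₀' : ∀ ξ j, symmetrize e θ (σ₀ ξ) (i j) = ξ j := fun ξ j =>
    DFunLike.congr_fun (LinearMap.congr_fun hσ₀ ξ) j
  let Θ : StarDual Λ J →ₗ[Λ] StarDual Λ (StarDual Λ J) := dualMap σ₀ ∘ₗ θ ∘ₗ σ₀
  let χ : StarDual Λ J →ₗ[Λ] J := (undual J).toLinearMap ∘ₗ adj Θ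
  have hχ : ∀ ξ ξ', ξ (χ ξ') = θ (σ₀ ξ) (σ₀ ξ') := fun ξ ξ' => by
    change ξ (undual J (adj Θ ξ')) = _
    rw [apply_undual, adj_apply, star_star]
    rfl
  let σ : StarDual Λ J →ₗ[Λ] M := σ₀ - i ∘ₗ χ
  have hσi : ∀ ξ j, symmetrize e θ (σ ξ) (i j) = ξ j := fun ξ j => by
    change symmetrize e θ (σ₀ ξ - i (χ ξ)) (i j) = _
    rw [map_sub, StarDual.sub_apply, hform, sub_zero, hσ₀']
  have hiσ : ∀ ξ j, symmetrize e θ (i j) (σ ξ) = e • star (ξ j) := fun ξ j => by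
    rw [symmetrize_symm, hσi]
  have hσσ : ∀ ξ ξ', symmetrize e θ (σ ξ) (σ ξ') = 0 := fun ξ ξ' => by
    have h1 : symmetrize e θ (σ ξ) (σ ξ') =
        symmetrize e θ (σ₀ ξ) (σ₀ ξ') - symmetrize e θ (i (χ ξ)) (σ₀ ξ') - ξ (χ ξ') := by
      conv_lhs => rw [show σ ξ' = σ₀ ξ' - i (χ ξ') from rfl, map_sub, hσi]
      rw [show σ ξ = σ₀ ξ - i (χ ξ) from rfl, map_sub, StarDual.sub_apply]
    rw [h1, symmetrize_symm e θ (i _), hσ₀', hχ, hχ, symmetrize_apply]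
    abel
  have hσq : ∀ ξ, QuadQuot.mk e (θ (σ ξ) (σ ξ)) = 0 := fun ξ => by
    have h1 := mk_add_self e θ (σ ξ) (i (χ ξ))
    rw [show σ ξ + i (χ ξ) = σ₀ ξ from sub_add_cancel _ _, hquad, hσi, hχ, add_zero] at h1
    exact right_eq_add.1 h1
  have hH : ∀ l φ l' φ', symmetrize e (hyperbolicMap (Λ := Λ) J) (l, φ) (l', φ') =
      φ l' + e • star (φ' l) := fun l φ l' φ' => symmetrize_apply _ _ _ _
  let s : J × StarDual Λ J →ₗ[Λ] M := i.coprod σ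
  have hs : ∀ p p', symmetrize e θ (s p) (s p') =
      symmetrize e (hyperbolicMap (Λ := Λ) J) p p' := fun ⟨l, φ⟩ ⟨l', φ'⟩ => by
    change symmetrize e θ (i l + σ φ) (i l' + σ φ') = _
    simp only [map_add, LinearMap.add_apply, StarDual.add_apply, hform, hσi, hiσ, hσσ, hH]
    abel
  have hsq : ∀ p, QuadQuot.mk e (θ (s p) (s p)) =
      QuadQuot.mk e (hyperbolicMap (Λ := Λ) J p p) := fun ⟨l, φ⟩ => by
    change QuadQuot.mk e (θ (i l + σ φ) (i l + σ φ)) = QuadQuot.mk e (φ l)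
    rw [mk_add_self, hquad, hσq, hiσ, QuadQuot.mk_smul_star, zero_add, zero_add]
  let π : M →ₗ[Λ] J × StarDual Λ J :=
    LinearMap.prod ((undual J).toLinearMap ∘ₗ (e • (dualMap σ ∘ₗ symmetrize e θ)))
      (dualMap i ∘ₗ symmetrize e θ)
  have hπ : ∀ m p, symmetrize e (hyperbolicMap (Λ := Λ) J) (π m) p =
      symmetrize e θ m (s p) := fun m ⟨l, φ⟩ => by
    change symmetrize e (hyperbolicMap (Λ := Λ) J) (undual J (e • dualMap σ (symmetrize e θ m)),
      dualMap i (symmetrize e θ m)) (l, φ) = symmetrize e θ m (i l + σ φ)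
    rw [hH, apply_undual, StarDual.units_smul_apply, star_star, smul_smul, Int.units_mul_self,
      one_smul, map_add]
    rfl
  have hnd : ∀ m, (∀ p, symmetrize e θ m (s p) = 0) → symmetrize e θ m = 0 := fun m hm => by
    obtain ⟨j, hj⟩ := hperp m fun j => by simpa [s] using hm (j, 0)
    have hj0 : j = 0 := ext_dual (Λ := Λ) fun φ => by
      have := hm (0, φ)
      rw [hj] at this
      have h2 : symmetrize e θ (i j) (σ φ) = 0 := by simpa [s] using this
      rw [hiσ] at h2
      have h3 := congrArg (fun t => star (e • t)) h2
      simpa [smul_smul, star_units_smul] using h3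
    rw [hj, hj0, map_zero, map_zero]
  have hsπ : ∀ m, symmetrize e θ (m - s (π m)) = 0 := fun m => hnd _ fun p => by
    rw [map_sub, StarDual.sub_apply, hs, hπ, sub_self]
  have hsπ' : ∀ m, symmetrize e θ (s (π m)) = symmetrize e θ m := fun m => by
    have := hsπ m
    rw [map_sub, sub_eq_zero] at this
    exact this.symm
  refine ⟨π, fun p => ⟨s p, ?_⟩, fun m m' => ?_, fun m => ?_⟩
  · obtain ⟨l, φ⟩ := p
    refine Prod.ext (ext_dual (Λ := Λ) fun φ' => ?_) (StarDual.ext fun l' => ?_)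
    · change φ' (undual J (e • dualMap σ (symmetrize e θ (s (l, φ))))) = φ' l
      rw [apply_undual, StarDual.units_smul_apply, dualMap_apply,
        show symmetrize e θ (s (l, φ)) (σ φ') = e • star (φ' l) by
          have := hs (l, φ) (0, φ')
          rw [hH] at this
          simpa [s] using this]
      rw [smul_smul, Int.units_mul_self, one_smul, star_star]
    · change symmetrize e θ (s (l, φ)) (i l') = φ l'
      have := hs (l, φ) (l', 0)
      rw [hH] at this
      simpa [s] using this
  · rw [hπ, symmetrize_symm, hsπ', ← symmetrize_symm]
  · have h1 := mk_add_self e θ (m - s (π m)) (s (π m))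
    rw [sub_add_cancel, hrad _ (hsπ m), hsπ, hsq] at h1
    rw [h1]
    simp

end Hyperbolic

section Elementary

variable {Λ : Type u} [Ring Λ] [StarRing Λ] {ε : ℤˣ}

open RegSplitPreformation

/-- A short exact sequence `0 → U → F^* → U^* → 0` induced by `β : U → G` makes `β(U)` an
h-lagrangian. -/
theorem RegSplitPreformation.isHLagrangian_range (z : RegSplitPreformation Λ ε) {U : Type u}
    [AddCommGroup U] [Module Λ U] [Module.Free Λ U] [Module.Finite Λ U] (β : U →ₗ[Λ] z.G)
    (hform : ∀ x y, z.μ (β x) (z.γ (β y)) = 0) (hquad : ∀ x, z.quad (β x) = 0)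
    (hinj : Function.Injective (z.μ ∘ₗ β))
    (hex : ∀ φ, dualMap (z.γ ∘ₗ β) φ = 0 → ∃ x, z.μ (β x) = φ)
    (hsurj : Function.Surjective (dualMap (z.γ ∘ₗ β))) :
    z.IsHLagrangian (LinearMap.range β) := by
  have hβ : Function.Injective β := fun x y h => hinj (by simp [h])
  let e : U ≃ₗ[Λ] LinearMap.range β := LinearEquiv.ofInjective β hβ
  obtain ⟨t, ht⟩ := Module.projective_lifting_property (dualMap (z.γ ∘ₗ β))
    (LinearMap.id : StarDual Λ U →ₗ[Λ] StarDual Λ U) hsurj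
  have ht' : ∀ ξ x, t ξ (z.γ (β x)) = ξ x := fun ξ x =>
    DFunLike.congr_fun (LinearMap.congr_fun ht ξ) x
  -- a retraction of `γ β`
  let r : z.F →ₗ[Λ] U := (undual U).toLinearMap ∘ₗ dualMap t ∘ₗ evalDual z.F
  have hr : ∀ x, r (z.γ (β x)) = x := fun x => ext_dual (Λ := Λ) fun ξ => by
    change ξ (undual U (dualMap t (evalDual z.F (z.γ (β x))))) = ξ x
    rw [apply_undual, dualMap_apply, evalDual_apply, star_star, ht']
  have hγ : Function.Injective (z.γ ∘ₗ β) := fun x y h => by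
    rw [← hr x, ← hr y]; exact congrArg r h
  refine ⟨Module.Free.of_equiv e, Module.Finite.equiv e, ?_, ?_, ?_, ?_, ?_, ?_, ?_⟩
  · rintro _ ⟨x, rfl⟩ _ ⟨y, rfl⟩; exact hform x y
  · rintro _ ⟨x, rfl⟩; exact hquad x
  · rintro ⟨_, x, rfl⟩ ⟨_, y, rfl⟩ h
    exact Subtype.ext (congrArg β (hγ h))
  · rintro ⟨_, x, rfl⟩ ⟨_, y, rfl⟩ h
    exact Subtype.ext (congrArg β (hinj h))
  · refine ⟨LinearMap.ker r, ?_⟩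
    rw [isCompl_iff, Submodule.disjoint_def, codisjoint_iff, eq_top_iff]
    refine ⟨?_, fun y _ => Submodule.mem_sup.2 ⟨z.γ (β (r y)), ?_, y - z.γ (β (r y)), ?_, ?_⟩⟩
    · rintro _ ⟨_, ⟨x, rfl⟩, rfl⟩ h
      rw [LinearMap.mem_ker, hr] at h
      rw [h, map_zero, map_zero]
    · exact ⟨_, ⟨_, rfl⟩, rfl⟩
    · rw [LinearMap.mem_ker, map_sub, hr, sub_self]
    · exact add_sub_cancel _ _
  · refine ⟨LinearMap.range t, ?_⟩
    rw [isCompl_iff, Submodule.disjoint_def, codisjoint_iff, eq_top_iff]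
    refine ⟨?_, fun φ _ => ?_⟩
    · rintro _ ⟨_, ⟨x, rfl⟩, rfl⟩ ⟨ξ, hξ⟩
      have : ξ = 0 := StarDual.ext fun y => by
        rw [← ht' ξ y, hξ]
        exact hform x y
      rw [← hξ, this, map_zero]
    · obtain ⟨x, hx⟩ := hex (φ - t (dualMap (z.γ ∘ₗ β) φ)) (StarDual.ext fun y => by
        rw [map_sub]
        change φ (z.γ (β y)) - t (dualMap (z.γ ∘ₗ β) φ) (z.γ (β y)) = 0
        rw [ht']
        exact sub_self _)
      refine Submodule.mem_sup.2 ⟨z.μ (β x), ⟨_, ⟨x, rfl⟩, rfl⟩,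
        t (dualMap (z.γ ∘ₗ β) φ), ⟨_, rfl⟩, ?_⟩
      rw [hx, sub_add_cancel]
  · have h : (LinearMap.range β).map z.μ ≤
        LinearMap.ker (restrictDual ((LinearMap.range β).map z.γ)) := by
      rintro _ ⟨_, ⟨x, rfl⟩, rfl⟩
      refine LinearMap.mem_ker.2 (StarDual.ext ?_)
      rintro ⟨_, _, ⟨y, rfl⟩, rfl⟩
      exact hform x y
    refine ⟨h, ?_, ?_⟩
    · rw [← LinearMap.ker_eq_bot, Submodule.ker_liftQ_eq_bot]
      intro φ hφ
      obtain ⟨x, hx⟩ := hex φ (StarDual.ext fun y =>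
        DFunLike.congr_fun (LinearMap.mem_ker.1 hφ) ⟨z.γ (β y), ⟨_, ⟨_, rfl⟩, rfl⟩⟩)
      exact ⟨_, ⟨x, rfl⟩, hx⟩
    · intro ξ
      let m : U →ₗ[Λ] (LinearMap.range β).map z.γ :=
        LinearMap.codRestrict _ (z.γ ∘ₗ β) fun x => ⟨_, ⟨x, rfl⟩, rfl⟩
      obtain ⟨φ, hφ⟩ := hsurj (dualMap m ξ)
      refine ⟨Submodule.Quotient.mk φ, StarDual.ext ?_⟩
      rintro ⟨_, _, ⟨y, rfl⟩, rfl⟩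
      exact DFunLike.congr_fun hφ y

/-- Adding the boundary of a hyperbolic form does not change the class in the `l`-monoid. -/
theorem LMonoid.mk_add_hyperbolic (z : RegSplitPreformation Λ ε) (L : Type u) [AddCommGroup L]
    [Module Λ L] [Module.Free Λ L] [Module.Finite Λ L] :
    LMonoid.mk (z.add (boundary ε (hyperbolicMap (Λ := Λ) L))) = LMonoid.mk z := by
  have h1 : Module.Free Λ PUnit.{u + 1} := Module.Free.of_subsingleton _ _
  have : Subsingleton (StarDual Λ PUnit.{u + 1}) :=
    ⟨fun φ χ => StarDual.ext fun x => by rw [Subsingleton.elim x 0, map_zero, map_zero]⟩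
  let e : ∀ (A : Type u) [AddCommGroup A] [Module Λ A],
      A ≃ₗ[Λ] A × (PUnit.{u + 1} × StarDual Λ PUnit.{u + 1}) := fun A _ _ =>
    LinearEquiv.ofLinearMap (LinearMap.inl _ _ _) (LinearMap.fst _ _ _)
      (LinearMap.ext fun p => Prod.ext rfl (Subsingleton.elim _ _)) rfl
  refine (Quot.sound ⟨L, PUnit, inferInstance, inferInstance, inferInstance, inferInstance,
    inferInstance, inferInstance, inferInstance, inferInstance,
    ⟨⟨e _, e _, fun x => rfl, fun x => StarDual.ext fun y => ?_, fun x => ?_⟩⟩⟩).symm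
  · have h0 : (boundary ε (hyperbolicMap (Λ := Λ) PUnit.{u + 1})).μ 0 = 0 := map_zero _
    exact (add_zero _).symm.trans (congrArg ((z.add (boundary ε (hyperbolicMap (Λ := Λ) L))).μ x y.1 + ·)
      (DFunLike.congr_fun h0 y.2).symm)
  · exact (add_zero (_ : QuadQuot Λ (-ε))).symm.trans
      (congrArg _ (map_zero (QuadQuot.mk (-ε))).symm)

/-- A class is elementary if, after adding a quadratic module `M` with a lagrangian `J`, there is
a map `U → G ⊕ M` inducing a short exact sequence `0 → U → F^* ⊕ M^* → U^* → 0`. -/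
theorem LMonoid.isElementary_of_exact (z : RegSplitPreformation Λ ε) {M J U : Type u}
    [AddCommGroup M] [Module Λ M] [AddCommGroup J] [Module Λ J] [Module.Free Λ J]
    [Module.Finite Λ J] [AddCommGroup U] [Module Λ U] [Module.Free Λ U] [Module.Finite Λ U]
    (θ : M →ₗ[Λ] StarDual Λ M) (i : J →ₗ[Λ] M)
    (hquad : ∀ j, QuadQuot.mk (-ε) (θ (i j) (i j)) = 0)
    (hform : ∀ j j', symmetrize (-ε) θ (i j) (i j') = 0)
    (hperp : ∀ m, (∀ j, symmetrize (-ε) θ m (i j) = 0) →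
      ∃ j, symmetrize (-ε) θ m = symmetrize (-ε) θ (i j))
    (hsurj : ∀ ξ : StarDual Λ J, ∃ m, dualMap i (symmetrize (-ε) θ m) = ξ)
    (hrad : ∀ m, symmetrize (-ε) θ m = 0 → QuadQuot.mk (-ε) (θ m m) = 0)
    (p : U →ₗ[Λ] z.G) (l : U →ₗ[Λ] M)
    (hqU : ∀ u, z.quad (p u) + QuadQuot.mk (-ε) (θ (l u) (l u)) = 0)
    (hfU : ∀ u u', z.μ (p u) (z.γ (p u')) + symmetrize (-ε) θ (l u) (l u') = 0)
    (hex : ∀ φ m, (∀ u, φ (z.γ (p u)) + symmetrize (-ε) θ m (l u) = 0) →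
      ∃ u, z.μ (p u) = φ ∧ symmetrize (-ε) θ (l u) = symmetrize (-ε) θ m)
    (hsU : ∀ ξ : StarDual Λ U, ∃ (φ : StarDual Λ z.F) (m : M), ∀ u, φ (z.γ (p u)) + symmetrize (-ε) θ m (l u) = ξ u)
    (hinj : ∀ u, z.μ (p u) = 0 → symmetrize (-ε) θ (l u) = 0 → u = 0) :
    LMonoid.IsElementary (LMonoid.mk z) := by
  obtain ⟨π, hπ, hπs, hπq⟩ := exists_isometry_hyperbolic (-ε) θ i hquad hform hperp hsurj hrad
  let H := boundary ε (hyperbolicMap (Λ := Λ) J)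
  have hH : ∀ ξ : StarDual Λ (J × StarDual Λ J), ∃ m,
      symmetrize (-ε) (hyperbolicMap (Λ := Λ) J) (π m) = ξ := fun ξ => by
    obtain ⟨m, hm⟩ := hπ ((-ε) • undual J (dualMap (LinearMap.inr Λ J (StarDual Λ J)) ξ),
      dualMap (LinearMap.inl Λ J (StarDual Λ J)) ξ)
    refine ⟨m, StarDual.ext ?_⟩
    rintro ⟨j, φ⟩
    rw [symmetrize_apply, hm]
    change ξ (j, 0) + (-ε) • star (φ ((-ε) • undual J _)) = ξ (j, φ)
    rw [map_units_smul, apply_undual, star_smul_star, dualMap_apply, LinearMap.inr_apply,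
      ← map_add, Prod.mk_add_mk, add_zero, zero_add]
  let β : U →ₗ[Λ] (z.add H).G := LinearMap.prod p (π ∘ₗ l)
  have hμ : ∀ u w, (z.add H).μ (β u) w =
      z.μ (p u) w.1 + symmetrize (-ε) (hyperbolicMap (Λ := Λ) J) (π (l u)) w.2 := fun u w => rfl
  have hγ : ∀ u, (z.add H).γ (β u) = (z.γ (p u), π (l u)) := fun u => rfl
  refine ⟨z.add H, mk_add_hyperbolic z J, LinearMap.range β,
    (z.add H).isHLagrangian_range β (fun x y => ?_) (fun x => ?_) ?_ (fun Φ hΦ => ?_)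
    (fun ξ => ?_)⟩
  · rw [hμ, hγ, hπs]; exact hfU x y
  · exact (congrArg _ (hπq _)).trans (hqU x)
  · rw [injective_iff_map_eq_zero]
    intro u hu
    refine hinj u (StarDual.ext fun x => ?_) (StarDual.ext fun m => ?_)
    · have := DFunLike.congr_fun hu ((x, 0) : z.F × (J × StarDual Λ J))
      change (z.add H).μ (β u) _ = 0 at this
      change z.μ (p u) x + symmetrize (-ε) (hyperbolicMap (Λ := Λ) J) (π (l u)) 0 = 0 at this
      rw [map_zero, add_zero] at this
      exact this
    · have := DFunLike.congr_fun hu ((0, π m) : z.F × (J × StarDual Λ J))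
      change (z.add H).μ (β u) _ = 0 at this
      change z.μ (p u) 0 + symmetrize (-ε) (hyperbolicMap (Λ := Λ) J) (π (l u)) (π m) = 0 at this
      rw [hπs, map_zero, zero_add] at this
      exact this
  · obtain ⟨m, hm⟩ := hH (dualMap (LinearMap.inr Λ z.F (J × StarDual Λ J)) Φ)
    have hm' : ∀ y, symmetrize (-ε) θ m y = Φ (0, π y) := fun y => by
      rw [← hπs, hm]; rfl
    obtain ⟨u, hu, hu'⟩ := hex (dualMap (LinearMap.inl Λ z.F (J × StarDual Λ J)) Φ) m fun u => by
      have := DFunLike.congr_fun hΦ u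
      rw [hm']
      change Φ (z.γ (p u), 0) + _ = 0
      refine Eq.trans (Eq.trans (map_add Φ _ _).symm (congrArg Φ ?_)) this
      exact Prod.ext (add_zero _) (zero_add _)
    refine ⟨u, StarDual.ext ?_⟩
    rintro ⟨x, h⟩
    obtain ⟨y, rfl⟩ := hπ h
    change z.μ (p u) x + symmetrize (-ε) (hyperbolicMap (Λ := Λ) J) (π (l u)) (π y) = _
    rw [hπs, hu, hu', hm']
    exact (map_add Φ _ _).symm.trans (congrArg Φ (Prod.ext (add_zero _) (zero_add _)))
  · obtain ⟨φ, m, h⟩ := hsU ξ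
    refine ⟨dualMap (LinearMap.fst Λ z.F (J × StarDual Λ J)) φ +
      dualMap (LinearMap.snd Λ z.F (J × StarDual Λ J))
        (symmetrize (-ε) (hyperbolicMap (Λ := Λ) J) (π m)), StarDual.ext fun u => ?_⟩
    rw [← h u, ← hπs]
    rfl

end Elementary

/-! ### Duality in quadratic pairs -/

section PairDuality

variable {Λ : Type u} [Ring Λ] [StarRing Λ]

namespace QStruct

variable {C : FreeComplex Λ} {n : ℤ}

theorem apply_symm₀_symm (ψ : QStruct C n) (p r : ℤ) (h : p + r = n) (α : StarDual Λ (C.X p))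
    (β : StarDual Λ (C.X r)) :
    β (ψ.symm₀ p r h α) = (p * r).negOnePow • star (α (ψ.symm₀ r p (by omega) β)) := by
  rw [apply_symm₀, apply_symm₀, mul_comm r p, star_add, star_units_smul, star_star, smul_add,
    smul_smul, Int.units_mul_self, one_smul, add_comm]

theorem at_symm₀ {D : FreeComplex Λ} (f : ChainMap C D) (ψ : QStruct C n) (p r r' : ℤ)
    (h : p + r' = n) (hr : r' = r) (α : StarDual Λ (C.X p)) :
    f.at' r' r hr (ψ.symm₀ p r' h α) = f.f r (ψ.symm₀ p r (by omega) α) := by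
  subst hr; rfl

end QStruct

namespace QuadPair

variable {C : FreeComplex Λ} {n : ℤ} {ψ : QStruct C n} (c : QuadPair C n ψ)

theorem apply_isCycle_rel (s : ℕ) (p r p' r' : ℤ) (h : p + r + s = n) (hp : p + 1 = p')
    (hr : r + 1 = r') (α : StarDual Λ (c.D.X p)) (β : StarDual Λ (c.D.X r)) :
    β (c.D.d r' r hr (c.δψ s p r' (by omega) α))
      + r.negOnePow • β (c.δψ s p' r (by omega) (dualMap (c.D.d p' p hp) α))
      + (n + 1 - s - 1).negOnePow • (β (c.δψ (s + 1) p r (by push_cast; omega) α)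
        + ((s : ℤ) + 1).negOnePow • (p * r).negOnePow •
          star (α (c.δψ (s + 1) r p (by push_cast; omega) β)))
      + n.negOnePow • dualMap (c.f.f r) β (ψ s p r h (dualMap (c.f.f p) α)) = 0 := by
  have h1 := congrArg β (LinearMap.congr_fun (c.isCycle_rel s p r h) α)
  rw [LinearMap.add_apply, LinearMap.smul_apply, map_add, map_units_smul,
    c.δψ.apply_diff n rfl s p r p' r' h hp hr] at h1
  exact h1.trans (map_zero β)

theorem d_symm₀ (p r : ℤ) (h : p + r = n) (r' p' : ℤ) (hr : r + 1 = r') (hp : p + 1 = p')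
    (α : StarDual Λ (c.D.X p)) :
    c.D.d r' r hr (c.δψ.symm₀ p r' (by omega) α) =
      r'.negOnePow • c.δψ.symm₀ p' r (by omega) (dualMap (c.D.d p' p hp) α)
        - n.negOnePow • c.f.f r (ψ.symm₀ p r h (dualMap (c.f.f p) α)) := by
  subst hr hp
  refine ext_dual (Λ := Λ) fun β => ?_
  have h1 := c.apply_isCycle_rel 0 p r _ _ (by simp; omega) rfl rfl α β
  have h2 := congrArg star (c.apply_isCycle_rel 0 r p _ _ (by simp; omega) rfl rfl β α)
  have h3 := c.δψ.apply_symm₀ p (r + 1) (by omega) α (dualMap (c.D.d (r + 1) r rfl) β)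
  have h4 := c.δψ.apply_symm₀ (p + 1) r (by omega) (dualMap (c.D.d (p + 1) p rfl) α) β
  have h5 := ψ.apply_symm₀ p r h (dualMap (c.f.f p) α) (dualMap (c.f.f r) β)
  rw [dualMap_apply] at h3
  rw [map_sub, map_units_smul, map_units_smul, h3, h4, ← dualMap_apply (c.f.f r), h5]
  simp only [star_add, star_units_smul, star_zero, star_star] at h2
  simp only [dualMap_apply, mul_add, add_mul, mul_one, one_mul, Int.negOnePow_add, Int.negOnePow_one,
    mul_comm r p, Nat.cast_zero, zero_add] at h1 h2 ⊢
  generalize (p * r).negOnePow = e at *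
  generalize p.negOnePow = e₁ at *
  generalize r.negOnePow = e₂ at *
  generalize n.negOnePow = e₄ at *
  generalize (n + 1 - 0 - 1).negOnePow = e₃ at *
  have key := congrArg₂ (· + e • ·) h1 h2
  simp only [smul_zero, add_zero] at key
  rw [← sub_eq_zero, ← key]
  clear key h1 h2 h3 h4 h5
  rcases Int.units_eq_one_or e with rfl | rfl <;> rcases Int.units_eq_one_or e₁ with rfl | rfl <;>
    rcases Int.units_eq_one_or e₂ with rfl | rfl <;>
    rcases Int.units_eq_one_or e₃ with rfl | rfl <;>
    rcases Int.units_eq_one_or e₄ with rfl | rfl <;>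
    simp only [Units.neg_smul, one_smul, mul_neg, mul_one, neg_neg, smul_neg, smul_add] <;> abel

theorem isChainMap_dualityMap :
    IsChainMap (c.D.dual (n + 1)) (FreeComplex.cone c.f) c.dualityMap := by
  intro i j h
  refine LinearMap.ext fun w => ?_
  change StarDual Λ (c.D.X (n + 1 - i)) at w
  have h1 := c.d_symm₀ (n + 1 - i) j (by omega) i (n + 1 - j) h (by omega) w
  have h2 := c.isCycle.d_symm₀ (n + 1 - i) (j - 1) (by omega) (i - 1) (n + 1 - j) (by omega)
    (by omega) (dualMap (c.f.f (n + 1 - i)) w)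
  refine Prod.ext ?_ ?_
  · change c.D.d i j h (c.δψ.symm₀ (n + 1 - i) i (by omega) w) +
      (i - 1).negOnePow • c.f.at' (i - 1) j (by omega) ((n + 1 - i).negOnePow •
        ψ.symm₀ (n + 1 - i) (i - 1) (by omega) (dualMap (c.f.f (n + 1 - i)) w)) =
      c.δψ.symm₀ (n + 1 - j) j (by omega)
        (i.negOnePow • dualMap (c.D.d (n + 1 - j) (n + 1 - i) (by omega)) w)
    rw [h1, map_units_smul, QStruct.at_symm₀, smul_smul, ← Int.negOnePow_add,
      show i - 1 + (n + 1 - i) = n by ring, sub_add_cancel, map_units_smul]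
  · change C.d (i - 1) (j - 1) (by omega) ((n + 1 - i).negOnePow •
        ψ.symm₀ (n + 1 - i) (i - 1) (by omega) (dualMap (c.f.f (n + 1 - i)) w)) =
      (n + 1 - j).negOnePow • ψ.symm₀ (n + 1 - j) (j - 1) (by omega)
        (dualMap (c.f.f (n + 1 - j))
          (i.negOnePow • dualMap (c.D.d (n + 1 - j) (n + 1 - i) (by omega)) w))
    rw [map_units_smul, h2, map_units_smul, map_units_smul, dual_d_f, smul_smul, smul_smul,
      ← Int.negOnePow_add, ← Int.negOnePow_add, show n + 1 - i + (i - 1) = n by ring,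
      show n + 1 - j + i = n + 2 by omega, Int.negOnePow_add n 2, Int.negOnePow_even 2 even_two,
      mul_one]

/-- The differential of the mapping cone of the duality map of a pair `f : C → D`, up to sign: the
map `D^p ⊕ D_i ⊕ C_j → D^{p'} ⊕ D_j ⊕ C_b`,
`(m, y, v) ↦ (d^* m, (1 + T) δψ_0 m - f v + d y, (-1)^n (1 + T) ψ_0 f^* m + d v)`. -/
def dualityDiff (i j b p p' : ℤ) (hij : j + 1 = i) (hjb : b + 1 = j) (hp : p + 1 = p')
    (hpj : p + j = n + 1) :
    StarDual Λ (c.D.X p) × c.D.X i × C.X j →ₗ[Λ] StarDual Λ (c.D.X p') × c.D.X j × C.X b :=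
  LinearMap.prod (dualMap (c.D.d p' p hp) ∘ₗ LinearMap.fst Λ _ _)
    (LinearMap.prod
      (c.δψ.symm₀ p j (by omega) ∘ₗ LinearMap.fst Λ _ _ -
          c.f.f j ∘ₗ LinearMap.snd Λ _ _ ∘ₗ LinearMap.snd Λ _ _ +
        c.D.d i j hij ∘ₗ LinearMap.fst Λ _ _ ∘ₗ LinearMap.snd Λ _ _)
      (n.negOnePow • (ψ.symm₀ p b (by omega) ∘ₗ dualMap (c.f.f p) ∘ₗ LinearMap.fst Λ _ _) +
        C.d j b hjb ∘ₗ LinearMap.snd Λ _ _ ∘ₗ LinearMap.snd Λ _ _))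

theorem dualityDiff_apply (i j b p p' : ℤ) (hij : j + 1 = i) (hjb : b + 1 = j) (hp : p + 1 = p')
    (hpj : p + j = n + 1) (m : StarDual Λ (c.D.X p)) (y : c.D.X i) (v : C.X j) :
    c.dualityDiff i j b p p' hij hjb hp hpj (m, y, v) =
      (dualMap (c.D.d p' p hp) m, c.δψ.symm₀ p j (by omega) m - c.f.f j v + c.D.d i j hij y,
        n.negOnePow • ψ.symm₀ p b (by omega) (dualMap (c.f.f p) m) + C.d j b hjb v) := rfl

/-- The mapping cone of the duality map. -/
abbrev dualityCone : FreeComplex Λ := FreeComplex.cone c.isChainMap_dualityMap.toChainMap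

/-- The identification of `(C^{n-*})_r` with `C^{n-r}`. -/
def _root_.AlgSurgery.FreeComplex.toDual (C : FreeComplex Λ) (n r : ℤ) :
    StarDual Λ (C.X (n - r)) →ₗ[Λ] (C.dual n).X r := LinearMap.id

open FreeComplex in
theorem exists_equiv_dualityCone (i b : ℤ) (h : b + 1 = i) (s s' : ℤˣ) :
    ∃ E : (StarDual Λ (c.D.X (n + 1 - b)) × c.D.X i × C.X b) ≃ₗ[Λ] c.dualityCone.X i,
      ∀ (m : StarDual Λ (c.D.X (n + 1 - b))) (y : c.D.X i) (v : C.X b), E (m, y, v) =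
        coneInl _ i (coneInl _ i y + s' • coneInr _ i b h v) +
          s • coneInr _ i b h (c.D.toDual (n + 1) b m) := by
  let g := c.isChainMap_dualityMap.toChainMap
  let f : StarDual Λ (c.D.X (n + 1 - b)) × c.D.X i × C.X b →ₗ[Λ] c.dualityCone.X i :=
    LinearMap.coprod (s • (coneInr g i b h ∘ₗ c.D.toDual (n + 1) b))
      (LinearMap.coprod (coneInl g i ∘ₗ coneInl c.f i)
        (s' • (coneInl g i ∘ₗ coneInr c.f i b h)))
  have hf : ∀ m y v, f (m, y, v) = coneInl g i (coneInl _ i y + s' • coneInr _ i b h v) +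
      s • coneInr g i b h (c.D.toDual (n + 1) b m) := fun m y v => by
    rw [map_add (coneInl g i), map_units_smul (coneInl g i)]
    exact add_comm _ _
  refine ⟨LinearEquiv.ofBijective f ⟨?_, ?_⟩, hf⟩
  · rw [injective_iff_map_eq_zero]
    rintro ⟨m, y, v⟩ h0
    rw [hf] at h0
    have h1 := congrArg (coneSnd g i b h) h0
    have h2 := congrArg (coneFst g i) h0
    have h3 := congrArg (coneFst c.f i) h2
    have h4 := congrArg (coneSnd c.f i b h) h2
    simp only [map_add, map_units_smul, coneSnd_inl, coneSnd_inr, coneFst_inl, coneFst_inr,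
      map_zero, zero_add, add_zero, smul_zero, smul_eq_zero_iff_eq] at h1 h3 h4
    exact Prod.ext h1 (Prod.ext h3 h4)
  · intro w
    obtain ⟨m, hm⟩ : ∃ m, c.D.toDual (n + 1) b m = coneSnd g i b h w := ⟨_, rfl⟩
    refine ⟨(s • m, coneFst _ i (coneFst g i w), s' • coneSnd _ i b h (coneFst g i w)), ?_⟩
    refine (hf _ _ _).trans ?_
    rw [map_units_smul (coneInr c.f i b h), smul_smul, Int.units_mul_self, one_smul,
      coneInl_add_coneInr, map_units_smul, hm, map_units_smul, smul_smul, Int.units_mul_self,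
      one_smul]
    exact coneInl_add_coneInr i b h w

variable {c}

open FreeComplex in
theorem d_dualityCone (i j b : ℤ) (hij : j + 1 = i) (hjb : b + 1 = j)
    (m : StarDual Λ (c.D.X (n + 1 - j))) (y : c.D.X i) (v : C.X j) :
    c.dualityCone.d i j hij (coneInl _ i (coneInl _ i y + (-j.negOnePow) • coneInr _ i j hij v) +
        j.negOnePow • coneInr _ i j hij (c.D.toDual (n + 1) j m)) =
      coneInl _ j (coneInl _ j (c.δψ.symm₀ (n + 1 - j) j (by omega) m - c.f.f j v + c.D.d i j hij y) +
        (-j.negOnePow) • coneInr _ j b hjb (n.negOnePow • ψ.symm₀ (n + 1 - j) b (by omega)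
          (dualMap (c.f.f (n + 1 - j)) m) + C.d j b hjb v)) +
        (1 : ℤˣ) • coneInr _ j b hjb (c.D.toDual (n + 1) b
          (dualMap (c.D.d (n + 1 - b) (n + 1 - j) (by omega)) m)) := by
  have h1 : coneInl c.f j (c.δψ.symm₀ (n + 1 - j) j (by omega) m) + (n + 1 - j).negOnePow •
      coneInr c.f j b hjb (ψ.symm₀ (n + 1 - j) b (by omega) (dualMap (c.f.f (n + 1 - j)) m)) =
      c.dualityMap j m := by
    obtain rfl : b = j - 1 := by omega
    rw [← map_units_smul]
    exact Prod.ext (add_zero _) (zero_add _)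
  have h2 : (c.D.dual (n + 1)).d j b hjb (c.D.toDual (n + 1) j m) = j.negOnePow •
      c.D.toDual (n + 1) b (dualMap (c.D.d (n + 1 - b) (n + 1 - j) (by omega)) m) := rfl
  rw [map_add (c.dualityCone.d i j hij),
    map_units_smul (c.dualityCone.d i j hij), d_coneInr i j b hij hjb, d_coneInl,
    map_add ((cone c.f).d i j hij), map_units_smul ((cone c.f).d i j hij), d_coneInl,
    d_coneInr i j b hij hjb, h2]
  rw [show c.isChainMap_dualityMap.toChainMap.f j (c.D.toDual (n + 1) j m) = c.dualityMap j m
    from rfl, ← h1]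
  have hs : n.negOnePow = - j.negOnePow * (n + 1 - j).negOnePow := by
    rw [neg_mul, ← Int.negOnePow_add, show j + (n + 1 - j) = n + 1 by ring,
      Int.negOnePow_succ, neg_neg]
  rw [hs]
  simp only [map_add, map_sub, map_units_smul, one_smul]
  generalize j.negOnePow = e
  generalize (n + 1 - j).negOnePow = e'
  rcases Int.units_eq_one_or e with rfl | rfl <;> rcases Int.units_eq_one_or e' with rfl | rfl <;>
    simp only [Units.neg_smul, one_smul, neg_neg, smul_neg, smul_add, mul_one, mul_neg] <;> abel

theorem exists_equiv_dualityDiff (i j b p p' : ℤ) (hij : j + 1 = i) (hjb : b + 1 = j)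
    (hp : p + 1 = p') (hpj : p + j = n + 1) :
    ∃ (E : (StarDual Λ (c.D.X p) × c.D.X i × C.X j) ≃ₗ[Λ] c.dualityCone.X i)
      (E' : (StarDual Λ (c.D.X p') × c.D.X j × C.X b) ≃ₗ[Λ] c.dualityCone.X j),
      (∀ x, E' (c.dualityDiff i j b p p' hij hjb hp hpj x) = c.dualityCone.d i j hij (E x)) ∧
      ∀ (b' p'' : ℤ) (hb : b' + 1 = b) (hp' : p' + 1 = p'') (w : StarDual Λ (c.D.X p'))
        (u : c.D.X j) (v : C.X b), dualMap (c.D.d p'' p' hp') w = 0 →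
        c.D.d j b hjb u + c.f.f b v + b.negOnePow • c.δψ.symm₀ p' b (by omega) w = 0 →
        C.d b b' hb v + p'.negOnePow • ψ.symm₀ p' b' (by omega) (dualMap (c.f.f p') w) = 0 →
        c.dualityCone.d j b hjb (E' (w, u, v)) = 0 := by
  obtain rfl : p = n + 1 - j := by omega
  obtain rfl : p' = n + 1 - b := by omega
  obtain ⟨E, hE⟩ := c.exists_equiv_dualityCone i j hij j.negOnePow (-j.negOnePow)
  obtain ⟨E', hE'⟩ := c.exists_equiv_dualityCone j b hjb 1 (-j.negOnePow)
  have hs : j.negOnePow = -b.negOnePow := by rw [← hjb, Int.negOnePow_succ]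
  refine ⟨E, E', ?_, ?_⟩
  · rintro ⟨m, y, v⟩
    rw [c.dualityDiff_apply, hE, hE', d_dualityCone i j b hij hjb]
  · rintro b' p'' hb hp' w u v hw hu hv
    obtain rfl : p'' = n + 1 - b' := by omega
    have h1 := d_dualityCone (c := c) j b b' hjb hb (b.negOnePow • w) u (-v)
    have hs' : b.negOnePow * n.negOnePow = -(n + 1 - b).negOnePow := by
      rw [← Int.negOnePow_add, ← Int.negOnePow_succ, show b + n = n + 1 - b + 1 + 2 * (b - 1) by ring,
        Int.negOnePow_add _ (2 * (b - 1)), Int.negOnePow_even _ (even_two_mul _), mul_one]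
    have hu' : c.δψ.symm₀ (n + 1 - b) b (by omega) (b.negOnePow • w) - c.f.f b (-v) +
        c.D.d j b hjb u = 0 := by
      rw [← hu, map_units_smul, map_neg]; abel
    have hv' : n.negOnePow • ψ.symm₀ (n + 1 - b) b' (by omega)
        (dualMap (c.f.f (n + 1 - b)) (b.negOnePow • w)) + C.d b b' hb (-v) = 0 := by
      rw [← neg_eq_zero, ← hv, map_units_smul, map_units_smul, map_neg, smul_smul,
        mul_comm n.negOnePow, hs', Units.neg_smul]
      abel
    rw [hu', hv', map_units_smul (dualMap _), hw] at h1
    simp only [map_zero, smul_zero, add_zero] at h1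
    rw [← h1, hE', hs]
    simp only [map_units_smul, map_neg, smul_smul, Int.units_mul_self, Units.neg_smul, neg_neg,
      smul_neg]

theorem IsPoincare.exactAt_dualityCone (hc : c.IsPoincare) (j : ℤ) : c.dualityCone.ExactAt j :=
  hc.isQuasiIso.exactAt_cone _ j

/-- The image of the duality differential of a Poincaré pair is a stably free direct summand. -/
theorem IsPoincare.stablyFree_range (hc : c.IsPoincare) (i j b p p' : ℤ) (hij : j + 1 = i)
    (hjb : b + 1 = j) (hp : p + 1 = p') (hpj : p + j = n + 1) :
    StablyFree Λ (LinearMap.range (c.dualityDiff i j b p p' hij hjb hp hpj)) := by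
  obtain ⟨E, E', hE, hE'⟩ := exists_equiv_dualityDiff (c := c) i j b p p' hij hjb hp hpj
  have h1 := c.dualityCone.stablyFree_range (j + 1) (fun j _ => hc.exactAt_dualityCone j) i j hij
    (by omega)
  refine h1.of_equiv (LinearEquiv.ofEq _ _ ?_ ≪≫ₗ
    (E'.submoduleMap (LinearMap.range (c.dualityDiff i j b p p' hij hjb hp hpj))).symm)
  ext w
  constructor
  · rintro ⟨x, rfl⟩
    refine ⟨_, ⟨E.symm x, rfl⟩, ?_⟩
    exact (hE _).trans (by rw [E.apply_symm_apply])
  · rintro ⟨_, ⟨x, rfl⟩, rfl⟩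
    exact ⟨E x, (hE x).symm⟩

theorem IsPoincare.exists_splitting (hc : c.IsPoincare) (i j b p p' : ℤ) (hij : j + 1 = i)
    (hjb : b + 1 = j) (hp : p + 1 = p') (hpj : p + j = n + 1) :
    ∃ s : (StarDual Λ (c.D.X p') × c.D.X j × C.X b) →ₗ[Λ]
        (StarDual Λ (c.D.X p) × c.D.X i × C.X j),
      ∀ x, c.dualityDiff i j b p p' hij hjb hp hpj (s (c.dualityDiff i j b p p' hij hjb hp hpj x)) =
        c.dualityDiff i j b p p' hij hjb hp hpj x := by
  obtain ⟨E, E', hE, hE'⟩ := exists_equiv_dualityDiff (c := c) i j b p p' hij hjb hp hpj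
  obtain ⟨s, hs⟩ := c.dualityCone.exists_splitting (j + 1) (fun j _ => hc.exactAt_dualityCone j)
    i j hij (by omega)
  refine ⟨E.symm.toLinearMap ∘ₗ s ∘ₗ E'.toLinearMap, fun x => E'.injective ?_⟩
  rw [hE, hE]
  change c.dualityCone.d i j hij (E (E.symm (s (E' _)))) = _
  rw [E.apply_symm_apply, hE, hs]

theorem IsPoincare.exists_dualityDiff_eq (hc : c.IsPoincare) (i j b p p' : ℤ) (hij : j + 1 = i)
    (hjb : b + 1 = j) (hp : p + 1 = p') (hpj : p + j = n + 1) (b' p'' : ℤ) (hb : b' + 1 = b)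
    (hp' : p' + 1 = p'') (w : StarDual Λ (c.D.X p')) (u : c.D.X j) (v : C.X b)
    (hw : dualMap (c.D.d p'' p' hp') w = 0)
    (hu : c.D.d j b hjb u + c.f.f b v + b.negOnePow • c.δψ.symm₀ p' b (by omega) w = 0)
    (hv : C.d b b' hb v + p'.negOnePow • ψ.symm₀ p' b' (by omega) (dualMap (c.f.f p') w) = 0) :
    ∃ x, c.dualityDiff i j b p p' hij hjb hp hpj x = (w, u, v) := by
  obtain ⟨E, E', hE, hE'⟩ := exists_equiv_dualityDiff (c := c) i j b p p' hij hjb hp hpj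
  obtain ⟨x, hx⟩ := hc.exactAt_dualityCone j i b hij hjb _ (hE' b' p'' hb hp' w u v hw hu hv)
  exact ⟨E.symm x, E'.injective (by rw [hE, E.apply_symm_apply, hx])⟩

theorem IsPoincare.exists_factor_dualityDiff (hc : c.IsPoincare) (i j b p p' : ℤ)
    (hij : j + 1 = i) (hjb : b + 1 = j) (hp : p + 1 = p') (hpj : p + j = n + 1)
    (M : c.D.X p) (Y : StarDual Λ (c.D.X i)) (V : StarDual Λ (C.X j))
    (h : ∀ m y v, c.dualityDiff i j b p p' hij hjb hp hpj (m, y, v) = 0 →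
      star (m M) + Y y + V v = 0) :
    ∃ (w : c.D.X p') (u : StarDual Λ (c.D.X j)) (a : StarDual Λ (C.X b)),
      Y = dualMap (c.D.d i j hij) u ∧
      V = dualMap (C.d j b hjb) a - dualMap (c.f.f j) u ∧
      M = c.D.d p' p hp w + (p * j).negOnePow • c.δψ.symm₀ j p (by omega) u +
        (n.negOnePow * (p * b).negOnePow) • c.f.f p (ψ.symm₀ b p (by omega) a) := by
  obtain ⟨s, hs⟩ := hc.exists_splitting i j b p p' hij hjb hp hpj
  have key : ∀ x : StarDual Λ (c.D.X p) × c.D.X i × C.X j,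
      let x' := s (c.dualityDiff i j b p p' hij hjb hp hpj x)
      star (x.1 M) + Y x.2.1 + V x.2.2 = star (x'.1 M) + Y x'.2.1 + V x'.2.2 := fun x => by
    have h1 := h (x - s (c.dualityDiff i j b p p' hij hjb hp hpj x)).1
      (x - s (c.dualityDiff i j b p p' hij hjb hp hpj x)).2.1
      (x - s (c.dualityDiff i j b p p' hij hjb hp hpj x)).2.2
      ((map_sub (c.dualityDiff i j b p p' hij hjb hp hpj) _ _).trans (by rw [hs, sub_self]))
    rw [← sub_eq_zero, ← h1]
    simp only [Prod.fst_sub, Prod.snd_sub, StarDual.sub_apply, map_sub, star_sub]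
    abel
  let L : StarDual Λ (c.D.X p') × c.D.X j × C.X b →ₗ[Λ] Λ :=
    (evalDual _ M : StarDual Λ (c.D.X p) →ₗ[Λ] Λ) ∘ₗ LinearMap.fst _ _ _ ∘ₗ s +
    (Y : c.D.X i →ₗ[Λ] Λ) ∘ₗ LinearMap.fst _ _ _ ∘ₗ LinearMap.snd _ _ _ ∘ₗ s +
    (V : C.X j →ₗ[Λ] Λ) ∘ₗ LinearMap.snd _ _ _ ∘ₗ LinearMap.snd _ _ _ ∘ₗ s
  have hL : ∀ m y v, star (m M) + Y y + V v =
    L (c.dualityDiff i j b p p' hij hjb hp hpj (m, y, v)) := fun m y v => key (m, y, v)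
  have hm : ∀ m' : StarDual Λ (c.D.X p'), m' (undual _ (show StarDual Λ (StarDual Λ (c.D.X p')) from
      L ∘ₗ LinearMap.inl _ _ _)) = star (L (m', 0, 0)) := fun m' => apply_undual _ _
  let u : StarDual Λ (c.D.X j) := L ∘ₗ LinearMap.inr _ _ _ ∘ₗ LinearMap.inl _ _ _
  let a : StarDual Λ (C.X b) := L ∘ₗ LinearMap.inr _ _ _ ∘ₗ LinearMap.inr _ _ _
  have hLs : ∀ m' y' v', L (m', y', v') = L (m', 0, 0) + u y' + a v' := fun m' y' v' => by
    change L (m', y', v') = L (m', 0, 0) + L (0, y', 0) + L (0, 0, v')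
    rw [← map_add, ← map_add]
    simp
  refine ⟨undual _ (show StarDual Λ (StarDual Λ (c.D.X p')) from L ∘ₗ LinearMap.inl _ _ _), u, a,
    StarDual.ext fun y => ?_, StarDual.ext fun v => ?_, ext_dual (Λ := Λ) fun m => ?_⟩
  · have h1 := hL 0 y 0
    rw [c.dualityDiff_apply] at h1
    simp only [map_zero, StarDual.zero_apply, star_zero, zero_add, add_zero, sub_zero,
      smul_zero] at h1
    exact h1
  · have h1 := hL 0 0 v
    rw [c.dualityDiff_apply, hLs] at h1
    simp only [map_zero, StarDual.zero_apply, star_zero, zero_add, add_zero, zero_sub,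
      smul_zero, map_neg] at h1
    rw [h1, show ((0, 0, 0) : StarDual Λ (c.D.X p') × c.D.X j × C.X b) = 0 from rfl, map_zero,
      zero_add, neg_add_eq_sub]
    rfl
  · have h1 := congrArg star (hL m 0 0)
    rw [c.dualityDiff_apply, hLs] at h1
    simp only [map_zero, star_star, add_zero, sub_zero, star_add, map_units_smul,
      star_units_smul] at h1
    rw [h1, map_add, map_add, map_units_smul, map_units_smul, ← dualMap_apply (c.D.d p' p hp), hm,
      c.δψ.apply_symm₀_symm _ _ _ m, ← dualMap_apply (c.f.f p),
      ψ.apply_symm₀_symm _ _ _ (dualMap (c.f.f p) m)]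
    simp only [star_units_smul, star_star, mul_smul]

theorem IsPoincare.exists_of_dualityDiff_eq_zero (hc : c.IsPoincare) (i j b p p' : ℤ)
    (hij : j + 1 = i) (hjb : b + 1 = j) (hp : p + 1 = p') (hpj : p + j = n + 1) (p₀ i' : ℤ)
    (hp₀ : p₀ + 1 = p) (hi' : i + 1 = i') (m : StarDual Λ (c.D.X p)) (y : c.D.X i) (v : C.X j)
    (h : c.dualityDiff i j b p p' hij hjb hp hpj (m, y, v) = 0) :
    ∃ x, c.dualityDiff i' i j p₀ p hi' hij hp₀ (by omega) x =
      (m, j.negOnePow • y, -(j.negOnePow • v)) := by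
  rw [c.dualityDiff_apply, Prod.mk_eq_zero, Prod.mk_eq_zero] at h
  obtain ⟨h1, h2, h3⟩ := h
  have hs : p.negOnePow = -(j.negOnePow * n.negOnePow) := by
    rw [← Int.negOnePow_add, ← Int.negOnePow_succ, show j + n + 1 = p + 2 * j by omega,
      Int.negOnePow_add, Int.negOnePow_even _ (even_two_mul _), mul_one]
  refine hc.exists_dualityDiff_eq i' i j p₀ p hi' hij hp₀ (by omega) b p' hjb hp _ _ _ h1 ?_ ?_
  · rw [map_neg, map_units_smul, map_units_smul, ← smul_neg, ← smul_add, ← smul_add]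
    refine Eq.trans (congrArg _ ?_) (smul_zero _)
    rw [← h2]; abel
  · rw [hs, map_neg, map_units_smul, Units.neg_smul, mul_smul, ← neg_add, ← smul_add,
      add_comm, h3, smul_zero, neg_zero]

/-- The boundary of a Poincaré pair is Poincaré: every homology class is dual to a cohomology
class. -/
theorem IsPoincare.exists_cocycle (hc : c.IsPoincare) (r p r₁ p₁ r₀ : ℤ) (h : p + r = n)
    (hr : r + 1 = r₁) (hp : p + 1 = p₁) (hr₀ : r₀ + 1 = r) (x : C.X r) (hx : C.d r r₀ hr₀ x = 0) :
    ∃ (a : StarDual Λ (C.X p)) (v : C.X r₁), dualMap (C.d p₁ p hp) a = 0 ∧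
      x = ψ.symm₀ p r h a + C.d r₁ r hr v := by
  obtain ⟨w, u, a, hu, ha, hw⟩ := hc.exists_factor_dualityDiff (p₁ + 1) p₁ p r r₁ rfl hp hr
    (by omega) (c.f.f r x) 0 0 fun m y v hD => by
      obtain ⟨⟨m0, y0, v0⟩, hx0⟩ := hc.exists_of_dualityDiff_eq_zero _ _ _ _ _ _ _ _ _ r₀ _ hr₀
        rfl _ _ _ hD
      have h1 : dualMap (c.D.d r r₀ hr₀) m0 = m := congrArg Prod.fst hx0
      rw [← h1, dualMap_apply, c.f.comm, hx, map_zero, map_zero]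
      simp
  have hda : dualMap (C.d p₁ p hp) a = dualMap (c.f.f p₁) u := by rw [← sub_eq_zero, ← ha]
  set s := n.negOnePow * (r * p).negOnePow with hs
  have e1 : p₁.negOnePow = -p.negOnePow := by rw [← hp, Int.negOnePow_succ]
  have e2 : n.negOnePow = p.negOnePow * r.negOnePow := by rw [← h, Int.negOnePow_add]
  have e3 : (r * p₁).negOnePow = (r * p).negOnePow * r.negOnePow := by
    rw [← hp, mul_add, mul_one, Int.negOnePow_add]
  obtain ⟨⟨m, y, v⟩, hx0⟩ := hc.exists_dualityDiff_eq (r₁ + 1) r₁ r p p₁ rfl hr hp (by omega) r₀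
    (p₁ + 1) hr₀ rfl ((-(r.negOnePow * (r * p₁).negOnePow)) • u) (-w)
    (x - s • ψ.symm₀ p r h a) (by rw [map_units_smul, ← hu, smul_zero]) (by
      rw [map_sub, map_units_smul, map_neg, hw, map_units_smul, smul_smul, mul_neg, ← mul_assoc,
        Int.units_mul_self, one_mul, Units.neg_smul]
      abel) (by
      rw [map_sub, hx, map_units_smul,
        c.isCycle.d_symm₀ p r₀ (by omega) r p₁ hr₀ hp, hda, map_units_smul, map_units_smul, smul_smul,
        smul_smul, zero_sub, hs, e1, e2, e3]
      generalize p.negOnePow = e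
      generalize r.negOnePow = e'
      generalize (r * p).negOnePow = e''
      rcases Int.units_eq_one_or e with rfl | rfl <;>
        rcases Int.units_eq_one_or e' with rfl | rfl <;>
        rcases Int.units_eq_one_or e'' with rfl | rfl <;> simp)
  rw [c.dualityDiff_apply, Prod.mk.injEq, Prod.mk.injEq] at hx0
  obtain ⟨h1, -, h3⟩ := hx0
  refine ⟨s • a + n.negOnePow • dualMap (c.f.f p) m, v, ?_, ?_⟩
  · rw [map_add, map_units_smul, map_units_smul, hda, ← dual_d_f, h1, map_units_smul, smul_smul,
      hs, e2, e3]
    generalize p.negOnePow = e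
    generalize r.negOnePow = e'
    generalize (r * p).negOnePow = e''
    rcases Int.units_eq_one_or e with rfl | rfl <;>
      rcases Int.units_eq_one_or e' with rfl | rfl <;>
      rcases Int.units_eq_one_or e'' with rfl | rfl <;> simp
  · rw [map_add, map_units_smul, map_units_smul, add_assoc, h3, add_sub_cancel]

/-- The boundary of a Poincaré pair is Poincaré: cohomology classes with trivial duals are
trivial. -/
theorem IsPoincare.exists_coboundary (hc : c.IsPoincare) (r p r₁ p₁ p₀ : ℤ) (h : p + r = n)
    (hr : r + 1 = r₁) (hp : p + 1 = p₁) (hp₀ : p₀ + 1 = p) (a : StarDual Λ (C.X p)) (v : C.X r₁)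
    (ha : dualMap (C.d p₁ p hp) a = 0) (hv : ψ.symm₀ p r h a = C.d r₁ r hr v) :
    ∃ a₀ : StarDual Λ (C.X p₀), a = dualMap (C.d p p₀ hp₀) a₀ := by
  set s := p.negOnePow * n.negOnePow * (p * r).negOnePow with hs
  obtain ⟨w, u, a', hu, ha', hw⟩ := hc.exists_factor_dualityDiff p₁ p p₀ r₁ (r₁ + 1) hp hp₀ rfl
    (by omega) (s • c.f.f r₁ v) 0 a fun m y v' hD => by
      obtain ⟨⟨m0, y0, v0⟩, hx0⟩ := hc.exists_of_dualityDiff_eq_zero _ _ _ _ _ _ _ _ _ r _ hr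
        rfl _ _ _ hD
      rw [c.dualityDiff_apply, Prod.mk.injEq, Prod.mk.injEq] at hx0
      obtain ⟨h1, -, h3⟩ := hx0
      have h4 := congrArg a h3
      have h5 : a (C.d p₁ p hp v0) = 0 := DFunLike.congr_fun ha v0
      rw [map_add, h5, add_zero, map_units_smul, map_neg, map_units_smul,
        ψ.apply_symm₀_symm, hv, dualMap_apply, ← c.f.comm, ← dualMap_apply (c.D.d r₁ r hr), h1] at h4
      have h6 : a v' = -(p.negOnePow • n.negOnePow • (r * p).negOnePow •
          star (m (c.f.f r₁ v))) := by
        rw [h4, smul_neg, smul_smul, Int.units_mul_self, one_smul, neg_neg]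
      rw [h6, map_units_smul, star_units_smul, hs, mul_comm p r, mul_smul, mul_smul]
      simp
  have hda : dualMap (C.d p p₀ hp₀) a' - a = dualMap (c.f.f p) u := by
    conv_lhs => rw [ha']
    abel
  have e1 : p₀.negOnePow = -p.negOnePow := by rw [← hp₀, Int.negOnePow_succ, neg_neg]
  have e2 : n.negOnePow = p.negOnePow * r.negOnePow := by rw [← h, Int.negOnePow_add]
  have e4 : r₁.negOnePow = -r.negOnePow := by rw [← hr, Int.negOnePow_succ]
  have e3 : (r₁ * p).negOnePow = (p * r).negOnePow * p.negOnePow := by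
    rw [← hr, add_mul, one_mul, Int.negOnePow_add, mul_comm r p]
  have e5 : (r₁ * p₀).negOnePow = -((p * r).negOnePow * p.negOnePow * r.negOnePow) := by
    rw [← hr, ← hp₀, show (r + 1) * p₀ = (p₀ + 1) * r + (p₀ + 1) - r - 1 by ring,
      Int.negOnePow_sub, Int.negOnePow_sub, Int.negOnePow_add, Int.negOnePow_one]
    simp
  obtain ⟨⟨m, y, v'⟩, hx0⟩ := hc.exists_dualityDiff_eq (r₁ + 1 + 1) (r₁ + 1) r₁ p₀ p rfl rfl hp₀
    (by omega) r p₁ hr hp ((-(r₁.negOnePow * (r₁ * p).negOnePow)) • u) (-w)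
    (s • v - (n.negOnePow * (r₁ * p₀).negOnePow) • ψ.symm₀ p₀ r₁ (by omega) a')
    (by rw [map_units_smul, ← hu, smul_zero]) (by
      rw [map_sub, map_units_smul, map_units_smul, map_neg, hw, map_units_smul, smul_smul, mul_neg,
        ← mul_assoc, Int.units_mul_self, one_mul, Units.neg_smul]
      abel) (by
      rw [map_sub, map_units_smul, ← hv, map_units_smul,
        c.isCycle.d_symm₀ p₀ r (by omega) r₁ p hr hp₀, map_units_smul, map_units_smul, ← hda, map_sub,
        smul_smul, smul_smul, e5, e4, e3, hs, e2, smul_sub]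
      generalize p.negOnePow = e
      generalize r.negOnePow = e'
      generalize (p * r).negOnePow = e''
      rcases Int.units_eq_one_or e with rfl | rfl <;>
        rcases Int.units_eq_one_or e' with rfl | rfl <;>
        rcases Int.units_eq_one_or e'' with rfl | rfl <;> simp)
  have h1 := congrArg Prod.fst hx0
  rw [c.dualityDiff_apply] at h1
  dsimp only at h1
  set t := -(r₁.negOnePow * (r₁ * p).negOnePow)
  refine ⟨a' - t • dualMap (c.f.f p₀) m, ?_⟩
  rw [map_sub, map_units_smul, ← dual_d_f, h1, map_units_smul, smul_smul, Int.units_mul_self,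
    one_smul, ← hda, sub_sub_cancel]

end QuadPair

end PairDuality

/-! ### The boundary of the pair `x` -/

section BoundaryX

variable {Λ : Type u} [Ring Λ] [StarRing Λ]

open FreeComplex

section TwoTermDual

variable {A B : Type u} [AddCommGroup A] [Module Λ A] [Module.Free Λ A] [Module.Finite Λ A]
  [AddCommGroup B] [Module Λ B] [Module.Free Λ B] [Module.Finite Λ B] {q : ℤ} {δ : A →ₗ[Λ] B}

theorem dualMap_inA_eq_zero {r : ℤ} (h : r ≠ q + 1) (φ : StarDual Λ ((twoTerm q δ).X r)) :
    dualMap (inA q δ r) φ = 0 :=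
  StarDual.ext fun a => by rw [dualMap_apply, inA_eq_zero h, map_zero, StarDual.zero_apply]

theorem dualMap_inB_eq_zero {r : ℤ} (h : r ≠ q) (φ : StarDual Λ ((twoTerm q δ).X r)) :
    dualMap (inB q δ r) φ = 0 :=
  StarDual.ext fun a => by rw [dualMap_apply, inB_eq_zero h, map_zero, StarDual.zero_apply]

@[simp] theorem dualMap_inA_outB {r : ℤ} (φ : StarDual Λ B) :
    dualMap (inA q δ r) (dualMap (outB q δ r) φ) = 0 :=
  StarDual.ext fun a => by simp

@[simp] theorem dualMap_inB_outA {r : ℤ} (φ : StarDual Λ A) :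
    dualMap (inB q δ r) (dualMap (outA q δ r) φ) = 0 :=
  StarDual.ext fun a => by simp

theorem dualMap_inA_outA {r : ℤ} (h : r = q + 1) (φ : StarDual Λ A) :
    dualMap (inA q δ r) (dualMap (outA q δ r) φ) = φ :=
  StarDual.ext fun a => by simp [outA_inA h]

theorem dualMap_inB_outB {r : ℤ} (h : r = q) (φ : StarDual Λ B) :
    dualMap (inB q δ r) (dualMap (outB q δ r) φ) = φ :=
  StarDual.ext fun a => by simp [outB_inB h]

theorem dual_twoTerm_ext {r : ℤ} {φ : StarDual Λ ((twoTerm q δ).X r)}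
    (hA : dualMap (inA q δ r) φ = 0) (hB : dualMap (inB q δ r) φ = 0) : φ = 0 :=
  StarDual.ext fun x => by
    rw [← inA_add_inB x, map_add]
    exact (congrArg₂ (· + ·) (DFunLike.congr_fun hA _) (DFunLike.congr_fun hB _)).trans
      (add_zero _)

theorem twoTerm_ext {r : ℤ} {x : (twoTerm q δ).X r} (hA : outA q δ r x = 0)
    (hB : outB q δ r x = 0) : x = 0 := by
  rw [← inA_add_inB x, hA, hB, map_zero, map_zero, add_zero]

end TwoTermDual

namespace RegSplitPreformation

variable {q : ℕ} {z : RegSplitPreformation Λ ((-1) ^ q)} {θ : z.G →ₗ[Λ] StarDual Λ z.G}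

/-- The complex `∂E`. -/
abbrev bdX (hθ : z.IsRepresentative θ) : FreeComplex Λ := (pairC'' hθ).gluedComplex (pairC hθ)

section Coordinates

variable (hθ : z.IsRepresentative θ) (r : ℤ)

/-- The projection `∂E_r → D'_r`. -/
def toFst : (bdX hθ).X r →ₗ[Λ] StarDual Λ (z.complexN'.X (2 * q + 1 - r)) :=
  LinearMap.fst Λ ((pairC'' hθ).D.X r)
    ((bdryComplex (isCycle_structN hθ)).X (r - 1) × (pairC hθ).D.X r)

/-- The projection `∂E_r → N_r ⊆ C_{r-1}`. -/
def toMid : (bdX hθ).X r →ₗ[Λ] z.complexN.X (r - 1 + 1) :=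
  LinearMap.fst Λ (z.complexN.X (r - 1 + 1)) (StarDual Λ (z.complexN.X (2 * q + 1 - (r - 1)))) ∘ₗ
  LinearMap.fst Λ ((bdryComplex (isCycle_structN hθ)).X (r - 1)) ((pairC hθ).D.X r) ∘ₗ
    LinearMap.snd Λ ((pairC'' hθ).D.X r)
      ((bdryComplex (isCycle_structN hθ)).X (r - 1) × (pairC hθ).D.X r)

/-- The projection `∂E_r → N^{2q+2-r} ⊆ C_{r-1}`. -/
def toMidDual : (bdX hθ).X r →ₗ[Λ] StarDual Λ (z.complexN.X (2 * q + 1 - (r - 1))) :=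
  LinearMap.snd Λ (z.complexN.X (r - 1 + 1)) (StarDual Λ (z.complexN.X (2 * q + 1 - (r - 1)))) ∘ₗ
  LinearMap.fst Λ ((bdryComplex (isCycle_structN hθ)).X (r - 1)) ((pairC hθ).D.X r) ∘ₗ
    LinearMap.snd Λ ((pairC'' hθ).D.X r)
      ((bdryComplex (isCycle_structN hθ)).X (r - 1) × (pairC hθ).D.X r)

/-- The projection `∂E_r → D_r`. -/
def toLast : (bdX hθ).X r →ₗ[Λ] StarDual Λ (z.complexN.X (2 * q + 1 - r)) :=
  LinearMap.snd Λ ((bdryComplex (isCycle_structN hθ)).X (r - 1)) ((pairC hθ).D.X r) ∘ₗ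
    LinearMap.snd Λ ((pairC'' hθ).D.X r)
      ((bdryComplex (isCycle_structN hθ)).X (r - 1) × (pairC hθ).D.X r)

/-- The component of `∂E_r` in `F = D'_q`. -/
def fstF : (bdX hθ).X r →ₗ[Λ] z.F :=
  (undual z.F).toLinearMap ∘ₗ dualMap (inA (q : ℤ) (dualMap z.γ) (2 * q + 1 - r)) ∘ₗ toFst hθ r

/-- The component of `∂E_r` in `G = D'_{q+1}`. -/
def fstG : (bdX hθ).X r →ₗ[Λ] z.G :=
  (undual z.G).toLinearMap ∘ₗ dualMap (inB (q : ℤ) (dualMap z.γ) (2 * q + 1 - r)) ∘ₗ toFst hθ r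

/-- The component of `∂E_r` in `F ⊆ C_q`. -/
def midF : (bdX hθ).X r →ₗ[Λ] z.F := outA (q : ℤ) (adj z.μ) (r - 1 + 1) ∘ₗ toMid hθ r

/-- The component of `∂E_r` in `G^* = C_{q-1}`. -/
def midGDual : (bdX hθ).X r →ₗ[Λ] StarDual Λ z.G :=
  outB (q : ℤ) (adj z.μ) (r - 1 + 1) ∘ₗ toMid hθ r

/-- The component of `∂E_r` in `F^* ⊆ C_q`. -/
def midFDual : (bdX hθ).X r →ₗ[Λ] StarDual Λ z.F :=
  dualMap (inA (q : ℤ) (adj z.μ) (2 * q + 1 - (r - 1))) ∘ₗ toMidDual hθ r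

/-- The component of `∂E_r` in `G = C_{q+1}`. -/
def midG : (bdX hθ).X r →ₗ[Λ] z.G :=
  (undual z.G).toLinearMap ∘ₗ dualMap (inB (q : ℤ) (adj z.μ) (2 * q + 1 - (r - 1))) ∘ₗ
    toMidDual hθ r

/-- The component of `∂E_r` in `F^* = D_q`. -/
def lastFDual : (bdX hθ).X r →ₗ[Λ] StarDual Λ z.F :=
  dualMap (inA (q : ℤ) (adj z.μ) (2 * q + 1 - r)) ∘ₗ toLast hθ r

/-- The component of `∂E_r` in `G = D_{q+1}`. -/
def lastG : (bdX hθ).X r →ₗ[Λ] z.G :=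
  (undual z.G).toLinearMap ∘ₗ dualMap (inB (q : ℤ) (adj z.μ) (2 * q + 1 - r)) ∘ₗ toLast hθ r

variable {hθ} {r}

theorem fstF_eq_zero (h : r ≠ q) (b) : fstF hθ r b = 0 :=
  (congrArg (undual z.F) (dualMap_inA_eq_zero (by omega) _)).trans (map_zero (undual z.F))

theorem fstG_eq_zero (h : r ≠ q + 1) (b) : fstG hθ r b = 0 :=
  (congrArg (undual z.G) (dualMap_inB_eq_zero (by omega) _)).trans (map_zero (undual z.G))

theorem midF_eq_zero (h : r ≠ q + 1) (b) : midF hθ r b = 0 := outA_eq_zero (by omega) _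

theorem midGDual_eq_zero (h : r ≠ q) (b) : midGDual hθ r b = 0 := outB_eq_zero (by omega) _

theorem midFDual_eq_zero (h : r ≠ q + 1) (b) : midFDual hθ r b = 0 :=
  dualMap_inA_eq_zero (by omega) _

theorem midG_eq_zero (h : r ≠ q + 2) (b) : midG hθ r b = 0 :=
  (congrArg (undual z.G) (dualMap_inB_eq_zero (by omega) _)).trans (map_zero (undual z.G))

theorem lastFDual_eq_zero (h : r ≠ q) (b) : lastFDual hθ r b = 0 :=
  dualMap_inA_eq_zero (by omega) _

theorem lastG_eq_zero (h : r ≠ q + 1) (b) : lastG hθ r b = 0 :=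
  (congrArg (undual z.G) (dualMap_inB_eq_zero (by omega) _)).trans (map_zero (undual z.G))

theorem bdX_ext {b b' : (bdX hθ).X r} (h₁ : fstF hθ r b = fstF hθ r b')
    (h₂ : fstG hθ r b = fstG hθ r b') (h₃ : midF hθ r b = midF hθ r b')
    (h₄ : midGDual hθ r b = midGDual hθ r b') (h₅ : midFDual hθ r b = midFDual hθ r b')
    (h₆ : midG hθ r b = midG hθ r b') (h₇ : lastFDual hθ r b = lastFDual hθ r b')
    (h₈ : lastG hθ r b = lastG hθ r b') : b = b' := by
  rw [← sub_eq_zero, ← map_sub] at h₁ h₂ h₃ h₄ h₅ h₆ h₇ h₈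
  rw [← sub_eq_zero]
  generalize b - b' = b at *
  have e₁ : toFst hθ r b = 0 := dual_twoTerm_ext ((undual _).map_eq_zero_iff.1 h₁)
    ((undual _).map_eq_zero_iff.1 h₂)
  have e₂ : toMid hθ r b = 0 := twoTerm_ext h₃ h₄
  have e₃ : toMidDual hθ r b = 0 := dual_twoTerm_ext h₅ ((undual _).map_eq_zero_iff.1 h₆)
  have e₄ : toLast hθ r b = 0 := dual_twoTerm_ext h₇ ((undual _).map_eq_zero_iff.1 h₈)
  exact Prod.ext e₁ (Prod.ext (Prod.ext e₂ e₃) e₄)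

theorem bdX_eq_zero (h₀ : r ≠ q) (h₁ : r ≠ q + 1) (h₂ : r ≠ q + 2) (b : (bdX hθ).X r) : b = 0 := by
  apply bdX_ext <;> simp only [fstF_eq_zero h₀, fstG_eq_zero h₁, midF_eq_zero h₁,
    midGDual_eq_zero h₀, midFDual_eq_zero h₁, midG_eq_zero h₂, lastFDual_eq_zero h₀,
    lastG_eq_zero h₁]

variable (hθ) (r)

/-- The element of `∂E_r` with given components. -/
def mkBdX (f : z.F) (g : z.G) (f₁ : z.F) (g₁ : StarDual Λ z.G) (f₂ : StarDual Λ z.F) (g₂ : z.G)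
    (f₃ : StarDual Λ z.F) (g₃ : z.G) : (bdX hθ).X r :=
  (dualMap (outA (q : ℤ) (dualMap z.γ) (2 * q + 1 - r)) (evalDual z.F f) +
      dualMap (outB (q : ℤ) (dualMap z.γ) (2 * q + 1 - r)) (evalDual z.G g),
    (inA (q : ℤ) (adj z.μ) (r - 1 + 1) f₁ + inB (q : ℤ) (adj z.μ) (r - 1 + 1) g₁,
      dualMap (outA (q : ℤ) (adj z.μ) (2 * q + 1 - (r - 1))) f₂ +
        dualMap (outB (q : ℤ) (adj z.μ) (2 * q + 1 - (r - 1))) (evalDual z.G g₂)),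
    dualMap (outA (q : ℤ) (adj z.μ) (2 * q + 1 - r)) f₃ +
      dualMap (outB (q : ℤ) (adj z.μ) (2 * q + 1 - r)) (evalDual z.G g₃))

variable {r} (f : z.F) (g : z.G) (f₁ : z.F) (g₁ : StarDual Λ z.G) (f₂ : StarDual Λ z.F) (g₂ : z.G)
    (f₃ : StarDual Λ z.F) (g₃ : z.G)

theorem fstG_mk (h : r = q + 1) : fstG hθ r (mkBdX hθ r f g f₁ g₁ f₂ g₂ f₃ g₃) = g := by
  change undual z.G (dualMap _ (_ + _)) = g
  rw [map_add, dualMap_inB_outA, dualMap_inB_outB (by omega), zero_add, undual_evalDual]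

theorem midF_mk (h : r = q + 1) : midF hθ r (mkBdX hθ r f g f₁ g₁ f₂ g₂ f₃ g₃) = f₁ := by
  change outA _ _ _ (_ + _) = f₁
  rw [map_add, outA_inA (by omega), outA_inB, add_zero]

theorem midFDual_mk (h : r = q + 1) : midFDual hθ r (mkBdX hθ r f g f₁ g₁ f₂ g₂ f₃ g₃) = f₂ := by
  change dualMap _ (_ + _) = f₂
  rw [map_add, dualMap_inA_outB, dualMap_inA_outA (by omega), add_zero]

theorem midG_mk (h : r = q + 2) : midG hθ r (mkBdX hθ r f g f₁ g₁ f₂ g₂ f₃ g₃) = g₂ := by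
  change undual z.G (dualMap _ (_ + _)) = g₂
  rw [map_add, dualMap_inB_outA, dualMap_inB_outB (by omega), zero_add, undual_evalDual]

theorem lastG_mk (h : r = q + 1) : lastG hθ r (mkBdX hθ r f g f₁ g₁ f₂ g₂ f₃ g₃) = g₃ := by
  change undual z.G (dualMap _ (_ + _)) = g₃
  rw [map_add, dualMap_inB_outA, dualMap_inB_outB (by omega), zero_add, undual_evalDual]

end Coordinates

/-- The identification of `C^{n-r}` with `(C^{n-*})_r`. -/
def _root_.AlgSurgery.FreeComplex.ofDual (C : FreeComplex Λ) (n r : ℤ) :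
    (C.dual n).X r →ₗ[Λ] StarDual Λ (C.X (n - r)) := LinearMap.id

section Differential

variable {hθ : z.IsRepresentative θ} {i j : ℤ}

theorem outA_symm₀_structN (p r : ℤ) (h : p + r = 2 * q + 1) (φ : StarDual Λ (z.complexN.X p)) :
    outA (q : ℤ) (adj z.μ) r ((z.structN θ).symm₀ p r h φ) =
      z.γ (undual z.G (dualMap (inB (q : ℤ) (adj z.μ) p) φ)) := by
  by_cases hr : r = q + 1
  · refine ext_dual (Λ := Λ) fun ξ => ?_
    have h1 := apply_symm₀_N (z := z) (θ := θ) p r h φ (dualMap (outA (q : ℤ) (adj z.μ) r) ξ)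
    rw [dualMap_inB_outA, map_zero, map_zero, map_zero, star_zero, smul_zero, add_zero,
      dualMap_inA_outA hr] at h1
    exact h1
  · rw [outA_eq_zero hr, dualMap_inB_eq_zero (by omega), map_zero, map_zero]

theorem outB_symm₀_structN (p r : ℤ) (h : p + r = 2 * q + 1) (φ : StarDual Λ (z.complexN.X p)) :
    outB (q : ℤ) (adj z.μ) r ((z.structN θ).symm₀ p r h φ) =
      dualMap z.γ (dualMap (inA (q : ℤ) (adj z.μ) p) φ) := by
  by_cases hr : r = q
  · refine StarDual.ext fun x => ?_
    have h1 := apply_symm₀_N (z := z) (θ := θ) p r h φ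
      (dualMap (outB (q : ℤ) (adj z.μ) r) (evalDual z.G x))
    have hs : (p * r).negOnePow = 1 :=
      Int.negOnePow_even _ (by
        rw [show p = q + 1 by omega, hr, mul_comm]; exact Int.even_mul_succ_self _)
    rw [dualMap_inA_outB, StarDual.zero_apply, zero_add, dualMap_inB_outB hr, hs, one_smul,
      undual_evalDual, dualMap_apply (outB _ _ _), evalDual_apply] at h1
    exact star_injective h1
  · rw [outB_eq_zero hr, dualMap_inA_eq_zero (by omega), map_zero]

theorem outB_d_twoTerm {A B : Type u} [AddCommGroup A] [Module Λ A] [Module.Free Λ A]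
    [Module.Finite Λ A] [AddCommGroup B] [Module Λ B] [Module.Free Λ B] [Module.Finite Λ B] {k : ℤ}
    {δ : A →ₗ[Λ] B} (h : j + 1 = i) (x : (twoTerm k δ).X i) :
    outB k δ j ((twoTerm k δ).d i j h x) = δ (outA k δ i x) := by
  rw [d_twoTerm]
  by_cases hj : j = k
  · rw [outB_inB hj]
  · rw [outB_eq_zero hj, outA_eq_zero (by omega), map_zero]

theorem dualMap_inA_d_twoTerm {A B : Type u} [AddCommGroup A] [Module Λ A] [Module.Free Λ A]
    [Module.Finite Λ A] [AddCommGroup B] [Module Λ B] [Module.Free Λ B] [Module.Finite Λ B] {k : ℤ}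
    {δ : A →ₗ[Λ] B} (h : j + 1 = i) (φ : StarDual Λ ((twoTerm k δ).X j)) :
    dualMap (inA k δ i) (dualMap ((twoTerm k δ).d i j h) φ) =
      dualMap δ (dualMap (inB k δ j) φ) :=
  StarDual.ext fun a => by simp [d_inA]

theorem dualMap_inB_d_twoTerm {A B : Type u} [AddCommGroup A] [Module Λ A] [Module.Free Λ A]
    [Module.Finite Λ A] [AddCommGroup B] [Module Λ B] [Module.Free Λ B] [Module.Finite Λ B] {k : ℤ}
    {δ : A →ₗ[Λ] B} (h : j + 1 = i) (φ : StarDual Λ ((twoTerm k δ).X j)) :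
    dualMap (inB k δ i) (dualMap ((twoTerm k δ).d i j h) φ) = 0 :=
  StarDual.ext fun a => by simp

theorem undual_dualMap_dualMap_γ (Ψ : StarDual Λ (StarDual Λ z.G)) :
    undual z.F (dualMap (dualMap z.γ) Ψ) = z.γ (undual z.G Ψ) :=
  ext_dual (Λ := Λ) fun φ => by
    rw [apply_undual, ← dualMap_apply z.γ, apply_undual, dualMap_apply]

theorem dualMap_adj_μ (Ψ : StarDual Λ (StarDual Λ z.G)) :
    dualMap (adj z.μ) Ψ = z.μ (undual z.G Ψ) :=
  StarDual.ext fun x => by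
    have := apply_undual Ψ (adj z.μ x)
    rw [adj_apply] at this
    exact (star_injective this).symm

theorem toFst_d (h : j + 1 = i) (b : (bdX hθ).X i) : toFst hθ j ((bdX hθ).d i j h b) =
    i.negOnePow • dualMap (z.complexN'.d (2 * q + 1 - j) (2 * q + 1 - i) (by omega)) (toFst hθ i b) +
      (i - 1).negOnePow • z.complexN'.ofDual (2 * q + 1) j ((mapC'' hθ).at' (i - 1) j (by omega) b.2.1) :=
  rfl

theorem toMid_d (h : j + 1 = i) (b : (bdX hθ).X i) : toMid hθ j ((bdX hθ).d i j h b) =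
    z.complexN.d (i - 1 + 1) (j - 1 + 1) (by omega) (toMid hθ i b) +
      (i - 1).negOnePow • (z.structN θ).symm₀ (2 * q + 1 - (i - 1)) (j - 1 + 1) (by omega)
        (toMidDual hθ i b) := rfl

theorem toMidDual_d (h : j + 1 = i) (b : (bdX hθ).X i) : toMidDual hθ j ((bdX hθ).d i j h b) =
    (i - 1).negOnePow • dualMap (z.complexN.d (2 * q + 1 - (j - 1)) (2 * q + 1 - (i - 1)) (by omega))
      (toMidDual hθ i b) := rfl

theorem toLast_d (h : j + 1 = i) (b : (bdX hθ).X i) : toLast hθ j ((bdX hθ).d i j h b) =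
      (i - 1).negOnePow • z.complexN.ofDual (2 * q + 1) j ((pairC hθ).f.at' (i - 1) j (by omega) b.2.1) +
    i.negOnePow • dualMap (z.complexN.d (2 * q + 1 - j) (2 * q + 1 - i) (by omega)) (toLast hθ i b) :=
  rfl

theorem dualMap_inA_mapC'' (k : ℤ) (hk : k = j) (c : (bdryComplex (isCycle_structN hθ)).X k) :
    dualMap (inA (q : ℤ) (dualMap z.γ) (2 * q + 1 - j))
      (z.complexN'.ofDual (2 * q + 1) j ((mapC'' hθ).at' k j hk c)) =
      evalDual z.F (outA (q : ℤ) (adj z.μ) (k + 1) c.1) := by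
  subst hk
  change dualMap _ (dualMap (outA (q : ℤ) (dualMap z.γ) (2 * q + 1 - k))
        (evalDual z.F (outA (q : ℤ) (adj z.μ) (k + 1) c.1)) +
    dualMap (outB (q : ℤ) (dualMap z.γ) (2 * q + 1 - k))
          (dualMap (inB (q : ℤ) (adj z.μ) (2 * q + 1 - k)) c.2)) = _
  rw [map_add, dualMap_inA_outB, add_zero]
  by_cases hk : k = q
  · rw [dualMap_inA_outA (by omega)]
  · rw [outA_eq_zero (by omega), map_zero, map_zero, map_zero]

theorem dualMap_inB_mapC'' (k : ℤ) (hk : k = j) (c : (bdryComplex (isCycle_structN hθ)).X k) :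
    dualMap (inB (q : ℤ) (dualMap z.γ) (2 * q + 1 - j))
      (z.complexN'.ofDual (2 * q + 1) j ((mapC'' hθ).at' k j hk c)) =
      dualMap (inB (q : ℤ) (adj z.μ) (2 * q + 1 - k)) c.2 := by
  subst hk
  change dualMap _ (dualMap (outA (q : ℤ) (dualMap z.γ) (2 * q + 1 - k))
        (evalDual z.F (outA (q : ℤ) (adj z.μ) (k + 1) c.1)) +
    dualMap (outB (q : ℤ) (dualMap z.γ) (2 * q + 1 - k))
          (dualMap (inB (q : ℤ) (adj z.μ) (2 * q + 1 - k)) c.2)) = _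
  rw [map_add, dualMap_inB_outA, zero_add]
  by_cases hk : 2 * (q : ℤ) + 1 - k = q
  · rw [dualMap_inB_outB hk]
  · rw [dualMap_inB_eq_zero hk, dualMap_inB_eq_zero hk]

theorem dualMap_inA_mapC (k : ℤ) (hk : k = j) (c : (bdryComplex (isCycle_structN hθ)).X k) :
    dualMap (inA (q : ℤ) (adj z.μ) (2 * q + 1 - j))
      (z.complexN.ofDual (2 * q + 1) j ((pairC hθ).f.at' k j hk c)) =
      dualMap (inA (q : ℤ) (adj z.μ) (2 * q + 1 - k)) c.2 := by
  subst hk; rfl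

theorem dualMap_inB_mapC (k : ℤ) (hk : k = j) (c : (bdryComplex (isCycle_structN hθ)).X k) :
    dualMap (inB (q : ℤ) (adj z.μ) (2 * q + 1 - j))
      (z.complexN.ofDual (2 * q + 1) j ((pairC hθ).f.at' k j hk c)) =
      dualMap (inB (q : ℤ) (adj z.μ) (2 * q + 1 - k)) c.2 := by
  subst hk; rfl

theorem fstF_d (h : j + 1 = i) (b : (bdX hθ).X i) : fstF hθ j ((bdX hθ).d i j h b) =
    i.negOnePow • z.γ (fstG hθ i b) + (i - 1).negOnePow • midF hθ i b := by
  change undual z.F (dualMap _ (toFst hθ j _)) = _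
  rw [toFst_d, map_add, map_add, map_units_smul, map_units_smul, map_units_smul, map_units_smul,
    dualMap_inA_mapC'', undual_evalDual, dualMap_inA_d_twoTerm, undual_dualMap_dualMap_γ]
  rfl

theorem fstG_d (h : j + 1 = i) (b : (bdX hθ).X i) : fstG hθ j ((bdX hθ).d i j h b) =
    (i - 1).negOnePow • midG hθ i b := by
  change undual z.G (dualMap _ (toFst hθ j _)) = _
  rw [toFst_d, map_add, map_add, map_units_smul, map_units_smul, map_units_smul, map_units_smul,
    dualMap_inB_mapC'', dualMap_inB_d_twoTerm, map_zero, smul_zero, zero_add]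
  rfl

theorem midF_d (h : j + 1 = i) (b : (bdX hθ).X i) : midF hθ j ((bdX hθ).d i j h b) =
    (i - 1).negOnePow • z.γ (midG hθ i b) := by
  change outA _ _ _ (toMid hθ j _) = _
  rw [toMid_d, map_add, map_units_smul, outA_symm₀_structN, d_twoTerm, outA_inB, zero_add]
  rfl

theorem midGDual_d (h : j + 1 = i) (b : (bdX hθ).X i) : midGDual hθ j ((bdX hθ).d i j h b) =
    adj z.μ (midF hθ i b) + (i - 1).negOnePow • dualMap z.γ (midFDual hθ i b) := by
  change outB _ _ _ (toMid hθ j _) = _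
  rw [toMid_d, map_add, map_units_smul, outB_symm₀_structN, outB_d_twoTerm]
  rfl

theorem midFDual_d (h : j + 1 = i) (b : (bdX hθ).X i) : midFDual hθ j ((bdX hθ).d i j h b) =
    (i - 1).negOnePow • z.μ (midG hθ i b) := by
  change dualMap _ (toMidDual hθ j _) = _
  rw [toMidDual_d, map_units_smul, dualMap_inA_d_twoTerm, dualMap_adj_μ]
  rfl

theorem midG_d (h : j + 1 = i) (b : (bdX hθ).X i) : midG hθ j ((bdX hθ).d i j h b) = 0 := by
  change undual z.G (dualMap _ (toMidDual hθ j _)) = _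
  rw [toMidDual_d, map_units_smul, map_units_smul, dualMap_inB_d_twoTerm, map_zero, smul_zero]

theorem lastFDual_d (h : j + 1 = i) (b : (bdX hθ).X i) : lastFDual hθ j ((bdX hθ).d i j h b) =
    (i - 1).negOnePow • midFDual hθ i b + i.negOnePow • z.μ (lastG hθ i b) := by
  change dualMap _ (toLast hθ j _) = _
  rw [toLast_d, map_add, map_units_smul, map_units_smul, dualMap_inA_mapC, dualMap_inA_d_twoTerm,
    dualMap_adj_μ]
  rfl

theorem lastG_d (h : j + 1 = i) (b : (bdX hθ).X i) : lastG hθ j ((bdX hθ).d i j h b) =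
    (i - 1).negOnePow • midG hθ i b := by
  change undual z.G (dualMap _ (toLast hθ j _)) = _
  rw [toLast_d, map_add, map_add, map_units_smul, map_units_smul, map_units_smul, map_units_smul,
    dualMap_inB_mapC, dualMap_inB_d_twoTerm, map_zero, smul_zero, add_zero]
  rfl

end Differential

section Alpha

variable (hθ : z.IsRepresentative θ)

/-- The map `g`, as a map `∂E_r → G`. -/
def gVal (r : ℤ) : (bdX hθ).X r →ₗ[Λ] z.G := fstG hθ r - lastG hθ r

theorem mapX_apply (r : ℤ) (b : (bdX hθ).X r) :
    (mapX hθ).f r b = Conc.of (Λ := Λ) (q + 1 : ℤ) z.G r (gVal hθ r b) := rfl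

/-- A map `∂E_q → G^*` with `α d = - ε λ g`. -/
def alphaB (r : ℤ) : (bdX hθ).X r →ₗ[Λ] StarDual Λ z.G :=
  -(((-1) ^ q : ℤˣ) • (adj z.μ ∘ₗ fstF hθ r)) + midGDual hθ r - dualMap z.γ ∘ₗ lastFDual hθ r

variable {hθ}

theorem alphaB_apply (r : ℤ) (b : (bdX hθ).X r) : alphaB hθ r b =
    -(((-1) ^ q : ℤˣ) • adj z.μ (fstF hθ r b)) + midGDual hθ r b -
      dualMap z.γ (lastFDual hθ r b) := rfl

theorem lam_symm (x y : z.G) :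
    z.μ x (z.γ y) = -(((-1) ^ q : ℤˣ) • star (z.μ y (z.γ x))) :=
  (z.isQuadraticForm.symm x y).trans (Units.neg_smul _ _)

theorem adj_μ_γ (x : z.G) :
    adj z.μ (z.γ x) = -(((-1) ^ q : ℤˣ) • dualMap z.γ (z.μ x)) :=
  StarDual.ext fun y => by
    rw [adj_apply, lam_symm, star_neg, star_units_smul, star_star]; simp

theorem alphaB_d {i j : ℤ} (h : j + 1 = i) (b : (bdX hθ).X i) :
    alphaB hθ j ((bdX hθ).d i j h b) =
      -(((-1) ^ q : ℤˣ) • dualMap z.γ (z.μ (gVal hθ i b))) := by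
  have e : ((q : ℤ)).negOnePow = (-1) ^ q := negOnePow_eq q
  rw [alphaB_apply, fstF_d, midGDual_d, lastFDual_d]
  change _ = -(((-1) ^ q : ℤˣ) • dualMap z.γ (z.μ (fstG hθ i b - lastG hθ i b)))
  by_cases hi : i = q + 1
  · have e1 : i.negOnePow = -(-1) ^ q := by rw [hi, Int.negOnePow_succ, e]
    have e2 : (i - 1).negOnePow = (-1) ^ q := by rw [hi, add_sub_cancel_right, e]
    simp only [map_add, map_sub, map_neg, map_units_smul, adj_μ_γ, e1, e2, smul_add, smul_smul,
      Int.units_mul_self, one_smul, Units.neg_smul, smul_neg, neg_neg, smul_sub]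
    abel
  · simp [fstG_eq_zero hi, midF_eq_zero hi, midFDual_eq_zero hi, lastG_eq_zero hi]

/-- A cycle in the kernel of `g` on which `α` is trivial bounds, compatibly with `g`. -/
theorem exists_boundary {i j k : ℤ} (hij : j + 1 = i) (hjk : k + 1 = j) (b : (bdX hθ).X j)
    (y : Conc (q + 1 : ℤ) z.G i) (hb : (bdX hθ).d j k hjk b = 0) (hg : gVal hθ j b = 0)
    (hα : alphaB hθ j b = -(((-1) ^ q : ℤˣ) •
      dualMap z.γ (z.μ (Conc.out (Λ := Λ) (q + 1 : ℤ) z.G i y)))) :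
    ∃ b₂ : (bdX hθ).X i, (bdX hθ).d i j hij b₂ = b ∧ (mapX hθ).f i b₂ = y := by
  have e : ((q : ℤ)).negOnePow = (-1) ^ q := negOnePow_eq q
  have n1 : ∀ x : z.F, (q : ℤ).negOnePow • (q : ℤ).negOnePow • x = x := fun x => by
    rw [smul_smul, Int.units_mul_self, one_smul]
  have n2 : ∀ x : StarDual Λ z.F, (q : ℤ).negOnePow • (q : ℤ).negOnePow • x = x := fun x => by
    rw [smul_smul, Int.units_mul_self, one_smul]
  have n3 : ∀ x : z.G, (q : ℤ).negOnePow • (q : ℤ).negOnePow • x = x := fun x => by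
    rw [smul_smul, Int.units_mul_self, one_smul]
  by_cases h0 : j = q
  · obtain rfl : i = q + 1 := by omega
    subst h0
    have e1 : ((q : ℤ) + 1).negOnePow = -(q : ℤ).negOnePow := Int.negOnePow_succ _
    have e2 : ((q : ℤ) + 1 - 1).negOnePow = (q : ℤ).negOnePow := by rw [add_sub_cancel_right]
    set y' := Conc.out (Λ := Λ) (q + 1 : ℤ) z.G (q + 1) y
    refine ⟨mkBdX hθ (q + 1) 0 y' ((q : ℤ).negOnePow • fstF hθ q b + z.γ y') 0
      ((q : ℤ).negOnePow • lastFDual hθ q b) 0 0 0, bdX_ext ?_ ?_ ?_ ?_ ?_ ?_ ?_ ?_, ?_⟩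
    · rw [fstF_d, fstG_mk hθ _ _ _ _ _ _ _ _ rfl, midF_mk hθ _ _ _ _ _ _ _ _ rfl, e1, e2, smul_add,
        n1, Units.neg_smul]
      abel
    · rw [fstG_eq_zero (by omega), fstG_eq_zero (by omega)]
    · rw [midF_eq_zero (by omega), midF_eq_zero (by omega)]
    · rw [midGDual_d, midF_mk hθ _ _ _ _ _ _ _ _ rfl, midFDual_mk hθ _ _ _ _ _ _ _ _ rfl, e2,
        map_units_smul, map_add, adj_μ_γ, map_units_smul, smul_smul, Int.units_mul_self, one_smul,
        ← hα, alphaB_apply, e]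
      abel
    · rw [midFDual_eq_zero (by omega), midFDual_eq_zero (by omega)]
    · rw [midG_eq_zero (by omega), midG_eq_zero (by omega)]
    · rw [lastFDual_d, midFDual_mk hθ _ _ _ _ _ _ _ _ rfl, lastG_mk hθ _ _ _ _ _ _ _ _ rfl, e2, n2,
        map_zero, smul_zero, add_zero]
    · rw [lastG_eq_zero (by omega), lastG_eq_zero (by omega)]
    · rw [mapX_apply, gVal, LinearMap.sub_apply, fstG_mk hθ _ _ _ _ _ _ _ _ rfl,
        lastG_mk hθ _ _ _ _ _ _ _ _ rfl, sub_zero, Conc.of_out]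
  have hy : y = 0 := (Conc.subsingleton (by omega)).elim _ _
  suffices h : ∃ b₂ : (bdX hθ).X i, (bdX hθ).d i j hij b₂ = b by
    obtain ⟨b₂, h⟩ := h
    exact ⟨b₂, h, (Conc.subsingleton (by omega)).elim _ _⟩
  by_cases h1 : j = q + 1
  · obtain rfl : i = q + 2 := by omega
    obtain rfl : k = q := by omega
    subst h1
    have e1 : ((q : ℤ) + 1).negOnePow = -(q : ℤ).negOnePow := Int.negOnePow_succ _
    have e2 : ((q : ℤ) + 1 - 1).negOnePow = (q : ℤ).negOnePow := by rw [add_sub_cancel_right]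
    have e3 : ((q : ℤ) + 2 - 1).negOnePow = -(q : ℤ).negOnePow := by
      rw [← e1]; congr 1; ring
    have d1 := congrArg (fstF hθ q) hb
    have d2 := congrArg (lastFDual hθ q) hb
    rw [fstF_d, map_zero, e1, e2, Units.neg_smul, neg_add_eq_zero] at d1
    rw [lastFDual_d, map_zero, e1, e2, Units.neg_smul, ← sub_eq_add_neg, sub_eq_zero] at d2
    have d1' := congrArg ((q : ℤ).negOnePow • ·) d1
    have d2' := congrArg ((q : ℤ).negOnePow • ·) d2
    simp only [n1, n2] at d1' d2'
    have d3 : lastG hθ (q + 1) b = fstG hθ (q + 1) b := (sub_eq_zero.1 hg).symm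
    refine ⟨mkBdX hθ (q + 2) 0 0 0 0 0 (-((q : ℤ).negOnePow • fstG hθ (q + 1) b)) 0 0,
      bdX_ext ?_ ?_ ?_ ?_ ?_ ?_ ?_ ?_⟩
    · rw [fstF_eq_zero (by omega), fstF_eq_zero (by omega)]
    · rw [fstG_d, midG_mk hθ _ _ _ _ _ _ _ _ rfl, e3, Units.neg_smul, smul_neg, neg_neg, n3]
    · rw [midF_d, midG_mk hθ _ _ _ _ _ _ _ _ rfl, e3, Units.neg_smul, map_neg, smul_neg, neg_neg,
        map_units_smul, n1, d1']
    · rw [midGDual_eq_zero (by omega), midGDual_eq_zero (by omega)]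
    · rw [midFDual_d, midG_mk hθ _ _ _ _ _ _ _ _ rfl, e3, Units.neg_smul, map_neg, smul_neg, neg_neg,
        map_units_smul, n2, d2', d3]
    · rw [midG_eq_zero (by omega), midG_eq_zero (by omega)]
    · rw [lastFDual_eq_zero (by omega), lastFDual_eq_zero (by omega)]
    · rw [lastG_d, midG_mk hθ _ _ _ _ _ _ _ _ rfl, e3, Units.neg_smul, smul_neg, neg_neg, n3, d3]
  refine ⟨0, (map_zero _).trans ?_⟩
  by_cases h2 : j = q + 2
  · have d1 := congrArg (fstG hθ k) hb
    rw [fstG_d, map_zero, smul_eq_zero_iff_eq] at d1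
    subst h2
    apply bdX_ext <;> simp only [map_zero, fstF_eq_zero h0, fstG_eq_zero h1, midF_eq_zero h1,
      midGDual_eq_zero h0, midFDual_eq_zero h1, d1, lastFDual_eq_zero h0, lastG_eq_zero h1]
  · exact (bdX_eq_zero h0 h1 h2 b).symm

end Alpha

end RegSplitPreformation

end BoundaryX

section BoundaryStruct

variable {Λ : Type u} [Ring Λ] [StarRing Λ]

open FreeComplex

namespace RegSplitPreformation

variable {q : ℕ} {z : RegSplitPreformation Λ ((-1) ^ q)} {θ : z.G →ₗ[Λ] StarDual Λ z.G}
  (hθ : z.IsRepresentative θ)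

/-- The inclusion `G^* = C_{q-1} → ∂E_q`. -/
def iotaB (r : ℤ) : StarDual Λ z.G →ₗ[Λ] (bdX hθ).X r :=
  unionIn₂ (pairC'' hθ).f (pairC hθ).f r ∘ₗ bdryInl (isCycle_structN hθ) (r - 1) ∘ₗ
    inB (q : ℤ) (adj z.μ) (r - 1 + 1)

variable {hθ}

theorem toFst_iota (r : ℤ) (w : StarDual Λ z.G) : toFst hθ r (iotaB hθ r w) = 0 := rfl

theorem toLast_iota (r : ℤ) (w : StarDual Λ z.G) : toLast hθ r (iotaB hθ r w) = 0 := rfl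

theorem toMidDual_iota (r : ℤ) (w : StarDual Λ z.G) : toMidDual hθ r (iotaB hθ r w) = 0 := rfl

theorem midF_iota (r : ℤ) (w : StarDual Λ z.G) : midF hθ r (iotaB hθ r w) = 0 :=
  outA_inB (q := (q : ℤ)) (δ := adj z.μ) (r := r - 1 + 1) w

theorem midGDual_iota {r : ℤ} (h : r = q) (w : StarDual Λ z.G) :
    midGDual hθ r (iotaB hθ r w) = w :=
  outB_inB (q := (q : ℤ)) (δ := adj z.μ) (r := r - 1 + 1) (by omega) w

theorem fstF_iota (r : ℤ) (w : StarDual Λ z.G) : fstF hθ r (iotaB hθ r w) = 0 := by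
  rw [fstF, LinearMap.comp_apply, LinearMap.comp_apply, toFst_iota, map_zero, map_zero]

theorem fstG_iota (r : ℤ) (w : StarDual Λ z.G) : fstG hθ r (iotaB hθ r w) = 0 := by
  rw [fstG, LinearMap.comp_apply, LinearMap.comp_apply, toFst_iota, map_zero, map_zero]

theorem midFDual_iota (r : ℤ) (w : StarDual Λ z.G) : midFDual hθ r (iotaB hθ r w) = 0 := by
  rw [midFDual, LinearMap.comp_apply, toMidDual_iota, map_zero]

theorem midG_iota (r : ℤ) (w : StarDual Λ z.G) : midG hθ r (iotaB hθ r w) = 0 := by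
  rw [midG, LinearMap.comp_apply, LinearMap.comp_apply, toMidDual_iota, map_zero, map_zero]

theorem lastFDual_iota (r : ℤ) (w : StarDual Λ z.G) : lastFDual hθ r (iotaB hθ r w) = 0 := by
  rw [lastFDual, LinearMap.comp_apply, toLast_iota, map_zero]

theorem lastG_iota (r : ℤ) (w : StarDual Λ z.G) : lastG hθ r (iotaB hθ r w) = 0 := by
  rw [lastG, LinearMap.comp_apply, LinearMap.comp_apply, toLast_iota, map_zero, map_zero]

theorem gVal_iota (r : ℤ) (w : StarDual Λ z.G) : gVal hθ r (iotaB hθ r w) = 0 := by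
  rw [gVal, LinearMap.sub_apply, fstG_iota, lastG_iota, sub_self]

theorem alphaB_iota {r : ℤ} (h : r = q) (w : StarDual Λ z.G) :
    alphaB hθ r (iotaB hθ r w) = w := by
  rw [alphaB_apply, fstF_iota, lastFDual_iota, midGDual_iota h]
  simp

theorem d_iota {i j : ℤ} (h : j + 1 = i) (w : StarDual Λ z.G) :
    (bdX hθ).d i j h (iotaB hθ i w) = 0 := by
  apply bdX_ext <;> simp only [fstF_d, fstG_d, midF_d, midGDual_d, midFDual_d, midG_d, lastFDual_d,
    lastG_d, fstF_iota, fstG_iota, midF_iota, midFDual_iota, midG_iota, lastFDual_iota, lastG_iota,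
    map_zero, smul_zero, add_zero]

/-- The cochain `b ↦ star (α b x)`. -/
def alphaX (hθ : z.IsRepresentative θ) (r : ℤ) (x : z.G) : StarDual Λ ((bdX hθ).X r) :=
  dualMap (alphaB hθ r) (evalDual z.G x)

theorem alphaX_apply (r : ℤ) (x : z.G) (b : (bdX hθ).X r) :
    alphaX hθ r x b = star (alphaB hθ r b x) := rfl

/-- The structure `ω` on `∂E`. -/
abbrev omegaX (hθ : z.IsRepresentative θ) : QStruct (bdX hθ) (2 * q + 1) :=
  (pairC'' hθ).gluedStruct (pairC hθ)

theorem gVal_omega (p r : ℤ) (h : p + r + (0 : ℕ) = 2 * q + 1) (β : StarDual Λ ((bdX hθ).X p)) :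
    gVal hθ r (omegaX hθ 0 p r h β) = undual z.G (dualMap (iotaB hθ p) β) := by
  have h1 : toFst hθ r (omegaX hθ 0 p r h β) = 0 := by
    refine (map_add (toFst hθ r) _ _).trans
      ((congrArg (· + _) (map_add (toFst hθ r) _ _)).trans ?_)
    change (0 + 0 + 0 : StarDual Λ (z.complexN'.X (2 * q + 1 - r))) = 0
    simp
  have h2 : toLast hθ r (omegaX hθ 0 p r h β) =
      -(dualMap (bdryInl (isCycle_structN hθ) (p - 1) ∘ₗ
        z.complexN.idMap (2 * q + 1 - r) (p - 1 + 1) (by push_cast at h; omega))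
        (dualMap (unionIn₂ (pairC'' hθ).f (pairC hθ).f p) β)) := by
    refine (map_add (toLast hθ r) _ _).trans
      ((congrArg (· + _) (map_add (toLast hθ r) _ _)).trans ?_)
    change (0 + 0 + (((0 : ℕ) : ℤ).negOnePow • (-(dualMap (bdryInl (isCycle_structN hθ) (p - 1) ∘ₗ
        z.complexN.idMap (2 * q + 1 - r) (p - 1 + 1) (by push_cast at h; omega))
        (dualMap (unionIn₂ (pairC'' hθ).f (pairC hθ).f p) β))) + -0) :
        StarDual Λ (z.complexN.X (2 * q + 1 - r))) = _
    simp
  rw [gVal, LinearMap.sub_apply, fstG, lastG]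
  simp only [LinearMap.comp_apply, h1, h2, map_zero, map_neg, zero_sub, neg_neg]
  refine congrArg (undual z.G) (StarDual.ext fun w => ?_)
  change β (unionIn₂ _ _ p (bdryInl _ (p - 1) (z.complexN.idMap (2 * q + 1 - r) (p - 1 + 1) _
    (inB (q : ℤ) (adj z.μ) (2 * q + 1 - r) w)))) = _
  rw [dualMap_idMap_inB]
  rfl

/-- The inclusion `D'_r → ∂E_r`. -/
def inFst (hθ : z.IsRepresentative θ) (r : ℤ) :
    StarDual Λ (z.complexN'.X (2 * q + 1 - r)) →ₗ[Λ] (bdX hθ).X r :=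
  unionIn₁ (pairC'' hθ).f (pairC hθ).f r

/-- The inclusion `C_{r-1} → ∂E_r`. -/
def inMid (hθ : z.IsRepresentative θ) (r : ℤ) :
    (bdryComplex (isCycle_structN hθ)).X (r - 1) →ₗ[Λ] (bdX hθ).X r :=
  unionIn₂ (pairC'' hθ).f (pairC hθ).f r

/-- The inclusion `D_r → ∂E_r`. -/
def inLast (hθ : z.IsRepresentative θ) (r : ℤ) :
    StarDual Λ (z.complexN.X (2 * q + 1 - r)) →ₗ[Λ] (bdX hθ).X r :=
  unionIn₃ (pairC'' hθ).f (pairC hθ).f r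

theorem alphaB_inFst (r : ℤ) (Φ : StarDual Λ (z.complexN'.X (2 * q + 1 - r))) :
    alphaB hθ r (inFst hθ r Φ) = -(((-1) ^ q : ℤˣ) • adj z.μ
      (undual z.F (dualMap (inA (q : ℤ) (dualMap z.γ) (2 * q + 1 - r)) Φ))) := by
  rw [alphaB_apply]
  change _ + outB (q : ℤ) (adj z.μ) (r - 1 + 1) 0 - dualMap z.γ (dualMap _ 0) = _
  rw [map_zero, map_zero, map_zero, add_zero, sub_zero]
  rfl

theorem alphaB_inMid (r : ℤ) (c : (bdryComplex (isCycle_structN hθ)).X (r - 1)) :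
    alphaB hθ r (inMid hθ r c) = outB (q : ℤ) (adj z.μ) (r - 1 + 1) c.1 := by
  rw [alphaB_apply]
  change -(((-1) ^ q : ℤˣ) • adj z.μ (undual z.F (dualMap _ 0))) + outB _ _ _ c.1 -
    dualMap z.γ (dualMap _ 0) = _
  simp

theorem alphaB_inLast (r : ℤ) (Φ : StarDual Λ (z.complexN.X (2 * q + 1 - r))) :
    alphaB hθ r (inLast hθ r Φ) =
      -dualMap z.γ (dualMap (inA (q : ℤ) (adj z.μ) (2 * q + 1 - r)) Φ) := by
  rw [alphaB_apply]
  change -(((-1) ^ q : ℤˣ) • adj z.μ (undual z.F (dualMap _ 0))) +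
    outB (q : ℤ) (adj z.μ) (r - 1 + 1) 0 - dualMap z.γ (dualMap _ Φ) = _
  simp

theorem gVal_inFst (r : ℤ) (Φ : StarDual Λ (z.complexN'.X (2 * q + 1 - r))) :
    gVal hθ r (inFst hθ r Φ) =
      undual z.G (dualMap (inB (q : ℤ) (dualMap z.γ) (2 * q + 1 - r)) Φ) := by
  change undual z.G (dualMap _ Φ) - undual z.G (dualMap _ 0) = _
  simp

theorem gVal_inMid (r : ℤ) (c : (bdryComplex (isCycle_structN hθ)).X (r - 1)) :
    gVal hθ r (inMid hθ r c) = 0 := by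
  change undual z.G (dualMap _ 0) - undual z.G (dualMap _ 0) = _
  simp

theorem gVal_inLast (r : ℤ) (Φ : StarDual Λ (z.complexN.X (2 * q + 1 - r))) :
    gVal hθ r (inLast hθ r Φ) =
      -undual z.G (dualMap (inB (q : ℤ) (adj z.μ) (2 * q + 1 - r)) Φ) := by
  change undual z.G (dualMap _ 0) - undual z.G (dualMap _ Φ) = _
  simp

theorem mapC''_bdryInl (r : ℤ) (x : z.complexN.X (r + 1))
    (A : StarDual Λ ((bdX hθ).X r)) :
    dualMap ((mapC'' hθ).f r) (dualMap (unionIn₁ (pairC'' hθ).f (pairC hθ).f r) A)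
      (bdryInl (isCycle_structN hθ) r x) =
      A (inFst hθ r (dualMap (outA (q : ℤ) (dualMap z.γ) (2 * q + 1 - r))
        (evalDual z.F (outA (q : ℤ) (adj z.μ) (r + 1) x)))) :=
  congrArg (fun t => A (inFst hθ r t)) (mapC''_inl hθ r x)

theorem omega_dualMap_mapX (p r : ℤ) (h : p + r + (0 : ℕ) = 2 * q + 1)
    (ξ : StarDual Λ (Conc (q + 1 : ℤ) z.G p)) :
    omegaX hθ 0 p r h (dualMap ((mapX hθ).f p) ξ) = 0 := by
  refine ext_dual (Λ := Λ) fun β => ?_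
  refine (apply_unionStruct (pairC'' hθ).f (pairC hθ).f _ _ _ 0 p r h _ β).trans ?_
  have h2 : dualMap (unionIn₂ (pairC'' hθ).f (pairC hθ).f p) (dualMap ((mapX hθ).f p) ξ) = 0 :=
    StarDual.ext fun c => by
      change ξ (Conc.of (Λ := Λ) (q + 1 : ℤ) z.G p (gVal hθ p (inMid hθ p c))) = 0
      rw [gVal_inMid, map_zero, map_zero]
  have h1 : (-(bdryStruct (isCycle_structN hθ)) : QStruct _ _) 0 p (r - 1) (by omega)
      (dualMap ((pairC'' hθ).f.f p) (dualMap (unionIn₁ (pairC'' hθ).f (pairC hθ).f p)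
        (dualMap ((mapX hθ).f p) ξ))) = 0 := by
    change -(bdryInr (isCycle_structN hθ) (r - 1) (dualMap (bdryInl (isCycle_structN hθ) p ∘ₗ
      z.complexN.idMap (2 * q + 1 - (r - 1)) (p + 1) (by push_cast at h; omega)) _)) = 0
    rw [neg_eq_zero]
    refine (congrArg (bdryInr (isCycle_structN hθ) (r - 1)) (StarDual.ext fun x => ?_)).trans
      (map_zero _)
    refine (mapC''_bdryInl p _ (dualMap ((mapX hθ).f p) ξ)).trans ?_
    change ξ (Conc.of (Λ := Λ) (q + 1 : ℤ) z.G p (gVal hθ p (inFst hθ p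
      (dualMap (outA (q : ℤ) (dualMap z.γ) (2 * q + 1 - p))
        (evalDual z.F (outA (q : ℤ) (adj z.μ) (p + 1)
          (z.complexN.idMap (2 * q + 1 - (r - 1)) (p + 1) (by push_cast at h; omega) x))))))) = 0
    rw [gVal_inFst, dualMap_inB_outA, map_zero, map_zero, map_zero]
  rw [h2, h1]
  change dualMap (unionIn₁ (pairC'' hθ).f (pairC hθ).f r) β 0 + _ + (_ +
    dualMap (unionIn₃ (pairC'' hθ).f (pairC hθ).f r) β (-0)) = _
  simp

theorem alphaX_bdryInl (r : ℤ) (x : z.G) (n : z.complexN.X (r - 1 + 1)) :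
    dualMap (unionIn₂ (pairC'' hθ).f (pairC hθ).f r) (alphaX hθ r x)
      (bdryInl (isCycle_structN hθ) (r - 1) n) = star (outB (q : ℤ) (adj z.μ) (r - 1 + 1) n x) :=
  congrArg (fun t : StarDual Λ z.G => star (t x))
    (alphaB_inMid (hθ := hθ) r (bdryInl (isCycle_structN hθ) (r - 1) n))

theorem dualMap_bdryInl_alphaX (r : ℤ) (x : z.G) :
    dualMap (bdryInl (isCycle_structN hθ) (r - 1))
      (dualMap (unionIn₂ (pairC'' hθ).f (pairC hθ).f r) (alphaX hθ r x)) =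
      dualMap (outB (q : ℤ) (adj z.μ) (r - 1 + 1)) (evalDual z.G x) :=
  StarDual.ext fun n => alphaX_bdryInl r x n

theorem mapC''_bdryInl_alphaX {r : ℤ} (h : r = q) (x : z.G) (n : z.complexN.X (r + 1)) :
    dualMap ((mapC'' hθ).f r) (dualMap (unionIn₁ (pairC'' hθ).f (pairC hθ).f r) (alphaX hθ r x))
      (bdryInl (isCycle_structN hθ) r n) =
      -(((-1) ^ q : ℤˣ) • z.μ x (outA (q : ℤ) (adj z.μ) (r + 1) n)) := by
  rw [mapC''_bdryInl]
  change star (alphaB hθ r (inFst hθ r _) x) = _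
  rw [alphaB_inFst, dualMap_inA_outA (by omega), undual_evalDual, StarDual.neg_apply,
    StarDual.units_smul_apply, adj_apply, star_neg, star_units_smul, star_star]

theorem alphaX_omega_alphaX (h : (q : ℤ) + q + (1 : ℕ) = 2 * q + 1) (x y : z.G) :
    alphaX hθ q y (omegaX hθ 1 q q h (alphaX hθ q x)) = -θ y x := by
  refine (apply_unionStruct (pairC'' hθ).f (pairC hθ).f _ _ _ 1 q q h _ _).trans ?_
  have e : ((q : ℤ)).negOnePow = (-1) ^ q := negOnePow_eq q
  have h3 : dualMap (unionIn₂ (pairC'' hθ).f (pairC hθ).f q) (alphaX hθ q y)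
      ((-(bdryStruct (isCycle_structN hθ)) : QStruct _ _) 1 q (q - 1)
      (by omega) (dualMap ((pairC'' hθ).f.f q) (dualMap (unionIn₁ (pairC'' hθ).f (pairC hθ).f q)
        (alphaX hθ q x)))) = star (z.μ x (z.γ y)) := by
    change dualMap (unionIn₂ (pairC'' hθ).f (pairC hθ).f q) (alphaX hθ q y)
      (-(bdryInl (isCycle_structN hθ) (q - 1)
      ((((2 : ℤ) * q - (q - 1) - ((0 : ℕ) + 1)).negOnePow •
      (z.structN θ).T 0 (q + 1) (q - 1 + 1) (by push_cast; omega)) (dualMap (bdryInl (isCycle_structN hθ) q)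
      (dualMap ((mapC'' hθ).f q) (dualMap (unionIn₁ (pairC'' hθ).f (pairC hθ).f q)
        (alphaX hθ q x))))))) = _
    have e1 : ((2 : ℤ) * q - (q - 1) - ((0 : ℕ) + 1)).negOnePow = (-1) ^ q := by
      rw [← e]; congr 1; push_cast; ring
    have e2 := (z.structN θ).apply_T 0 (q + 1) (q - 1 + 1) (by push_cast; omega)
      (dualMap (bdryInl (isCycle_structN hθ) q)
      (dualMap ((mapC'' hθ).f q) (dualMap (unionIn₁ (pairC'' hθ).f (pairC hθ).f q)
        (alphaX hθ q x)))) (dualMap (outB (q : ℤ) (adj z.μ) (q - 1 + 1)) (evalDual z.G y))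
    have e3 : (((q : ℤ) + 1) * (q - 1 + 1)).negOnePow = 1 := Int.negOnePow_even _ (by
      rw [sub_add_cancel, mul_comm]; exact Int.even_mul_succ_self _)
    have e4 : z.structN θ 0 (q - 1 + 1) (q + 1) (by push_cast; omega)
        (dualMap (outB (q : ℤ) (adj z.μ) (q - 1 + 1)) (evalDual z.G y)) =
        inA (q : ℤ) (adj z.μ) (q + 1) (z.γ y) := by
      change inA (q : ℤ) (adj z.μ) (q + 1) (z.γ (undual z.G (dualMap _ _))) = _
      rw [dualMap_inB_outB (by omega), undual_evalDual]
    rw [e4, e3, one_smul, dualMap_apply (bdryInl _ _), mapC''_bdryInl_alphaX rfl,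
      outA_inA rfl, dualMap_apply (outB _ _ _), evalDual_apply, star_neg, star_units_smul] at e2
    rw [map_neg, alphaX_bdryInl, LinearMap.smul_apply, map_units_smul, StarDual.units_smul_apply,
      star_units_smul, e2, e1, smul_neg, neg_neg, smul_smul, Int.units_mul_self, one_smul]
  have h4 : dualMap (unionIn₂ (pairC'' hθ).f (pairC hθ).f q) (alphaX hθ q x)
      ((-(bdryStruct (isCycle_structN hθ)) : QStruct _ _) 2 (q - 1) (q - 1)
      (by push_cast; omega) (dualMap (unionIn₂ (pairC'' hθ).f (pairC hθ).f q) (alphaX hθ q y))) =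
      ((-1) ^ q : ℤˣ) • θ x y := by
    change dualMap (unionIn₂ (pairC'' hθ).f (pairC hθ).f q) (alphaX hθ q x)
      (-(bdryInl (isCycle_structN hθ) (q - 1)
      ((((2 : ℤ) * q - (q - 1) - ((1 : ℕ) + 1)).negOnePow •
      (z.structN θ).T 1 (q - 1 + 1) (q - 1 + 1) (by push_cast; omega))
      (dualMap (bdryInl (isCycle_structN hθ) (q - 1))
        (dualMap (unionIn₂ (pairC'' hθ).f (pairC hθ).f q) (alphaX hθ q y)))))) = _
    have e1 : ((2 : ℤ) * q - (q - 1) - ((1 : ℕ) + 1)).negOnePow = -(-1) ^ q := by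
      rw [show (2 : ℤ) * q - (q - 1) - ((1 : ℕ) + 1) = q - 1 by push_cast; ring, Int.negOnePow_sub, e]
      simp
    have e2 := (z.structN θ).apply_T 1 (q - 1 + 1) (q - 1 + 1) (by push_cast; omega)
      (dualMap (bdryInl (isCycle_structN hθ) (q - 1))
        (dualMap (unionIn₂ (pairC'' hθ).f (pairC hθ).f q) (alphaX hθ q y)))
      (dualMap (outB (q : ℤ) (adj z.μ) (q - 1 + 1)) (evalDual z.G x))
    have e3 : (((q : ℤ) - 1 + 1) * (q - 1 + 1)).negOnePow = (-1) ^ q := by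
      rw [sub_add_cancel, Int.negOnePow_mul_self, e]
    have e4 : z.structN θ 1 (q - 1 + 1) (q - 1 + 1) (by push_cast; omega)
        (dualMap (outB (q : ℤ) (adj z.μ) (q - 1 + 1)) (evalDual z.G x)) =
        inB (q : ℤ) (adj z.μ) (q - 1 + 1) (((-1) ^ q : ℤˣ) • θ x) := by
      change inB (q : ℤ) (adj z.μ) (q - 1 + 1)
        ((((-1) ^ q : ℤˣ) • θ) (undual z.G (dualMap _ _))) = _
      rw [dualMap_inB_outB (by omega), undual_evalDual]
      rfl
    rw [e4, e3, dualMap_bdryInl_alphaX, dualMap_apply, dualMap_apply, outB_inB (by omega),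
      evalDual_apply, evalDual_apply, star_star, StarDual.units_smul_apply, smul_smul,
      Int.units_mul_self, one_smul] at e2
    rw [map_neg, alphaX_bdryInl, LinearMap.smul_apply, map_units_smul, StarDual.units_smul_apply,
      star_units_smul, dualMap_bdryInl_alphaX, e2, e1, Units.neg_smul, neg_neg]
  have h5 : dualMap ((pairC hθ).f.f q)
      (dualMap (unionIn₃ (pairC'' hθ).f (pairC hθ).f q) (alphaX hθ q y))
      ((-(bdryStruct (isCycle_structN hθ)) : QStruct _ _) 1 (q - 1) q (by omega)
        (dualMap (unionIn₂ (pairC'' hθ).f (pairC hθ).f q) (alphaX hθ q x))) = 0 := by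
    change alphaX hθ q y (inLast hθ q (-0)) = 0
    rw [neg_zero, map_zero, map_zero]
  have h6 : (-(pairC hθ).δψ : QStruct _ _) 1 q q (by push_cast; omega)
      (dualMap (unionIn₃ (pairC'' hθ).f (pairC hθ).f q) (alphaX hθ q x)) = 0 := neg_zero
  have h7 : (pairC'' hθ).δψ 1 q q (by push_cast; omega)
      (dualMap (unionIn₁ (pairC'' hθ).f (pairC hθ).f q) (alphaX hθ q x)) = 0 := rfl
  have s1 : ((2 : ℤ) * q - q).negOnePow = (-1) ^ q := by rw [← e]; congr 1; ring
  have s2 : ((2 : ℤ) * q - q - (1 : ℕ) + 1).negOnePow = (-1) ^ q := by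
    rw [← e]; congr 1; push_cast; ring
  have s3 : (((q : ℤ) - 1) * (q - 1)).negOnePow = -(-1) ^ q := by
    rw [Int.negOnePow_mul_self, Int.negOnePow_sub, e]; simp
  have key := hθ.apply_eq x y
  refine (congrArg₂ (· + ·) (congrArg₂ (· + ·) (congrArg _ h7) (congrArg₂ (· + ·)
    (congrArg (_ • ·) h3) (congrArg (fun t => _ • _ • star t) h4)))
    (congrArg₂ (· + ·) (congrArg (_ • ·) h5) (congrArg _ h6))).trans ?_
  rw [s1, s2, s3, ← key]
  rcases Int.units_eq_one_or ((-1) ^ q) with e | e <;> (simp [e]; try abel)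

end RegSplitPreformation

end BoundaryStruct

section BoundaryPoincare

variable {Λ : Type u} [Ring Λ] [StarRing Λ]

open FreeComplex

theorem QStruct.symm₀_zero {C : FreeComplex Λ} {n : ℤ} (p r : ℤ) (h : p + r = n)
    (α : StarDual Λ (C.X p)) : (0 : QStruct C n).symm₀ p r h α = 0 :=
  ext_dual (Λ := Λ) fun β => by
    rw [apply_symm₀]
    change β 0 + _ • star (α 0) = β 0
    simp

namespace QuadPair

variable {C : FreeComplex Λ} {n : ℤ} {ψ : QStruct C n} (c : QuadPair C n ψ)

theorem dualityMap_eq (r k : ℤ) (h : k + 1 = r) (m : StarDual Λ (c.D.X (n + 1 - r))) :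
    c.dualityMap r (c.D.toDual (n + 1) r m) =
      coneInl c.f r (c.δψ.symm₀ (n + 1 - r) r (by omega) m) +
        coneInr c.f r k h ((n + 1 - r).negOnePow • ψ.symm₀ (n + 1 - r) k (by omega)
          (dualMap (c.f.f (n + 1 - r)) m)) := by
  obtain rfl : k = r - 1 := by omega
  exact Prod.ext (add_zero _).symm (zero_add _).symm

/-- An elementwise criterion for a pair to be Poincaré. -/
theorem isPoincare_of_elementwise
    (hinj : ∀ (i j k p p₀ p₁ : ℤ) (hij : j + 1 = i) (hjk : k + 1 = j) (hp : p + j = n + 1)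
      (hp₀ : p₀ + 1 = p) (hp₁ : p + 1 = p₁) (m : StarDual Λ (c.D.X p)) (y : c.D.X i) (v : C.X j),
      dualMap (c.D.d p₁ p hp₁) m = 0 →
      c.D.d i j hij y + j.negOnePow • c.f.f j v = c.δψ.symm₀ p j hp m →
      C.d j k hjk v = p.negOnePow • ψ.symm₀ p k (by omega) (dualMap (c.f.f p) m) →
      ∃ m₀, dualMap (c.D.d p p₀ hp₀) m₀ = m)
    (hsurj : ∀ (i j k l p p₁ : ℤ) (hij : j + 1 = i) (hjk : k + 1 = j) (hkl : l + 1 = k)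
      (hp : p + j = n + 1) (hp₁ : p + 1 = p₁) (y : c.D.X j) (v : C.X k),
      c.D.d j k hjk y + k.negOnePow • c.f.f k v = 0 → C.d k l hkl v = 0 →
      ∃ (m : StarDual Λ (c.D.X p)) (y' : c.D.X i) (v' : C.X j), dualMap (c.D.d p₁ p hp₁) m = 0 ∧
        c.δψ.symm₀ p j hp m + (c.D.d i j hij y' + j.negOnePow • c.f.f j v') = y ∧
        p.negOnePow • ψ.symm₀ p k (by omega) (dualMap (c.f.f p) m) + C.d j k hjk v' = v) :
    c.IsPoincare := by
  refine IsQuasiIso.isChainEquivalence ⟨fun i j k hij hjk m y hm hy => ?_,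
    fun i j k hij hjk y hy => ?_⟩ c.isChainMap_dualityMap
  · replace hy := hy.trans (c.dualityMap_eq j k hjk m)
    rw [← coneInl_add_coneInr i j hij y, map_add, d_coneInl, d_coneInr i j k hij hjk] at hy
    have h1 := congrArg (coneFst c.f j) hy
    have h2 := congrArg (coneSnd c.f j k hjk) hy
    simp only [map_add, map_units_smul, coneFst_inl, coneFst_inr, coneSnd_inl, coneSnd_inr,
      smul_zero, add_zero, zero_add] at h1 h2
    have hm' : dualMap (c.D.d (n + 1 - k) (n + 1 - j) (by omega)) m = 0 := by
      have : j.negOnePow • dualMap (c.D.d (n + 1 - k) (n + 1 - j) (by omega)) m = 0 := hm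
      rwa [smul_eq_zero_iff_eq] at this
    obtain ⟨m₀, rfl⟩ := hinj i j k (n + 1 - j) (n + 1 - i) (n + 1 - k) hij hjk (by omega) (by omega)
      (by omega) m _ _ hm' h1 h2
    refine ⟨c.D.toDual (n + 1) i (i.negOnePow • m₀), ?_⟩
    change i.negOnePow • dualMap _ (i.negOnePow • m₀) = _
    rw [map_units_smul, smul_smul, Int.units_mul_self, one_smul]
  · rw [← coneInl_add_coneInr j k hjk y, map_add, d_coneInl, d_coneInr j k (k - 1) hjk (by omega)]
      at hy
    have h1 := congrArg (coneFst c.f k) hy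
    have h2 := congrArg (coneSnd c.f k (k - 1) (by omega)) hy
    simp only [map_add, map_units_smul, coneFst_inl, coneFst_inr, coneSnd_inl, coneSnd_inr,
      smul_zero, add_zero, zero_add, map_zero] at h1 h2
    obtain ⟨m, y', v', h3, h4, h5⟩ := hsurj i j k (k - 1) (n + 1 - j) (n + 1 - k) hij hjk (by omega)
      (by omega) (by omega) _ _ h1 h2
    refine ⟨c.D.toDual (n + 1) j m, coneInl c.f i y' + coneInr c.f i j hij v', ?_, ?_⟩
    · change j.negOnePow • dualMap _ m = _
      rw [h3, smul_zero]
      rfl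
    · rw [c.dualityMap_eq j k hjk m, map_add, d_coneInl, d_coneInr i j k hij hjk,
        ← coneInl_add_coneInr j k hjk y, ← h4, ← h5]
      simp only [map_add, map_units_smul]
      abel

end QuadPair

namespace RegSplitPreformation

variable {q : ℕ} {z : RegSplitPreformation Λ ((-1) ^ q)} {θ : z.G →ₗ[Λ] StarDual Λ z.G}
  {hθ : z.IsRepresentative θ}

theorem alphaB_eq_zero {r : ℤ} (h : r ≠ q) (b : (bdX hθ).X r) : alphaB hθ r b = 0 := by
  rw [alphaB_apply, fstF_eq_zero h, midGDual_eq_zero h, lastFDual_eq_zero h]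
  simp

theorem symm₀_omega_mapX (p r : ℤ) (h : p + r = 2 * q + 1)
    (ξ : StarDual Λ (Conc (q + 1 : ℤ) z.G p)) :
    (omegaX hθ).symm₀ p r h (dualMap ((mapX hθ).f p) ξ) =
      (p * r).negOnePow • iotaB hθ r (dualMap (Conc.of (q + 1 : ℤ) z.G p) ξ) := by
  refine ext_dual (Λ := Λ) fun β => ?_
  rw [QStruct.apply_symm₀, omega_dualMap_mapX, map_zero, zero_add, map_units_smul]
  congr 1
  change star (ξ (Conc.of (Λ := Λ) (q + 1 : ℤ) z.G p (gVal hθ p (omegaX hθ 0 r p _ β)))) = _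
  rw [gVal_omega, ← dualMap_apply (Conc.of (Λ := Λ) (q + 1 : ℤ) z.G p), apply_undual, star_star,
    dualMap_apply]

theorem isPoincare_pairX (z : RegSplitPreformation Λ ((-1) ^ q)) (θ : z.G →ₗ[Λ] StarDual Λ z.G)
    (hθ : z.IsRepresentative θ) : (pairX z θ hθ).IsPoincare := by
  have hδ : ∀ (p r : ℤ) (h : p + r = 2 * q + 1 + 1) m, (pairX z θ hθ).δψ.symm₀ p r h m = 0 :=
    fun p r h m => QStruct.symm₀_zero p r h m
  apply QuadPair.isPoincare_of_elementwise
  · intro i j k p p₀ p₁ hij hjk hp hp₀ hp₁ m y v hm hy hv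
    refine ⟨0, (map_zero _).trans ?_⟩
    change StarDual Λ (Conc (q + 1 : ℤ) z.G p) at m
    change (bdX hθ).X j at v
    replace hy : (0 : Conc (q + 1 : ℤ) z.G j) + j.negOnePow •
      (show Conc (q + 1 : ℤ) z.G j from (mapX hθ).f j v) = 0 :=
      hy.trans (hδ _ _ _ _)
    replace hv : (bdX hθ).d j k hjk v = p.negOnePow •
        (omegaX hθ).symm₀ p k (by omega) (dualMap ((mapX hθ).f p) m) := hv
    rw [zero_add, smul_eq_zero_iff_eq] at hy
    change Conc.of (Λ := Λ) (q + 1 : ℤ) z.G _ (gVal hθ _ v) = 0 at hy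
    rw [symm₀_omega_mapX] at hv
    by_cases hj : j = q + 1
    · have h1 := congrArg (alphaB hθ k) hv
      have h2 := congrArg (Conc.out (Λ := Λ) (q + 1 : ℤ) z.G j) hy
      rw [Conc.out_of hj, map_zero] at h2
      rw [alphaB_d, h2, map_zero, map_zero, smul_zero, neg_zero, map_units_smul, map_units_smul,
        alphaB_iota (by omega), eq_comm, smul_eq_zero_iff_eq, smul_eq_zero_iff_eq] at h1
      refine (StarDual.ext (M := Conc (q + 1 : ℤ) z.G p) fun x => ?_).symm
      have h3 := DFunLike.congr_fun h1 (Conc.out (Λ := Λ) (q + 1 : ℤ) z.G p x)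
      rw [dualMap_apply, Conc.of_out] at h3
      exact h3
    · refine (StarDual.ext (M := Conc (q + 1 : ℤ) z.G p) fun x => ?_).symm
      rw [(Conc.subsingleton (k := (q + 1 : ℤ)) (M := z.G) (r := p) (by omega)).elim x 0]
      exact map_zero m
  · intro i j k l p p₁ hij hjk hkl hp hp₁ y v hy hv
    change Conc (q + 1 : ℤ) z.G j at y
    change (bdX hθ).X k at v
    replace hy : (0 : Conc (q + 1 : ℤ) z.G k) + k.negOnePow •
      (show Conc (q + 1 : ℤ) z.G k from (mapX hθ).f k v) = 0 := hy
    rw [zero_add, smul_eq_zero_iff_eq] at hy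
    change Conc.of (Λ := Λ) (q + 1 : ℤ) z.G _ (gVal hθ _ v) = 0 at hy
    have hg : gVal hθ k v = 0 := by
      by_cases hk : k = q + 1
      · have h2 := congrArg (Conc.out (Λ := Λ) (q + 1 : ℤ) z.G k) hy
        rwa [Conc.out_of hk, map_zero] at h2
      · rw [gVal, LinearMap.sub_apply, fstG_eq_zero hk, lastG_eq_zero hk, sub_zero]
    set y₁ : Conc (q + 1 : ℤ) z.G j := j.negOnePow • y
    set η : StarDual Λ z.G := alphaB hθ k v + ((-1) ^ q : ℤˣ) •
      dualMap z.γ (z.μ (Conc.out (Λ := Λ) (q + 1 : ℤ) z.G j y₁)) with hη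
    have hη' : j ≠ q + 1 → η = 0 := fun hj => by
      rw [hη, alphaB_eq_zero (by omega), Conc.out_eq_zero hj, map_zero, map_zero, smul_zero,
        add_zero]
    set s : ℤˣ := p.negOnePow * (p * k).negOnePow
    set m : StarDual Λ (Conc (q + 1 : ℤ) z.G p) :=
      s • dualMap (Conc.out (q + 1 : ℤ) z.G p) η
    have hm : p.negOnePow • (omegaX hθ).symm₀ p k (by omega) (dualMap ((mapX hθ).f p) m) =
        iotaB hθ k η := by
      rw [symm₀_omega_mapX, smul_smul, ← map_units_smul, ← map_units_smul, smul_smul,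
        Int.units_mul_self, one_smul]
      congr 1
      refine StarDual.ext fun x => ?_
      by_cases hj : j = q + 1
      · rw [dualMap_apply, dualMap_apply, Conc.out_of (by omega)]
      · rw [hη' hj, map_zero, map_zero]
    obtain ⟨b₂, h1, h2⟩ := exists_boundary hjk hkl (v - iotaB hθ k η) y₁
      (by rw [map_sub, hv, d_iota, sub_zero]) (by rw [map_sub, hg, gVal_iota, sub_zero]) (by
        by_cases hj : j = q + 1
        · rw [map_sub, alphaB_iota (by omega), hη]; abel
        · rw [alphaB_eq_zero (by omega), Conc.out_eq_zero hj, map_zero, map_zero, smul_zero,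
            neg_zero])
    refine ⟨m, 0, b₂, StarDual.ext fun x => map_zero m, ?_, ?_⟩
    · refine (congrArg₂ (· + ·) (hδ p j hp m) (congrArg (_ + _ • ·) h2)).trans ?_
      change (0 : Conc (q + 1 : ℤ) z.G j) + (0 + j.negOnePow • j.negOnePow • y) = y
      rw [zero_add, zero_add, smul_smul, Int.units_mul_self, one_smul]
    · refine (congrArg₂ (· + ·) hm h1).trans (add_sub_cancel _ _)

end RegSplitPreformation

end BoundaryPoincare

section SurgeryForm

variable {Λ : Type u} [Ring Λ] [StarRing Λ]

open FreeComplex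

theorem mk_star (e : ℤˣ) (b : Λ) : QuadQuot.mk e (star b) = e • QuadQuot.mk e b := by
  rw [← map_units_smul, ← QuadQuot.mk_smul_star e (e • b), star_units_smul, smul_smul,
    Int.units_mul_self, one_smul]

namespace QuadPair

variable {C : FreeComplex Λ} {n : ℤ} {ψ : QStruct C n} (c : QuadPair C n ψ) (k : ℤ) (hk : k + k = n)
  (R : Type u) [AddCommGroup R] [Module Λ R]

/-- The module `C^k ⊕ C_{k+1} ⊕ N ⊕ N^*`, with `N = D_{k+1} ⊕ R`. -/
abbrev FormModule : Type u :=
  StarDual Λ (C.X k) × C.X (k + 1) × (c.D.X (k + 1) × R) × StarDual Λ (c.D.X (k + 1) × R)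

/-- The form `((a, v, u, w), (a', v', u', w')) ↦ a(ψ₀ a' + d v') + w(u')`. -/
def formMap : c.FormModule k R →ₗ[Λ] StarDual Λ (c.FormModule k R) :=
  dualMap (ψ 0 k k (by simpa using hk) ∘ₗ LinearMap.fst Λ _ _ +
      C.d (k + 1) k rfl ∘ₗ LinearMap.fst Λ _ _ ∘ₗ LinearMap.snd Λ _ _) ∘ₗ LinearMap.fst Λ _ _ +
    dualMap (LinearMap.fst Λ _ _ ∘ₗ LinearMap.snd Λ _ _ ∘ₗ LinearMap.snd Λ _ _) ∘ₗ
      LinearMap.snd Λ _ _ ∘ₗ LinearMap.snd Λ _ _ ∘ₗ LinearMap.snd Λ _ _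

theorem formMap_apply (x y : c.FormModule k R) :
    c.formMap k hk R x y = x.1 (ψ 0 k k (by simpa using hk) y.1 + C.d (k + 1) k rfl y.2.1) +
      x.2.2.2 y.2.2.1 := rfl

theorem symmetrize_formMap (κ : ℤˣ) (x y : c.FormModule k R) :
    symmetrize k.negOnePow (κ • c.formMap k hk R) x y =
      κ • (x.1 (ψ.symm₀ k k hk y.1 + C.d (k + 1) k rfl y.2.1) + x.2.2.2 y.2.2.1 +
        k.negOnePow • star (y.1 (C.d (k + 1) k rfl x.2.1)) +
        k.negOnePow • star (y.2.2.2 x.2.2.1)) := by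
  rw [symmetrize_apply, LinearMap.smul_apply, LinearMap.smul_apply, StarDual.units_smul_apply,
    StarDual.units_smul_apply, formMap_apply, formMap_apply, map_add x.1, map_add x.1, map_add y.1,
    ψ.apply_symm₀, Int.negOnePow_mul_self, star_units_smul, smul_comm k.negOnePow κ, ← smul_add,
    star_add, star_add]
  simp only [smul_add]
  abel

variable {c k R}

variable (s : (StarDual Λ (c.D.X (k + 1)) × c.D.X (k + 1) × C.X k) →ₗ[Λ]
    (StarDual Λ (c.D.X k) × c.D.X (k + 1 + 1) × C.X (k + 1)))

/-- The inclusion of the boundaries of the algebraic mapping cone of the duality map. -/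
def formIncl : (StarDual Λ (c.D.X (k + 1)) × c.D.X (k + 1) × C.X k) × R →ₗ[Λ] c.FormModule k R :=
  LinearMap.prod
    (dualMap (c.f.f k) ∘ₗ LinearMap.fst Λ _ _ ∘ₗ s ∘ₗ LinearMap.fst Λ _ _)
    (LinearMap.prod (LinearMap.snd Λ _ _ ∘ₗ LinearMap.snd Λ _ _ ∘ₗ s ∘ₗ LinearMap.fst Λ _ _)
      (LinearMap.prod
        (LinearMap.prodMap (LinearMap.fst Λ _ _ ∘ₗ LinearMap.snd Λ _ _) LinearMap.id)
        (dualMap (LinearMap.fst Λ _ R) ∘ₗ LinearMap.fst Λ _ _ ∘ₗ LinearMap.fst Λ _ _)))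

theorem formIncl_apply (t : StarDual Λ (c.D.X (k + 1)) × c.D.X (k + 1) × C.X k) (ρ : R) :
    formIncl s (t, ρ) = (dualMap (c.f.f k) (s t).1, (s t).2.2, (t.2.1, ρ),
      dualMap (LinearMap.fst Λ _ R) t.1) := rfl

variable (c) in
/-- The differential `D^k ⊕ D_{k+2} ⊕ C_{k+1} → D^{k+1} ⊕ D_{k+1} ⊕ C_k` of the algebraic mapping
cone of the duality map, for `n = 2k`. -/
abbrev midDiff : (StarDual Λ (c.D.X k) × c.D.X (k + 1 + 1) × C.X (k + 1)) →ₗ[Λ]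
    (StarDual Λ (c.D.X (k + 1)) × c.D.X (k + 1) × C.X k) :=
  c.dualityDiff (k + 1 + 1) (k + 1) k k (k + 1) rfl rfl rfl (by omega)

variable {s}

theorem midDiff_apply (m : StarDual Λ (c.D.X k)) (y : c.D.X (k + 1 + 1))
    (v : C.X (k + 1)) : c.midDiff hk (m, y, v) = (dualMap (c.D.d (k + 1) k rfl) m,
      c.δψ.symm₀ k (k + 1) (by omega) m - c.f.f (k + 1) v + c.D.d (k + 1 + 1) (k + 1) rfl y,
      ψ.symm₀ k k hk (dualMap (c.f.f k) m) + C.d (k + 1) k rfl v) := by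
  rw [dualityDiff_apply, Int.negOnePow_even n ⟨k, hk.symm⟩, one_smul]

theorem midDiff_section (hs : ∀ x, c.midDiff hk (s (c.midDiff hk x)) = c.midDiff hk x)
    {t : StarDual Λ (c.D.X (k + 1)) × c.D.X (k + 1) × C.X k}
    (ht : t ∈ LinearMap.range (c.midDiff hk)) :
    dualMap (c.D.d (k + 1) k rfl) (s t).1 = t.1 ∧
      c.δψ.symm₀ k (k + 1) (by omega) (s t).1 - c.f.f (k + 1) (s t).2.2 +
        c.D.d (k + 1 + 1) (k + 1) rfl (s t).2.1 = t.2.1 ∧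
      ψ.symm₀ k k hk (dualMap (c.f.f k) (s t).1) + C.d (k + 1) k rfl (s t).2.2 = t.2.2 := by
  have h1 : c.midDiff hk (s t) = t := by
    obtain ⟨y, rfl⟩ := ht
    exact hs y
  generalize s t = x at h1 ⊢
  obtain ⟨m, y, v⟩ := x
  rw [midDiff_apply] at h1
  subst h1
  exact ⟨rfl, rfl, rfl⟩

theorem symmetrize_formMap_incl (hs : ∀ x, c.midDiff hk (s (c.midDiff hk x)) = c.midDiff hk x)
    (κ : ℤˣ) (x : c.FormModule k R) (t : StarDual Λ (c.D.X (k + 1)) × c.D.X (k + 1) × C.X k)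
    (ht : t ∈ LinearMap.range (c.midDiff hk)) (ρ : R) :
    symmetrize k.negOnePow (κ • c.formMap k hk R) x (formIncl s (t, ρ)) =
      κ • (x.1 t.2.2 + x.2.2.2 (t.2.1, ρ) +
        k.negOnePow • star (t.1 (x.2.2.1.1 + c.f.f (k + 1) x.2.1))) := by
  obtain ⟨h1, -, h3⟩ := midDiff_section hk hs ht
  rw [symmetrize_formMap, formIncl_apply, ← h3]
  conv_rhs => rw [← h1]
  simp only [dualMap_apply, map_add, star_add, smul_add, LinearMap.fst_apply, c.f.comm]
  rw [← h1, dualMap_apply]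
  abel

theorem formIncl_quad (hs : ∀ x, c.midDiff hk (s (c.midDiff hk x)) = c.midDiff hk x)
    (κ : ℤˣ) (t : StarDual Λ (c.D.X (k + 1)) × c.D.X (k + 1) × C.X k)
    (ht : t ∈ LinearMap.range (c.midDiff hk)) (ρ : R) :
    QuadQuot.mk k.negOnePow ((κ • c.formMap k hk R) (formIncl s (t, ρ)) (formIncl s (t, ρ))) =
      0 := by
  have hn : n.negOnePow = 1 := Int.negOnePow_even n ⟨k, hk.symm⟩
  obtain ⟨h1, h2, -⟩ := midDiff_section hk hs ht
  have e1 : ((k * (k + 1)).negOnePow) = 1 := Int.negOnePow_even _ (Int.even_mul_succ_self _)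
  rw [LinearMap.smul_apply, StarDual.units_smul_apply, map_units_smul, formMap_apply,
    formIncl_apply]
  simp only
  have h4 := c.apply_isCycle_rel 0 k k _ _ (by simpa using hk) rfl rfl (s t).1 (s t).1
  have h5 := c.δψ.apply_symm₀ k (k + 1) (by omega) (s t).1 (dualMap (c.D.d (k + 1) k rfl) (s t).1)
  rw [← h2, ← h1]
  generalize s t = x at *
  simp only [dualMap_apply, map_add, map_sub, LinearMap.fst_apply, c.D.d_d, c.f.comm] at h4 h5 ⊢
  have h6 := congrArg (QuadQuot.mk k.negOnePow) h4
  have e2 : (n + 1 - (0 : ℕ) - 1).negOnePow = 1 := by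
    rw [← hn]; congr 1; push_cast; ring
  rw [e2, hn, Int.negOnePow_mul_self, show (((0 : ℕ) : ℤ) + 1).negOnePow = -1 from rfl] at h6
  simp only [map_add, map_zero, map_units_smul, mk_star] at h6
  rw [smul_smul k.negOnePow, Int.units_mul_self] at h6
  simp only [one_smul, Units.neg_smul, add_neg_cancel, add_zero] at h6
  rw [h5, e1, one_smul, map_add, mk_star, map_zero x.1, map_zero (QuadQuot.mk _)]
  refine (congrArg (κ • ·) (Eq.trans ?_ h6)).trans (smul_zero κ)
  abel

theorem formIncl_form (hs : ∀ x, c.midDiff hk (s (c.midDiff hk x)) = c.midDiff hk x)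
    (κ : ℤˣ) (t t' : StarDual Λ (c.D.X (k + 1)) × c.D.X (k + 1) × C.X k)
    (ht : t ∈ LinearMap.range (c.midDiff hk)) (ht' : t' ∈ LinearMap.range (c.midDiff hk))
    (ρ ρ' : R) :
    symmetrize k.negOnePow (κ • c.formMap k hk R) (formIncl s (t, ρ)) (formIncl s (t', ρ')) =
      0 := by
  have hn : n.negOnePow = 1 := Int.negOnePow_even n ⟨k, hk.symm⟩
  have e1 : (((k + 1) * k).negOnePow) = 1 := Int.negOnePow_even _ (by
    rw [mul_comm]; exact Int.even_mul_succ_self _)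
  obtain ⟨h1, h2, -⟩ := midDiff_section hk hs ht
  obtain ⟨h1', h2', h3'⟩ := midDiff_section hk hs ht'
  have h4 := congrArg (s t).1 (c.d_symm₀ k k hk _ _ rfl rfl (s t').1)
  have h5 := c.δψ.apply_symm₀_symm (k + 1) k (by omega)
    (dualMap (c.D.d (k + 1) k rfl) (s t').1) (s t).1
  rw [symmetrize_formMap_incl hk hs _ _ _ ht', formIncl_apply, ← h2, ← h1, ← h2', ← h1', ← h3']
  generalize s t = x at *
  generalize s t' = x' at *
  simp only [dualMap_apply, map_add, map_sub, LinearMap.fst_apply, c.D.d_d, ← c.f.comm,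
    map_units_smul, h5, hn, Int.negOnePow_succ, e1, one_smul, Units.neg_smul] at h4 ⊢
  rw [h4]
  rw [map_neg, map_units_smul, h5, e1, one_smul]
  simp only [dualMap_apply, map_zero, map_sub, map_add, star_add, star_sub, star_zero]
  refine (congrArg (κ • ·) ?_).trans (smul_zero κ)
  simp only [smul_add, smul_sub, smul_zero]
  abel

theorem exists_formIncl_of_perp [Module.Free Λ R] [Module.Finite Λ R] (hc : c.IsPoincare)
    (hs : ∀ x, c.midDiff hk (s (c.midDiff hk x)) = c.midDiff hk x) (κ : ℤˣ) (x : c.FormModule k R)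
    (hx : ∀ t ∈ LinearMap.range (c.midDiff hk), ∀ ρ,
      symmetrize k.negOnePow (κ • c.formMap k hk R) x (formIncl s (t, ρ)) = 0) :
    ∃ t ∈ LinearMap.range (c.midDiff hk), ∃ ρ, symmetrize k.negOnePow (κ • c.formMap k hk R) x =
      symmetrize k.negOnePow (κ • c.formMap k hk R) (formIncl s (t, ρ)) := by
  have e1 : ((k * (k + 1)).negOnePow) = 1 := Int.negOnePow_even _ (Int.even_mul_succ_self _)
  obtain ⟨a, v, ⟨u, ρ⟩, w⟩ := x
  have hx' : ∀ m y v' ρ', a (ψ.symm₀ k k hk (dualMap (c.f.f k) m) + C.d (k + 1) k rfl v') +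
      w (c.δψ.symm₀ k (k + 1) (by omega) m - c.f.f (k + 1) v' + c.D.d (k + 1 + 1) (k + 1) rfl y, ρ') +
      k.negOnePow • star (m (c.D.d (k + 1) k rfl (u + c.f.f (k + 1) v))) = 0 := fun m y v' ρ' => by
    have h1 := hx _ ⟨(m, y, v'), rfl⟩ ρ'
    rw [symmetrize_formMap_incl hk hs _ _ _ ⟨_, rfl⟩, midDiff_apply, smul_eq_zero_iff_eq] at h1
    exact h1
  have hw : ∀ u' ρ', w (u', ρ') = w (u', 0) := fun u' ρ' => by
    have h1 := hx' 0 0 0 ρ'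
    simp only [map_zero, add_zero, sub_zero, StarDual.zero_apply, star_zero, smul_zero,
      zero_add] at h1
    rw [← add_zero u', ← zero_add ρ', ← Prod.mk_add_mk, map_add, h1, add_zero]
    simp
  set w₁ : StarDual Λ (c.D.X (k + 1)) := dualMap (LinearMap.inl Λ _ R) w
  have h1 : ∀ v', a (C.d (k + 1) k rfl v') = w₁ (c.f.f (k + 1) v') := fun v' => by
    have h1 := hx' 0 0 v' 0
    simp only [map_zero, zero_sub, zero_add, add_zero, StarDual.zero_apply, star_zero, smul_zero] at h1
    have h2 : w (-c.f.f (k + 1) v', 0) = -w₁ (c.f.f (k + 1) v') :=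
      map_neg w₁ _
    rwa [h2, ← sub_eq_add_neg, sub_eq_zero] at h1
  have h2 : ∀ y, w₁ (c.D.d (k + 1 + 1) (k + 1) rfl y) = 0 := fun y => by
    have h1 := hx' 0 y 0 0
    simp only [map_zero, sub_zero, zero_add, add_zero, StarDual.zero_apply, star_zero,
      smul_zero] at h1
    exact h1
  have h3 : c.D.d (k + 1) k rfl u + c.f.f k (ψ.symm₀ k k hk a + C.d (k + 1) k rfl v) +
      k.negOnePow • c.δψ.symm₀ (k + 1) k (by omega) w₁ = 0 := by
    refine ext_dual (Λ := Λ) fun m => ?_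
    have h1 := hx' m 0 0 0
    simp only [map_zero, sub_zero, add_zero] at h1
    have h4 := c.δψ.apply_symm₀_symm k (k + 1) (by omega) m w₁
    have h5 := ψ.apply_symm₀_symm k k hk (dualMap (c.f.f k) m) a
    rw [Int.negOnePow_mul_self] at h5
    rw [e1, one_smul] at h4
    rw [h5] at h1
    replace h1 := congrArg (fun t => k.negOnePow • star t) ((congrArg (_ + · + _) h4.symm).trans h1)
    simp only [map_add, star_add, star_units_smul, star_star, smul_add, smul_smul,
      Int.units_mul_self, one_smul, star_zero, smul_zero, dualMap_apply] at h1
    simp only [map_add, map_units_smul, map_zero, c.f.comm, ← h1]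
    abel
  obtain ⟨x, hx⟩ := hc.exists_dualityDiff_eq (k + 1 + 1) (k + 1) k k (k + 1) rfl rfl rfl (by omega)
    (k - 1) (k + 1 + 1) (by omega) rfl w₁ u (ψ.symm₀ k k hk a + C.d (k + 1) k rfl v)
    (StarDual.ext h2) h3 (by
      have h4 : dualMap (c.f.f (k + 1)) w₁ = dualMap (C.d (k + 1) k rfl) a :=
        StarDual.ext fun v' => (h1 v').symm
      rw [map_add, C.d_d, add_zero, c.isCycle.d_symm₀ k (k - 1) (by omega) k (k + 1) (by omega) rfl,
        h4, Int.negOnePow_succ, Units.neg_smul, add_neg_cancel])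
  refine ⟨_, ⟨x, rfl⟩, ρ, StarDual.ext fun x' => ?_⟩
  rw [symmetrize_symm, symmetrize_symm _ _ (formIncl s _), symmetrize_formMap_incl hk hs _ _ _ ⟨x, rfl⟩,
    symmetrize_formMap, hx]
  refine congrArg (fun t => k.negOnePow • star (κ • t)) ?_
  have h4 : w x'.2.2.1 = w₁ x'.2.2.1.1 := hw _ _
  simp only [map_add, star_add, smul_add, ← h1, h4]
  abel

theorem exists_symmetrize_formMap_incl (hs : ∀ x, c.midDiff hk (s (c.midDiff hk x)) = c.midDiff hk x)
    (κ : ℤˣ) (ξ : StarDual Λ (LinearMap.range (c.midDiff hk) × R)) :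
    ∃ x : c.FormModule k R, ∀ t, ∀ ht : t ∈ LinearMap.range (c.midDiff hk), ∀ ρ,
      symmetrize k.negOnePow (κ • c.formMap k hk R) x (formIncl s (t, ρ)) = ξ (⟨t, ht⟩, ρ) := by
  let Ξ : StarDual Λ ((StarDual Λ (c.D.X (k + 1)) × c.D.X (k + 1) × C.X k) × R) :=
    dualMap (LinearMap.prodMap ((c.midDiff hk).rangeRestrict ∘ₗ s) LinearMap.id) ξ
  have hΞ : ∀ t, ∀ ht : t ∈ LinearMap.range (c.midDiff hk), ∀ ρ, Ξ (t, ρ) = ξ (⟨t, ht⟩, ρ) := by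
    rintro t ⟨y, rfl⟩ ρ
    exact congrArg (fun t => ξ (t, ρ)) (Subtype.ext (hs y))
  let A : StarDual Λ (C.X k) :=
    dualMap (LinearMap.inl Λ _ R ∘ₗ LinearMap.inr Λ _ _ ∘ₗ LinearMap.inr Λ _ _) Ξ
  let W : StarDual Λ (c.D.X (k + 1) × R) :=
    dualMap (LinearMap.prodMap (LinearMap.inr Λ _ _ ∘ₗ LinearMap.inl Λ _ _) LinearMap.id) Ξ
  let u : c.D.X (k + 1) := undual _ (dualMap (LinearMap.inl Λ _ R ∘ₗ LinearMap.inl Λ _ _) Ξ)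
  have hu : ∀ w : StarDual Λ (c.D.X (k + 1)), star (w u) = Ξ ((w, 0, 0), 0) := fun w => by
    rw [apply_undual, star_star]; rfl
  refine ⟨κ • (A, 0, (k.negOnePow • u, 0), W), fun t ht ρ => ?_⟩
  rw [map_units_smul, StarDual.units_smul_apply, symmetrize_formMap_incl hk hs _ _ _ ht, smul_smul,
    Int.units_mul_self, one_smul, ← hΞ t ht ρ]
  obtain ⟨w, u', c'⟩ := t
  simp only [map_zero, add_zero, map_units_smul, star_units_smul, smul_smul, Int.units_mul_self,
    one_smul, hu]
  change Ξ ((0, 0, c'), 0) + Ξ ((0, u', 0), ρ) + _ = _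
  rw [← map_add, ← map_add]
  congr 1
  simp

theorem formMap_quad_of_radical [Module.Free Λ R] [Module.Finite Λ R] (hc : c.IsPoincare)
    (κ : ℤˣ) (x : c.FormModule k R) (hx : symmetrize k.negOnePow (κ • c.formMap k hk R) x = 0) :
    QuadQuot.mk k.negOnePow ((κ • c.formMap k hk R) x x) = 0 := by
  obtain ⟨a, v, u, w⟩ := x
  have hx' : ∀ (a' : StarDual Λ (C.X k)) (v' : C.X (k + 1)) (u' : c.D.X (k + 1) × R)
      (w' : StarDual Λ (c.D.X (k + 1) × R)), a' (ψ.symm₀ k k hk a + C.d (k + 1) k rfl v) + w' u +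
        k.negOnePow • star (a (C.d (k + 1) k rfl v')) + k.negOnePow • star (w u') = 0 :=
      fun a' v' u' w' => by
    have h1 := symmetrize_symm k.negOnePow (κ • c.formMap k hk R) (a, v, u, w) (a', v', u', w')
    rw [hx, StarDual.zero_apply, eq_comm, smul_eq_zero_iff_eq, star_eq_zero, symmetrize_formMap,
      smul_eq_zero_iff_eq] at h1
    exact h1
  have h1 : ψ.symm₀ k k hk a + C.d (k + 1) k rfl v = 0 := ext_dual (Λ := Λ) fun a' => by
    simpa using hx' a' 0 0 0
  have h2 : u = 0 := ext_dual (Λ := Λ) fun w' => by simpa using hx' 0 0 0 w'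
  have h3 : dualMap (C.d (k + 1) k rfl) a = 0 := StarDual.ext fun v' => by
    have := hx' 0 v' 0 0
    simpa [smul_eq_zero_iff_eq] using this
  obtain ⟨b, rfl⟩ := hc.exists_coboundary k k (k + 1) (k + 1) (k - 1) hk rfl rfl (by omega) a (-v) h3
    (by rw [map_neg]; exact eq_neg_of_add_eq_zero_left h1)
  rw [LinearMap.smul_apply, StarDual.units_smul_apply, map_units_smul, formMap_apply]
  refine (congrArg (κ • ·) ?_).trans (smul_zero κ)
  simp only [h2, map_zero, add_zero, map_add, dualMap_apply, C.d_d]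
  have h4 := c.isCycle.apply_eq_zero 0 k (k - 1) (k + 1) k (by push_cast; omega) rfl (by omega)
    (dualMap (C.d k (k - 1) (by omega)) b) b
  have h5 := c.isCycle.apply_eq_zero 1 (k - 1) (k - 1) k k (by push_cast; omega) (by omega) (by omega)
    b b
  have e1 : (n - (0 : ℕ) - 1).negOnePow = -1 := by
    rw [← hk, show k + k - (0 : ℕ) - 1 = k + k - 1 by push_cast; ring, Int.negOnePow_sub,
      Int.negOnePow_even _ ⟨k, rfl⟩]
    rfl
  have e2 : (k * (k - 1)).negOnePow = 1 := Int.negOnePow_even _ (Int.even_mul_pred_self _)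
  have e3 : (n - (1 : ℕ) - 1).negOnePow = 1 := by
    rw [← hk, show k + k - (1 : ℕ) - 1 = (k - 1) + (k - 1) by push_cast; ring]
    exact Int.negOnePow_even _ ⟨_, rfl⟩
  have e4 : (k - 1).negOnePow = -k.negOnePow := by rw [Int.negOnePow_sub]; simp
  rw [h3, e1, e2, show (((0 : ℕ) : ℤ) + 1).negOnePow = -1 from rfl] at h4
  rw [e3, Int.negOnePow_mul_self, e4, show (((1 : ℕ) : ℤ) + 1).negOnePow = 1 from rfl] at h5
  have h6 := congrArg (QuadQuot.mk k.negOnePow) h4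
  have h7 := congrArg (QuadQuot.mk k.negOnePow) h5
  simp only [map_add, map_zero, map_units_smul, mk_star, Units.neg_smul, one_smul, smul_zero,
    add_zero, map_neg, dualMap_apply, smul_neg, neg_neg] at h6 h7
  rw [smul_smul k.negOnePow, Int.units_mul_self, one_smul, add_neg_cancel, add_zero] at h7
  have h8 := congrArg (k.negOnePow • ·) h7
  simp only [smul_add, smul_neg, smul_smul, Int.units_mul_self, one_smul, smul_zero] at h8
  refine Eq.trans ?_ (congrArg₂ (· - ·) h6 h8 |>.trans (sub_zero _))
  abel

variable (c k) in
theorem stablyFree_range_midDiff (hc : c.IsPoincare) :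
    StablyFree Λ (LinearMap.range (c.midDiff hk)) :=
  hc.stablyFree_range _ _ _ _ _ _ _ _ _

variable (c) in
theorem isElementary_of_isPoincare (hc : c.IsPoincare) {ε : ℤˣ} (hε : k.negOnePow = -ε) (κ : ℤˣ)
    [Module.Free Λ R] [Module.Finite Λ R] [Module.Free Λ (LinearMap.range (c.midDiff hk) × R)]
    [Module.Finite Λ (LinearMap.range (c.midDiff hk) × R)] (z : RegSplitPreformation Λ ε)
    {U : Type u} [AddCommGroup U] [Module Λ U] [Module.Free Λ U] [Module.Finite Λ U]
    (p : U →ₗ[Λ] z.G) (l : U →ₗ[Λ] c.FormModule k R)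
    (hqU : ∀ u, z.quad (p u) + QuadQuot.mk (-ε) ((κ • c.formMap k hk R) (l u) (l u)) = 0)
    (hfU : ∀ u u', z.μ (p u) (z.γ (p u')) +
      symmetrize k.negOnePow (κ • c.formMap k hk R) (l u) (l u') = 0)
    (hex : ∀ (φ : StarDual Λ z.F) (m : c.FormModule k R), (∀ u, φ (z.γ (p u)) +
        symmetrize k.negOnePow (κ • c.formMap k hk R) m (l u) = 0) →
      ∃ u, z.μ (p u) = φ ∧ symmetrize k.negOnePow (κ • c.formMap k hk R) (l u) =
        symmetrize k.negOnePow (κ • c.formMap k hk R) m)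
    (hsU : ∀ ξ : StarDual Λ U, ∃ (φ : StarDual Λ z.F) (m : c.FormModule k R), ∀ u, φ (z.γ (p u)) +
        symmetrize k.negOnePow (κ • c.formMap k hk R) m (l u) = ξ u)
    (hinj : ∀ u, z.μ (p u) = 0 → symmetrize k.negOnePow (κ • c.formMap k hk R) (l u) = 0 → u = 0) :
    LMonoid.IsElementary (LMonoid.mk z) := by
  obtain ⟨s, hs⟩ : ∃ s : (StarDual Λ (c.D.X (k + 1)) × c.D.X (k + 1) × C.X k) →ₗ[Λ]
      (StarDual Λ (c.D.X k) × c.D.X (k + 1 + 1) × C.X (k + 1)), ∀ x, c.midDiff hk (s (c.midDiff hk x)) = c.midDiff hk x :=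
    hc.exists_splitting _ _ _ _ _ _ _ _ _
  refine LMonoid.isElementary_of_exact z (κ • c.formMap k hk R)
    (formIncl s ∘ₗ LinearMap.prodMap (LinearMap.range (c.midDiff hk)).subtype LinearMap.id)
    ?_ ?_ ?_ ?_ ?_ p l hqU ?_ ?_ ?_ ?_ <;> rw [← hε]
  · rintro ⟨⟨t, ht⟩, ρ⟩
    exact formIncl_quad hk hs κ t ht ρ
  · rintro ⟨⟨t, ht⟩, ρ⟩ ⟨⟨t', ht'⟩, ρ'⟩
    exact formIncl_form hk hs κ t t' ht ht' ρ ρ'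
  · intro x hx
    obtain ⟨t, ht, ρ, h⟩ := exists_formIncl_of_perp hk hc hs κ x fun t ht ρ => hx (⟨t, ht⟩, ρ)
    exact ⟨(⟨t, ht⟩, ρ), h⟩
  · intro ξ
    obtain ⟨x, hx⟩ := exists_symmetrize_formMap_incl hk hs κ ξ
    exact ⟨x, StarDual.ext fun t => hx _ _ _⟩
  · exact formMap_quad_of_radical hk hc κ
  · exact hfU
  · exact hex
  · exact hsU
  · exact hinj

end QuadPair

end SurgeryForm

section ElementaryCriterion

variable {Λ : Type u} [Ring Λ] [StarRing Λ]

open FreeComplex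

namespace QuadPair

variable {C : FreeComplex Λ} {n : ℤ} {ψ : QStruct C n} (c : QuadPair C n ψ) {k : ℤ} (hk : k + k = n)

set_option maxHeartbeats 800000 in
/-- An `ε`-quadratic split preformation `z` is stably elementary, if there are a Poincaré pair with
boundary `(C, ψ)` and a map `α : C_k → G^*` which pulls the form of `z` back to that of `C^k`, such
that `G` is identified with the homology of the algebraic mapping cone of `α` in the middle
dimension. -/
theorem isElementary_of_alpha (hc : c.IsPoincare) {ε : ℤˣ} (hε : k.negOnePow = -ε)
    (z : RegSplitPreformation Λ ε) (α : C.X k →ₗ[Λ] StarDual Λ z.G)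
    (hα : ∀ v, α (C.d (k + 1) k rfl v) = 0)
    (hquad : ∀ x, z.quad x + QuadQuot.mk (-ε) (ε • adj α x (ψ 0 k k (by simpa using hk) (adj α x))) = 0)
    (hform : ∀ x y, z.μ x (z.γ y) + ε • adj α x (ψ.symm₀ k k hk (adj α y)) = 0)
    (hsf : StablyFree Λ (LinearMap.range (dualMap (C.d (k + 1) k rfl))))
    (σ : StarDual Λ (C.X (k + 1)) →ₗ[Λ] StarDual Λ (C.X k))
    (hσ : ∀ a, dualMap (C.d (k + 1) k rfl) (σ (dualMap (C.d (k + 1) k rfl) a)) =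
      dualMap (C.d (k + 1) k rfl) a)
    (hex : ∀ (φ : StarDual Λ z.F) (b : C.X k), C.d k (k - 1) (by omega) b = 0 →
      dualMap z.γ φ = α b → ∃ x v, z.μ x = φ ∧ b = ψ.symm₀ k k hk (adj α x) + C.d (k + 1) k rfl v)
    (hsurj : ∀ ξ : StarDual Λ z.G, ∃ (φ : StarDual Λ z.F) (b : C.X k),
      C.d k (k - 1) (by omega) b = 0 ∧ dualMap z.γ φ - α b = ξ)
    (hinj : ∀ x v, z.μ x = 0 → ψ.symm₀ k k hk (adj α x) = C.d (k + 1) k rfl v → x = 0) :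
    LMonoid.IsElementary (LMonoid.mk z) := by
  obtain ⟨R, _, _, _, _, ⟨_, _⟩, ⟨_, _⟩⟩ := hsf.common (stablyFree_range_midDiff c k hk hc)
  have hεε : ε * k.negOnePow = -1 := by rw [hε, mul_neg, Int.units_mul_self]
  let I := LinearMap.range (dualMap (C.d (k + 1) k rfl))
  let δ : StarDual Λ (C.X k) →ₗ[Λ] I := (dualMap (C.d (k + 1) k rfl)).rangeRestrict
  let V : StarDual Λ (I × R) →ₗ[Λ] C.X (k + 1) :=
    (undual _).toLinearMap ∘ₗ dualMap (LinearMap.inl Λ I R ∘ₗ δ ∘ₗ σ)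
  have hV : ∀ (Q : StarDual Λ (I × R)) (a : StarDual Λ (C.X k)), a (C.d (k + 1) k rfl (V Q)) = star (Q (δ a, 0)) := fun Q a => by
    refine (apply_undual _ (dualMap (C.d (k + 1) k rfl) a)).trans ?_
    exact congrArg (fun t : I => star (Q (t, 0))) (Subtype.ext (hσ a))
  let l : z.G × StarDual Λ (I × R) × c.D.X (k + 1) →ₗ[Λ] c.FormModule k R :=
    LinearMap.prod (adj α ∘ₗ LinearMap.fst Λ _ _)
      (LinearMap.prod (V ∘ₗ LinearMap.fst Λ _ _ ∘ₗ LinearMap.snd Λ _ _)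
        (LinearMap.prod (LinearMap.inl Λ _ R ∘ₗ LinearMap.snd Λ _ _ ∘ₗ LinearMap.snd Λ _ _)
          (dualMap (LinearMap.inr Λ I R ∘ₗ LinearMap.snd Λ _ R) ∘ₗ LinearMap.fst Λ _ _ ∘ₗ
            LinearMap.snd Λ _ _)))
  have hl : ∀ x Q u, l (x, Q, u) =
    (adj α x, V Q, (u, 0), dualMap (LinearMap.inr Λ I R ∘ₗ LinearMap.snd Λ _ R) Q) := fun _ _ _ => rfl
  have hlam : ∀ (a : StarDual Λ (C.X k)) (v : C.X (k + 1)) (u : c.D.X (k + 1)) (u' : R)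
      (w : StarDual Λ (c.D.X (k + 1) × R)) (x : z.G) (Q : StarDual Λ (I × R)) (u₀ : c.D.X (k + 1)),
      symmetrize k.negOnePow (ε • c.formMap k hk R) (a, v, (u, u'), w)
      (l (x, Q, u₀)) = ε • (a (ψ.symm₀ k k hk (adj α x)) + star (Q (δ a, k.negOnePow • u')) +
        w (u₀, 0)) := by
    intro a v u u' w x Q u₀
    have h1 : (δ a, k.negOnePow • u') = (δ a, (0 : R)) + k.negOnePow • ((0 : I), u') := by
      rcases Int.units_eq_one_or k.negOnePow with h | h <;> simp [h]
    rw [symmetrize_formMap, hl, h1]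
    simp only [map_add, hV, star_add, adj_apply, hα, StarDual.zero_apply, star_zero, smul_zero,
      add_zero, map_units_smul, star_units_smul]
    change ε • (_ + _ + _ + k.negOnePow • star (Q (0, u'))) = _
    congr 1
    abel
  have hψ : ∀ (a : StarDual Λ (C.X k)) (x : z.G), a (ψ.symm₀ k k hk (adj α x)) = k.negOnePow • α (ψ.symm₀ k k hk a) x := by
    intro a x
    rw [ψ.apply_symm₀_symm, Int.negOnePow_mul_self, adj_apply, star_star]
  refine c.isElementary_of_isPoincare hk (R := R) hc hε ε z (LinearMap.fst Λ _ _) l ?_ ?_ ?_ ?_ ?_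
  · rintro ⟨x, Q, u⟩
    rw [LinearMap.smul_apply, StarDual.units_smul_apply, formMap_apply, hl, map_add, adj_apply,
      adj_apply, hα, StarDual.zero_apply, star_zero, add_zero]
    change _ + QuadQuot.mk (-ε) (ε • (_ + Q (0, 0))) = 0
    rw [show Q (0, 0) = 0 from map_zero Q, add_zero]
    exact hquad x
  · rintro ⟨x, Q, u⟩ ⟨x', Q', u'⟩
    have h1 : δ (adj α x) = 0 := Subtype.ext (StarDual.ext fun v => by
      change star (α (C.d (k + 1) k rfl v) x) = 0
      rw [hα, StarDual.zero_apply, star_zero])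
    rw [hl x Q u, hlam, smul_zero, h1, show Q' (0, 0) = 0 from map_zero Q', star_zero, add_zero]
    change _ + ε • (_ + Q (0, 0)) = 0
    rw [show Q (0, 0) = 0 from map_zero Q, add_zero]
    exact hform x x'
  · rintro φ ⟨a, v, ⟨u, u'⟩, w⟩ h
    have h0 : ∀ (x : z.G) (Q : StarDual Λ (I × R)) (u₀ : c.D.X (k + 1)), φ (z.γ x) + ε • (k.negOnePow • α (ψ.symm₀ k k hk a) x +
        star (Q (δ a, k.negOnePow • u')) + w (u₀, 0)) = 0 := fun x Q u₀ => by
      rw [← hψ, ← hlam a v u]; exact h (x, Q, u₀)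
    have h1 : (δ a, k.negOnePow • u') = 0 := ext_dual (Λ := Λ) fun Q => by
      have h1 := h0 0 Q 0
      rw [show w (0, 0) = 0 from map_zero w, map_zero, map_zero, map_zero, smul_zero, zero_add,
        zero_add, add_zero, smul_eq_zero_iff_eq, star_eq_zero] at h1
      rw [h1, map_zero]
    have h2 : ∀ u₀, w (u₀, 0) = 0 := fun u₀ => by
      have h2 := h0 0 0 u₀
      rwa [map_zero, map_zero, map_zero, smul_zero, zero_add, zero_add, StarDual.zero_apply, star_zero,
        zero_add, smul_eq_zero_iff_eq] at h2
    have h3 : dualMap z.γ φ = α (ψ.symm₀ k k hk a) := StarDual.ext fun x => by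
      have h3 := h0 x 0 0
      rw [show w (0, 0) = 0 from map_zero w, StarDual.zero_apply, star_zero, add_zero, add_zero,
        smul_smul, hεε, Units.neg_smul, one_smul, ← sub_eq_add_neg, sub_eq_zero] at h3
      exact h3
    have h4 : dualMap (C.d (k + 1) k rfl) a = 0 := 
      congrArg (fun t : I × R => (t.1.1 : StarDual Λ (C.X (k + 1)))) h1
    have h5 : u' = 0 := by
      have := congrArg Prod.snd h1
      rwa [Prod.snd_zero, smul_eq_zero_iff_eq] at this
    obtain ⟨x, v₀, hx, hv₀⟩ := hex φ (ψ.symm₀ k k hk a + C.d (k + 1) k rfl v)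
      (by rw [map_add, C.d_d, add_zero, c.isCycle.d_symm₀ k (k - 1) (by omega) k (k + 1) (by omega) rfl,
        h4, map_zero, smul_zero]) (by rw [map_add, hα, add_zero, h3])
    let Q : StarDual Λ (I × R) := dualMap (LinearMap.fst Λ I R) (dualMap I.subtype (evalDual _ v₀)) +
      dualMap (LinearMap.inr Λ _ R ∘ₗ LinearMap.snd Λ I R) w
    have hQ : ∀ (t : I) (r : R), Q (t, r) = star (t.1 v₀) + w (0, r) := fun _ _ => rfl
    refine ⟨(x, Q, u), hx, StarDual.ext ?_⟩
    rintro ⟨a₁, v₁, ⟨u₁, u₁'⟩, w₁⟩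
    rw [symmetrize_symm, hlam, symmetrize_symm _ _ _ (a₁, v₁, _, w₁), symmetrize_formMap, hQ, hv₀, h5]
    refine congrArg (fun t => k.negOnePow • star (ε • t)) ?_
    have h6 : a (C.d (k + 1) k rfl v₁) = 0 := DFunLike.congr_fun h4 v₁
    have h7 : w (u₁, u₁') = w (0, u₁') := by
      have : (u₁, u₁') = (u₁, (0 : R)) + (0, u₁') := by simp
      rw [this, map_add, h2, zero_add]
    have h8 : w (0, k.negOnePow • u₁') = k.negOnePow • w (0, u₁') := by
      have : ((0 : c.D.X (k + 1)), k.negOnePow • u₁') = k.negOnePow • (0, u₁') := by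
        rcases Int.units_eq_one_or k.negOnePow with h | h <;> simp [h]
      rw [this, map_units_smul]
    have h9 : (δ a₁).1 v₀ = a₁ (C.d (k + 1) k rfl v₀) := rfl
    simp only [map_add, star_add, star_star, h6, h7, h8, h9, star_zero, smul_zero, add_zero,
      star_units_smul]
    abel
  · intro ξ
    obtain ⟨T, hT⟩ : ∃ T : I × R, ∀ Q : StarDual Λ (I × R), star (Q T) = ξ (0, Q, 0) :=
      ⟨undual _ (dualMap (LinearMap.inr Λ z.G _ ∘ₗ LinearMap.inl Λ _ _) ξ), fun Q => by
        rw [apply_undual, star_star]; rfl⟩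
    obtain ⟨a₀, ha₀⟩ : ∃ a₀, δ a₀ = T.1 := by
      obtain ⟨a₀, ha₀⟩ := T.1.2
      exact ⟨a₀, Subtype.ext ha₀⟩
    obtain ⟨φ, b, hb, hφ⟩ := hsurj (dualMap (LinearMap.inl Λ _ _) ξ + ε • α (ψ.symm₀ k k hk a₀))
    obtain ⟨a₁, v₁, ha₁, rfl⟩ := hc.exists_cocycle k k (k + 1) (k + 1) (k - 1) hk rfl rfl (by omega)
      b hb
    have hδ : δ a₁ = 0 := Subtype.ext ha₁
    refine ⟨φ, (ε • a₀ + a₁, 0, (0, (k.negOnePow * ε) • T.2), ε • dualMap (LinearMap.fst Λ _ R)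
      (dualMap (LinearMap.inr Λ z.G _ ∘ₗ LinearMap.inr Λ _ _) ξ)), ?_⟩
    rintro ⟨x, Q, u⟩
    have h1 : star (Q (ε • T.1, ε • T.2)) = ε • ξ (0, Q, 0) := by
      rw [← hT, ← star_units_smul, ← map_units_smul]
      rfl
    rw [hlam, hψ, map_add δ, map_units_smul δ, ha₀, hδ, add_zero, smul_smul, ← mul_assoc,
      Int.units_mul_self, one_mul, h1,
      StarDual.units_smul_apply, smul_add, smul_add, smul_smul, smul_smul, smul_smul,
      Int.units_mul_self, one_smul, one_smul, hεε]
    have h2 := DFunLike.congr_fun hφ x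
    rw [map_add α, hα, add_zero] at h2
    simp only [StarDual.sub_apply, StarDual.add_apply, dualMap_apply, LinearMap.inl_apply,
      StarDual.units_smul_apply, map_add, map_units_smul, sub_eq_iff_eq_add, Units.neg_smul,
      one_smul] at h2 ⊢
    have h3 : (x, Q, u) = (x, 0) + ((0, Q, 0) + (0, 0, u)) := by simp
    change φ (z.γ x) + (-(ε • α (ψ.symm₀ k k hk a₀) x + α (ψ.symm₀ k k hk a₁) x) + ξ (0, Q, 0) + ξ (0, 0, u)) = ξ (x, Q, u)
    rw [h2, h3, map_add, map_add]
    change _ = ξ (x, 0) + _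
    abel
  · rintro ⟨x, Q, u⟩ hx h
    have h0 : ∀ (a : StarDual Λ (C.X k)) (v : C.X (k + 1)) (u₁ : c.D.X (k + 1)) (u' : R)
        (w : StarDual Λ (c.D.X (k + 1) × R)), a (ψ.symm₀ k k hk (adj α x)) + star (Q (δ a, k.negOnePow • u')) +
        w (u, 0) = 0 := fun a v u₁ u' w => by
      have h1 := symmetrize_symm k.negOnePow (ε • c.formMap k hk R) (l (x, Q, u)) (a, v, (u₁, u'), w)
      rw [h, hlam, StarDual.zero_apply, eq_comm, smul_eq_zero_iff_eq, star_eq_zero,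
        smul_eq_zero_iff_eq] at h1
      exact h1
    have hu : u = 0 := ext_dual (Λ := Λ) fun w => by
      have h1 := h0 0 0 0 0 (dualMap (LinearMap.fst Λ _ R) w)
      simp only [StarDual.zero_apply, map_zero, smul_zero, zero_add] at h1
      rw [show Q (0, 0) = 0 from map_zero Q, star_zero, zero_add] at h1
      rw [map_zero]
      exact h1
    have h1 : ∀ a u', a (ψ.symm₀ k k hk (adj α x)) + star (Q (δ a, u')) = 0 := fun a u' => by
      have h1 := h0 a 0 0 (k.negOnePow • u') 0
      rwa [smul_smul, Int.units_mul_self, one_smul, StarDual.zero_apply, add_zero] at h1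
    have hx' : x = 0 := by
      refine hinj x (-V Q) hx (ext_dual (Λ := Λ) fun a => ?_)
      rw [map_neg, map_neg, hV]
      exact eq_neg_of_add_eq_zero_left (h1 a 0)
    have hQ : Q = 0 := StarDual.ext fun t => by
      obtain ⟨⟨_, a, rfl⟩, r⟩ := t
      have h2 := h1 a r
      rw [hx', map_zero, map_zero, map_zero, zero_add, star_eq_zero] at h2
      exact h2
    rw [hx', hQ, hu]
    rfl

end QuadPair

end ElementaryCriterion

section UnionCoordinates

variable {Λ : Type u} [Ring Λ] [StarRing Λ] {C D₁ D₂ : FreeComplex Λ} {n : ℤ}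
  (f₁ : ChainMap C D₁) (f₂ : ChainMap C D₂)

/-- The inclusion `C_k → (D₁ ∪_C D₂)_r`, for `k = r - 1`. -/
def unionMid (r k : ℤ) (h : k + 1 = r) : C.X k →ₗ[Λ] (unionComplex f₁ f₂).X r :=
  unionIn₂ f₁ f₂ r ∘ₗ C.idMap k (r - 1) (by omega)

theorem exists_eq_union (r k : ℤ) (h : k + 1 = r) (c : (unionComplex f₁ f₂).X r) :
    ∃ e b y, c = unionIn₁ f₁ f₂ r e + unionMid f₁ f₂ r k h b + unionIn₃ f₁ f₂ r y := by
  obtain rfl : k = r - 1 := by omega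
  obtain ⟨e, b, y⟩ := c
  refine ⟨e, b, y, ?_⟩
  change (e, b, y) = (e + 0 + 0, 0 + b + 0, 0 + 0 + y)
  simp

theorem union_eq_zero (r k : ℤ) (h : k + 1 = r) (e : D₁.X r) (b : C.X k) (y : D₂.X r)
    (hc : unionIn₁ f₁ f₂ r e + unionMid f₁ f₂ r k h b + unionIn₃ f₁ f₂ r y = 0) :
    e = 0 ∧ b = 0 ∧ y = 0 := by
  obtain rfl : k = r - 1 := by omega
  change (e + 0 + 0, 0 + b + 0, 0 + 0 + y) = (0, 0, 0) at hc
  simpa using hc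

theorem d_unionMid (i j k : ℤ) (hij : j + 1 = i) (hjk : k + 1 = j) (b : C.X j) :
    (unionComplex f₁ f₂).d i j hij (unionMid f₁ f₂ i j hij b) =
      j.negOnePow • unionIn₁ f₁ f₂ j (f₁.f j b) + unionMid f₁ f₂ j k hjk (C.d j k hjk b) +
        j.negOnePow • unionIn₃ f₁ f₂ j (f₂.f j b) := by
  obtain rfl : j = i - 1 := by omega
  obtain rfl : k = i - 1 - 1 := by omega
  exact d_unionIn₂ f₁ f₂ i (i - 1) hij b

theorem apply_unionStruct' (δ₁ : QStruct D₁ (n + 1)) (δ₂ : QStruct D₂ (n + 1)) (ψ : QStruct C n)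
    (s : ℕ) (p r p' r' : ℤ) (h : p + r + s = n + 1) (hp : p' + 1 = p) (hr : r' + 1 = r)
    (A : StarDual Λ ((unionComplex f₁ f₂).X p)) (B : StarDual Λ ((unionComplex f₁ f₂).X r)) :
    B (unionStruct f₁ f₂ δ₁ δ₂ ψ s p r h A) =
      dualMap (unionIn₁ f₁ f₂ r) B (δ₁ s p r h (dualMap (unionIn₁ f₁ f₂ p) A))
      + ((n - r).negOnePow • dualMap (unionMid f₁ f₂ r r' hr) B (ψ s p r' (by omega)
            (dualMap (f₁.f p) (dualMap (unionIn₁ f₁ f₂ p) A)))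
        + (n - r - s + 1).negOnePow • (p' * r').negOnePow •
          star (dualMap (unionMid f₁ f₂ p p' hp) A
            (ψ (s + 1) r' p' (by push_cast; omega) (dualMap (unionMid f₁ f₂ r r' hr) B))))
      + ((s : ℤ).negOnePow • dualMap (f₂.f r) (dualMap (unionIn₃ f₁ f₂ r) B)
            (ψ s p' r (by omega) (dualMap (unionMid f₁ f₂ p p' hp) A))
        + dualMap (unionIn₃ f₁ f₂ r) B (δ₂ s p r h (dualMap (unionIn₃ f₁ f₂ p) A))) := by
  obtain rfl : p' = p - 1 := by omega
  obtain rfl : r' = r - 1 := by omega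
  exact apply_unionStruct f₁ f₂ δ₁ δ₂ ψ s p r h A B

end UnionCoordinates

section DualSplitting

variable {Λ : Type u} [Ring Λ] [StarRing Λ]

namespace FreeComplex

variable (C : FreeComplex Λ) (p p' : ℤ) (hp : p + 1 = p')

theorem exactAt_dual_of_cohomology
    (hC : ∀ (i j k : ℤ) (hij : i + 1 = j) (hjk : j + 1 = k), p < j → ∀ a : StarDual Λ (C.X j),
    dualMap (C.d k j hjk) a = 0 → ∃ a₀, a = dualMap (C.d j i hij) a₀)
    (j : ℤ) (hj : j < -p) : (C.dual 0).ExactAt j := by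
  intro i k hij hjk a ha
  replace ha : j.negOnePow • dualMap (C.d (0 - k) (0 - j) (by omega)) a = 0 := ha
  rw [smul_eq_zero_iff_eq] at ha
  obtain ⟨a₀, h⟩ := hC (0 - i) (0 - j) (0 - k) (by omega) (by omega) (by omega) a ha
  refine ⟨C.toDual 0 i (i.negOnePow • a₀), ?_⟩
  change i.negOnePow • dualMap _ (i.negOnePow • a₀) = _
  rw [map_units_smul, smul_smul, Int.units_mul_self, one_smul]
  exact h.symm

theorem exists_splitting_dualMap
    (hC : ∀ (i j k : ℤ) (hij : i + 1 = j) (hjk : j + 1 = k), p < j → ∀ a : StarDual Λ (C.X j),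
    dualMap (C.d k j hjk) a = 0 → ∃ a₀, a = dualMap (C.d j i hij) a₀) :
    ∃ σ : StarDual Λ (C.X p') →ₗ[Λ] StarDual Λ (C.X p),
    ∀ a, dualMap (C.d p' p hp) (σ (dualMap (C.d p' p hp) a)) = dualMap (C.d p' p hp) a := by
  obtain ⟨i, rfl⟩ : ∃ i, p = 0 - i := ⟨-p, by omega⟩
  obtain ⟨j, rfl⟩ : ∃ j, p' = 0 - j := ⟨-p', by omega⟩
  obtain ⟨s, hs⟩ := (C.dual 0).exists_splitting i
    (fun j hj => C.exactAt_dual_of_cohomology (0 - i) hC j (by omega)) i j (by omega) (by omega)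
  refine ⟨i.negOnePow • s, fun a => ?_⟩
  have h : i.negOnePow • dualMap (C.d (0 - j) (0 - i) hp) (s (i.negOnePow • dualMap (C.d (0 - j) (0 - i) hp) a)) =
    i.negOnePow • dualMap (C.d (0 - j) (0 - i) hp) a := hs a
  have h1 := congrArg (i.negOnePow • ·) h
  simp only [smul_smul, Int.units_mul_self, one_smul] at h1
  exact (congrArg _ (map_units_smul s _ _).symm).trans h1

theorem stablyFree_range_dualMap
    (hC : ∀ (i j k : ℤ) (hij : i + 1 = j) (hjk : j + 1 = k), p < j → ∀ a : StarDual Λ (C.X j),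
    dualMap (C.d k j hjk) a = 0 → ∃ a₀, a = dualMap (C.d j i hij) a₀) :
    StablyFree Λ (LinearMap.range (dualMap (C.d p' p hp))) := by
  obtain ⟨i, rfl⟩ : ∃ i, p = 0 - i := ⟨-p, by omega⟩
  obtain ⟨j, rfl⟩ : ∃ j, p' = 0 - j := ⟨-p', by omega⟩
  have h := (C.dual 0).stablyFree_range i
    (fun j hj => C.exactAt_dual_of_cohomology (0 - i) hC j (by omega)) i j (by omega) (by omega)
  have h1 : LinearMap.range ((C.dual 0).d i j (by omega)) =
      LinearMap.range (dualMap (C.d (0 - j) (0 - i) hp)) := by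
    ext y
    constructor
    · rintro ⟨a, rfl⟩
      exact ⟨i.negOnePow • a, map_units_smul _ _ _⟩
    · rintro ⟨a, rfl⟩
      refine ⟨C.toDual 0 i (i.negOnePow • a), ?_⟩
      change i.negOnePow • dualMap _ (i.negOnePow • a) = _
      rw [map_units_smul, smul_smul, Int.units_mul_self, one_smul]
  exact h1 ▸ h

end FreeComplex

end DualSplitting

section GluedX

variable {Λ : Type u} [Ring Λ] [StarRing Λ]

open FreeComplex

namespace RegSplitPreformation

variable {q : ℕ} {z : RegSplitPreformation Λ ((-1) ^ q)} {θ : z.G →ₗ[Λ] StarDual Λ z.G}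
  {hθ : z.IsRepresentative θ} (x' : QuadPair (bdX hθ) (2 * q + 1) (omegaX hθ))

/-- The complex `E' ∪ E`, for a pair with boundary `∂E`. -/
abbrev glX : FreeComplex Λ := unionComplex x'.f (mapX hθ)

/-- The structure on `E' ∪ E`. -/
abbrev glStructX : QStruct (glX x') (2 * q + 1 + 1) := x'.gluedStruct (pairX z θ hθ)

/-- The inclusion of `G` into `E' ∪ E`. -/
def inGlG (r : ℤ) : z.G →ₗ[Λ] (glX x').X r :=
  unionIn₃ x'.f (mapX hθ) r ∘ₗ Conc.of (Λ := Λ) (q + 1 : ℤ) z.G r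

/-- The extension of `α` to `E' ∪ E`. -/
def alphaGl (r : ℤ) : (glX x').X r →ₗ[Λ] StarDual Λ z.G :=
  alphaB hθ (r - 1) ∘ₗ LinearMap.fst Λ ((bdX hθ).X (r - 1)) (Conc (q + 1 : ℤ) z.G r) ∘ₗ
      LinearMap.snd Λ (x'.D.X r) ((bdX hθ).X (r - 1) × Conc (q + 1 : ℤ) z.G r) -
    dualMap z.γ ∘ₗ z.μ ∘ₗ Conc.out (Λ := Λ) (q + 1 : ℤ) z.G r ∘ₗ
      LinearMap.snd Λ ((bdX hθ).X (r - 1)) (Conc (q + 1 : ℤ) z.G r) ∘ₗ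
      LinearMap.snd Λ (x'.D.X r) ((bdX hθ).X (r - 1) × Conc (q + 1 : ℤ) z.G r)

theorem exists_eq_gl (r k : ℤ) (h : k + 1 = r) (c : (glX x').X r) : ∃ e b y,
    c = unionIn₁ x'.f (mapX hθ) r e + unionMid x'.f (mapX hθ) r k h b + inGlG x' r y := by
  obtain ⟨e, b, y, hc⟩ := exists_eq_union x'.f (mapX hθ) r k h c
  exact ⟨e, b, Conc.out (Λ := Λ) (q + 1 : ℤ) z.G r y, hc.trans (congrArg
    (fun t => _ + unionIn₃ x'.f (mapX hθ) r t) (Conc.of_out y).symm)⟩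

theorem inGlG_eq_zero {r : ℤ} (h : r ≠ q + 1) (y : z.G) : inGlG x' r y = 0 :=
  (congrArg (unionIn₃ x'.f (mapX hθ) r) (Conc.of_eq_zero h y)).trans (map_zero _)

theorem gl_eq_zero (r k : ℤ) (h : k + 1 = r) (e : x'.D.X r) (b : (bdX hθ).X k) (y : z.G)
    (hc : unionIn₁ x'.f (mapX hθ) r e + unionMid x'.f (mapX hθ) r k h b + inGlG x' r y = 0) :
    e = 0 ∧ b = 0 ∧ (r = q + 1 → y = 0) := by
  obtain ⟨h1, h2, h3⟩ := union_eq_zero x'.f (mapX hθ) r k h e b _ hc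
  refine ⟨h1, h2, fun hr => ?_⟩
  rw [← Conc.out_of (Λ := Λ) hr y]
  exact (congrArg (Conc.out (Λ := Λ) (q + 1 : ℤ) z.G r) h3).trans (map_zero _)

theorem d_inGlG (i j : ℤ) (h : j + 1 = i) (y : z.G) : (glX x').d i j h (inGlG x' i y) = 0 :=
  (d_unionIn₃ x'.f (mapX hθ) i j h _).trans (map_zero _)

theorem d_glMid (i j k : ℤ) (hij : j + 1 = i) (hjk : k + 1 = j) (b : (bdX hθ).X j) :
    (glX x').d i j hij (unionMid x'.f (mapX hθ) i j hij b) =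
      j.negOnePow • unionIn₁ x'.f (mapX hθ) j (x'.f.f j b) +
        unionMid x'.f (mapX hθ) j k hjk ((bdX hθ).d j k hjk b) +
        j.negOnePow • inGlG x' j (gVal hθ j b) :=
  d_unionMid x'.f (mapX hθ) i j k hij hjk b

theorem alphaGl_in₁ (r : ℤ) (e : x'.D.X r) :
    alphaGl x' r (unionIn₁ x'.f (mapX hθ) r e) = 0 := by
  change alphaB hθ (r - 1) 0 - dualMap z.γ (z.μ (Conc.out (Λ := Λ) (q + 1 : ℤ) z.G r 0)) = 0
  simp

theorem alphaGl_mid (r k : ℤ) (h : k + 1 = r) (b : (bdX hθ).X k) :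
    alphaGl x' r (unionMid x'.f (mapX hθ) r k h b) = alphaB hθ k b := by
  obtain rfl : k = r - 1 := by omega
  change alphaB hθ (r - 1) b - dualMap z.γ (z.μ (Conc.out (Λ := Λ) (q + 1 : ℤ) z.G r 0)) = _
  simp

theorem alphaGl_inGlG {r : ℤ} (h : r = q + 1) (y : z.G) :
    alphaGl x' r (inGlG x' r y) = -dualMap z.γ (z.μ y) := by
  change alphaB hθ (r - 1) 0 - dualMap z.γ (z.μ (Conc.out (Λ := Λ) (q + 1 : ℤ) z.G r
    (Conc.of (Λ := Λ) (q + 1 : ℤ) z.G r y))) = _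
  rw [Conc.out_of h, map_zero, zero_sub]

theorem negOnePow_succ_eq (q : ℕ) : ((q : ℤ) + 1).negOnePow = -(-1) ^ q := by
  rw [Int.negOnePow_succ, negOnePow_eq]

theorem alphaGl_d {i : ℤ} (hi : (q : ℤ) + 1 + 1 = i) (c : (glX x').X i) :
    alphaGl x' (q + 1) ((glX x').d i (q + 1) hi c) = 0 := by
  obtain ⟨e, b, y, rfl⟩ := exists_eq_gl x' i (q + 1) hi c
  rw [map_add, map_add, map_add, d_inGlG, d_unionIn₁, d_glMid x' i (q + 1) q hi rfl]
  simp only [map_add, map_neg, map_units_smul, alphaGl_in₁, alphaGl_mid, alphaGl_inGlG, alphaB_d,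
    negOnePow_succ_eq, map_zero, smul_zero, Units.neg_smul, smul_neg]
  abel

/-- The cochain of `E' ∪ E` given by `x ∈ G`. -/
abbrev betaGl (r : ℤ) (x : z.G) : StarDual Λ ((glX x').X r) := adj (alphaGl x' r) x

theorem betaGl_in₁ (r : ℤ) (x : z.G) :
    dualMap (unionIn₁ x'.f (mapX hθ) r) (betaGl x' r x) = 0 :=
  StarDual.ext fun e => by
    rw [dualMap_apply, adj_apply, alphaGl_in₁, StarDual.zero_apply, star_zero, StarDual.zero_apply]

theorem betaGl_mid (r k : ℤ) (h : k + 1 = r) (x : z.G) :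
    dualMap (unionMid x'.f (mapX hθ) r k h) (betaGl x' r x) = alphaX hθ k x :=
  StarDual.ext fun e => by rw [dualMap_apply, adj_apply, alphaGl_mid, alphaX_apply]

theorem betaGl_mapX {r : ℤ} (h : r = q + 1) (x : z.G) (b : (bdX hθ).X r) :
    dualMap ((mapX hθ).f r) (dualMap (unionIn₃ x'.f (mapX hθ) r) (betaGl x' r x)) b =
      ((-1) ^ q : ℤˣ) • z.μ x (z.γ (gVal hθ r b)) := by
  change star (alphaGl x' r (inGlG x' r (gVal hθ r b)) x) = _
  rw [alphaGl_inGlG x' h, StarDual.neg_apply, star_neg, dualMap_apply, lam_symm x, smul_neg,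
    smul_smul, Int.units_mul_self, one_smul]

theorem apply_glStruct_betaGl (h : (q : ℤ) + 1 + (q + 1) + (0 : ℕ) = 2 * q + 1 + 1) (x : z.G)
    (B : StarDual Λ ((glX x').X (q + 1))) :
    B (glStructX x' 0 (q + 1) (q + 1) h (betaGl x' (q + 1) x)) =
      star (alphaX hθ q x (omegaX hθ 1 q q (by push_cast; omega)
        (dualMap (unionMid x'.f (mapX hθ) (q + 1) q rfl) B))) - B (inGlG x' (q + 1) x) := by
  refine (apply_unionStruct' x'.f (mapX hθ) x'.δψ (-0) (-omegaX hθ) 0 (q + 1) (q + 1) q q h rfl rfl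
    _ B).trans ?_
  rw [betaGl_in₁, betaGl_mid]
  have e1 : ∀ v, dualMap ((mapX hθ).f (q + 1)) (dualMap (unionIn₃ x'.f (mapX hθ) (q + 1)) B) v =
    B (inGlG x' (q + 1) (gVal hθ (q + 1) v)) := fun _ => rfl
  have e2 : gVal hθ (q + 1) ((-omegaX hθ) 0 q (q + 1) (by push_cast; omega) (alphaX hθ q x)) = -x := by
    refine (map_neg (gVal hθ (q + 1)) _).trans ?_
    rw [gVal_omega]
    congr 1
    refine ext_dual (Λ := Λ) fun φ => ?_
    rw [apply_undual, dualMap_apply, alphaX_apply, alphaB_iota rfl, star_star]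
  have s1 : (2 * (q : ℤ) + 1 - (q + 1) - (0 : ℕ) + 1).negOnePow = -(-1) ^ q := by
    rw [← negOnePow_succ_eq]; congr 1; push_cast; ring
  have s2 : ((q : ℤ) * q).negOnePow = (-1) ^ q := by rw [Int.negOnePow_mul_self, negOnePow_eq]
  rw [e1, e2, s1, s2]
  change B _ + (_ • dualMap _ B (-(omegaX hθ 0 (q + 1) q _ _)) + _ • _ • star (alphaX hθ q x
    (-(omegaX hθ 1 q q _ _)))) + (_ + dualMap _ B (-0)) = _
  simp only [map_neg, map_zero, smul_zero, smul_neg, neg_zero, add_zero, zero_add, star_neg,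
    Units.neg_smul, neg_neg, smul_smul, Int.units_mul_self, one_smul]
  simp [sub_eq_add_neg]

theorem betaGl_glStruct_betaGl (h : (q : ℤ) + 1 + (q + 1) + (0 : ℕ) = 2 * q + 1 + 1) (x y : z.G) :
    betaGl x' (q + 1) y (glStructX x' 0 (q + 1) (q + 1) h (betaGl x' (q + 1) x)) =
      -(((-1) ^ q : ℤˣ) • θ y x) := by
  rw [apply_glStruct_betaGl, betaGl_mid, alphaX_omega_alphaX, adj_apply, alphaGl_inGlG x' rfl,
    StarDual.neg_apply, dualMap_apply, star_neg, star_neg, sub_neg_eq_add]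
  have h1 := hθ.apply_eq x y
  rw [← h1, star_sub, star_units_smul, star_star]
  abel

theorem apply_glSymm_betaGl (h : (q : ℤ) + 1 + (q + 1) = 2 * q + 1 + 1) (x : z.G)
    (B : StarDual Λ ((glX x').X (q + 1))) :
    B ((glStructX x').symm₀ (q + 1) (q + 1) h (betaGl x' (q + 1) x)) =
      star (alphaX hθ q x (omegaX hθ 1 q q (by push_cast; omega)
        (dualMap (unionMid x'.f (mapX hθ) (q + 1) q rfl) B))) - B (inGlG x' (q + 1) x) +
      (star (alphaX hθ q x (omegaX hθ 0 (q + 1) q (by push_cast; omega) (dualMap (x'.f.f (q + 1))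
        (dualMap (unionIn₁ x'.f (mapX hθ) (q + 1)) B)))) -
      ((-1) ^ q : ℤˣ) • B (unionMid x'.f (mapX hθ) (q + 1) q rfl (omegaX hθ 1 q q (by push_cast; omega)
        (alphaX hθ q x))) +
      B (unionMid x'.f (mapX hθ) (q + 1) q rfl (iotaB hθ q (dualMap z.γ (z.μ x))))) := by
  rw [QStruct.apply_symm₀, apply_glStruct_betaGl]
  congr 1
  refine (congrArg (fun t => _ • star t) (apply_unionStruct' x'.f (mapX hθ) x'.δψ (-0) (-omegaX hθ)
    0 (q + 1) (q + 1) q q (by push_cast; omega) rfl rfl B _)).trans ?_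
  rw [betaGl_in₁, betaGl_mid, betaGl_mapX x' rfl]
  have e2 : gVal hθ (q + 1) ((-omegaX hθ) 0 q (q + 1) (by push_cast; omega)
      (dualMap (unionMid x'.f (mapX hθ) (q + 1) q rfl) B)) = -undual z.G (dualMap (iotaB hθ q)
        (dualMap (unionMid x'.f (mapX hθ) (q + 1) q rfl) B)) := by
    refine (map_neg (gVal hθ (q + 1)) _).trans ?_
    rw [gVal_omega]
  have s0 : (2 * (q : ℤ) + 1 - (q + 1)).negOnePow = (-1) ^ q := by
    rw [← negOnePow_eq]; congr 1; ring
  have s1 : (2 * (q : ℤ) + 1 - (q + 1) - (0 : ℕ) + 1).negOnePow = -(-1) ^ q := by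
    rw [← negOnePow_succ_eq]; congr 1; push_cast; ring
  have s2 : ((q : ℤ) * q).negOnePow = (-1) ^ q := by rw [Int.negOnePow_mul_self, negOnePow_eq]
  have s3 : (((q : ℤ) + 1) * (q + 1)).negOnePow = -(-1) ^ q := by
    rw [Int.negOnePow_mul_self, negOnePow_succ_eq]
  rw [e2, s0, s1, s2, s3, map_neg, map_neg, ← dualMap_apply z.γ (z.μ x), apply_undual]
  change _ • star ((0 : StarDual Λ (x'.D.X (q + 1))) _ + (_ • alphaX hθ q x (-(omegaX hθ 0 (q + 1) q _ _)) +
    _ • _ • star (dualMap _ B (-(omegaX hθ 1 q q _ _)))) + (_ +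
      dualMap (unionIn₃ x'.f (mapX hθ) (q + 1)) (betaGl x' (q + 1) x) (-0))) = _
  rw [neg_zero, (map_zero (dualMap (unionIn₃ x'.f (mapX hθ) (q + 1)) (betaGl x' (q + 1) x)) : _), map_neg,
    map_neg, StarDual.zero_apply]
  simp only [Nat.cast_zero, Int.negOnePow_zero, one_smul, dualMap_apply, star_add, star_neg, star_units_smul, star_star, smul_neg, Units.neg_smul, neg_neg,
    smul_smul, Int.units_mul_self, smul_add, zero_add, add_zero, one_mul, mul_neg, neg_mul]
  abel

theorem exists_glSymm_betaGl (h : (q : ℤ) + 1 + (q + 1) = 2 * q + 1 + 1) (x : z.G) :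
    ∃ v, (glStructX x').symm₀ (q + 1) (q + 1) h (betaGl x' (q + 1) x) =
      -inGlG x' (q + 1) x + (glX x').d (q + 1 + 1) (q + 1) rfl v := by
  let b : (bdX hθ).X (q + 1) := -(((-1) ^ q : ℤˣ) • coadj (omegaX hθ 0 (q + 1) q
    (by push_cast; omega)) (alphaX hθ q x))
  have hb : ∀ β : StarDual Λ ((bdX hθ).X (q + 1)), β b = -(((-1) ^ q : ℤˣ) • star (alphaX hθ q x
      (omegaX hθ 0 (q + 1) q (by push_cast; omega) β))) := fun β => by
    rw [map_neg, map_units_smul, apply_coadj]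
  have hg : gVal hθ (q + 1) b = 0 := ext_dual (Λ := Λ) fun φ => by
    have h1 := hb (dualMap ((mapX hθ).f (q + 1)) (dualMap (Conc.out (Λ := Λ) (q + 1 : ℤ) z.G _) φ))
    rw [omega_dualMap_mapX, map_zero, star_zero, smul_zero, neg_zero] at h1
    refine Eq.trans ?_ (h1.trans (map_zero φ).symm)
    exact congrArg φ (Conc.out_of (Λ := Λ) rfl (gVal hθ (q + 1) b)).symm
  refine ⟨unionMid x'.f (mapX hθ) (q + 1 + 1) (q + 1) rfl b, ext_dual (Λ := Λ) fun B => ?_⟩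
  have e0 := d_glMid x' (q + 1 + 1) (q + 1) q rfl rfl b
  rw [hg, map_zero, smul_zero, add_zero] at e0
  rw [apply_glSymm_betaGl, e0]
  have e1 : B (unionIn₁ x'.f (mapX hθ) (q + 1) (x'.f.f (q + 1) b)) = _ :=
    hb (dualMap (x'.f.f (q + 1)) (dualMap (unionIn₁ x'.f (mapX hθ) (q + 1)) B))
  have e2 : B (unionMid x'.f (mapX hθ) (q + 1) q rfl ((bdX hθ).d (q + 1) q rfl b)) = _ :=
    hb (dualMap ((bdX hθ).d (q + 1) q rfl) (dualMap (unionMid x'.f (mapX hθ) (q + 1) q rfl) B))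
  rw [map_add, map_add, map_neg, map_units_smul, e1, e2, negOnePow_succ_eq]
  have hω : (omegaX hθ).IsCycle := (pairX z θ hθ).isCycle
  have key := congrArg star (hω.apply_eq_zero 0 q q (q + 1) (q + 1)
    (by push_cast; omega) rfl rfl (dualMap (unionMid x'.f (mapX hθ) (q + 1) q rfl) B) (alphaX hθ q x))
  have e3 : star (alphaX hθ q x ((bdX hθ).d (q + 1) q rfl (omegaX hθ 0 q (q + 1)
      (by push_cast; omega) (dualMap (unionMid x'.f (mapX hθ) (q + 1) q rfl) B)))) =
      B (unionMid x'.f (mapX hθ) (q + 1) q rfl (iotaB hθ q (dualMap z.γ (z.μ x)))) := by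
    rw [alphaX_apply, star_star, alphaB_d, gVal_omega, StarDual.neg_apply, StarDual.units_smul_apply,
      dualMap_apply, ← star_star (z.μ _ _), ← star_units_smul, ← star_neg, ← lam_symm,
      ← dualMap_apply z.γ (z.μ x), apply_undual, star_star, dualMap_apply, dualMap_apply]
  have s1 : (2 * (q : ℤ) + 1 - (0 : ℕ) - 1).negOnePow = 1 :=
    Int.negOnePow_even _ ⟨q, by push_cast; ring⟩
  have s2 : ((q : ℤ) * q).negOnePow = (-1) ^ q := by rw [Int.negOnePow_mul_self, negOnePow_eq]
  rw [star_add, star_add, e3, s1, s2, negOnePow_eq] at key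
  simp only [Nat.cast_zero, zero_add, Int.negOnePow_one, one_smul, star_add, star_units_smul, star_star, star_zero,
    dualMap_apply, Units.neg_smul, smul_neg, neg_neg, smul_smul, Int.units_mul_self, one_mul,
    neg_mul, star_neg] at key ⊢
  rw [← sub_eq_zero, ← key]
  abel

end RegSplitPreformation

end GluedX

section HCobordism

variable {Λ : Type u} [Ring Λ] [StarRing Λ]

open FreeComplex

theorem FreeComplex.d_eq_zero_congr (C : FreeComplex Λ) {i j j' : ℤ} (hj : j = j') {h : j + 1 = i}
    {x : C.X i} (hx : C.d i j h x = 0) : C.d i j' (by omega) x = 0 := by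
  subst hj; exact hx

namespace RegSplitPreformation

variable {q : ℕ} {z : RegSplitPreformation Λ ((-1) ^ q)} {θ : z.G →ₗ[Λ] StarDual Λ z.G}
  {hθ : z.IsRepresentative θ}

theorem d_inLast (i j : ℤ) (h : j + 1 = i) (Φ : StarDual Λ (z.complexN.X (2 * q + 1 - i))) :
    (bdX hθ).d i j h (inLast hθ i Φ) = inLast hθ j ((pairC hθ).D.d i j h Φ) :=
  d_unionIn₃ (pairC'' hθ).f (pairC hθ).f i j h Φ

theorem inLast_injective (r : ℤ) : Function.Injective (inLast hθ r) := fun _ _ h =>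
  congrArg (toLast hθ r) h

theorem lastFDual_inLast (r : ℤ) (Φ : StarDual Λ (z.complexN.X (2 * q + 1 - r))) :
    lastFDual hθ r (inLast hθ r Φ) = dualMap (inA (q : ℤ) (adj z.μ) (2 * q + 1 - r)) Φ := rfl

theorem μ_gVal_inLast (Φ : StarDual Λ (z.complexN.X (2 * q + 1 - (q + 1)))) :
    z.μ (gVal hθ (q + 1) (inLast hθ (q + 1) Φ)) =
      ((-1) ^ q : ℤˣ) • lastFDual hθ q ((bdX hθ).d (q + 1) q rfl (inLast hθ (q + 1) Φ)) := by
  have h1 : midFDual hθ (q + 1) (inLast hθ (q + 1) Φ) = 0 := map_zero (dualMap _)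
  have h2 : gVal hθ (q + 1) (inLast hθ (q + 1) Φ) = -lastG hθ (q + 1) (inLast hθ (q + 1) Φ) :=
    gVal_inLast _ _
  rw [lastFDual_d, h1, h2, smul_zero, zero_add, negOnePow_succ_eq, Units.neg_smul, smul_neg,
    smul_smul, Int.units_mul_self, one_smul, map_neg]

theorem gVal_eq_zero {r : ℤ} (h : r ≠ q + 1) (b : (bdX hθ).X r) : gVal hθ r b = 0 := by
  rw [gVal, LinearMap.sub_apply, fstG_eq_zero h, lastG_eq_zero h, sub_zero]

variable {x' : QuadPair (bdX hθ) (2 * q + 1) (omegaX hθ)}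

theorem exists_inLast_of_boundary 
    (hx' : QuadPair.IsAlgebraicHCobordism (c := pairC'' hθ) (c' := pairC hθ) x') (i j k : ℤ) (hij : j + 1 = i)
    (hjk : k + 1 = j) (Φ : StarDual Λ (z.complexN.X (2 * q + 1 - j))) (y : x'.D.X i)
    (hΦ : (bdX hθ).d j k hjk (inLast hθ j Φ) = 0)
    (hy : x'.D.d i j hij y = x'.f.f j (inLast hθ j Φ)) :
    ∃ Φ', (bdX hθ).d i j hij (inLast hθ i Φ') = inLast hθ j Φ := by
  rw [d_inLast] at hΦ
  obtain ⟨Φ', h⟩ := hx'.equiv_right.isQuasiIso.inj i j k hij hjk Φ y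
    (inLast_injective k (hΦ.trans (map_zero _).symm)) hy
  exact ⟨Φ', (d_inLast i j hij Φ').trans (congrArg (inLast hθ j) h)⟩

theorem exists_inLast_add_boundary 
    (hx' : QuadPair.IsAlgebraicHCobordism (c := pairC'' hθ) (c' := pairC hθ) x') (i j k : ℤ) (hij : j + 1 = i)
    (hjk : k + 1 = j) (y : x'.D.X j) (hy : x'.D.d j k hjk y = 0) :
    ∃ Φ w, (bdX hθ).d j k hjk (inLast hθ j Φ) = 0 ∧
      x'.f.f j (inLast hθ j Φ) + x'.D.d i j hij w = y := by
  obtain ⟨Φ, w, h1, h2⟩ := hx'.equiv_right.isQuasiIso.surj i j k hij hjk y hy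
  exact ⟨Φ, w, (d_inLast j k hjk Φ).trans ((congrArg (inLast hθ k) h1).trans (map_zero _)), h2⟩

theorem gl_exactAt 
    (hx' : QuadPair.IsAlgebraicHCobordism (c := pairC'' hθ) (c' := pairC hθ) x') (i j k : ℤ) (hij : j + 1 = i)
    (hjk : k + 1 = j) (hj : j < q + 1) (c : (glX x').X j) (hc : (glX x').d j k hjk c = 0) :
    ∃ v, (glX x').d i j hij v = c := by
  obtain ⟨e, b, y, rfl⟩ := exists_eq_gl x' j k hjk c
  have hb : b = 0 := bdX_eq_zero (by omega) (by omega) (by omega) b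
  have hy := inGlG_eq_zero x' (r := j) (by omega) y
  rw [hb, map_zero, hy, add_zero, add_zero] at hc ⊢
  rw [d_unionIn₁] at hc
  obtain ⟨Φ, w, h1, rfl⟩ := exists_inLast_add_boundary hx' i j k hij hjk e (congrArg Prod.fst hc)
  refine ⟨j.negOnePow • unionMid x'.f (mapX hθ) i j hij (inLast hθ j Φ) + unionIn₁ _ _ i w, ?_⟩
  rw [map_add, map_units_smul, d_glMid x' i j k hij hjk, h1, gVal_eq_zero (by omega), d_unionIn₁]
  simp [smul_smul, smul_add]

theorem gl_cohomology 
    (hx' : QuadPair.IsAlgebraicHCobordism (c := pairC'' hθ) (c' := pairC hθ) x')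
    {e : QuadPair (glX x') (2 * q + 1 + 1) (glStructX x')} (he : e.IsPoincare)
    (i j k : ℤ) (hij : i + 1 = j) (hjk : j + 1 = k) (hj : (q : ℤ) + 1 < j)
    (a : StarDual Λ ((glX x').X j)) (ha : dualMap ((glX x').d k j hjk) a = 0) :
    ∃ a₀, a = dualMap ((glX x').d j i hij) a₀ := by
  set r : ℤ := 2 * q + 1 + 1 - j with hr
  have hjr : j + r = 2 * q + 1 + 1 := by omega
  have h1 : (glX x').d r (r - 1) (by omega) ((glStructX x').symm₀ j r hjr a) = 0 := by
    rw [e.isCycle.d_symm₀ j (r - 1) (by omega) r k (by omega) hjk, ha, map_zero, smul_zero]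
  obtain ⟨v, hv⟩ := gl_exactAt hx' (r + 1) r (r - 1) rfl (by omega) (by omega) _ h1
  exact he.exists_coboundary r j (r + 1) k i hjr rfl hjk hij a v ha hv.symm

theorem isElementary_of_isPoincare 
    (hx' : QuadPair.IsAlgebraicHCobordism (c := pairC'' hθ) (c' := pairC hθ) x')
    (e : QuadPair (glX x') (2 * q + 1 + 1) (glStructX x')) (he : e.IsPoincare) :
    LMonoid.IsElementary (LMonoid.mk z) := by
  have hk : (q : ℤ) + 1 + (q + 1) = 2 * q + 1 + 1 := by ring
  have hcoh := fun i j k hij hjk hj a ha => gl_cohomology hx' he i j k hij hjk hj a ha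
  obtain ⟨σ, hσ⟩ := (glX x').exists_splitting_dualMap (q + 1) (q + 1 + 1) rfl hcoh
  refine e.isElementary_of_alpha hk he (negOnePow_succ_eq q) z (alphaGl x' (q + 1))
    (alphaGl_d x' rfl) ?_ ?_ ((glX x').stablyFree_range_dualMap (q + 1) (q + 1 + 1) rfl hcoh) σ hσ
    ?_ ?_ ?_
  · intro x
    rw [betaGl_glStruct_betaGl x' _ x x, smul_neg, smul_smul, Int.units_mul_self, one_smul, map_neg,
      hθ.mk_apply, add_neg_cancel]
  · intro x y
    have h1 := (glStructX x').apply_symm₀ (q + 1) (q + 1) hk (betaGl x' (q + 1) y)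
      (betaGl x' (q + 1) x)
    rw [betaGl_glStruct_betaGl, betaGl_glStruct_betaGl, Int.negOnePow_mul_self, negOnePow_succ_eq] at h1
    rw [h1, ← hθ.apply_eq x y]
    simp only [star_neg, star_units_smul, smul_add, smul_neg, Units.neg_smul, smul_smul,
      Int.units_mul_self, one_smul, neg_neg, mul_one, mul_neg, neg_mul, one_mul]
    abel
  · intro φ c hc hφ
    replace hc := (glX x').d_eq_zero_congr (j' := q) (by omega) hc
    obtain ⟨e', b, y, rfl⟩ := exists_eq_gl x' (q + 1) q rfl c
    rw [map_add, map_add, alphaGl_in₁, alphaGl_mid, alphaGl_inGlG x' rfl, zero_add] at hφ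
    rw [map_add, map_add, d_unionIn₁, d_inGlG, d_glMid x' (q + 1) q (q - 1) rfl (by omega)] at hc
    have hc1 : x'.D.d (q + 1) q rfl e' + (q : ℤ).negOnePow • x'.f.f q b = 0 := by
      refine (gl_eq_zero x' q (q - 1) (by omega) _ ((bdX hθ).d q (q - 1) (by omega) b)
        ((q : ℤ).negOnePow • gVal hθ q b) (Eq.trans ?_ hc)).1
      rw [map_add, map_units_smul, map_units_smul]
      abel
    let Φ : StarDual Λ (z.complexN.X (2 * q + 1 - q)) := dualMap (outA (q : ℤ) (adj z.μ) _) φ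
    have hΦ : dualMap (inA (q : ℤ) (adj z.μ) (2 * q + 1 - q)) Φ = φ := dualMap_inA_outA (by omega) φ
    have hd : ∀ b : (bdX hθ).X q, (bdX hθ).d q (q - 1) (by omega) b = 0 := fun b =>
      bdX_eq_zero (by omega) (by omega) (by omega) _
    obtain ⟨b₂, hb₂, hg₂⟩ := exists_boundary (i := q + 1) (j := q) (k := q - 1) rfl (by omega)
      (b + inLast hθ q Φ) (-(((-1) ^ q : ℤˣ) • Conc.of (Λ := Λ) (q + 1 : ℤ) z.G (q + 1) y)) (hd _)
      (gVal_eq_zero (by omega) _) (by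
        rw [map_add, alphaB_inLast, hΦ, map_neg, map_units_smul, Conc.out_of rfl, hφ, map_neg, map_neg,
          map_units_smul, map_units_smul, smul_neg, smul_smul, Int.units_mul_self, one_smul]
        abel)
    have hg₂' : gVal hθ (q + 1) b₂ = -(((-1) ^ q : ℤˣ) • y) := by
      have h1 := congrArg (Conc.out (Λ := Λ) (q + 1 : ℤ) z.G (q + 1)) hg₂
      rw [map_neg, map_units_smul, Conc.out_of rfl] at h1
      exact (Conc.out_of (Λ := Λ) rfl _).symm.trans h1
    have hf : ∀ b : (bdX hθ).X (q + 1), x'.D.d (q + 1) q rfl (x'.f.f (q + 1) b) =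
      x'.f.f q ((bdX hθ).d (q + 1) q rfl b) := x'.f.comm _ _ _
    rw [negOnePow_eq] at hc1
    obtain ⟨Φ₁, hΦ₁⟩ := exists_inLast_of_boundary hx' (q + 1) q (q - 1) rfl (by omega) Φ
      (x'.f.f (q + 1) b₂ + ((-1) ^ q : ℤˣ) • e') (hd _) (by
        rw [map_add, hf, hb₂, map_add, map_units_smul, eq_neg_of_add_eq_zero_left hc1, smul_neg,
          smul_smul, Int.units_mul_self, one_smul]
        abel)
    obtain ⟨Φ₂, w, hΦ₂, hw⟩ := exists_inLast_add_boundary hx' (q + 1 + 1) (q + 1) q rfl rfl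
      (e' + ((-1) ^ q : ℤˣ) • x'.f.f (q + 1) b₂ -
        ((-1) ^ q : ℤˣ) • x'.f.f (q + 1) (inLast hθ (q + 1) Φ₁)) (by
        rw [map_sub, map_add, map_units_smul, map_units_smul, hf, hf, hb₂, hΦ₁,
          eq_neg_of_add_eq_zero_left hc1, map_add, smul_add]
        abel)
    let x : z.G := ((-1) ^ q : ℤˣ) • gVal hθ (q + 1) (inLast hθ (q + 1) Φ₁) +
      gVal hθ (q + 1) (inLast hθ (q + 1) Φ₂)
    obtain ⟨v₀, hv₀⟩ := exists_glSymm_betaGl x' hk x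
    refine ⟨x, unionMid x'.f (mapX hθ) (q + 1 + 1) (q + 1) rfl
      (b₂ - inLast hθ (q + 1) Φ₁ - ((-1) ^ q : ℤˣ) • inLast hθ (q + 1) Φ₂) +
      unionIn₁ x'.f (mapX hθ) (q + 1 + 1) w - v₀, ?_, ?_⟩
    · rw [map_add, map_units_smul, μ_gVal_inLast, μ_gVal_inLast, hΦ₁, hΦ₂, map_zero, smul_zero,
        add_zero, smul_smul, Int.units_mul_self, one_smul, lastFDual_inLast, hΦ]
    · have he' : e' = x'.f.f (q + 1) (inLast hθ (q + 1) Φ₂) + x'.D.d (q + 1 + 1) (q + 1) rfl w -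
          ((-1) ^ q : ℤˣ) • x'.f.f (q + 1) b₂ +
          ((-1) ^ q : ℤˣ) • x'.f.f (q + 1) (inLast hθ (q + 1) Φ₁) := by rw [hw]; abel
      rw [hv₀, map_sub ((glX x').d _ _ _), map_add ((glX x').d _ _ _), d_unionIn₁,
        d_glMid x' (q + 1 + 1) (q + 1) q rfl rfl, negOnePow_succ_eq, he']
      simp only [map_sub, map_add, map_units_smul, hΦ₁, hΦ₂, hb₂, hg₂', smul_sub, smul_add, smul_neg,
        Units.neg_smul, smul_smul, Int.units_mul_self, one_smul, map_neg, smul_zero,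
        neg_mul, neg_neg, map_zero, x]
      abel
  · intro ξ
    obtain ⟨Φ, w, hΦ, hw⟩ := exists_inLast_add_boundary hx' (q + 1) q (q - 1) rfl (by omega)
      (x'.f.f q (iotaB hθ q (-ξ))) (by
        rw [x'.f.comm q (q - 1) (by omega), d_iota, map_zero])
    refine ⟨dualMap (inA (q : ℤ) (adj z.μ) (2 * q + 1 - q)) Φ,
      unionMid x'.f (mapX hθ) (q + 1) q rfl (iotaB hθ q (-ξ) - inLast hθ q Φ) -
        ((-1) ^ q : ℤˣ) • unionIn₁ x'.f (mapX hθ) (q + 1) w, ?_, ?_⟩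
    · refine (glX x').d_eq_zero_congr (j := q) (h := rfl) (by omega) ?_
      rw [map_sub ((glX x').d _ _ _), map_units_smul, d_unionIn₁, d_glMid x' (q + 1) q (q - 1) rfl (by omega), map_sub, map_sub,
        map_sub, d_iota, hΦ, ← hw, gVal_eq_zero (by omega), negOnePow_eq]
      simp
    · rw [map_sub (alphaGl x' (q + 1)), map_units_smul, alphaGl_in₁, alphaGl_mid, map_sub, alphaB_iota rfl,
        alphaB_inLast]
      simp
  · intro x v hx hv
    obtain ⟨v₀, hv₀⟩ := exists_glSymm_betaGl x' hk x
    rw [hv₀] at hv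
    obtain ⟨e', b, y, he'⟩ := exists_eq_gl x' (q + 1 + 1) (q + 1) rfl (v₀ - v)
    have h1 : (glX x').d (q + 1 + 1) (q + 1) rfl (v₀ - v) = inGlG x' (q + 1) x := by
      rw [map_sub, ← hv]; abel
    rw [he', map_add, map_add, d_unionIn₁, d_inGlG, d_glMid x' (q + 1 + 1) (q + 1) q rfl rfl,
      negOnePow_succ_eq] at h1
    obtain ⟨h2, h3, h4⟩ := gl_eq_zero x' (q + 1) q rfl (x'.D.d (q + 1 + 1) (q + 1) rfl e' -
      ((-1) ^ q : ℤˣ) • x'.f.f (q + 1) b) ((bdX hθ).d (q + 1) q rfl b)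
      (-(((-1) ^ q : ℤˣ) • gVal hθ (q + 1) b) - x) (by
        rw [map_sub, map_sub, map_units_smul, map_neg, map_units_smul, ← h1]
        simp only [Units.neg_smul]
        abel)
    replace h4 := h4 rfl
    let Φ : StarDual Λ (z.complexN.X (2 * q + 1 - (q + 1))) :=
      dualMap (outB (q : ℤ) (adj z.μ) _) (evalDual z.G x)
    have hg : gVal hθ (q + 1) (inLast hθ (q + 1) Φ) = -x := by
      rw [gVal_inLast, dualMap_inB_outB (by omega), undual_evalDual]
    have hd : (bdX hθ).d (q + 1) q rfl (inLast hθ (q + 1) Φ) = 0 := by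
      have h5 := μ_gVal_inLast (hθ := hθ) Φ
      rw [hg, map_neg, hx, neg_zero, eq_comm, smul_eq_zero_iff_eq] at h5
      have h6 := (congrArg (lastFDual hθ q) (d_inLast (q + 1) q rfl Φ)).symm.trans h5
      exact (d_inLast _ _ _ _).trans ((congrArg (inLast hθ q) (dual_twoTerm_ext h6
        (dualMap_inB_eq_zero (by omega) _))).trans (map_zero _))
    obtain ⟨b₂, hb₂, -⟩ := exists_boundary (i := q + 1 + 1) (j := q + 1) (k := q) rfl rfl
      (b - ((-1) ^ q : ℤˣ) • inLast hθ (q + 1) Φ) 0 (by rw [map_sub, map_units_smul, h3, hd]; simp)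
      (by
        rw [map_sub, map_units_smul, hg, smul_neg, sub_neg_eq_add, ← eq_of_sub_eq_zero h4, smul_neg, smul_smul,
          Int.units_mul_self, one_smul]
        abel) (by
        rw [alphaB_eq_zero (by omega), map_zero, map_zero, map_zero, smul_zero, neg_zero])
    obtain ⟨Φ', hΦ'⟩ := exists_inLast_of_boundary hx' (q + 1 + 1) (q + 1) q rfl rfl Φ
      (e' - ((-1) ^ q : ℤˣ) • x'.f.f (q + 1 + 1) b₂) hd (by
        rw [map_sub, map_units_smul, x'.f.comm _ _ rfl, hb₂, eq_of_sub_eq_zero h2, map_sub,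
          map_units_smul, smul_sub, smul_smul, Int.units_mul_self, one_smul]
        abel)
    have h5 : gVal hθ (q + 1) (inLast hθ (q + 1) Φ) = 0 := by
      rw [← hΦ', gVal, LinearMap.sub_apply, fstG_d, lastG_d, sub_self]
    rw [hg, neg_eq_zero] at h5
    exact h5

end RegSplitPreformation

end HCobordism

section Lagrangian

variable {Λ : Type u} [Ring Λ] [StarRing Λ]

theorem StarDual.ext_basis {M : Type u} [AddCommGroup M] [Module Λ M] {ι : Type*} [Fintype ι]
    (b : Module.Basis ι Λ M) {φ χ : StarDual Λ M} (h : ∀ i, φ (b i) = χ (b i)) : φ = χ :=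
  (dualEquivFun b).injective (funext fun i => congrArg star (h i))

/-- A symmetric form whose diagonal entries are even is even. -/
theorem exists_eq_add_star {U : Type u} [AddCommGroup U] [Module Λ U] [Module.Free Λ U]
    [Module.Finite Λ U] (e : ℤˣ) (θ : U →ₗ[Λ] StarDual Λ U) (h : ∀ x y, θ x y = e • star (θ y x))
    (h' : ∀ x, QuadQuot.mk (-e) (θ x x) = 0) :
    ∃ χ : U →ₗ[Λ] StarDual Λ U, ∀ x y, θ x y = χ x y + e • star (χ y x) := by
  classical
  let b := (Module.Free.chooseBasis Λ U).reindex (Fintype.equivFin _)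
  have hc : ∀ i, ∃ c, c + e • star c = θ (b i) (b i) := fun i => by
    obtain ⟨c, hc⟩ := (QuotientAddGroup.eq_zero_iff _).1 (h' (b i))
    refine ⟨c, Eq.trans ?_ hc⟩
    change _ = c - (-e) • star c
    rw [Units.neg_smul, sub_neg_eq_add]
  choose c hc using hc
  let χ : U →ₗ[Λ] StarDual Λ U := b.constr ℤ fun i => (dualEquivFun b).symm fun k =>
    star (if i < k then θ (b i) (b k) else if i = k then c i else 0)
  have hχ : ∀ i k, χ (b i) (b k) =
      if i < k then θ (b i) (b k) else if i = k then c i else 0 := fun i k => by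
    refine star_injective ?_
    rw [Module.Basis.constr_basis]
    exact congrFun ((dualEquivFun b).apply_symm_apply _) k
  refine ⟨χ, fun x y => ?_⟩
  suffices θ = χ + e • adj χ by
    refine (DFunLike.congr_fun (LinearMap.congr_fun this x) y).trans ?_
    rw [LinearMap.add_apply, StarDual.add_apply, LinearMap.smul_apply, StarDual.units_smul_apply,
      adj_apply]
  refine b.ext fun i => StarDual.ext_basis b fun k => ?_
  rw [LinearMap.add_apply, StarDual.add_apply, LinearMap.smul_apply, StarDual.units_smul_apply,
    adj_apply, hχ, hχ]
  rcases lt_trichotomy i k with hik | rfl | hik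
  · rw [if_pos hik, if_neg hik.not_gt, if_neg hik.ne', star_zero, smul_zero, add_zero]
  · rw [if_neg (lt_irrefl _), if_pos rfl, hc]
  · rw [if_pos hik, if_neg hik.not_gt, if_neg hik.ne', zero_add, h]

namespace RegSplitPreformation

variable {ε : ℤˣ} (z : RegSplitPreformation Λ ε)

/-- The sequences `U → F^* → U^*` and `U → F → U^*` given by `j : U → G` are short exact. -/
structure IsLagrangianMap {U : Type u} [AddCommGroup U] [Module Λ U] (j : U →ₗ[Λ] z.G) : Prop where
  lam_eq_zero : ∀ x y, z.μ (j x) (z.γ (j y)) = 0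
  injective_μ : ∀ x, z.μ (j x) = 0 → x = 0
  exact_μ : ∀ φ : StarDual Λ z.F, (∀ x, φ (z.γ (j x)) = 0) → ∃ x, z.μ (j x) = φ
  surjective_γ : ∀ η : StarDual Λ U, ∃ φ : StarDual Λ z.F, ∀ x, φ (z.γ (j x)) = η x
  injective_γ : ∀ x, z.γ (j x) = 0 → x = 0
  exact_γ : ∀ f : z.F, (∀ x, z.μ (j x) f = 0) → ∃ x, z.γ (j x) = f
  surjective_μ : ∀ η : StarDual Λ U, ∃ f : z.F, ∀ x, star (z.μ (j x) f) = η x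

variable {z}

theorem isLagrangianMap_of_exact {U : Type u} [AddCommGroup U] [Module Λ U] [Module.Free Λ U]
    [Module.Finite Λ U] (j : U →ₗ[Λ] z.G) (h₀ : ∀ x y, z.μ (j x) (z.γ (j y)) = 0)
    (hμ : ∀ x, z.μ (j x) = 0 → x = 0) (hγ : ∀ x, z.γ (j x) = 0 → x = 0)
    (hex : ∀ φ : StarDual Λ z.F, (∀ x, φ (z.γ (j x)) = 0) → ∃ x, z.μ (j x) = φ)
    (hsurj : ∀ η : StarDual Λ U, ∃ φ : StarDual Λ z.F, ∀ x, φ (z.γ (j x)) = η x) :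
    z.IsLagrangianMap j := by
  obtain ⟨σ, hσ⟩ := Module.projective_lifting_property (dualMap (z.γ ∘ₗ j)) LinearMap.id fun η => by
    obtain ⟨φ, h⟩ := hsurj η
    exact ⟨φ, StarDual.ext h⟩
  have hσ' : ∀ η x, σ η (z.γ (j x)) = η x := fun η x =>
    DFunLike.congr_fun (LinearMap.congr_fun hσ η) x
  have hP : ∀ φ : StarDual Λ z.F,
      ∃ x, z.μ (j x) = φ - σ (dualMap (z.γ ∘ₗ j) φ) := fun φ => hex _ fun x => by
    rw [StarDual.sub_apply, hσ']
    exact sub_self _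
  let e := LinearEquiv.ofInjective (z.μ ∘ₗ j) ((injective_iff_map_eq_zero _).2 hμ)
  let ρ : StarDual Λ z.F →ₗ[Λ] U := e.symm.toLinearMap ∘ₗ LinearMap.codRestrict
    (LinearMap.range (z.μ ∘ₗ j)) (LinearMap.id - σ ∘ₗ dualMap (z.γ ∘ₗ j)) hP
  have hρ : ∀ x, ρ (z.μ (j x)) = x := fun x => by
    refine e.symm_apply_eq.2 (Subtype.ext ?_)
    change z.μ (j x) - σ (dualMap (z.γ ∘ₗ j) (z.μ (j x))) = z.μ (j x)
    rw [show dualMap (z.γ ∘ₗ j) (z.μ (j x)) = 0 from StarDual.ext fun y => h₀ x y, map_zero, sub_zero]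
  refine ⟨h₀, hμ, hex, hsurj, hγ, fun f hf => ?_, fun η => ?_⟩
  · refine ⟨undual U (dualMap σ (evalDual z.F f)), ext_dual (Λ := Λ) fun φ => ?_⟩
    obtain ⟨x, hx⟩ := hP φ
    refine (apply_undual (dualMap σ (evalDual z.F f)) (dualMap (z.γ ∘ₗ j) φ)).trans ?_
    rw [dualMap_apply, evalDual_apply, star_star]
    have h := hf x
    rw [hx, StarDual.sub_apply, sub_eq_zero] at h
    exact h.symm
  · refine ⟨undual z.F (dualMap ρ η), fun x => ?_⟩
    rw [apply_undual, star_star, dualMap_apply, hρ]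

theorem IsHLagrangian.isLagrangianMap {U : Submodule Λ z.G} (h : z.IsHLagrangian U) :
    z.IsLagrangianMap U.subtype := by
  have := h.free
  have := h.finite
  obtain ⟨hle, hinj, hsurj⟩ := h.quotient_bijective
  have hγ : Function.Injective (z.γ.submoduleMap U) := fun x y hxy =>
    h.injective_γ (congrArg Subtype.val hxy)
  let e : U ≃ₗ[Λ] U.map z.γ := LinearEquiv.ofBijective (z.γ.submoduleMap U)
    ⟨hγ, z.γ.submoduleMap_surjective U⟩
  refine isLagrangianMap_of_exact _ (fun x y => h.form_eq_zero x x.2 y y.2)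
    ((injective_iff_map_eq_zero _).1 h.injective_μ) ((injective_iff_map_eq_zero _).1 h.injective_γ)
    (fun φ hφ => ?_) (fun η => ?_)
  · have h1 : restrictDual (U.map z.γ) φ = 0 := StarDual.ext fun y => by
      obtain ⟨_, x, hx, rfl⟩ := y
      exact hφ ⟨x, hx⟩
    have h2 : (U.map z.μ).mkQ φ = 0 := hinj (by
      rw [map_zero, Submodule.mkQ_apply, Submodule.liftQ_apply, h1])
    obtain ⟨x, hx, hφ⟩ := (Submodule.Quotient.mk_eq_zero _).1 h2
    exact ⟨⟨x, hx⟩, hφ⟩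
  · obtain ⟨φ, hφ⟩ := hsurj (dualMap e.symm.toLinearMap η)
    obtain ⟨φ, rfl⟩ := Submodule.mkQ_surjective _ φ
    refine ⟨φ, fun x => ?_⟩
    have h1 := DFunLike.congr_fun hφ (e x)
    rw [Submodule.mkQ_apply, Submodule.liftQ_apply, dualMap_apply] at h1
    exact h1.trans (congrArg η (e.symm_apply_apply x))

end RegSplitPreformation

end Lagrangian

section ThreeTerm

variable {Λ : Type u} [Ring Λ] [StarRing Λ]

namespace FreeComplex

variable {A B C : Type u} [AddCommGroup A] [Module Λ A] [Module.Free Λ A] [Module.Finite Λ A]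
  [AddCommGroup B] [Module Λ B] [Module.Free Λ B] [Module.Finite Λ B]
  [AddCommGroup C] [Module Λ C] [Module.Free Λ C] [Module.Finite Λ C]

/-- The complex `A → B → C` with `C` in degree `q`. -/
def threeTerm (q : ℤ) (a : A →ₗ[Λ] B) (b : B →ₗ[Λ] C) (hab : ∀ x, b (a x) = 0) :
    FreeComplex Λ where
  X r := Conc (q + 2) A r × Conc (q + 1) B r × Conc q C r
  d i j _ := LinearMap.prod 0 (LinearMap.prod
    (Conc.of (q + 1) B j ∘ₗ a ∘ₗ Conc.out (q + 2) A i ∘ₗ LinearMap.fst Λ _ _)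
    (Conc.of q C j ∘ₗ b ∘ₗ Conc.out (q + 1) B i ∘ₗ LinearMap.fst Λ _ _ ∘ₗ LinearMap.snd Λ _ _))
  d_d i j k hij hjk x := by
    refine Prod.ext rfl (Prod.ext ?_ ?_)
    · change Conc.of (Λ := Λ) (q + 1) B k (a (Conc.out (Λ := Λ) (q + 2) A j 0)) = 0
      rw [map_zero, map_zero, map_zero]
    · change Conc.of (Λ := Λ) q C k (b (Conc.out (Λ := Λ) (q + 1) B j
        (Conc.of (Λ := Λ) (q + 1) B j (a (Conc.out (Λ := Λ) (q + 2) A i x.1))))) = 0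
      by_cases h : j = q + 1
      · rw [Conc.out_of h, hab, map_zero]
      · rw [Conc.out_eq_zero h, map_zero, map_zero]
  bounded := ⟨q, q + 2, fun i h => by
    have := Conc.subsingleton (k := q + 2) (M := A) (r := i) (by omega)
    have := Conc.subsingleton (k := q + 1) (M := B) (r := i) (by omega)
    have := Conc.subsingleton (k := q) (M := C) (r := i) (by omega)
    infer_instance⟩

section

variable (q : ℤ) (a : A →ₗ[Λ] B) (b : B →ₗ[Λ] C) (hab : ∀ x, b (a x) = 0) (r : ℤ)

/-- The inclusion of `A` (zero unless `r = q + 2`). -/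
def in₂ : A →ₗ[Λ] (threeTerm q a b hab).X r :=
  LinearMap.inl Λ (Conc (q + 2) A r) (Conc (q + 1) B r × Conc q C r) ∘ₗ Conc.of (q + 2) A r

/-- The inclusion of `B` (zero unless `r = q + 1`). -/
def in₁ : B →ₗ[Λ] (threeTerm q a b hab).X r :=
  LinearMap.inr Λ (Conc (q + 2) A r) (Conc (q + 1) B r × Conc q C r) ∘ₗ
    LinearMap.inl Λ (Conc (q + 1) B r) (Conc q C r) ∘ₗ Conc.of (q + 1) B r

/-- The inclusion of `C` (zero unless `r = q`). -/
def in₀ : C →ₗ[Λ] (threeTerm q a b hab).X r :=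
  LinearMap.inr Λ (Conc (q + 2) A r) (Conc (q + 1) B r × Conc q C r) ∘ₗ
    LinearMap.inr Λ (Conc (q + 1) B r) (Conc q C r) ∘ₗ Conc.of q C r

/-- The projection to `A` (zero unless `r = q + 2`). -/
def out₂ : (threeTerm q a b hab).X r →ₗ[Λ] A :=
  Conc.out (q + 2) A r ∘ₗ LinearMap.fst Λ (Conc (q + 2) A r) (Conc (q + 1) B r × Conc q C r)

/-- The projection to `B` (zero unless `r = q + 1`). -/
def out₁ : (threeTerm q a b hab).X r →ₗ[Λ] B :=
  Conc.out (q + 1) B r ∘ₗ LinearMap.fst Λ (Conc (q + 1) B r) (Conc q C r) ∘ₗ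
    LinearMap.snd Λ (Conc (q + 2) A r) (Conc (q + 1) B r × Conc q C r)

/-- The projection to `C` (zero unless `r = q`). -/
def out₀ : (threeTerm q a b hab).X r →ₗ[Λ] C :=
  Conc.out q C r ∘ₗ LinearMap.snd Λ (Conc (q + 1) B r) (Conc q C r) ∘ₗ
    LinearMap.snd Λ (Conc (q + 2) A r) (Conc (q + 1) B r × Conc q C r)

end

variable {q : ℤ} {a : A →ₗ[Λ] B} {b : B →ₗ[Λ] C} {hab : ∀ x, b (a x) = 0} {r : ℤ}

theorem in₂_eq_zero (h : r ≠ q + 2) (x : A) : in₂ q a b hab r x = 0 := by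
  change (Conc.of (Λ := Λ) (q + 2) A r x, (0 : Conc (q + 1) B r × Conc q C r)) = 0
  rw [Conc.of_eq_zero h]; rfl

theorem in₁_eq_zero (h : r ≠ q + 1) (x : B) : in₁ q a b hab r x = 0 := by
  change ((0 : Conc (q + 2) A r), Conc.of (Λ := Λ) (q + 1) B r x, (0 : Conc q C r)) = 0
  rw [Conc.of_eq_zero h]; rfl

theorem in₀_eq_zero (h : r ≠ q) (x : C) : in₀ q a b hab r x = 0 := by
  change ((0 : Conc (q + 2) A r), (0 : Conc (q + 1) B r), Conc.of (Λ := Λ) q C r x) = 0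
  rw [Conc.of_eq_zero h]; rfl

theorem out₂_eq_zero (h : r ≠ q + 2) (x) : out₂ q a b hab r x = 0 := Conc.out_eq_zero h _

theorem out₁_eq_zero (h : r ≠ q + 1) (x) : out₁ q a b hab r x = 0 := Conc.out_eq_zero h _

theorem out₀_eq_zero (h : r ≠ q) (x) : out₀ q a b hab r x = 0 := Conc.out_eq_zero h _

theorem out₂_in₂ (h : r = q + 2) (x : A) : out₂ q a b hab r (in₂ q a b hab r x) = x :=
  Conc.out_of h x

theorem out₁_in₁ (h : r = q + 1) (x : B) : out₁ q a b hab r (in₁ q a b hab r x) = x :=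
  Conc.out_of h x

theorem out₀_in₀ (h : r = q) (x : C) : out₀ q a b hab r (in₀ q a b hab r x) = x :=
  Conc.out_of h x

@[simp] theorem out₂_in₁ (x : B) : out₂ q a b hab r (in₁ q a b hab r x) = 0 := map_zero (Conc.out _ _ _)

@[simp] theorem out₂_in₀ (x : C) : out₂ q a b hab r (in₀ q a b hab r x) = 0 := map_zero (Conc.out _ _ _)

@[simp] theorem out₁_in₂ (x : A) : out₁ q a b hab r (in₂ q a b hab r x) = 0 := map_zero (Conc.out _ _ _)

@[simp] theorem out₁_in₀ (x : C) : out₁ q a b hab r (in₀ q a b hab r x) = 0 := map_zero (Conc.out _ _ _)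

@[simp] theorem out₀_in₂ (x : A) : out₀ q a b hab r (in₂ q a b hab r x) = 0 := map_zero (Conc.out _ _ _)

@[simp] theorem out₀_in₁ (x : B) : out₀ q a b hab r (in₁ q a b hab r x) = 0 := map_zero (Conc.out _ _ _)

theorem in_add_in_add_in (x : (threeTerm q a b hab).X r) :
    in₂ q a b hab r (out₂ q a b hab r x) + (in₁ q a b hab r (out₁ q a b hab r x) +
      in₀ q a b hab r (out₀ q a b hab r x)) = x := by
  refine Prod.ext ?_ (Prod.ext ?_ ?_)
  · change Conc.of (Λ := Λ) (q + 2) A r (Conc.out (Λ := Λ) (q + 2) A r x.1) + (0 + 0) = x.1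
    rw [Conc.of_out, add_zero, add_zero]
  · change 0 + (Conc.of (Λ := Λ) (q + 1) B r (Conc.out (Λ := Λ) (q + 1) B r x.2.1) + 0) = x.2.1
    rw [Conc.of_out, add_zero, zero_add]
  · change 0 + (0 + Conc.of (Λ := Λ) q C r (Conc.out (Λ := Λ) q C r x.2.2)) = x.2.2
    rw [Conc.of_out, zero_add, zero_add]

theorem threeTerm_ext {x y : (threeTerm q a b hab).X r}
    (h₂ : out₂ q a b hab r x = out₂ q a b hab r y) (h₁ : out₁ q a b hab r x = out₁ q a b hab r y)
    (h₀ : out₀ q a b hab r x = out₀ q a b hab r y) : x = y := by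
  rw [← in_add_in_add_in x, ← in_add_in_add_in y, h₂, h₁, h₀]

theorem dual_threeTerm_ext {φ χ : StarDual Λ ((threeTerm q a b hab).X r)}
    (h₂ : dualMap (in₂ q a b hab r) φ = dualMap (in₂ q a b hab r) χ)
    (h₁ : dualMap (in₁ q a b hab r) φ = dualMap (in₁ q a b hab r) χ)
    (h₀ : dualMap (in₀ q a b hab r) φ = dualMap (in₀ q a b hab r) χ) : φ = χ :=
  StarDual.ext fun x => by
    rw [← in_add_in_add_in x, map_add, map_add, map_add, map_add]
    exact congrArg₂ (· + ·) (DFunLike.congr_fun h₂ _)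
      (congrArg₂ (· + ·) (DFunLike.congr_fun h₁ _) (DFunLike.congr_fun h₀ _))

theorem d_threeTerm (i j : ℤ) (h : j + 1 = i) (x : (threeTerm q a b hab).X i) :
    (threeTerm q a b hab).d i j h x =
      in₁ q a b hab j (a (out₂ q a b hab i x)) + in₀ q a b hab j (b (out₁ q a b hab i x)) := by
  refine Prod.ext ?_ (Prod.ext ?_ ?_)
  · exact (add_zero (0 : Conc (q + 2) A j)).symm
  · exact (add_zero (Conc.of (Λ := Λ) (q + 1) B j _)).symm
  · exact (zero_add (Conc.of (Λ := Λ) q C j _)).symm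

theorem d_in₂ (i j : ℤ) (h : j + 1 = i) (x : A) :
    (threeTerm q a b hab).d i j h (in₂ q a b hab i x) = in₁ q a b hab j (a x) := by
  rw [d_threeTerm, out₁_in₂, map_zero, map_zero, add_zero]
  by_cases hi : i = q + 2
  · rw [out₂_in₂ hi]
  · rw [in₁_eq_zero (by omega), in₁_eq_zero (by omega)]

theorem d_in₁ (i j : ℤ) (h : j + 1 = i) (x : B) :
    (threeTerm q a b hab).d i j h (in₁ q a b hab i x) = in₀ q a b hab j (b x) := by
  rw [d_threeTerm, out₂_in₁, map_zero, map_zero, zero_add]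
  by_cases hi : i = q + 1
  · rw [out₁_in₁ hi]
  · rw [in₀_eq_zero (by omega), in₀_eq_zero (by omega)]

theorem d_in₀ (i j : ℤ) (h : j + 1 = i) (x : C) :
    (threeTerm q a b hab).d i j h (in₀ q a b hab i x) = 0 := by
  rw [d_threeTerm, out₂_in₀, out₁_in₀, map_zero, map_zero, map_zero, map_zero, add_zero]

theorem out₂_d (i j : ℤ) (h : j + 1 = i) (x : (threeTerm q a b hab).X i) :
    out₂ q a b hab j ((threeTerm q a b hab).d i j h x) = 0 := by
  rw [d_threeTerm, map_add, out₂_in₁, out₂_in₀, add_zero]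

theorem out₁_d (i j : ℤ) (h : j + 1 = i) (x : (threeTerm q a b hab).X i) :
    out₁ q a b hab j ((threeTerm q a b hab).d i j h x) = a (out₂ q a b hab i x) := by
  rw [d_threeTerm, map_add, out₁_in₀, add_zero]
  by_cases hj : j = q + 1
  · rw [out₁_in₁ hj]
  · rw [out₁_eq_zero hj, out₂_eq_zero (by omega), map_zero]

theorem out₀_d (i j : ℤ) (h : j + 1 = i) (x : (threeTerm q a b hab).X i) :
    out₀ q a b hab j ((threeTerm q a b hab).d i j h x) = b (out₁ q a b hab i x) := by
  rw [d_threeTerm, map_add, out₀_in₁, zero_add]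
  by_cases hj : j = q
  · rw [out₀_in₀ hj]
  · rw [out₀_eq_zero hj, out₁_eq_zero (by omega), map_zero]

/-- The cochain with the components `α`, `β`, `γ`. -/
def coThree (q : ℤ) (a : A →ₗ[Λ] B) (b : B →ₗ[Λ] C) (hab : ∀ x, b (a x) = 0) (r : ℤ)
    (α : StarDual Λ A) (β : StarDual Λ B) (γ : StarDual Λ C) :
    StarDual Λ ((threeTerm q a b hab).X r) :=
  dualMap (out₂ q a b hab r) α + dualMap (out₁ q a b hab r) β + dualMap (out₀ q a b hab r) γ

variable (α : StarDual Λ A) (β : StarDual Λ B) (γ : StarDual Λ C)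

theorem coThree_apply (x : (threeTerm q a b hab).X r) : coThree q a b hab r α β γ x =
    α (out₂ q a b hab r x) + β (out₁ q a b hab r x) + γ (out₀ q a b hab r x) := rfl

theorem dualMap_in₂_coThree (h : r = q + 2) :
    dualMap (in₂ q a b hab r) (coThree q a b hab r α β γ) = α :=
  StarDual.ext fun x => by
    rw [dualMap_apply, coThree_apply, out₂_in₂ h, out₁_in₂, out₀_in₂, map_zero, map_zero, add_zero,
      add_zero]

theorem dualMap_in₁_coThree (h : r = q + 1) :
    dualMap (in₁ q a b hab r) (coThree q a b hab r α β γ) = β :=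
  StarDual.ext fun x => by
    rw [dualMap_apply, coThree_apply, out₂_in₁, out₁_in₁ h, out₀_in₁, map_zero, map_zero, add_zero,
      zero_add]

theorem dualMap_in₀_coThree (h : r = q) :
    dualMap (in₀ q a b hab r) (coThree q a b hab r α β γ) = γ :=
  StarDual.ext fun x => by
    rw [dualMap_apply, coThree_apply, out₂_in₀, out₁_in₀, out₀_in₀ h, map_zero, map_zero, zero_add,
      zero_add]

theorem dualMap_in₂_eq_zero (h : r ≠ q + 2) (m : StarDual Λ ((threeTerm q a b hab).X r)) :
    dualMap (in₂ q a b hab r) m = 0 :=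
  StarDual.ext fun x => by rw [dualMap_apply, in₂_eq_zero h]; exact map_zero m

theorem dualMap_in₁_eq_zero (h : r ≠ q + 1) (m : StarDual Λ ((threeTerm q a b hab).X r)) :
    dualMap (in₁ q a b hab r) m = 0 :=
  StarDual.ext fun x => by rw [dualMap_apply, in₁_eq_zero h]; exact map_zero m

theorem dualMap_in₀_eq_zero (h : r ≠ q) (m : StarDual Λ ((threeTerm q a b hab).X r)) :
    dualMap (in₀ q a b hab r) m = 0 :=
  StarDual.ext fun x => by rw [dualMap_apply, in₀_eq_zero h]; exact map_zero m

theorem dualMap_in₂_dualMap_d (i j : ℤ) (h : j + 1 = i)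
    (m : StarDual Λ ((threeTerm q a b hab).X j)) :
    dualMap (in₂ q a b hab i) (dualMap ((threeTerm q a b hab).d i j h) m) =
      dualMap a (dualMap (in₁ q a b hab j) m) :=
  StarDual.ext fun x => congrArg m (d_in₂ i j h x)

theorem dualMap_in₁_dualMap_d (i j : ℤ) (h : j + 1 = i)
    (m : StarDual Λ ((threeTerm q a b hab).X j)) :
    dualMap (in₁ q a b hab i) (dualMap ((threeTerm q a b hab).d i j h) m) =
      dualMap b (dualMap (in₀ q a b hab j) m) :=
  StarDual.ext fun x => congrArg m (d_in₁ i j h x)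

theorem dualMap_in₀_dualMap_d (i j : ℤ) (h : j + 1 = i)
    (m : StarDual Λ ((threeTerm q a b hab).X j)) :
    dualMap (in₀ q a b hab i) (dualMap ((threeTerm q a b hab).d i j h) m) = 0 :=
  StarDual.ext fun x => (congrArg m (d_in₀ i j h x)).trans (map_zero m)

end FreeComplex

end ThreeTerm

section LagrangianPair

variable {Λ : Type u} [Ring Λ] [StarRing Λ]

open FreeComplex

namespace RegSplitPreformation

variable {q : ℕ} {z : RegSplitPreformation Λ ((-1) ^ q)} {θ : z.G →ₗ[Λ] StarDual Λ z.G}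
  {U : Type u} [AddCommGroup U] [Module Λ U] [Module.Free Λ U] [Module.Finite Λ U]
  (j : U →ₗ[Λ] z.G)

/-- The map `-ε j^* λ : G → U^*`. -/
def colam : z.G →ₗ[Λ] StarDual Λ U := -(((-1) ^ q : ℤˣ) • (dualMap (z.γ ∘ₗ j) ∘ₗ z.μ))

theorem colam_apply (x : z.G) : colam j x = -(((-1) ^ q : ℤˣ) • dualMap j (dualMap z.γ (z.μ x))) :=
  rfl

theorem dualMap_colam_evalDual (u : U) :
    dualMap (colam j) (evalDual U u) = dualMap z.γ (z.μ (j u)) :=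
  StarDual.ext fun x => by
    rw [dualMap_apply, evalDual_apply, colam_apply, StarDual.neg_apply, StarDual.units_smul_apply,
      star_neg, star_units_smul, dualMap_apply, dualMap_apply, dualMap_apply, lam_symm (j u) x]

/-- The complex `U → G → U^*`. -/
abbrev lagComplex (hj : ∀ x, colam j (j x) = 0) : FreeComplex Λ := threeTerm (q : ℤ) j (colam j) hj

variable (hθ : z.IsRepresentative θ) {j} (hj : ∀ x, colam j (j x) = 0)

theorem gVal_d {i k : ℤ} (h : k + 1 = i) (b : (bdX hθ).X i) :
    gVal hθ k ((bdX hθ).d i k h b) = 0 := by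
  have h1 := (mapX hθ).comm i k h b
  by_cases hk : k = q + 1
  · have h2 := congrArg (Conc.out (Λ := Λ) (q + 1 : ℤ) z.G k) h1
    exact (Conc.out_of hk _).symm.trans (h2.symm.trans (map_zero _))
  · exact gVal_eq_zero hk _

/-- The chain map `∂E → E'`. -/
def lagMap : ChainMap (bdX hθ) (lagComplex j hj) where
  f r := in₁ (q : ℤ) j (colam j) hj r ∘ₗ gVal hθ r +
    in₀ (q : ℤ) j (colam j) hj r ∘ₗ dualMap j ∘ₗ alphaB hθ r
  comm i k h b := by
    change (lagComplex j hj).d i k h (in₁ (q : ℤ) j (colam j) hj i (gVal hθ i b) +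
      in₀ (q : ℤ) j (colam j) hj i (dualMap j (alphaB hθ i b))) =
      in₁ (q : ℤ) j (colam j) hj k (gVal hθ k ((bdX hθ).d i k h b)) +
      in₀ (q : ℤ) j (colam j) hj k (dualMap j (alphaB hθ k ((bdX hθ).d i k h b)))
    rw [map_add, d_in₁, d_in₀, gVal_d, map_zero, zero_add, add_zero, alphaB_d, map_neg,
      map_units_smul, colam_apply]

variable {hθ}

theorem lagMap_apply (r : ℤ) (b : (bdX hθ).X r) : (lagMap hθ hj).f r b =
    in₁ (q : ℤ) j (colam j) hj r (gVal hθ r b) +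
      in₀ (q : ℤ) j (colam j) hj r (dualMap j (alphaB hθ r b)) := rfl

theorem out₂_lagMap (r : ℤ) (b : (bdX hθ).X r) :
    out₂ (q : ℤ) j (colam j) hj r ((lagMap hθ hj).f r b) = 0 := by
  rw [lagMap_apply, map_add, out₂_in₁, out₂_in₀, add_zero]

theorem out₁_lagMap (r : ℤ) (b : (bdX hθ).X r) :
    out₁ (q : ℤ) j (colam j) hj r ((lagMap hθ hj).f r b) = gVal hθ r b := by
  rw [lagMap_apply, map_add, out₁_in₀, add_zero]
  by_cases hr : r = q + 1
  · rw [out₁_in₁ hr]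
  · rw [out₁_eq_zero hr, gVal_eq_zero hr]

theorem out₀_lagMap (r : ℤ) (b : (bdX hθ).X r) :
    out₀ (q : ℤ) j (colam j) hj r ((lagMap hθ hj).f r b) = dualMap j (alphaB hθ r b) := by
  rw [lagMap_apply, map_add, out₀_in₁, zero_add]
  by_cases hr : r = q
  · rw [out₀_in₀ hr]
  · rw [out₀_eq_zero hr, alphaB_eq_zero hr, map_zero]

theorem lagMap_iota (r : ℤ) (w : StarDual Λ z.G) :
    (lagMap hθ hj).f r (iotaB hθ r w) = in₀ (q : ℤ) j (colam j) hj r (dualMap j w) := by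
  rw [lagMap_apply, gVal_iota, map_zero, zero_add]
  by_cases hr : r = q
  · rw [alphaB_iota hr]
  · rw [in₀_eq_zero hr, in₀_eq_zero hr]

theorem lagMap_eq_zero {r : ℤ} (h : r < q) (b : (bdX hθ).X r) : (lagMap hθ hj).f r b = 0 := by
  rw [lagMap_apply, in₁_eq_zero (by omega), in₀_eq_zero (by omega), add_zero]

/-- The component in `U` of a cochain. -/
def coU (p : ℤ) : StarDual Λ ((lagComplex j hj).X p) →ₗ[Λ] U :=
  (undual U).toLinearMap ∘ₗ dualMap (in₀ (q : ℤ) j (colam j) hj p)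

theorem apply_coU (p : ℤ) (m : StarDual Λ ((lagComplex j hj).X p)) (φ : StarDual Λ U) :
    φ (coU hj p m) = star (m (in₀ (q : ℤ) j (colam j) hj p φ)) :=
  apply_undual _ _

theorem coU_eq_zero {p : ℤ} (h : p ≠ q) (m : StarDual Λ ((lagComplex j hj).X p)) :
    coU hj p m = 0 := by
  rw [coU, LinearMap.comp_apply, dualMap_in₀_eq_zero h, map_zero]

theorem coU_dualMap_d (i k : ℤ) (h : k + 1 = i) (m : StarDual Λ ((lagComplex j hj).X k)) :
    coU hj i (dualMap ((lagComplex j hj).d i k h) m) = 0 := by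
  rw [coU, LinearMap.comp_apply, dualMap_in₀_dualMap_d, map_zero]

theorem dualMap_in₀_eq (p : ℤ) (m : StarDual Λ ((lagComplex j hj).X p)) :
    dualMap (in₀ (q : ℤ) j (colam j) hj p) m = evalDual U (coU hj p m) :=
  StarDual.ext fun φ => by rw [evalDual_apply, apply_coU, star_star, dualMap_apply]

theorem dualMap_lagMap (p : ℤ) (m : StarDual Λ ((lagComplex j hj).X p)) :
    dualMap ((lagMap hθ hj).f p) m =
      dualMap ((mapX hθ).f p) (dualMap (Conc.out (q + 1 : ℤ) z.G p)
        (dualMap (in₁ (q : ℤ) j (colam j) hj p) m)) + alphaX hθ p (j (coU hj p m)) := by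
  refine StarDual.ext fun b => ?_
  change m ((lagMap hθ hj).f p b) = m (in₁ (q : ℤ) j (colam j) hj p
    (Conc.out (Λ := Λ) (q + 1 : ℤ) z.G p (Conc.of (Λ := Λ) (q + 1 : ℤ) z.G p (gVal hθ p b)))) +
      star (dualMap j (alphaB hθ p b) (coU hj p m))
  rw [lagMap_apply, map_add, apply_coU, star_star]
  congr 1
  by_cases hp : p = q + 1
  · rw [Conc.out_of hp]
  · rw [in₁_eq_zero hp, in₁_eq_zero hp]

/-- The structure `δω'` on `E'`. -/
def lagStruct (ρ : U →ₗ[Λ] StarDual Λ U) : QStruct (lagComplex j hj) (2 * q + 1 + 1)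
  | 0, p, r, _ => in₂ (q : ℤ) j (colam j) hj r ∘ₗ coU hj p
  | 1, _, _, _ => 0
  | 2, p, r, _ => in₀ (q : ℤ) j (colam j) hj r ∘ₗ ρ ∘ₗ coU hj p
  | _ + 3, _, _, _ => 0

theorem push_lagMap_eq_zero (s : ℕ) (p r : ℤ) (h : p + r + s = 2 * q + 1) (hpr : p < q ∨ r < q)
    (α : StarDual Λ ((lagComplex j hj).X p)) :
    QStruct.push (lagMap hθ hj) (omegaX hθ) s p r h α = 0 := by
  change (lagMap hθ hj).f r (omegaX hθ s p r h (dualMap ((lagMap hθ hj).f p) α)) = 0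
  rcases hpr with hp | hr
  · have : dualMap ((lagMap hθ hj).f p) α = 0 := StarDual.ext fun b =>
      (congrArg α (lagMap_eq_zero hj hp b)).trans (map_zero α)
    rw [this, map_zero, map_zero]
  · exact lagMap_eq_zero hj hr _

theorem push_lagMap_zero (p r : ℤ) (h : p + r + (0 : ℕ) = 2 * q + 1)
    (α : StarDual Λ ((lagComplex j hj).X p)) :
    QStruct.push (lagMap hθ hj) (omegaX hθ) 0 p r h α =
      in₁ (q : ℤ) j (colam j) hj r (j (coU hj p α)) := by
  change (lagMap hθ hj).f r (omegaX hθ 0 p r h (dualMap ((lagMap hθ hj).f p) α)) = _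
  rw [lagMap_apply, gVal_omega]
  have e1 : undual z.G (dualMap (iotaB hθ p) (dualMap ((lagMap hθ hj).f p) α)) =
      j (coU hj p α) := ext_dual (Λ := Λ) fun w => by
    rw [apply_undual, dualMap_apply, dualMap_apply, lagMap_iota, ← apply_coU, dualMap_apply]
  rw [e1]
  by_cases hr : r = q
  · rw [dualMap_lagMap, coU_eq_zero hj (show p ≠ q by push_cast at h; omega), map_zero,
      show alphaX hθ p 0 = 0 by rw [alphaX, map_zero, map_zero], add_zero, omega_dualMap_mapX,
      map_zero, map_zero, map_zero, map_zero, add_zero]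
  · rw [in₀_eq_zero hr, add_zero]

theorem apply_push_lagMap_one (h : (q : ℤ) + q + (1 : ℕ) = 2 * q + 1)
    (α β : StarDual Λ ((lagComplex j hj).X q)) :
    β (QStruct.push (lagMap hθ hj) (omegaX hθ) 1 q q h α) =
      -θ (j (coU hj q β)) (j (coU hj q α)) := by
  have e : ∀ γ : StarDual Λ ((lagComplex j hj).X q), dualMap ((lagMap hθ hj).f q) γ =
      alphaX hθ q (j (coU hj q γ)) := fun γ => by
    rw [dualMap_lagMap, dualMap_in₁_eq_zero (by omega), map_zero]
    exact (congrArg (· + _) (map_zero (dualMap ((mapX hθ).f q)))).trans (zero_add _)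
  refine Eq.trans ?_ (alphaX_omega_alphaX (hθ := hθ) h (j (coU hj q α)) (j (coU hj q β)))
  rw [← e, ← e]
  rfl

/-- The pair `(∂E → E', (δω', ω))`. -/
def lagPair (hθ : z.IsRepresentative θ) (ρ : U →ₗ[Λ] StarDual Λ U)
    (hρ : ∀ x y, star (ρ x y) + ((-1) ^ q : ℤˣ) • ρ y x + θ (j y) (j x) = 0) :
    QuadPair (bdX hθ) (2 * q + 1) (omegaX hθ) where
  D := lagComplex j hj
  f := lagMap hθ hj
  δψ := lagStruct hj ρ
  isCycle := (pairX z θ hθ).isCycle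
  isCycle_rel s p r h := by
    have e0 : (2 * (q : ℤ) + 1).negOnePow = -1 :=
      Int.negOnePow_odd _ (odd_two_mul_add_one _)
    refine LinearMap.ext fun α => ext_dual (Λ := Λ) fun β => ?_
    refine (map_add β _ _).trans ((congrArg₂ (· + ·)
      ((lagStruct hj ρ).apply_diff (2 * q + 1) rfl s p r _ _ h rfl rfl α β)
      (congrArg β (congrArg (· • QStruct.push (lagMap hθ hj) (omegaX hθ) s p r h α) e0))).trans
      (Eq.trans ?_ (map_zero β).symm))
    match s, h with
    | 0, h =>
      change β ((lagComplex j hj).d (r + 1) r rfl (in₂ (q : ℤ) j (colam j) hj (r + 1) (coU hj p α)))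
        + r.negOnePow • β (in₂ (q : ℤ) j (colam j) hj r (coU hj (p + 1) (dualMap _ α))) +
        _ • (β 0 + _ • _ • star (α 0)) + _ = 0
      rw [d_in₂, coU_dualMap_d, push_lagMap_zero, map_zero, map_zero, map_zero]
      simp
    | 1, h =>
      change β ((lagComplex j hj).d (r + 1) r rfl 0) + r.negOnePow • β 0 +
        _ • (β (in₀ (q : ℤ) j (colam j) hj r (ρ (coU hj p α))) + _ • _ •
          star (α (in₀ (q : ℤ) j (colam j) hj p (ρ (coU hj r β))))) + _ = 0
      by_cases hp : p = q
      · obtain rfl : r = q := by push_cast at h; omega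
        subst hp
        rw [← apply_coU, Units.neg_smul, map_neg, one_smul, apply_push_lagMap_one, neg_neg,
          map_zero, map_zero, smul_zero, zero_add, zero_add, Int.negOnePow_mul_self, negOnePow_eq,
          ← star_star (β _), ← apply_coU, ← hρ,
          Int.negOnePow_even (2 * (q : ℤ) + 1 + 1 - (1 : ℕ) - 1) ⟨q, by push_cast; ring⟩,
          Int.negOnePow_even _ (by decide), one_smul, one_smul]
      · rw [push_lagMap_eq_zero hj 1 p r h (by push_cast at h; omega), in₀_eq_zero hp,
          coU_eq_zero hj hp]
        simp
    | 2, h =>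
      change β ((lagComplex j hj).d (r + 1) r rfl
        (in₀ (q : ℤ) j (colam j) hj (r + 1) (ρ (coU hj p α)))) +
        r.negOnePow • β (in₀ (q : ℤ) j (colam j) hj r (ρ (coU hj (p + 1) (dualMap _ α)))) +
        _ • (β 0 + _ • _ • star (α 0)) + _ = 0
      rw [push_lagMap_eq_zero hj 2 p r h (by push_cast at h; omega), d_in₀, coU_dualMap_d]
      simp
    | s + 3, h =>
      change β ((lagComplex j hj).d (r + 1) r rfl 0) + r.negOnePow • β 0 +
        _ • (β 0 + _ • _ • star (α 0)) + _ = 0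
      rw [push_lagMap_eq_zero hj (s + 3) p r h (by push_cast at h; omega)]
      simp

end RegSplitPreformation

end LagrangianPair

section LagrangianPoincare

variable {Λ : Type u} [Ring Λ] [StarRing Λ]

open FreeComplex

namespace RegSplitPreformation

variable {q : ℕ} {z : RegSplitPreformation Λ ((-1) ^ q)} {θ : z.G →ₗ[Λ] StarDual Λ z.G}
  {U : Type u} [AddCommGroup U] [Module Λ U] [Module.Free Λ U] [Module.Finite Λ U]
  {j : U →ₗ[Λ] z.G} (hθ : z.IsRepresentative θ) (hj : ∀ x, colam j (j x) = 0)

theorem gVal_symm₀_alphaX {p : ℤ} (hp : p = q) (r : ℤ) (h : p + r = 2 * q + 1) (x : z.G) :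
    gVal hθ r ((omegaX hθ).symm₀ p r h (alphaX hθ p x)) = x := by
  refine ext_dual (Λ := Λ) fun φ => ?_
  have hr : r = q + 1 := by omega
  set ξ : StarDual Λ (Conc (q + 1 : ℤ) z.G r) := dualMap (Conc.out (q + 1 : ℤ) z.G r) φ
  have hξ : ∀ b, dualMap ((mapX hθ).f r) ξ b = φ (gVal hθ r b) := fun b =>
    congrArg φ (Conc.out_of hr _)
  have h1 := (omegaX hθ).apply_symm₀ p r h (alphaX hθ p x) (dualMap ((mapX hθ).f r) ξ)
  rw [hξ, hξ, omega_dualMap_mapX, map_zero, star_zero, smul_zero, add_zero, gVal_omega,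
    apply_undual, dualMap_apply, alphaX_apply, alphaB_iota hp, star_star] at h1
  exact h1

theorem d_symm₀_alphaX (p r r' : ℤ) (h : p + r = 2 * q + 1) (hr : r' + 1 = r) {x : z.G}
    (hx : dualMap z.γ (z.μ x) = 0) :
    (bdX hθ).d r r' hr ((omegaX hθ).symm₀ p r h (alphaX hθ p x)) = 0 := by
  have hd : dualMap ((bdX hθ).d (p + 1) p rfl) (alphaX hθ p x) = 0 := StarDual.ext fun b => by
    rw [dualMap_apply, alphaX_apply, alphaB_d, StarDual.neg_apply, StarDual.units_smul_apply,
      dualMap_apply, star_neg, star_units_smul, ← lam_symm]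
    exact DFunLike.congr_fun hx _
  rw [(pairX z θ hθ).isCycle.d_symm₀ p r' (by omega) r (p + 1) hr rfl, hd, map_zero, smul_zero]

variable {hθ}

theorem symm₀_lagStruct (ρ : U →ₗ[Λ] StarDual Λ U) (p r : ℤ) (h : p + r = 2 * q + 1 + 1)
    (m : StarDual Λ ((lagComplex j hj).X p)) :
    (lagStruct hj ρ).symm₀ p r h m = in₂ (q : ℤ) j (colam j) hj r (coU hj p m) +
      (p * r).negOnePow • in₀ (q : ℤ) j (colam j) hj r (dualMap (in₂ (q : ℤ) j (colam j) hj p) m) := by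
  refine ext_dual (Λ := Λ) fun β => ?_
  rw [QStruct.apply_symm₀, map_add, map_units_smul]
  change β (in₂ (q : ℤ) j (colam j) hj r (coU hj p m)) + _ • star
    (dualMap (in₂ (q : ℤ) j (colam j) hj p) m (coU hj r β)) = _
  rw [apply_coU, star_star]

theorem symm₀_omega_lagMap (p r : ℤ) (h : p + r = 2 * q + 1)
    (m : StarDual Λ ((lagComplex j hj).X p)) :
    (omegaX hθ).symm₀ p r h (dualMap ((lagMap hθ hj).f p) m) =
      (p * r).negOnePow • iotaB hθ r (dualMap (in₁ (q : ℤ) j (colam j) hj p) m) +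
        (omegaX hθ).symm₀ p r h (alphaX hθ p (j (coU hj p m))) := by
  rw [dualMap_lagMap]
  refine (map_add ((omegaX hθ).symm₀ p r h) _ _).trans (congrArg (· + _) ?_)
  rw [symm₀_omega_mapX]
  congr 2
  refine StarDual.ext fun x => ?_
  by_cases hp : p = q + 1
  · rw [dualMap_apply, dualMap_apply, Conc.out_of hp]
  · rw [dualMap_in₁_eq_zero hp, map_zero, map_zero]

theorem isPoincare_lagPair (ρ : U →ₗ[Λ] StarDual Λ U)
    (hρ : ∀ x y, star (ρ x y) + ((-1) ^ q : ℤˣ) • ρ y x + θ (j y) (j x) = 0) :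
    (lagPair hj hθ ρ hρ).IsPoincare := by
  have sq : (q : ℤ).negOnePow = (-1) ^ q := negOnePow_eq q
  apply QuadPair.isPoincare_of_elementwise
  · intro i j' k p p₀ p₁ hij hjk hp hp₀ hp₁ m y v hm hy hv
    change StarDual Λ ((lagComplex j hj).X p) at m
    change (lagComplex j hj).X i at y
    replace hy : (lagComplex j hj).d i j' hij y + j'.negOnePow • (lagMap hθ hj).f j' v =
      (lagStruct hj ρ).symm₀ p j' hp m := hy
    replace hv : (bdX hθ).d j' k hjk v = p.negOnePow •
      (omegaX hθ).symm₀ p k (by omega) (dualMap ((lagMap hθ hj).f p) m) := hv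
    have h₂ := congrArg (out₂ (q : ℤ) j (colam j) hj j') hy
    have h₁ := congrArg (out₁ (q : ℤ) j (colam j) hj j') hy
    have h₀ := congrArg (out₀ (q : ℤ) j (colam j) hj j') hy
    simp only [symm₀_lagStruct, map_add, map_units_smul, out₂_d, out₂_lagMap, out₂_in₀, out₁_d,
      out₁_lagMap, out₁_in₂, out₁_in₀, out₀_d, out₀_lagMap, out₀_in₂, smul_zero, add_zero,
      zero_add] at h₂ h₁ h₀
    have hu : coU hj p m = 0 := by
      by_cases h : p = q
      · rw [out₂_in₂ (by omega)] at h₂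
        exact h₂.symm
      · exact coU_eq_zero hj h m
    have e0 : (omegaX hθ).symm₀ p k (by omega) (alphaX hθ p (j 0)) = 0 := by
      rw [alphaX, map_zero, map_zero, map_zero, map_zero]
    rw [symm₀_omega_lagMap, hu, e0, add_zero] at hv
    have h₁' : gVal hθ j' v = -(j'.negOnePow • j (out₂ (q : ℤ) j (colam j) hj i y)) := by
      rw [eq_neg_of_add_eq_zero_left h₁, smul_neg, neg_neg, smul_smul, Int.units_mul_self, one_smul]
    refine ⟨coThree (q : ℤ) j (colam j) hj p₀ 0 ((p * j').negOnePow •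
      (j'.negOnePow • alphaB hθ j' v -
        ((-1) ^ q : ℤˣ) • dualMap z.γ (z.μ (out₁ (q : ℤ) j (colam j) hj i y))))
      (evalDual U (((-1) ^ q : ℤˣ) • out₂ (q : ℤ) j (colam j) hj i y)), ?_⟩
    change dualMap ((lagComplex j hj).d p p₀ hp₀) _ = m
    refine dual_threeTerm_ext ?_ ?_ ?_
    · rw [dualMap_in₂_dualMap_d]
      by_cases h : p = q + 2
      · rw [dualMap_in₁_coThree _ _ _ (by omega), map_units_smul, map_sub, map_units_smul,
          map_units_smul]
        rw [out₀_in₀ (by omega), colam_apply] at h₀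
        refine Eq.trans ?_ ((congrArg ((p * j').negOnePow • ·) h₀).trans
          (by rw [smul_smul, Int.units_mul_self, one_smul]))
        rw [neg_add_eq_sub]
      · rw [dualMap_in₁_eq_zero (by omega), dualMap_in₂_eq_zero h, map_zero]
    · rw [dualMap_in₁_dualMap_d]
      by_cases h : p = q + 1
      · rw [dualMap_in₀_coThree _ _ _ (by omega), dualMap_colam_evalDual]
        have h3 := congrArg (alphaB hθ k) hv
        have e1 : j'.negOnePow = -(-1) ^ q := by
          rw [show j' = q + 1 by omega, Int.negOnePow_succ, sq]
        have e2 : p.negOnePow = -(-1) ^ q := by rw [h, Int.negOnePow_succ, sq]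
        have e3 : (p * k).negOnePow = 1 := by
          obtain rfl : k = q := by omega
          rw [h, mul_comm]
          exact Int.negOnePow_even _ (Int.even_mul_succ_self _)
        rw [alphaB_d, h₁', map_units_smul, map_units_smul, alphaB_iota (by omega), e1, e2, e3] at h3
        have h4 := congrArg (fun t => (-(-1) ^ q : ℤˣ) • t) h3
        simp only [smul_smul, Int.units_mul_self, one_smul, Units.neg_smul, smul_neg, neg_neg,
          neg_mul, mul_neg, map_neg, map_units_smul, mul_one] at h4 ⊢
        exact h4
      · rw [dualMap_in₀_eq_zero (by omega), dualMap_in₁_eq_zero h, map_zero]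
    · rw [dualMap_in₀_dualMap_d, dualMap_in₀_eq, hu, map_zero]
  · intro i j' k l p p₁ hij hjk hkl hp hp₁ y v hy hv
    change (lagComplex j hj).X j' at y
    change (bdX hθ).X k at v
    change (bdX hθ).d k l hkl v = 0 at hv
    replace hy : (lagComplex j hj).d j' k hjk y + k.negOnePow • (lagMap hθ hj).f k v = 0 := hy
    have h₁ := congrArg (out₁ (q : ℤ) j (colam j) hj k) hy
    have h₀ := congrArg (out₀ (q : ℤ) j (colam j) hj k) hy
    simp only [map_add, map_units_smul, out₁_d, out₁_lagMap, out₀_d, out₀_lagMap, map_zero]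
      at h₁ h₀
    set u := out₂ (q : ℤ) j (colam j) hj j' y with hu
    set y₁ := out₁ (q : ℤ) j (colam j) hj j' y with hy₁
    have hju : j u = -(k.negOnePow • gVal hθ k v) := eq_neg_of_add_eq_zero_left h₁
    have hu0 : j' ≠ q + 2 → u = 0 := fun h => out₂_eq_zero h _
    have hy0 : j' ≠ q + 1 → y₁ = 0 := fun h => out₁_eq_zero h _
    have hμu : dualMap z.γ (z.μ (j u)) = 0 := by
      have h3 := congrArg (alphaB hθ l) hv
      rw [alphaB_d, map_zero, neg_eq_zero, smul_eq_zero_iff_eq] at h3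
      rw [hju, map_neg, map_neg, map_units_smul, map_units_smul, h3, smul_zero, neg_zero]
    set η : StarDual Λ z.G := alphaB hθ k v - dualMap z.γ (z.μ y₁) with hη
    have hη0 : j' ≠ q + 1 → η = 0 := fun h => by
      rw [hη, alphaB_eq_zero (by omega), hy0 h, map_zero, map_zero, sub_zero]
    have hjη : dualMap j η = 0 := by
      by_cases h : j' = q + 1
      · have e1 : k.negOnePow = (-1) ^ q := by rw [show k = q by omega, sq]
        rw [colam_apply, e1, neg_add_eq_sub, ← smul_sub, smul_eq_zero_iff_eq, ← map_sub] at h₀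
        exact h₀
      · rw [hη0 h, map_zero]
    set s : ℤˣ := p.negOnePow * (p * k).negOnePow with hs
    obtain ⟨v', hv', hg'⟩ := exists_boundary hjk hkl
      (v - iotaB hθ k η - p.negOnePow • (omegaX hθ).symm₀ p k (by omega) (alphaX hθ p (j u)))
      (Conc.of (Λ := Λ) (q + 1 : ℤ) z.G j' (j'.negOnePow • y₁))
      (by rw [map_sub, map_sub, hv, d_iota, map_units_smul, d_symm₀_alphaX hθ p k l _ hkl hμu]; simp)
      (by
        rw [map_sub, map_sub, gVal_iota, map_units_smul, sub_zero]
        by_cases h : j' = q + 2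
        · rw [gVal_symm₀_alphaX hθ (by omega), hju, show p.negOnePow = -k.negOnePow by
              rw [show k = p + 1 by omega, Int.negOnePow_succ, neg_neg], Units.neg_smul, smul_neg,
            neg_neg, smul_smul, Int.units_mul_self, one_smul, sub_self]
        · rw [hu0 h, map_zero, show alphaX hθ p 0 = 0 by rw [alphaX, map_zero, map_zero], map_zero,
            map_zero, smul_zero, sub_zero]
          by_cases hk : k = q + 1
          · omega
          · exact gVal_eq_zero hk v)
      (by
        by_cases h : j' = q + 1
        · rw [map_sub, map_sub, alphaB_iota (by omega), Conc.out_of h, hu0 (by omega), map_zero,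
            show alphaX hθ p 0 = 0 by rw [alphaX, map_zero, map_zero], map_zero, smul_zero, map_zero,
            h, Int.negOnePow_succ, sq, hη]
          simp only [map_units_smul, smul_smul, Int.units_mul_self, Units.neg_smul, map_neg, smul_neg,
            neg_neg, one_smul]
          abel
        · rw [alphaB_eq_zero (by omega), hy0 h, smul_zero, map_zero, map_zero, map_zero, map_zero,
            smul_zero, neg_zero])
    have hgv : gVal hθ j' v' = j'.negOnePow • y₁ := by
      by_cases h : j' = q + 1
      · exact (Conc.out_of h _).symm.trans
          ((congrArg (Conc.out (Λ := Λ) (q + 1 : ℤ) z.G j') hg').trans (Conc.out_of h _))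
      · rw [gVal_eq_zero h, hy0 h, smul_zero]
    set m := coThree (q : ℤ) j (colam j) hj p ((p * j').negOnePow • (out₀ (q : ℤ) j (colam j) hj j' y -
      j'.negOnePow • dualMap j (alphaB hθ j' v'))) (s • η) (evalDual U u) with hm
    have hmu : coU hj p m = u := by
      by_cases h : p = q
      · rw [coU, LinearMap.comp_apply, hm, dualMap_in₀_coThree _ _ _ h]
        exact undual_evalDual u
      · rw [coU_eq_zero hj h, hu0 (by omega)]
    have hm₁ : dualMap (in₁ (q : ℤ) j (colam j) hj p) m = s • η := by
      by_cases h : p = q + 1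
      · rw [hm, dualMap_in₁_coThree _ _ _ h]
      · rw [dualMap_in₁_eq_zero h, hη0 (by omega), smul_zero]
    refine ⟨m, (0 : (lagComplex j hj).X i), v', ?_, ?_, ?_⟩
    · change dualMap ((lagComplex j hj).d p₁ p hp₁) m = 0
      refine dual_threeTerm_ext ?_ ?_ ?_
      · rw [dualMap_in₂_dualMap_d, hm₁, map_units_smul, hjη, smul_zero, map_zero]
      · rw [dualMap_in₁_dualMap_d, dualMap_in₀_eq, hmu, dualMap_colam_evalDual, hμu, map_zero]
      · rw [dualMap_in₀_dualMap_d, map_zero]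
    · change (lagStruct hj ρ).symm₀ p j' hp m + ((lagComplex j hj).d i j' hij 0 +
        j'.negOnePow • (lagMap hθ hj).f j' v') = y
      rw [map_zero, zero_add, symm₀_lagStruct, hmu]
      refine threeTerm_ext ?_ ?_ ?_ <;> simp only [map_add, map_units_smul, out₂_lagMap, out₁_lagMap,
        out₀_lagMap, out₂_in₀, out₁_in₂, out₁_in₀, out₀_in₂, smul_zero, add_zero, zero_add]
      · by_cases h : j' = q + 2
        · rw [out₂_in₂ h]
        · rw [out₂_eq_zero h, out₂_eq_zero h]
      · rw [hgv, smul_smul, Int.units_mul_self, one_smul]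
      · by_cases h : j' = q
        · rw [out₀_in₀ h, hm, dualMap_in₂_coThree _ _ _ (by omega), smul_smul, Int.units_mul_self,
            one_smul, sub_add_cancel]
        · rw [out₀_eq_zero h, out₀_eq_zero h, alphaB_eq_zero h, map_zero, smul_zero, smul_zero,
            add_zero]
    · change p.negOnePow • (omegaX hθ).symm₀ p k (by omega) (dualMap ((lagMap hθ hj).f p) m) +
        (bdX hθ).d j' k hjk v' = v
      rw [hv', symm₀_omega_lagMap, hmu, hm₁, smul_add, smul_smul, ← map_units_smul, smul_smul, ← hs,
        Int.units_mul_self, one_smul]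
      abel

end RegSplitPreformation

end LagrangianPoincare

section Trace

variable {Λ : Type u} [Ring Λ] [StarRing Λ]

open FreeComplex

namespace RegSplitPreformation

variable {q : ℕ} {z : RegSplitPreformation Λ ((-1) ^ q)} {θ : z.G →ₗ[Λ] StarDual Λ z.G}
  {U : Type u} [AddCommGroup U] [Module Λ U] [Module.Free Λ U] [Module.Finite Λ U]
  {j : U →ₗ[Λ] z.G} (hθ : z.IsRepresentative θ) (hj : ∀ x, colam j (j x) = 0)

/-- The complex `E' ∪ E`. -/
abbrev lagGl : FreeComplex Λ := unionComplex (lagMap hθ hj) (mapX hθ)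

/-- The inclusion of `E'`. -/
def glE (r : ℤ) : (lagComplex j hj).X r →ₗ[Λ] (lagGl hθ hj).X r :=
  unionIn₁ (lagMap hθ hj) (mapX hθ) r

/-- The inclusion of `∂E_k`, for `k + 1 = r`. -/
def glM (r k : ℤ) (h : k + 1 = r) : (bdX hθ).X k →ₗ[Λ] (lagGl hθ hj).X r :=
  unionMid (lagMap hθ hj) (mapX hθ) r k h

/-- The inclusion of `G`. -/
def glG (r : ℤ) : z.G →ₗ[Λ] (lagGl hθ hj).X r :=
  unionIn₃ (lagMap hθ hj) (mapX hθ) r ∘ₗ Conc.of (Λ := Λ) (q + 1 : ℤ) z.G r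

theorem exists_eq_lagGl (r k : ℤ) (h : k + 1 = r) (c : (lagGl hθ hj).X r) : ∃ e b y,
    c = glE hθ hj r e + glM hθ hj r k h b + glG hθ hj r y := by
  obtain ⟨e, b, y, hc⟩ := exists_eq_union (lagMap hθ hj) (mapX hθ) r k h c
  exact ⟨e, b, Conc.out (Λ := Λ) (q + 1 : ℤ) z.G r y, hc.trans (congrArg
    (fun t => _ + unionIn₃ (lagMap hθ hj) (mapX hθ) r t) (Conc.of_out y).symm)⟩

theorem glG_eq_zero {r : ℤ} (h : r ≠ q + 1) (y : z.G) : glG hθ hj r y = 0 :=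
  (congrArg (unionIn₃ (lagMap hθ hj) (mapX hθ) r) (Conc.of_eq_zero h y)).trans (map_zero _)

theorem lagGl_eq_zero (r k : ℤ) (h : k + 1 = r) (e : (lagComplex j hj).X r) (b : (bdX hθ).X k)
    (y : z.G) (hc : glE hθ hj r e + glM hθ hj r k h b + glG hθ hj r y = 0) :
    e = 0 ∧ b = 0 ∧ (r = q + 1 → y = 0) := by
  obtain ⟨h1, h2, h3⟩ := union_eq_zero (lagMap hθ hj) (mapX hθ) r k h e b _ hc
  refine ⟨h1, h2, fun hr => ?_⟩
  rw [← Conc.out_of (Λ := Λ) hr y]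
  exact (congrArg (Conc.out (Λ := Λ) (q + 1 : ℤ) z.G r) h3).trans (map_zero _)

theorem d_glE (i k : ℤ) (h : k + 1 = i) (e : (lagComplex j hj).X i) :
    (lagGl hθ hj).d i k h (glE hθ hj i e) = glE hθ hj k ((lagComplex j hj).d i k h e) :=
  d_unionIn₁ (lagMap hθ hj) (mapX hθ) i k h e

theorem d_glM (i k l : ℤ) (h : k + 1 = i) (hl : l + 1 = k) (b : (bdX hθ).X k) :
    (lagGl hθ hj).d i k h (glM hθ hj i k h b) =
      k.negOnePow • glE hθ hj k ((lagMap hθ hj).f k b) + glM hθ hj k l hl ((bdX hθ).d k l hl b) +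
        k.negOnePow • glG hθ hj k (gVal hθ k b) :=
  d_unionMid (lagMap hθ hj) (mapX hθ) i k l h hl b

theorem d_glG (i k : ℤ) (h : k + 1 = i) (y : z.G) :
    (lagGl hθ hj).d i k h (glG hθ hj i y) = 0 :=
  (d_unionIn₃ (lagMap hθ hj) (mapX hθ) i k h _).trans (map_zero _)

/-- The component `E'_r ⊕ ∂E_{r-1} ⊕ E_r → Z_r` of the chain map to `Z = (U → G)`. -/
def traceComponent (r : ℤ) : (lagGl hθ hj).X r →ₗ[Λ] (twoTerm ((q : ℤ) + 1) j).X r :=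
  inA ((q : ℤ) + 1) j r ∘ₗ out₂ (q : ℤ) j (colam j) hj r ∘ₗ
      LinearMap.fst Λ ((lagComplex j hj).X r) ((bdX hθ).X (r - 1) × Conc (q + 1 : ℤ) z.G r) +
    inB ((q : ℤ) + 1) j r ∘ₗ (out₁ (q : ℤ) j (colam j) hj r ∘ₗ
      LinearMap.fst Λ ((lagComplex j hj).X r) ((bdX hθ).X (r - 1) × Conc (q + 1 : ℤ) z.G r) -
      Conc.out (Λ := Λ) (q + 1 : ℤ) z.G r ∘ₗ
        LinearMap.snd Λ ((bdX hθ).X (r - 1)) (Conc (q + 1 : ℤ) z.G r) ∘ₗ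
        LinearMap.snd Λ ((lagComplex j hj).X r) ((bdX hθ).X (r - 1) × Conc (q + 1 : ℤ) z.G r))

theorem trace_glE (r : ℤ) (e : (lagComplex j hj).X r) :
    traceComponent hθ hj r (glE hθ hj r e) =
      inA ((q : ℤ) + 1) j r (out₂ (q : ℤ) j (colam j) hj r e) +
        inB ((q : ℤ) + 1) j r (out₁ (q : ℤ) j (colam j) hj r e) := by
  change inA ((q : ℤ) + 1) j r (out₂ (q : ℤ) j (colam j) hj r e) + inB ((q : ℤ) + 1) j r
    (out₁ (q : ℤ) j (colam j) hj r e - Conc.out (Λ := Λ) (q + 1 : ℤ) z.G r 0) = _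
  rw [map_zero, sub_zero]

theorem trace_glM (r k : ℤ) (h : k + 1 = r) (b : (bdX hθ).X k) :
    traceComponent hθ hj r (glM hθ hj r k h b) = 0 := by
  obtain rfl : k = r - 1 := by omega
  change inA ((q : ℤ) + 1) j r (out₂ (q : ℤ) j (colam j) hj r 0) + inB ((q : ℤ) + 1) j r
    (out₁ (q : ℤ) j (colam j) hj r 0 - Conc.out (Λ := Λ) (q + 1 : ℤ) z.G r 0) = _
  simp only [map_zero, sub_zero, add_zero]

theorem trace_glG (r : ℤ) (y : z.G) :
    traceComponent hθ hj r (glG hθ hj r y) = -inB ((q : ℤ) + 1) j r y := by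
  change inA ((q : ℤ) + 1) j r (out₂ (q : ℤ) j (colam j) hj r 0) + inB ((q : ℤ) + 1) j r
    (out₁ (q : ℤ) j (colam j) hj r 0 - Conc.out (Λ := Λ) (q + 1 : ℤ) z.G r
      (Conc.of (Λ := Λ) (q + 1 : ℤ) z.G r y)) = _
  rw [map_zero, map_zero, map_zero, zero_add, zero_sub, map_neg]
  by_cases h : r = q + 1
  · rw [Conc.out_of h]
  · rw [inB_eq_zero h, inB_eq_zero h]

/-- The chain map `E' ∪ E → Z`. -/
def traceMap : ChainMap (lagGl hθ hj) (twoTerm ((q : ℤ) + 1) j) where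
  f := traceComponent hθ hj
  comm i k h c := by
    obtain ⟨e, b, y, rfl⟩ := exists_eq_lagGl hθ hj i k h c
    simp only [map_add, d_glE, d_glM hθ hj i k (k - 1) h (by omega), d_glG, trace_glE, trace_glM,
      trace_glG, map_neg, d_inB, d_inA, map_units_smul, out₂_d, out₁_d, out₂_lagMap, out₁_lagMap,
      map_zero, zero_add, add_zero, neg_zero, smul_neg, add_neg_cancel]

variable {hθ}

theorem dualMap_glM_trace (r k : ℤ) (h : k + 1 = r)
    (m : StarDual Λ ((twoTerm ((q : ℤ) + 1) j).X r)) :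
    dualMap (glM hθ hj r k h) (dualMap ((traceMap hθ hj).f r) m) = 0 :=
  StarDual.ext fun b => (congrArg m (trace_glM hθ hj r k h b)).trans (map_zero m)

theorem coU_trace (r : ℤ) (m : StarDual Λ ((twoTerm ((q : ℤ) + 1) j).X r)) :
    coU hj r (dualMap (glE hθ hj r) (dualMap ((traceMap hθ hj).f r) m)) = 0 := by
  refine ext_dual (Λ := Λ) fun φ => ?_
  rw [apply_coU, map_zero, dualMap_apply, dualMap_apply]
  change star (m (traceComponent hθ hj r (glE hθ hj r (in₀ (q : ℤ) j (colam j) hj r φ)))) = 0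
  rw [trace_glE, out₂_in₀, out₁_in₀, map_zero, map_zero, add_zero, map_zero, star_zero]

theorem lagStruct_eq_zero (ρ : U →ₗ[Λ] StarDual Λ U) (s : ℕ) (p r : ℤ)
    (h : p + r + s = 2 * q + 1 + 1) {m : StarDual Λ ((lagComplex j hj).X p)}
    (hm : coU hj p m = 0) : lagStruct hj ρ s p r h m = 0 :=
  match s, h with
  | 0, _ => (congrArg (in₂ (q : ℤ) j (colam j) hj r) hm).trans (map_zero _)
  | 1, _ => rfl
  | 2, _ => (congrArg (fun u => in₀ (q : ℤ) j (colam j) hj r (ρ u)) hm).trans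
      (by rw [map_zero, map_zero])
  | _ + 3, _ => rfl

/-- The structure on `E' ∪ E`. -/
abbrev lagGlStruct (ρ : U →ₗ[Λ] StarDual Λ U) : QStruct (lagGl hθ hj) (2 * q + 1 + 1) :=
  unionStruct (lagMap hθ hj) (mapX hθ) (lagStruct hj ρ) (-0) (-omegaX hθ)

theorem apply_lagGlStruct (ρ : U →ₗ[Λ] StarDual Λ U)
    (s : ℕ) (p r p' r' : ℤ) (h : p + r + s = 2 * q + 1 + 1) (hp : p' + 1 = p) (hr : r' + 1 = r)
    (A : StarDual Λ ((lagGl hθ hj).X p)) (B : StarDual Λ ((lagGl hθ hj).X r)) :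
    B (lagGlStruct hj ρ s p r h A) =
      dualMap (glE hθ hj r) B (lagStruct hj ρ s p r h (dualMap (glE hθ hj p) A))
      + (-((2 * q + 1 - r : ℤ).negOnePow • dualMap (glM hθ hj r r' hr) B (omegaX hθ s p r' (by omega)
            (dualMap ((lagMap hθ hj).f p) (dualMap (glE hθ hj p) A))))
        + -((2 * q + 1 - r - s + 1 : ℤ).negOnePow • (p' * r').negOnePow •
          star (dualMap (glM hθ hj p p' hp) A
            (omegaX hθ (s + 1) r' p' (by push_cast; omega) (dualMap (glM hθ hj r r' hr) B)))))
      + -((s : ℤ).negOnePow • B (glG hθ hj r (gVal hθ r (omegaX hθ s p' r (by omega)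
          (dualMap (glM hθ hj p p' hp) A))))) := by
  refine (apply_unionStruct' (lagMap hθ hj) (mapX hθ) (lagStruct hj ρ) (-0) (-omegaX hθ) s p r p' r'
    h hp hr A B).trans ?_
  change _ + (_ • dualMap (glM hθ hj r r' hr) B (-(omegaX hθ s p r' _ _)) + _ • _ •
    star (dualMap (glM hθ hj p p' hp) A (-(omegaX hθ (s + 1) r' p' _ _)))) +
    (_ • dualMap ((mapX hθ).f r) (dualMap (unionIn₃ (lagMap hθ hj) (mapX hθ) r) B)
      (-(omegaX hθ s p' r _ _)) + dualMap (unionIn₃ (lagMap hθ hj) (mapX hθ) r) B (-0)) = _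
  have e : ∀ w, dualMap ((mapX hθ).f r) (dualMap (unionIn₃ (lagMap hθ hj) (mapX hθ) r) B) w =
    B (glG hθ hj r (gVal hθ r w)) := fun _ => rfl
  rw [neg_zero, e]
  simp only [map_neg, map_zero, smul_neg, star_neg, add_zero]
  rfl

theorem omega_lagMap_trace (p r : ℤ) (h : p + r + (0 : ℕ) = 2 * q + 1)
    (m : StarDual Λ ((twoTerm ((q : ℤ) + 1) j).X p)) :
    omegaX hθ 0 p r h (dualMap ((lagMap hθ hj).f p)
      (dualMap (glE hθ hj p) (dualMap ((traceMap hθ hj).f p) m))) = 0 := by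
  rw [dualMap_lagMap, coU_trace, map_zero, show alphaX hθ p 0 = 0 by rw [alphaX, map_zero, map_zero],
    add_zero]
  exact omega_dualMap_mapX _ _ _ _

theorem lagGlStruct_trace (ρ : U →ₗ[Λ] StarDual Λ U) (p r : ℤ)
    (h : p + r + (0 : ℕ) = 2 * q + 1 + 1) (m : StarDual Λ ((twoTerm ((q : ℤ) + 1) j).X p)) :
    lagGlStruct hj ρ 0 p r h (dualMap ((traceMap hθ hj).f p) m) = 0 := by
  refine ext_dual (Λ := Λ) fun B => ?_
  rw [apply_lagGlStruct hj ρ 0 p r (p - 1) (r - 1) h (by omega) (by omega),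
    lagStruct_eq_zero hj ρ _ _ _ _ (coU_trace hj p m), dualMap_glM_trace, omega_lagMap_trace]
  simp

theorem symm₀_lagGlStruct (ρ : U →ₗ[Λ] StarDual Λ U) (p r r' : ℤ) (h : p + r = 2 * q + 1 + 1)
    (hr : r' + 1 = r) (m : StarDual Λ ((twoTerm ((q : ℤ) + 1) j).X p)) :
    (lagGlStruct hj ρ).symm₀ p r h (dualMap ((traceMap hθ hj).f p) m) = (p * r).negOnePow •
      (glE hθ hj r (in₀ (q : ℤ) j (colam j) hj r (dualMap (inA ((q : ℤ) + 1) j p) m)) +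
        glM hθ hj r r' hr (iotaB hθ r' (dualMap (inB ((q : ℤ) + 1) j p) m))) := by
  refine ext_dual (Λ := Λ) fun B => ?_
  rw [QStruct.apply_symm₀, lagGlStruct_trace, map_zero, zero_add, map_units_smul]
  congr 1
  rw [apply_lagGlStruct hj ρ 0 r p r' (p - 1) (by push_cast; omega) hr (by omega),
    dualMap_glM_trace, dualMap_apply ((traceMap hθ hj).f p), map_add]
  change star (m (traceComponent hθ hj p (glE hθ hj p (in₂ (q : ℤ) j (colam j) hj p
    (coU hj r (dualMap (glE hθ hj r) B))))) + _ + -(_ • m (traceComponent hθ hj p _))) = _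
  rw [trace_glE, trace_glG, out₁_in₂, map_zero, add_zero, gVal_omega, map_neg, smul_neg, neg_neg]
  have e : out₂ (q : ℤ) j (colam j) hj p (in₂ (q : ℤ) j (colam j) hj p
      (coU hj r (dualMap (glE hθ hj r) B))) = coU hj r (dualMap (glE hθ hj r) B) := by
    by_cases hp : p = q + 2
    · rw [out₂_in₂ hp]
    · rw [coU_eq_zero hj (show r ≠ q by omega), map_zero, map_zero]
  rw [e, ← dualMap_apply (inA ((q : ℤ) + 1) j p) m, apply_coU, ← dualMap_apply (inB ((q : ℤ) + 1) j p) m,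
    apply_undual]
  simp

/-- The pair `(E' ∪ E → Z, (0, ω'))`. -/
def tracePair (hθ : z.IsRepresentative θ) (ρ : U →ₗ[Λ] StarDual Λ U)
    (hρ : ∀ x y, star (ρ x y) + ((-1) ^ q : ℤˣ) • ρ y x + θ (j y) (j x) = 0) :
    QuadPair (lagGl hθ hj) (2 * q + 1 + 1) (lagGlStruct hj ρ) where
  D := twoTerm ((q : ℤ) + 1) j
  f := traceMap hθ hj
  δψ := 0
  isCycle := QuadPair.isCycle_gluedStruct (lagPair hj hθ ρ hρ) (pairX z θ hθ)
  isCycle_rel s p r h := by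
    have e : QStruct.push (traceMap hθ hj) (lagGlStruct hj ρ) s p r h = 0 := by
      refine LinearMap.ext fun m => ext_dual (Λ := Λ) fun β => ?_
      refine (apply_lagGlStruct hj ρ s p r (p - 1) (r - 1) h (by omega) (by omega)
        (dualMap ((traceMap hθ hj).f p) m) (dualMap ((traceMap hθ hj).f r) β)).trans ?_
      rw [lagStruct_eq_zero hj ρ _ _ _ _ (coU_trace hj p m), dualMap_glM_trace, dualMap_glM_trace]
      simp
    rw [e, QStruct.diff_zero, smul_zero]
    exact zero_add _

set_option maxHeartbeats 1000000 in
theorem isPoincare_tracePair (hj' : ∀ x y, z.μ (j x) (z.γ (j y)) = 0) (ρ : U →ₗ[Λ] StarDual Λ U)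
    (hρ : ∀ x y, star (ρ x y) + ((-1) ^ q : ℤˣ) • ρ y x + θ (j y) (j x) = 0) :
    (tracePair hj hθ ρ hρ).IsPoincare := by
  have sq : (q : ℤ).negOnePow = (-1) ^ q := negOnePow_eq q
  have hδ : ∀ (p r : ℤ) (h : p + r = 2 * q + 1 + 1 + 1) m,
    (tracePair hj hθ ρ hρ).δψ.symm₀ p r h m = 0 := fun p r h m => QStruct.symm₀_zero p r h m
  apply QuadPair.isPoincare_of_elementwise
  · intro i j' k p p₀ p₁ hij hjk hp hp₀ hp₁ m y v hm hy hv
    change StarDual Λ ((twoTerm ((q : ℤ) + 1) j).X p) at m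
    replace hv : (lagGl hθ hj).d j' k hjk v = p.negOnePow •
      (lagGlStruct hj ρ).symm₀ p k (by omega) (dualMap ((traceMap hθ hj).f p) m) := hv
    obtain ⟨e, b, y', rfl⟩ := exists_eq_lagGl hθ hj j' k hjk v
    rw [symm₀_lagGlStruct hj ρ p k (k - 1) (by omega) (by omega), map_add, map_add, d_glE,
      d_glM hθ hj j' k (k - 1) hjk (by omega), d_glG, smul_smul] at hv
    set s : ℤˣ := p.negOnePow * (p * k).negOnePow with hs
    obtain ⟨h₁, h₂, h₃⟩ := lagGl_eq_zero hθ hj k (k - 1) (by omega)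
      ((lagComplex j hj).d j' k hjk e + k.negOnePow • (lagMap hθ hj).f k b -
        s • in₀ (q : ℤ) j (colam j) hj k (dualMap (inA ((q : ℤ) + 1) j p) m))
      ((bdX hθ).d k (k - 1) (by omega) b -
        s • iotaB hθ (k - 1) (dualMap (inB ((q : ℤ) + 1) j p) m))
      (k.negOnePow • gVal hθ k b) (by
        rw [← sub_eq_zero.2 hv]
        simp only [map_add, map_sub, map_units_smul, smul_add]
        abel)
    have hg : gVal hθ k b = 0 := by
      by_cases h : k = q + 1
      · have := h₃ h
        rwa [smul_eq_zero_iff_eq] at this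
      · exact gVal_eq_zero h b
    have hB : dualMap (inB ((q : ℤ) + 1) j p) m = 0 := by
      by_cases h : p = q + 1
      · have h4 := congrArg (alphaB hθ (k - 1)) h₂
        rw [map_sub, alphaB_d, hg, map_units_smul, alphaB_iota (by omega), map_zero, map_zero,
          map_zero, smul_zero, neg_zero, zero_sub, neg_eq_zero, smul_eq_zero_iff_eq] at h4
        exact h4
      · exact dualMap_inB_eq_zero h m
    have h₀ := congrArg (out₀ (q : ℤ) j (colam j) hj k) h₁
    rw [map_sub, map_add, map_units_smul, map_units_smul, out₀_d, out₀_lagMap, map_zero,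
      sub_eq_zero] at h₀
    refine ⟨dualMap (outB ((q : ℤ) + 1) j p₀) (s • (k.negOnePow • alphaB hθ k b -
      ((-1) ^ q : ℤˣ) • dualMap z.γ (z.μ (out₁ (q : ℤ) j (colam j) hj j' e)))), ?_⟩
    change dualMap ((twoTerm ((q : ℤ) + 1) j).d p p₀ hp₀) _ = m
    rw [← sub_eq_zero]
    refine dual_twoTerm_ext ?_ ?_
    · rw [map_sub, dualMap_inA_d_twoTerm, sub_eq_zero]
      by_cases h : p = q + 1 + 1
      · rw [dualMap_inB_outB (by omega)]
        rw [out₀_in₀ (by omega)] at h₀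
        refine Eq.trans ?_ ((congrArg (s • ·) h₀).trans
          (by rw [smul_smul, Int.units_mul_self, one_smul]))
        rw [colam_apply, map_units_smul, map_sub, map_units_smul, map_units_smul, neg_add_eq_sub]
      · rw [dualMap_inB_eq_zero (by omega), dualMap_inA_eq_zero h, map_zero]
    · rw [map_sub, dualMap_inB_d_twoTerm, hB, sub_zero]
  · intro i j' k l p p₁ hij hjk hkl hp hp₁ y v hy hv
    change (twoTerm ((q : ℤ) + 1) j).X j' at y
    replace hy : (twoTerm ((q : ℤ) + 1) j).d j' k hjk y +
      k.negOnePow • traceComponent hθ hj k v = 0 := hy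
    replace hv : (lagGl hθ hj).d k l hkl v = 0 := hv
    obtain ⟨e, b, g, rfl⟩ := exists_eq_lagGl hθ hj k l hkl v
    set g₁ : z.G := if k = q + 1 then g else 0 with hg₁
    have hgg : glG hθ hj k g = glG hθ hj k g₁ := by
      by_cases h : k = q + 1
      · rw [hg₁, if_pos h]
      · rw [glG_eq_zero hθ hj h, glG_eq_zero hθ hj h]
    have hg0 : k ≠ q + 1 → g₁ = 0 := fun h => by rw [hg₁, if_neg h]
    rw [hgg] at hy hv ⊢
    clear hgg
    clear_value g₁
    rw [map_add, map_add, d_glE, d_glM hθ hj k l (l - 1) hkl (by omega), d_glG] at hv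
    obtain ⟨h₁, h₂, h₃⟩ := lagGl_eq_zero hθ hj l (l - 1) (by omega)
      ((lagComplex j hj).d k l hkl e + l.negOnePow • (lagMap hθ hj).f l b)
      ((bdX hθ).d l (l - 1) (by omega) b) (l.negOnePow • gVal hθ l b) (by
        rw [← hv]
        simp only [map_add, map_units_smul, smul_add]
        abel)
    have hg : gVal hθ l b = 0 := by
      by_cases h : l = q + 1
      · have := h₃ h
        rwa [smul_eq_zero_iff_eq] at this
      · exact gVal_eq_zero h b
    have h₀ := congrArg (out₀ (q : ℤ) j (colam j) hj l) h₁
    rw [map_add, map_units_smul, out₀_d, out₀_lagMap, map_zero] at h₀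
    have ht : traceComponent hθ hj k (glE hθ hj k e + glM hθ hj k l hkl b + glG hθ hj k g₁) =
        inA ((q : ℤ) + 1) j k (out₂ (q : ℤ) j (colam j) hj k e) +
          inB ((q : ℤ) + 1) j k (out₁ (q : ℤ) j (colam j) hj k e - g₁) := by
      rw [map_add, map_add, trace_glE, trace_glM, trace_glG, add_zero, map_sub]
      abel
    have hA := congrArg (outA ((q : ℤ) + 1) j k) hy
    have hB := congrArg (outB ((q : ℤ) + 1) j k) hy
    rw [ht] at hA hB
    rw [map_add, d_twoTerm, outA_inB, zero_add, map_units_smul, map_add, outA_inB, add_zero, map_zero,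
      smul_eq_zero_iff_eq] at hA
    rw [map_add, outB_d_twoTerm, map_units_smul, map_add, outB_inA, zero_add, map_zero] at hB
    have he₂ : out₂ (q : ℤ) j (colam j) hj k e = 0 := by
      by_cases h : k = q + 2
      · rwa [outA_inA (by omega)] at hA
      · exact out₂_eq_zero h e
    have he₁ : out₁ (q : ℤ) j (colam j) hj k e - g₁ =
        -(k.negOnePow • j (outA ((q : ℤ) + 1) j j' y)) := by
      by_cases h : k = q + 1
      · rw [outB_inB h] at hB
        rw [eq_neg_of_add_eq_zero_left hB, smul_neg, neg_neg, smul_smul, Int.units_mul_self, one_smul]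
      · rw [out₁_eq_zero h, hg0 h, outA_eq_zero (by omega), map_zero, smul_zero, neg_zero, sub_zero]
    set s : ℤˣ := p.negOnePow * (p * k).negOnePow with hs
    set η : StarDual Λ z.G := alphaB hθ l b - dualMap z.γ (z.μ g₁) with hη
    have hη0 : k ≠ q + 1 → η = 0 := fun h => by
      rw [hη, alphaB_eq_zero (by omega), hg0 h, map_zero, map_zero, sub_zero]
    have hjη : dualMap j η = 0 := by
      by_cases h : k = q + 1
      · have e1 : l.negOnePow = (-1) ^ q := by rw [show l = q by omega, sq]
        rw [colam_apply, e1, neg_add_eq_sub, ← smul_sub, smul_eq_zero_iff_eq, sub_eq_zero] at h₀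
        rw [hη, map_sub, h₀, ← map_sub, ← map_sub, ← map_sub, he₁]
        refine StarDual.ext fun x => ?_
        rw [map_neg, map_units_smul, map_neg, map_neg, map_units_smul, map_units_smul,
          StarDual.neg_apply, StarDual.units_smul_apply, dualMap_apply, dualMap_apply, hj', smul_zero,
          neg_zero, StarDual.zero_apply]
      · rw [hη0 h, map_zero]
    obtain ⟨b', hb', hg'⟩ := exists_boundary hkl (by omega : l - 1 + 1 = l) (b - iotaB hθ l η)
      (Conc.of (Λ := Λ) (q + 1 : ℤ) z.G k (k.negOnePow • g₁))
      (by rw [map_sub, h₂, d_iota, sub_zero]) (by rw [map_sub, hg, gVal_iota, sub_zero]) (by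
        by_cases h : k = q + 1
        · rw [map_sub, alphaB_iota (by omega), Conc.out_of h, h, Int.negOnePow_succ, sq, hη]
          simp only [map_units_smul, smul_smul, Int.units_mul_self, Units.neg_smul, map_neg, smul_neg,
            neg_neg, one_smul]
          abel
        · rw [alphaB_eq_zero (by omega), hg0 h, smul_zero, map_zero, map_zero, map_zero, map_zero,
            smul_zero, neg_zero])
    have hgb : gVal hθ k b' = k.negOnePow • g₁ := by
      by_cases h : k = q + 1
      · exact (Conc.out_of h _).symm.trans
          ((congrArg (Conc.out (Λ := Λ) (q + 1 : ℤ) z.G k) hg').trans (Conc.out_of h _))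
      · rw [gVal_eq_zero h, hg0 h, smul_zero]
    set e' := in₂ (q : ℤ) j (colam j) hj j' (j'.negOnePow • outA ((q : ℤ) + 1) j j' y) +
      in₁ (q : ℤ) j (colam j) hj j' (j'.negOnePow • outB ((q : ℤ) + 1) j j' y) with he'
    have he'₂ : out₂ (q : ℤ) j (colam j) hj j' e' = j'.negOnePow • outA ((q : ℤ) + 1) j j' y := by
      by_cases h : j' = q + 2
      · rw [he', map_add, out₂_in₂ h, out₂_in₁, add_zero]
      · rw [out₂_eq_zero h, outA_eq_zero (by omega), smul_zero]
    have he'₁ : out₁ (q : ℤ) j (colam j) hj j' e' = j'.negOnePow • outB ((q : ℤ) + 1) j j' y := by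
      by_cases h : j' = q + 1
      · rw [he', map_add, out₁_in₁ h, out₁_in₂, zero_add]
      · rw [out₁_eq_zero h, outB_eq_zero (by omega), smul_zero]
    clear_value e'
    set m := dualMap (outA ((q : ℤ) + 1) j p) (s • (out₀ (q : ℤ) j (colam j) hj k e -
      colam j (out₁ (q : ℤ) j (colam j) hj j' e') - k.negOnePow • dualMap j (alphaB hθ k b'))) +
      dualMap (outB ((q : ℤ) + 1) j p) (s • η) with hm
    have hmA : p = q + 1 + 1 → dualMap (inA ((q : ℤ) + 1) j p) m =
      s • (out₀ (q : ℤ) j (colam j) hj k e - colam j (out₁ (q : ℤ) j (colam j) hj j' e') -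
        k.negOnePow • dualMap j (alphaB hθ k b')) := fun h => by
      rw [hm, map_add, dualMap_inA_outA h, dualMap_inA_outB, add_zero]
    have hmB : dualMap (inB ((q : ℤ) + 1) j p) m = s • η := by
      by_cases h : p = q + 1
      · rw [hm, map_add, dualMap_inB_outB h, dualMap_inB_outA, zero_add]
      · rw [dualMap_inB_eq_zero h, hη0 (by omega), smul_zero]
    clear_value m
    refine ⟨m, (0 : (twoTerm ((q : ℤ) + 1) j).X i), glE hθ hj j' e' + glM hθ hj j' k hjk b',
      ?_, ?_, ?_⟩
    · change dualMap ((twoTerm ((q : ℤ) + 1) j).d p₁ p hp₁) m = 0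
      refine dual_twoTerm_ext ?_ ?_
      · rw [dualMap_inA_d_twoTerm, hmB, map_units_smul, hjη, smul_zero]
      · rw [dualMap_inB_d_twoTerm]
    · refine (congrArg (· + _) (hδ p j' hp m)).trans ((zero_add _).trans ?_)
      change (twoTerm ((q : ℤ) + 1) j).d i j' hij 0 + j'.negOnePow • traceComponent hθ hj j'
        (glE hθ hj j' e' + glM hθ hj j' k hjk b') = y
      rw [map_zero, zero_add, map_add, trace_glE, trace_glM, add_zero, he'₁, he'₂, map_units_smul,
        map_units_smul, ← smul_add, smul_smul, Int.units_mul_self, one_smul, inA_add_inB]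
    · change p.negOnePow • (lagGlStruct hj ρ).symm₀ p k (by omega) (dualMap ((traceMap hθ hj).f p) m) +
        (lagGl hθ hj).d j' k hjk (glE hθ hj j' e' + glM hθ hj j' k hjk b') =
          glE hθ hj k e + glM hθ hj k l hkl b + glG hθ hj k g₁
      rw [symm₀_lagGlStruct hj ρ p k l (by omega) (by omega), map_add ((lagGl hθ hj).d j' k hjk), d_glE,
        d_glM hθ hj j' k l hjk hkl, hmB, hgb, hb', smul_smul, ← hs, map_units_smul (glG hθ hj k),
        smul_smul k.negOnePow k.negOnePow, Int.units_mul_self, one_smul]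
      have hE : s • in₀ (q : ℤ) j (colam j) hj k (dualMap (inA ((q : ℤ) + 1) j p) m) +
          ((lagComplex j hj).d j' k hjk e' + k.negOnePow • (lagMap hθ hj).f k b') = e := by
        refine threeTerm_ext ?_ ?_ ?_ <;> simp only [map_add, map_units_smul, out₂_d, out₂_lagMap, out₁_lagMap,
          out₀_lagMap, out₂_in₀, out₁_in₀, out₁_d, out₀_d, smul_zero, add_zero, zero_add]
        · exact he₂.symm
        · rw [he'₂, hgb, map_units_smul, smul_smul, Int.units_mul_self, one_smul,
            show j'.negOnePow = -k.negOnePow by rw [← hjk, Int.negOnePow_succ],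
            eq_add_of_sub_eq he₁, Units.neg_smul]
        · by_cases h : k = q
          · rw [out₀_in₀ h, hmA (by omega), smul_smul, Int.units_mul_self, one_smul]
            abel
          · rw [out₀_eq_zero h, out₀_eq_zero h, out₁_eq_zero (by omega), alphaB_eq_zero h, map_zero,
              map_zero, smul_zero, smul_zero, add_zero, add_zero]
      conv_rhs => rw [← hE]
      simp only [map_add, map_sub, map_units_smul, smul_add, smul_smul, Int.units_mul_self, one_smul]
      abel
end RegSplitPreformation

end Trace

section ThickeningPoincare

variable {Λ : Type u} [Ring Λ] [StarRing Λ]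

open FreeComplex

theorem FreeComplex.idMap_idMap (C : FreeComplex Λ) (i j : ℤ) (h : i = j) (h' : j = i) (x : C.X i) :
    C.idMap j i h' (C.idMap i j h x) = x := by
  subst h; rfl

section

variable {C : FreeComplex Λ} {m : ℤ} {ψ : QStruct C (m + 1)} (hψ : ψ.IsCycle)

theorem symm₀_bdryStruct_thickeningMap (p k : ℤ) (h : p + k = m)
    (M : StarDual Λ (StarDual Λ (C.X (m + 1 - p)))) :
    (bdryStruct hψ).symm₀ p k h (dualMap (M := (bdryComplex hψ).X p) ((thickeningMap hψ).f p) M) =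
      (p * k).negOnePow • bdryInl hψ k (C.idMap (m + 1 - p) (k + 1) (by omega) (undual _ M)) := by
  refine ext_dual (Λ := Λ) fun β => ?_
  rw [QStruct.apply_symm₀, map_units_smul]
  have h1 : dualMap (bdryInl hψ p ∘ₗ C.idMap (m + 1 - k) (p + 1) (by omega))
      (dualMap (M := (bdryComplex hψ).X p) ((thickeningMap hψ).f p) M) = 0 :=
    StarDual.ext fun x => map_zero M
  change β (bdryInr hψ k (dualMap (bdryInl hψ p ∘ₗ C.idMap (m + 1 - k) (p + 1) _)
    (dualMap (M := (bdryComplex hψ).X p) ((thickeningMap hψ).f p) M))) + _ •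
    star (M (dualMap (bdryInl hψ k ∘ₗ C.idMap (m + 1 - p) (k + 1) _) β)) = _
  rw [h1, map_zero, map_zero, zero_add, ← apply_undual]
  rfl

set_option maxHeartbeats 1000000 in
/-- A pair isomorphic to a thickening on the boundary is Poincaré. -/
theorem isPoincare_of_thickeningMap {B : FreeComplex Λ} {β : QStruct B m}
    (h : ChainMap B (bdryComplex hψ)) (c : QuadPair B m β)
    (hinj : ∀ r, Function.Injective (h.f r)) (hsurj : ∀ r, Function.Surjective (h.f r))
    (hβ : ∀ p k hpk α, h.f k (β.symm₀ p k hpk (dualMap (h.f p) α)) = (bdryStruct hψ).symm₀ p k hpk α)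
    (hrel : ∀ s p r hs, (0 : QStruct (C.dual (m + 1)) (m + 1)).diff m rfl s p r hs + m.negOnePow •
      QStruct.push ((thickeningMap hψ).comp h) β s p r hs = 0) :
    (⟨C.dual (m + 1), (thickeningMap hψ).comp h, 0, c.isCycle, hrel⟩ : QuadPair B m β).IsPoincare := by
  have hM : ∀ (p k : ℤ) (hpk : p + k = m) (M : StarDual Λ (StarDual Λ (C.X (m + 1 - p)))),
      h.f k (β.symm₀ p k hpk (dualMap (M := B.X p) (((thickeningMap hψ).comp h).f p) M)) =
        (p * k).negOnePow • bdryInl hψ k (C.idMap (m + 1 - p) (k + 1) (by omega) (undual _ M)) :=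
    fun p k hpk M => (hβ p k hpk (dualMap (M := (bdryComplex hψ).X p) ((thickeningMap hψ).f p) M)).trans
      (symm₀_bdryStruct_thickeningMap hψ p k hpk M)
  have hδ : ∀ (p j : ℤ) (hp : p + j = m + 1) (M : StarDual Λ (StarDual Λ (C.X (m + 1 - p)))),
      (0 : QStruct (C.dual (m + 1)) (m + 1)).symm₀ p j hp M = (0 : StarDual Λ (C.X (m + 1 - j))) :=
    fun p j hp M => QStruct.symm₀_zero p j hp _
  apply QuadPair.isPoincare_of_elementwise
  · intro i j k p p₀ p₁ hij hjk hp hp₀ hp₁ M y v hM' hy hv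
    change StarDual Λ (StarDual Λ (C.X (m + 1 - p))) at M
    change StarDual Λ (C.X (m + 1 - i)) at y
    obtain ⟨⟨x, φ⟩, hx⟩ : ∃ w : C.X (j + 1) × StarDual Λ (C.X (m + 1 - j)), h.f j v = w := ⟨_, rfl⟩
    replace hy : (C.dual (m + 1)).d i j hij y + j.negOnePow • (((thickeningMap hψ).comp h).f j v) =
      (0 : QStruct (C.dual (m + 1)) (m + 1)).symm₀ p j hp M := hy
    replace hy := hy.trans (hδ p j hp M)
    replace hy : i.negOnePow • dualMap (C.d (m + 1 - j) (m + 1 - i) (by omega)) y +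
        j.negOnePow • φ = 0 := by
      refine Eq.trans ?_ hy
      change _ = i.negOnePow • dualMap (C.d (m + 1 - j) (m + 1 - i) _) y +
        j.negOnePow • (show StarDual Λ (C.X (m + 1 - j)) from (thickeningMap hψ).f j (h.f j v))
      rw [hx]
      rfl
    replace hv : B.d j k hjk v = p.negOnePow • β.symm₀ p k (by omega)
      (dualMap (M := B.X p) (((thickeningMap hψ).comp h).f p) M) := hv
    have h1 := congrArg (h.f k) hv
    rw [← h.comm, hx, map_units_smul] at h1
    have h5 := hM p k (by omega) M
    rw [h5] at h1
    rw [RegSplitPreformation.d_bdryComplex] at h1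
    replace h1 := congrArg (fun w : C.X (k + 1) × StarDual Λ (C.X (m + 1 - k)) => w.1) h1
    replace h1 : C.d (j + 1) (k + 1) (by omega) x + j.negOnePow • ψ.symm₀ (m + 1 - j) (k + 1) (by omega) φ =
      p.negOnePow • (p * k).negOnePow • C.idMap (m + 1 - p) (k + 1) (by omega) (undual _ M) := h1
    have hφ : φ = dualMap (C.d (m + 1 - j) (m + 1 - i) (by omega)) y := by
      have e : i.negOnePow = -j.negOnePow := by rw [← hij, Int.negOnePow_succ]
      rw [e, Units.neg_smul, neg_add_eq_sub, ← smul_sub, smul_eq_zero_iff_eq, sub_eq_zero] at hy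
      exact hy
    have h2 := hψ.d_symm₀ (m + 1 - i) (k + 1) (by omega) (j + 1) (m + 1 - j) (by omega) (by omega) y
    rw [← hφ, Int.negOnePow_succ, Units.neg_smul] at h2
    set s : ℤˣ := p.negOnePow * (p * k).negOnePow with hs
    set c' : C.X (j + 1) := s • (x - ψ.symm₀ (m + 1 - i) (j + 1) (by omega) y) with hc'
    have h3 : C.d (j + 1) (k + 1) (by omega) c' = C.idMap (m + 1 - p) (k + 1) (by omega) (undual _ M) := by
      rw [hc', map_units_smul, map_sub, h2, sub_neg_eq_add, h1, smul_smul p.negOnePow, ← hs, smul_smul,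
        Int.units_mul_self, one_smul]
    have h4 : C.d (m + 1 - p₀) (m + 1 - p) (by omega) (C.idMap (j + 1) (m + 1 - p₀) (by omega) c') =
        undual _ M := by
      rw [← d_idMap C (j + 1) (m + 1 - p₀) (k + 1) (m + 1 - p) (by omega) (by omega) (by omega), h3,
        idMap_idMap]
    refine ⟨evalDual _ (p.negOnePow • C.idMap (j + 1) (m + 1 - p₀) (by omega) c'),
      StarDual.ext (M := StarDual Λ (C.X (m + 1 - p))) fun χ => ?_⟩
    change star ((p.negOnePow • dualMap (C.d (m + 1 - p₀) (m + 1 - p) _) χ)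
      (p.negOnePow • C.idMap (j + 1) (m + 1 - p₀) _ c')) = M χ
    rw [StarDual.units_smul_apply, map_units_smul, smul_smul, Int.units_mul_self, one_smul,
      dualMap_apply, h4, apply_undual, star_star]
  · intro i j k l p p₁ hij hjk hkl hp hp₁ y v hy hv
    change StarDual Λ (C.X (m + 1 - j)) at y
    obtain ⟨⟨x, φ⟩, hx⟩ : ∃ w : C.X (k + 1) × StarDual Λ (C.X (m + 1 - k)), h.f k v = w := ⟨_, rfl⟩
    replace hy : j.negOnePow • dualMap (C.d (m + 1 - k) (m + 1 - j) (by omega)) y +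
        k.negOnePow • φ = 0 := by
      refine Eq.trans ?_ hy
      change _ = j.negOnePow • dualMap (C.d (m + 1 - k) (m + 1 - j) _) y +
        k.negOnePow • (show StarDual Λ (C.X (m + 1 - k)) from (thickeningMap hψ).f k (h.f k v))
      rw [hx]
      rfl
    have e : j.negOnePow = -k.negOnePow := by rw [← hjk, Int.negOnePow_succ]
    have hφ : φ = dualMap (C.d (m + 1 - k) (m + 1 - j) (by omega)) y := by
      rw [e, Units.neg_smul, neg_add_eq_sub, ← smul_sub, smul_eq_zero_iff_eq, sub_eq_zero] at hy
      exact hy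
    have h1 := congrArg (h.f l) hv
    rw [← h.comm, hx, map_zero, RegSplitPreformation.d_bdryComplex] at h1
    replace h1 := congrArg (fun w : C.X (l + 1) × StarDual Λ (C.X (m + 1 - l)) => w.1) h1
    replace h1 : C.d (k + 1) (l + 1) (by omega) x +
      k.negOnePow • ψ.symm₀ (m + 1 - k) (l + 1) (by omega) φ = 0 := h1
    have h2 := hψ.d_symm₀ (m + 1 - j) (l + 1) (by omega) (k + 1) (m + 1 - k) (by omega) (by omega) y
    rw [← hφ, Int.negOnePow_succ, Units.neg_smul] at h2
    set s : ℤˣ := p.negOnePow * (p * k).negOnePow with hs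
    set c' : C.X (k + 1) := s • (x - ψ.symm₀ (m + 1 - j) (k + 1) (by omega) y) with hc'
    have h3 : C.d (k + 1) (l + 1) (by omega) c' = 0 := by
      rw [hc', map_units_smul, map_sub, h2, sub_neg_eq_add, h1, smul_zero]
    set M : StarDual Λ (StarDual Λ (C.X (m + 1 - p))) :=
      evalDual _ (C.idMap (k + 1) (m + 1 - p) (by omega) c') with hMdef
    obtain ⟨v', hv'⟩ := hsurj j ((0, j.negOnePow • y) : C.X (j + 1) × StarDual Λ (C.X (m + 1 - j)))
    refine ⟨M, (0 : StarDual Λ (C.X (m + 1 - i))), v', ?_, ?_, hinj k ?_⟩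
    · refine StarDual.ext (M := StarDual Λ (C.X (m + 1 - p₁))) fun χ => ?_
      change star ((p₁.negOnePow • dualMap (C.d (m + 1 - p) (m + 1 - p₁) _) χ)
        (C.idMap (k + 1) (m + 1 - p) _ c')) = 0
      rw [StarDual.units_smul_apply, dualMap_apply, ← d_idMap C (k + 1) (m + 1 - p) (l + 1) (m + 1 - p₁)
        (by omega) (by omega) (by omega), h3, map_zero, map_zero, smul_zero, star_zero]
    · change (0 : QStruct (C.dual (m + 1)) (m + 1)).symm₀ p j hp M +
        ((C.dual (m + 1)).d i j hij 0 + j.negOnePow • (((thickeningMap hψ).comp h).f j v')) = y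
      refine (congrArg (· + _) (hδ p j hp M)).trans ((zero_add _).trans ?_)
      change i.negOnePow • dualMap (C.d (m + 1 - j) (m + 1 - i) _) 0 +
        j.negOnePow • (show StarDual Λ (C.X (m + 1 - j)) from (thickeningMap hψ).f j (h.f j v')) = y
      rw [hv', map_zero, smul_zero, zero_add]
      change j.negOnePow • j.negOnePow • y = y
      rw [smul_smul, Int.units_mul_self, one_smul]
    · refine (map_add (h.f k) _ _).trans (Eq.trans (congrArg₂ (· + ·) ((map_units_smul (h.f k) _ _).trans
        (congrArg (p.negOnePow • ·) (hM p k (by omega) M))) ((h.comm j k hjk v').symm.trans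
          (congrArg _ hv'))) ?_)
      rw [hx, RegSplitPreformation.d_bdryComplex, hMdef, undual_evalDual, idMap_idMap, map_zero, zero_add]
      refine Prod.ext ?_ ?_
      · change p.negOnePow • (p * k).negOnePow • c' +
          j.negOnePow • ψ.symm₀ (m + 1 - j) (k + 1) _ (j.negOnePow • y) = x
        rw [smul_smul, ← hs, hc', smul_smul, map_units_smul, smul_smul, Int.units_mul_self,
          Int.units_mul_self, one_smul, one_smul, sub_add_cancel]
      · change p.negOnePow • (p * k).negOnePow • 0 +
          j.negOnePow • dualMap (C.d (m + 1 - k) (m + 1 - j) _) (j.negOnePow • y) = φ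
        rw [smul_zero, smul_zero, zero_add, map_units_smul, smul_smul, Int.units_mul_self, one_smul, hφ]

theorem isPoincare_thickening : (thickening hψ).IsPoincare :=
  isPoincare_of_thickeningMap hψ (β := bdryStruct hψ) ⟨fun _ => LinearMap.id, fun _ _ _ _ => rfl⟩
    (thickening hψ) (fun _ _ _ h => h) (fun _ x => ⟨x, rfl⟩) (fun _ _ _ _ => rfl)
    (thickening hψ).isCycle_rel

end

end ThickeningPoincare

section BoundaryIso

variable {Λ : Type u} [Ring Λ] [StarRing Λ]

open FreeComplex

namespace RegSplitPreformation

variable {q : ℕ} {z : RegSplitPreformation Λ ((-1) ^ q)} {θ : z.G →ₗ[Λ] StarDual Λ z.G}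
  (hθ : z.IsRepresentative θ)

theorem idMap_inA {A B : Type u} [AddCommGroup A] [Module Λ A] [Module.Free Λ A] [Module.Finite Λ A]
    [AddCommGroup B] [Module Λ B] [Module.Free Λ B] [Module.Finite Λ B] {k : ℤ} (δ : A →ₗ[Λ] B)
    (r p : ℤ) (h : r = p) (a : A) : (twoTerm k δ).idMap r p h (inA k δ r a) = inA k δ p a := by
  subst h; rfl

theorem idMap_inB {A B : Type u} [AddCommGroup A] [Module Λ A] [Module.Free Λ A] [Module.Finite Λ A]
    [AddCommGroup B] [Module Λ B] [Module.Free Λ B] [Module.Finite Λ B] {k : ℤ} (δ : A →ₗ[Λ] B)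
    (r p : ℤ) (h : r = p) (b : B) : (twoTerm k δ).idMap r p h (inB k δ r b) = inB k δ p b := by
  subst h; rfl

theorem evalDual_undual {M : Type u} [AddCommGroup M] [Module Λ M] [Module.Free Λ M]
    [Module.Finite Λ M] (Ψ : StarDual Λ (StarDual Λ M)) : evalDual M (undual M Ψ) = Ψ :=
  (LinearEquiv.ofBijective _ evalDual_bijective).apply_symm_apply Ψ

theorem dualMap_outA_add_outB {A B : Type u} [AddCommGroup A] [Module Λ A] [Module.Free Λ A]
    [Module.Finite Λ A] [AddCommGroup B] [Module Λ B] [Module.Free Λ B] [Module.Finite Λ B] {k : ℤ}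
    (δ : A →ₗ[Λ] B) (r : ℤ) (Φ : StarDual Λ ((twoTerm k δ).X r)) :
    dualMap (outA k δ r) (dualMap (inA k δ r) Φ) + dualMap (outB k δ r) (dualMap (inB k δ r) Φ) = Φ := by
  refine StarDual.ext fun x => ?_
  conv_rhs => rw [← inA_add_inB x, map_add]
  rfl

theorem boundaryMap_inl (r : ℤ) (x : z.complexN.X (r + 1)) :
    (boundaryMap hθ).f r (bdryInl (isCycle_structN hθ) r x) =
      bdryInl (isCycle_structN' hθ) r (inB (q : ℤ) (dualMap z.γ) (r + 1)
          (outB (q : ℤ) (adj z.μ) (r + 1) x)) +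
        bdryInr (isCycle_structN' hθ) r (dualMap (outA (q : ℤ) (dualMap z.γ) (2 * q + 1 - r))
          (evalDual z.F (outA (q : ℤ) (adj z.μ) (r + 1) x))) := by
  refine (boundaryMapComponent_apply hθ r x 0).trans ?_
  rw [map_zero, map_zero, map_zero, smul_zero, map_zero, zero_add, add_zero]
  exact Prod.ext (add_zero _).symm (zero_add _).symm

theorem boundaryMap_inr (r : ℤ) (Φ : StarDual Λ (z.complexN.X (2 * q + 1 - r))) :
    (boundaryMap hθ).f r (bdryInr (isCycle_structN hθ) r Φ) =
      bdryInl (isCycle_structN' hθ) r (inA (q : ℤ) (dualMap z.γ) (r + 1)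
          (((-1) ^ q : ℤˣ) • dualMap (inA (q : ℤ) (adj z.μ) (2 * q + 1 - r)) Φ)) +
        bdryInr (isCycle_structN' hθ) r (dualMap (outB (q : ℤ) (dualMap z.γ) (2 * q + 1 - r))
          (dualMap (inB (q : ℤ) (adj z.μ) (2 * q + 1 - r)) Φ)) := by
  refine (boundaryMapComponent_apply hθ r 0 Φ).trans ?_
  rw [map_zero, map_zero, map_zero, map_zero, map_zero, add_zero, zero_add]
  exact Prod.ext (add_zero _).symm (zero_add _).symm

variable {hθ}

theorem apply_boundaryMap_bdryStruct (p k : ℤ) (h : p + k + (0 : ℕ) = 2 * q)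
    (α : StarDual Λ ((bdryComplex (isCycle_structN' hθ)).X p))
    (β : StarDual Λ ((bdryComplex (isCycle_structN' hθ)).X k)) :
    β ((boundaryMap hθ).f k (bdryStruct (isCycle_structN hθ) 0 p k h
      (dualMap ((boundaryMap hθ).f p) α))) =
      ((-1) ^ q : ℤˣ) • dualMap (bdryInl (isCycle_structN' hθ) k ∘ₗ inA (q : ℤ) (dualMap z.γ) (k + 1)) β
        (dualMap (evalDual z.F ∘ₗ outA (q : ℤ) (adj z.μ) (p + 1) ∘ₗ inA (q : ℤ) (adj z.μ) (p + 1))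
          (dualMap (bdryInr (isCycle_structN' hθ) p ∘ₗ
            dualMap (outA (q : ℤ) (dualMap z.γ) (2 * q + 1 - p))) α)) +
      dualMap (bdryInr (isCycle_structN' hθ) k ∘ₗ dualMap (outB (q : ℤ) (dualMap z.γ) (2 * q + 1 - k))) β
        (dualMap (bdryInl (isCycle_structN' hθ) p ∘ₗ inB (q : ℤ) (dualMap z.γ) (p + 1)) α) := by
  change β ((boundaryMap hθ).f k (bdryInr (isCycle_structN hθ) k (dualMap (bdryInl (isCycle_structN hθ) p ∘ₗ
    z.complexN.idMap (2 * q + 1 - k) (p + 1) (by push_cast at h; omega))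
      (dualMap ((boundaryMap hθ).f p) α)))) = _
  rw [boundaryMap_inr, map_add, map_units_smul, map_units_smul, map_units_smul]
  congr 1
  · congr 1
    refine congrArg (fun t => β (bdryInl (isCycle_structN' hθ) k
      (inA (q : ℤ) (dualMap z.γ) (k + 1) t))) (StarDual.ext fun a => ?_)
    change α ((boundaryMap hθ).f p (bdryInl (isCycle_structN hθ) p (z.complexN.idMap _ (p + 1) _
      (inA (q : ℤ) (adj z.μ) (2 * q + 1 - k) a)))) = _
    rw [idMap_inA, boundaryMap_inl, outB_inA, map_zero, map_zero, zero_add]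
    rfl
  · refine congrArg (fun t => β (bdryInr (isCycle_structN' hθ) k
      (dualMap (outB (q : ℤ) (dualMap z.γ) (2 * q + 1 - k)) t))) (StarDual.ext fun b => ?_)
    change α ((boundaryMap hθ).f p (bdryInl (isCycle_structN hθ) p (z.complexN.idMap _ (p + 1) _
      (inB (q : ℤ) (adj z.μ) (2 * q + 1 - k) b)))) = _
    rw [idMap_inB, boundaryMap_inl, outA_inB, map_zero, map_zero, map_zero, add_zero, inB_outB_inB]
    rfl

theorem apply_bdryStruct_structN' (p k : ℤ) (h : p + k + (0 : ℕ) = 2 * q)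
    (α : StarDual Λ ((bdryComplex (isCycle_structN' hθ)).X p))
    (β : StarDual Λ ((bdryComplex (isCycle_structN' hθ)).X k)) :
    β (bdryStruct (isCycle_structN' hθ) 0 p k h α) =
      dualMap (bdryInr (isCycle_structN' hθ) k ∘ₗ dualMap (outA (q : ℤ) (dualMap z.γ) (2 * q + 1 - k))) β
        (dualMap (bdryInl (isCycle_structN' hθ) p ∘ₗ inA (q : ℤ) (dualMap z.γ) (p + 1)) α) +
      dualMap (bdryInr (isCycle_structN' hθ) k ∘ₗ dualMap (outB (q : ℤ) (dualMap z.γ) (2 * q + 1 - k))) β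
        (dualMap (bdryInl (isCycle_structN' hθ) p ∘ₗ inB (q : ℤ) (dualMap z.γ) (p + 1)) α) := by
  change β (bdryInr (isCycle_structN' hθ) k _) = β (bdryInr (isCycle_structN' hθ) k _) +
    β (bdryInr (isCycle_structN' hθ) k _)
  rw [← map_add, ← map_add]
  refine congrArg (fun t => β (bdryInr (isCycle_structN' hθ) k t)) (StarDual.ext fun x => ?_)
  change α (bdryInl (isCycle_structN' hθ) p (z.complexN'.idMap (2 * q + 1 - k) (p + 1) _ x)) =
    α (bdryInl (isCycle_structN' hθ) p (inA (q : ℤ) (dualMap z.γ) (p + 1) (outA _ _ _ x))) +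
      α (bdryInl (isCycle_structN' hθ) p (inB (q : ℤ) (dualMap z.γ) (p + 1) (outB _ _ _ x)))
  rw [← map_add, ← map_add]
  nth_rewrite 1 [← inA_add_inB x]
  rw [map_add, idMap_inA, idMap_inB]

theorem boundaryMap_symm₀ (p k : ℤ) (h : p + k = 2 * q)
    (α : StarDual Λ ((bdryComplex (isCycle_structN' hθ)).X p)) :
    (boundaryMap hθ).f k ((bdryStruct (isCycle_structN hθ)).symm₀ p k h
      (dualMap ((boundaryMap hθ).f p) α)) = (bdryStruct (isCycle_structN' hθ)).symm₀ p k h α := by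
  refine ext_dual (Λ := Λ) fun β => ?_
  have h1 := (bdryStruct (isCycle_structN hθ)).apply_symm₀ p k h (dualMap ((boundaryMap hθ).f p) α)
    (dualMap ((boundaryMap hθ).f k) β)
  rw [dualMap_apply, dualMap_apply, dualMap_apply, apply_boundaryMap_bdryStruct (hθ := hθ),
    apply_boundaryMap_bdryStruct (hθ := hθ)] at h1
  rw [h1, QStruct.apply_symm₀, apply_bdryStruct_structN' (hθ := hθ), apply_bdryStruct_structN' (hθ := hθ)]
  simp only [star_add, smul_add]
  have hA : ∀ (r : ℤ), r ≠ q → ∀ γ : StarDual Λ ((bdryComplex (isCycle_structN' hθ)).X r),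
      dualMap (bdryInl (isCycle_structN' hθ) r ∘ₗ inA (q : ℤ) (dualMap z.γ) (r + 1)) γ = 0 :=
    fun r hr γ => StarDual.ext fun φ => by
      rw [dualMap_apply, LinearMap.comp_apply, inA_eq_zero (by omega), map_zero]
      exact map_zero γ
  by_cases hp : p = q
  · obtain rfl : k = q := by omega
    subst hp
    have hP : ∀ (α β : StarDual Λ ((bdryComplex (isCycle_structN' hθ)).X q)),
        dualMap (bdryInl (isCycle_structN' hθ) q ∘ₗ inA (q : ℤ) (dualMap z.γ) (q + 1)) β
          (dualMap (evalDual z.F ∘ₗ outA (q : ℤ) (adj z.μ) (q + 1) ∘ₗ inA (q : ℤ) (adj z.μ) (q + 1))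
            (dualMap (bdryInr (isCycle_structN' hθ) q ∘ₗ
              dualMap (outA (q : ℤ) (dualMap z.γ) (2 * q + 1 - q))) α)) =
        star (dualMap (bdryInr (isCycle_structN' hθ) q ∘ₗ
            dualMap (outA (q : ℤ) (dualMap z.γ) (2 * q + 1 - q))) α
          (dualMap (bdryInl (isCycle_structN' hθ) q ∘ₗ inA (q : ℤ) (dualMap z.γ) (q + 1)) β)) := by
      intro α β
      set P := dualMap (bdryInl (isCycle_structN' hθ) q ∘ₗ inA (q : ℤ) (dualMap z.γ) (q + 1)) β
      set R := dualMap (bdryInr (isCycle_structN' hθ) q ∘ₗ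
        dualMap (outA (q : ℤ) (dualMap z.γ) (2 * q + 1 - q))) α
      rw [← star_star (P _), ← apply_undual, dualMap_apply, LinearMap.comp_apply, LinearMap.comp_apply,
        outA_inA rfl, evalDual_undual]
    have e : ((q : ℤ) * q).negOnePow = ((-1) ^ q : ℤˣ) := by
      rw [Int.negOnePow_mul_self, Int.negOnePow_def, zpow_natCast]
    rw [hP, hP, e]
    simp only [star_units_smul, star_star, smul_smul, Int.units_mul_self, one_smul]
    abel
  · rw [hA p hp, hA k (by omega), map_zero, map_zero]
    simp

theorem boundaryMap_injective (r : ℤ) : Function.Injective ((boundaryMap hθ).f r) := by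
  refine (injective_iff_map_eq_zero _).2 ?_
  rintro ⟨x, Φ⟩ hx
  replace hx := (boundaryMapComponent_apply hθ r x Φ).symm.trans hx
  have h1 := congrArg Prod.fst hx
  have h2 := congrArg Prod.snd hx
  replace h1 : inA (q : ℤ) (dualMap z.γ) (r + 1) (((-1) ^ q : ℤˣ) •
      dualMap (inA (q : ℤ) (adj z.μ) (2 * q + 1 - r)) Φ) +
    inB (q : ℤ) (dualMap z.γ) (r + 1) (outB (q : ℤ) (adj z.μ) (r + 1) x) = 0 := h1
  replace h2 : dualMap (outA (q : ℤ) (dualMap z.γ) (2 * q + 1 - r))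
      (evalDual z.F (outA (q : ℤ) (adj z.μ) (r + 1) x)) +
    dualMap (outB (q : ℤ) (dualMap z.γ) (2 * q + 1 - r))
      (dualMap (inB (q : ℤ) (adj z.μ) (2 * q + 1 - r)) Φ) = 0 := h2
  have hA := congrArg (outA (q : ℤ) (dualMap z.γ) (r + 1)) h1
  have hB := congrArg (outB (q : ℤ) (dualMap z.γ) (r + 1)) h1
  have hA' := congrArg (dualMap (inA (q : ℤ) (dualMap z.γ) (2 * q + 1 - r))) h2
  have hB' := congrArg (dualMap (inB (q : ℤ) (dualMap z.γ) (2 * q + 1 - r))) h2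
  rw [map_add, outA_inB, add_zero, map_zero] at hA
  rw [map_add, outB_inA, zero_add, map_zero] at hB
  rw [map_add, dualMap_inA_outB, add_zero, map_zero] at hA'
  rw [map_add, dualMap_inB_outA, zero_add, map_zero] at hB'
  refine Prod.ext (twoTerm_ext ?_ ?_) (dual_twoTerm_ext ?_ ?_)
  · by_cases h : r = q
    · rw [dualMap_inA_outA (by omega)] at hA'
      rw [← undual_evalDual (Λ := Λ) (outA (q : ℤ) (adj z.μ) (r + 1) x), hA', map_zero]
    · exact outA_eq_zero (by omega) _
  · by_cases h : r + 1 = q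
    · rwa [outB_inB h] at hB
    · exact outB_eq_zero h _
  · by_cases h : r = q
    · rw [outA_inA (by omega), smul_eq_zero_iff_eq] at hA
      exact hA
    · exact dualMap_inA_eq_zero (by omega) _
  · by_cases h : r = q + 1
    · rwa [dualMap_inB_outB (by omega)] at hB'
    · exact dualMap_inB_eq_zero (by omega) _

theorem boundaryMap_surjective (r : ℤ) : Function.Surjective ((boundaryMap hθ).f r) := by
  rintro ⟨x, Φ⟩
  change z.complexN'.X (r + 1) at x
  change StarDual Λ (z.complexN'.X (2 * q + 1 - r)) at Φ
  refine ⟨(inA (q : ℤ) (adj z.μ) (r + 1) (undual z.F (dualMap (inA (q : ℤ) (dualMap z.γ) (2 * q + 1 - r)) Φ)) +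
    inB (q : ℤ) (adj z.μ) (r + 1) (outB (q : ℤ) (dualMap z.γ) (r + 1) x),
    dualMap (outA (q : ℤ) (adj z.μ) (2 * q + 1 - r))
      (((-1) ^ q : ℤˣ) • outA (q : ℤ) (dualMap z.γ) (r + 1) x) +
    dualMap (outB (q : ℤ) (adj z.μ) (2 * q + 1 - r))
      (dualMap (inB (q : ℤ) (dualMap z.γ) (2 * q + 1 - r)) Φ)), ?_⟩
  refine (boundaryMapComponent_apply hθ r _ _).trans ?_
  refine Prod.ext (Eq.trans (congrArg₂ (· + ·) ?_ ?_) (inA_add_inB x))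
    (Eq.trans (congrArg₂ (· + ·) ?_ ?_) (dualMap_outA_add_outB _ _ Φ))
  · rw [map_add, dualMap_inA_outB, add_zero]
    by_cases h : r = q
    · rw [dualMap_inA_outA (by omega), smul_smul, Int.units_mul_self, one_smul]
    · rw [inA_eq_zero (by omega), inA_eq_zero (by omega)]
  · rw [map_add, outB_inA, zero_add, inB_outB_inB]
  · rw [map_add, outA_inB, add_zero]
    by_cases h : r = q
    · rw [outA_inA (by omega), evalDual_undual]
    · rw [dualMap_inA_eq_zero (r := 2 * q + 1 - r) (by omega), map_zero, map_zero, map_zero, map_zero]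
  · rw [map_add, dualMap_inB_outA, zero_add]
    by_cases h : r = q + 1
    · rw [dualMap_inB_outB (by omega)]
    · rw [dualMap_inB_eq_zero (r := 2 * q + 1 - r) (by omega),
        dualMap_inB_eq_zero (δ := dualMap z.γ) (r := 2 * q + 1 - r) (by omega), map_zero]

theorem isPoincare_pairC (hθ : z.IsRepresentative θ) : (pairC hθ).IsPoincare :=
  isPoincare_thickening _

theorem isPoincare_pairC'' (hθ : z.IsRepresentative θ) : (pairC'' hθ).IsPoincare :=
  isPoincare_of_thickeningMap (isCycle_structN' hθ) (boundaryMap hθ) (pairC'' hθ)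
    boundaryMap_injective boundaryMap_surjective boundaryMap_symm₀ (pairC'' hθ).isCycle_rel

end RegSplitPreformation

end BoundaryIso

section EndEquivalence

variable {Λ : Type u} [Ring Λ] [StarRing Λ]

open FreeComplex

namespace RegSplitPreformation

section

variable {q : ℕ} {z : RegSplitPreformation Λ ((-1) ^ q)}
  {U : Type u} [AddCommGroup U] [Module Λ U] [Module.Free Λ U] [Module.Finite Λ U]
  {j : U →ₗ[Λ] z.G} (hj : ∀ x, colam j (j x) = 0)
  {A : Type u} [AddCommGroup A] [Module Λ A] [Module.Free Λ A] [Module.Finite Λ A]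
  (δ : A →ₗ[Λ] StarDual Λ z.G)

/-- The component in `G` of an element of the dual complex. -/
def dualG (r : ℤ) : ((twoTerm (q : ℤ) δ).dual (2 * q + 1)).X r →ₗ[Λ] z.G :=
  (undual z.G).toLinearMap ∘ₗ dualMap (inB (q : ℤ) δ (2 * q + 1 - r))

/-- The component in `A^*` of an element of the dual complex. -/
def dualA (r : ℤ) : ((twoTerm (q : ℤ) δ).dual (2 * q + 1)).X r →ₗ[Λ] StarDual Λ A :=
  dualMap (inA (q : ℤ) δ (2 * q + 1 - r))

/-- The map from the dual of a two-term complex to `U → G → U^*` with the given components. -/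
def dualLagMap (σ : ℤˣ) (τ : StarDual Λ A →ₗ[Λ] StarDual Λ U) (r : ℤ) :
    ((twoTerm (q : ℤ) δ).dual (2 * q + 1)).X r →ₗ[Λ] (lagComplex j hj).X r :=
  σ • (in₁ (q : ℤ) j (colam j) hj r ∘ₗ dualG δ r) + in₀ (q : ℤ) j (colam j) hj r ∘ₗ τ ∘ₗ dualA δ r

variable {δ}

theorem dualG_eq_zero {r : ℤ} (h : r ≠ q + 1) (Φ : ((twoTerm (q : ℤ) δ).dual (2 * q + 1)).X r) :
    dualG δ r Φ = 0 := by
  change StarDual Λ ((twoTerm (q : ℤ) δ).X (2 * q + 1 - r)) at Φ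
  change undual z.G (dualMap (inB (q : ℤ) δ (2 * q + 1 - r)) Φ) = 0
  rw [dualMap_inB_eq_zero (by omega), map_zero]

theorem dualA_eq_zero {r : ℤ} (h : r ≠ q) (Φ : ((twoTerm (q : ℤ) δ).dual (2 * q + 1)).X r) :
    dualA δ r Φ = 0 :=
  dualMap_inA_eq_zero (q := (q : ℤ)) (by omega) Φ

theorem dual_ext {r : ℤ} {Φ Ψ : ((twoTerm (q : ℤ) δ).dual (2 * q + 1)).X r}
    (hG : dualG δ r Φ = dualG δ r Ψ) (hA : dualA δ r Φ = dualA δ r Ψ) : Φ = Ψ :=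
  sub_eq_zero.1 (dual_twoTerm_ext (q := (q : ℤ)) (δ := δ)
    ((map_sub (dualA δ r) Φ Ψ).trans (sub_eq_zero.2 hA))
    ((map_sub (dualMap (inB (q : ℤ) δ (2 * q + 1 - r))) Φ Ψ).trans
      (sub_eq_zero.2 ((undual z.G).injective hG))))

theorem dualG_d (i k : ℤ) (h : k + 1 = i) (Φ : ((twoTerm (q : ℤ) δ).dual (2 * q + 1)).X i) :
    dualG δ k (((twoTerm (q : ℤ) δ).dual (2 * q + 1)).d i k h Φ) = 0 := by
  change StarDual Λ ((twoTerm (q : ℤ) δ).X (2 * q + 1 - i)) at Φ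
  change undual z.G (dualMap (inB (q : ℤ) δ (2 * q + 1 - k)) (i.negOnePow •
    dualMap ((twoTerm (q : ℤ) δ).d (2 * q + 1 - k) (2 * q + 1 - i) (by omega)) Φ)) = 0
  rw [map_units_smul, dualMap_inB_d_twoTerm, smul_zero, map_zero]

theorem dualA_d (i k : ℤ) (h : k + 1 = i) (Φ : ((twoTerm (q : ℤ) δ).dual (2 * q + 1)).X i) :
    dualA δ k (((twoTerm (q : ℤ) δ).dual (2 * q + 1)).d i k h Φ) =
      -(((-1) ^ q : ℤˣ) • dualMap δ (evalDual z.G (dualG δ i Φ))) := by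
  change StarDual Λ ((twoTerm (q : ℤ) δ).X (2 * q + 1 - i)) at Φ
  change dualMap (inA (q : ℤ) δ (2 * q + 1 - k)) (i.negOnePow •
    dualMap ((twoTerm (q : ℤ) δ).d (2 * q + 1 - k) (2 * q + 1 - i) (by omega)) Φ) =
    -(((-1) ^ q : ℤˣ) • dualMap δ (evalDual z.G (undual z.G (dualMap (inB (q : ℤ) δ (2 * q + 1 - i)) Φ))))
  rw [map_units_smul, dualMap_inA_d_twoTerm, evalDual_undual]
  by_cases hi : i = q + 1
  · rw [show i.negOnePow = -((-1) ^ q : ℤˣ) by rw [hi, Int.negOnePow_succ, negOnePow_eq],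
      Units.neg_smul]
  · rw [dualMap_inB_eq_zero (r := 2 * q + 1 - i) (by omega), map_zero, smul_zero, smul_zero, neg_zero]

theorem exists_dual (r : ℤ) (x : z.G) (f : StarDual Λ A) :
    ∃ Φ : ((twoTerm (q : ℤ) δ).dual (2 * q + 1)).X r,
      (r = q + 1 → dualG δ r Φ = x) ∧ (r = q → dualA δ r Φ = f) := by
  refine ⟨dualMap (outB (q : ℤ) δ (2 * q + 1 - r)) (evalDual z.G x) +
    dualMap (outA (q : ℤ) δ (2 * q + 1 - r)) f, fun h => ?_, fun h => ?_⟩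
  · refine (map_add (dualG δ r) _ _).trans ?_
    change undual z.G (dualMap (inB _ _ _) (dualMap (outB (q : ℤ) δ (2 * q + 1 - r)) (evalDual z.G x))) +
      undual z.G (dualMap (inB _ _ _) (dualMap (outA (q : ℤ) δ (2 * q + 1 - r)) f)) = x
    rw [dualMap_inB_outA, map_zero, dualMap_inB_outB (by omega), undual_evalDual, add_zero]
  · refine (map_add (dualA δ r) _ _).trans ?_
    change dualMap (inA _ _ _) (dualMap (outB (q : ℤ) δ (2 * q + 1 - r)) (evalDual z.G x)) +
      dualMap (inA _ _ _) (dualMap (outA (q : ℤ) δ (2 * q + 1 - r)) f) = f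
    rw [dualMap_inA_outB, dualMap_inA_outA (by omega), zero_add]

variable {hj} {σ : ℤˣ} {τ : StarDual Λ A →ₗ[Λ] StarDual Λ U}

theorem dualLagMap_apply (r : ℤ) (Φ : ((twoTerm (q : ℤ) δ).dual (2 * q + 1)).X r) :
    dualLagMap hj δ σ τ r Φ = σ • in₁ (q : ℤ) j (colam j) hj r (dualG δ r Φ) +
      in₀ (q : ℤ) j (colam j) hj r (τ (dualA δ r Φ)) := rfl

theorem out₂_dualLagMap (r : ℤ) (Φ : ((twoTerm (q : ℤ) δ).dual (2 * q + 1)).X r) :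
    out₂ (q : ℤ) j (colam j) hj r (dualLagMap hj δ σ τ r Φ) = 0 := by
  rw [dualLagMap_apply, map_add, map_units_smul, out₂_in₁, out₂_in₀, smul_zero, add_zero]

theorem out₁_dualLagMap (r : ℤ) (Φ : ((twoTerm (q : ℤ) δ).dual (2 * q + 1)).X r) :
    out₁ (q : ℤ) j (colam j) hj r (dualLagMap hj δ σ τ r Φ) = σ • dualG δ r Φ := by
  rw [dualLagMap_apply, map_add, map_units_smul, out₁_in₀, add_zero]
  by_cases hr : r = q + 1
  · rw [out₁_in₁ hr]
  · rw [out₁_eq_zero hr, dualG_eq_zero hr]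

theorem out₀_dualLagMap (r : ℤ) (Φ : ((twoTerm (q : ℤ) δ).dual (2 * q + 1)).X r) :
    out₀ (q : ℤ) j (colam j) hj r (dualLagMap hj δ σ τ r Φ) = τ (dualA δ r Φ) := by
  rw [dualLagMap_apply, map_add, map_units_smul, out₀_in₁, smul_zero, zero_add]
  by_cases hr : r = q
  · rw [out₀_in₀ hr]
  · rw [out₀_eq_zero hr, dualA_eq_zero hr, map_zero]

theorem isChainEquivalence_dualLagMap
    (hτ : ∀ x, τ (dualMap δ (evalDual z.G x)) = -(((-1) ^ q * σ : ℤˣ) • colam j x))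
    (hker : ∀ f, τ f = 0 → ∃ u, dualMap δ (evalDual z.G (j u)) = f)
    (hsurj : Function.Surjective τ)
    (hinj : ∀ u, dualMap δ (evalDual z.G (j u)) = 0 → u = 0) :
    IsChainEquivalence ((twoTerm (q : ℤ) δ).dual (2 * q + 1)) (lagComplex j hj)
      (dualLagMap hj δ σ τ) := by
  refine IsQuasiIso.isChainEquivalence ⟨?_, ?_⟩ ?_
  · intro i k l hik hkl Φ y hΦ hy
    have h1 := congrArg (out₁ (q : ℤ) j (colam j) hj k) hy
    have h0 := congrArg (out₀ (q : ℤ) j (colam j) hj k) hy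
    rw [out₁_d, out₁_dualLagMap] at h1
    rw [out₀_d, out₀_dualLagMap] at h0
    have h2 := congrArg (dualA δ l) hΦ
    rw [dualA_d, map_zero, neg_eq_zero, smul_eq_zero_iff_eq] at h2
    have hu : out₂ (q : ℤ) j (colam j) hj i y = 0 := hinj _ (by
      rw [h1, map_units_smul, map_units_smul, h2, smul_zero])
    rw [hu, map_zero, eq_comm, smul_eq_zero_iff_eq] at h1
    set x := out₁ (q : ℤ) j (colam j) hj i y
    obtain ⟨u, hu⟩ := hker (dualA δ k Φ + (((-1) ^ q * σ : ℤˣ) • dualMap δ (evalDual z.G x))) (by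
      rw [map_add, map_units_smul, hτ, ← h0, smul_neg, smul_smul, Int.units_mul_self, one_smul,
        add_neg_cancel])
    obtain ⟨Φ', hG, -⟩ := exists_dual (δ := δ) i
      (-(((-1) ^ q : ℤˣ) • (j u - ((-1) ^ q * σ : ℤˣ) • x))) 0
    refine ⟨Φ', dual_ext ?_ ?_⟩
    · rw [dualG_d, h1]
    · by_cases hk : k = q
      · rw [dualA_d, hG (by omega), map_neg, map_neg, smul_neg, neg_neg, map_units_smul,
          map_units_smul, smul_smul, Int.units_mul_self, one_smul, map_sub, map_sub, hu,
          map_units_smul, map_units_smul, add_sub_cancel_right]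
      · rw [dualA_eq_zero hk, dualA_eq_zero hk]
  · intro i k l hik hkl y hy
    have h1 := congrArg (out₁ (q : ℤ) j (colam j) hj l) hy
    have h0 := congrArg (out₀ (q : ℤ) j (colam j) hj l) hy
    rw [out₁_d, map_zero] at h1
    rw [out₀_d, map_zero] at h0
    have hu : out₂ (q : ℤ) j (colam j) hj k y = 0 := hinj _ (by rw [h1, map_zero, map_zero])
    set x := out₁ (q : ℤ) j (colam j) hj k y with hx
    obtain ⟨u, hu'⟩ := hker (dualMap δ (evalDual z.G x)) (by rw [hτ, h0, smul_zero, neg_zero])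
    obtain ⟨c, hc⟩ := hsurj (out₀ (q : ℤ) j (colam j) hj k y)
    obtain ⟨Φ, hG, hA⟩ := exists_dual (δ := δ) k (σ • (x - j u)) c
    refine ⟨Φ, in₂ (q : ℤ) j (colam j) hj i u, dual_ext ?_ ?_, threeTerm_ext ?_ ?_ ?_⟩
    · rw [dualG_d, map_zero]
    · rw [dualA_d, map_zero]
      by_cases hk : k = q + 1
      · rw [hG hk, map_units_smul, map_units_smul, map_sub, map_sub, hu', sub_self, smul_zero,
          smul_zero, neg_zero]
      · rw [dualG_eq_zero hk, map_zero, map_zero, smul_zero, neg_zero]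
    · rw [map_add, out₂_dualLagMap, out₂_d, add_zero, hu]
    · rw [map_add, out₁_dualLagMap, out₁_d, ← hx]
      by_cases hk : k = q + 1
      · rw [hG hk, out₂_in₂ (by omega), smul_smul, Int.units_mul_self, one_smul, sub_add_cancel]
      · rw [dualG_eq_zero hk, out₂_eq_zero (by omega), map_zero, smul_zero, add_zero, hx,
          out₁_eq_zero hk]
    · rw [map_add, out₀_dualLagMap, out₀_d, out₁_in₂, map_zero, add_zero]
      by_cases hk : k = q
      · rw [hA hk, hc]
      · rw [dualA_eq_zero hk, map_zero, out₀_eq_zero hk]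
  · intro i k h
    refine LinearMap.ext fun Φ => ?_
    change (lagComplex j hj).d i k h (dualLagMap hj δ σ τ i Φ) = dualLagMap hj δ σ τ k
      (((twoTerm (q : ℤ) δ).dual (2 * q + 1)).d i k h Φ)
    refine threeTerm_ext ?_ ?_ ?_
    · rw [out₂_d, out₂_dualLagMap]
    · rw [out₁_d, out₁_dualLagMap, out₂_dualLagMap, dualG_d, map_zero, smul_zero]
    · rw [out₀_d, out₀_dualLagMap, out₁_dualLagMap, dualA_d, map_neg, map_units_smul, map_units_smul,
        hτ, smul_neg, neg_neg, smul_smul, ← mul_assoc, Int.units_mul_self, one_mul]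

end

section

variable {q : ℕ} {z : RegSplitPreformation Λ ((-1) ^ q)} {θ : z.G →ₗ[Λ] StarDual Λ z.G}
  {hθ : z.IsRepresentative θ}
  {U : Type u} [AddCommGroup U] [Module Λ U] [Module.Free Λ U] [Module.Finite Λ U]
  {j : U →ₗ[Λ] z.G} (hj : ∀ x, colam j (j x) = 0) (ρ : U →ₗ[Λ] StarDual Λ U)
  (hρ : ∀ x y, star (ρ x y) + ((-1) ^ q : ℤˣ) • ρ y x + θ (j y) (j x) = 0)

theorem dualMap_dualMap_evalDual (x : z.G) :
    dualMap (dualMap z.γ) (evalDual z.G x) = evalDual z.F (z.γ x) := rfl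

theorem isChainEquivalence_endLeft (hL : z.IsLagrangianMap j) :
    IsChainEquivalence (pairC'' hθ).D (lagPair hj hθ ρ hρ).D
      (QuadPair.endLeft (c := pairC'' hθ) (c' := pairC hθ) (lagPair hj hθ ρ hρ)) := by
  have h := isChainEquivalence_dualLagMap (hj := hj) (δ := dualMap z.γ) (σ := 1)
    (τ := -(((-1) ^ q : ℤˣ) • (dualMap j ∘ₗ adj z.μ ∘ₗ (undual z.F).toLinearMap)))
    (fun x => ?_) (fun Ψ hΨ => ?_) (fun η => ?_) (fun u hu => ?_)
  · refine Eq.mp (congrArg (IsChainEquivalence _ _) (funext fun r => LinearMap.ext fun Φ => ?_)) h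
    refine Eq.trans ?_ (lagMap_apply (hθ := hθ) hj r (inFst hθ r Φ)).symm
    change StarDual Λ (z.complexN'.X (2 * q + 1 - r)) at Φ
    change dualLagMap hj (dualMap z.γ) 1 _ r Φ = in₁ (q : ℤ) j (colam j) hj r (gVal hθ r (inFst hθ r Φ)) +
      in₀ (q : ℤ) j (colam j) hj r (dualMap j (alphaB hθ r (inFst hθ r Φ)))
    rw [gVal_inFst, alphaB_inFst, map_neg, map_units_smul]
    exact (dualLagMap_apply (hj := hj) r Φ).trans (congrArg (· + _) (one_smul ℤˣ _))
  · change -(((-1) ^ q : ℤˣ) • dualMap j (adj z.μ (undual z.F (dualMap (dualMap z.γ) (evalDual z.G x))))) = _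
    rw [dualMap_dualMap_evalDual, undual_evalDual, adj_μ_γ, colam_apply, map_neg, map_units_smul,
      mul_one]
  · replace hΨ : -(((-1) ^ q : ℤˣ) • dualMap j (adj z.μ (undual z.F Ψ))) = 0 := hΨ
    rw [neg_eq_zero, smul_eq_zero_iff_eq] at hΨ
    obtain ⟨u, hu⟩ := hL.exact_γ (undual z.F Ψ) fun u => star_eq_zero.1 (DFunLike.congr_fun hΨ u)
    exact ⟨u, by rw [dualMap_dualMap_evalDual, hu, evalDual_undual]⟩
  · obtain ⟨f, hf⟩ := hL.surjective_μ (-(((-1) ^ q : ℤˣ) • η))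
    refine ⟨evalDual z.F f, ?_⟩
    change -(((-1) ^ q : ℤˣ) • dualMap j (adj z.μ (undual z.F (evalDual z.F f)))) = η
    rw [undual_evalDual, show dualMap j (adj z.μ f) = _ from StarDual.ext hf, smul_neg, neg_neg,
      smul_smul, Int.units_mul_self, one_smul]
  · rw [dualMap_dualMap_evalDual] at hu
    exact hL.injective_γ u (evalDual_bijective.1 (hu.trans (map_zero _).symm))

theorem isChainEquivalence_endRight (hL : z.IsLagrangianMap j) :
    IsChainEquivalence (pairC hθ).D (lagPair hj hθ ρ hρ).D
      (QuadPair.endRight (c := pairC'' hθ) (c' := pairC hθ) (lagPair hj hθ ρ hρ)) := by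
  have e : ∀ x : z.G, dualMap (adj z.μ) (evalDual z.G x) = z.μ x := fun x => StarDual.ext fun f =>
    star_star _
  have h := isChainEquivalence_dualLagMap (hj := hj) (δ := adj z.μ) (σ := -1)
    (τ := -(dualMap j ∘ₗ dualMap z.γ))
    (fun x => ?_) (fun φ hφ => ?_) (fun η => ?_) (fun u hu => ?_)
  · refine Eq.mp (congrArg (IsChainEquivalence _ _) (funext fun r => LinearMap.ext fun Φ => ?_)) h
    refine Eq.trans ?_ (lagMap_apply (hθ := hθ) hj r (inLast hθ r Φ)).symm
    change StarDual Λ (z.complexN.X (2 * q + 1 - r)) at Φ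
    change dualLagMap hj (adj z.μ) (-1) _ r Φ = in₁ (q : ℤ) j (colam j) hj r (gVal hθ r (inLast hθ r Φ)) +
      in₀ (q : ℤ) j (colam j) hj r (dualMap j (alphaB hθ r (inLast hθ r Φ)))
    rw [gVal_inLast, alphaB_inLast, map_neg, map_neg (dualMap j), map_neg]
    refine (dualLagMap_apply (hj := hj) r Φ).trans (congrArg₂ (· + ·) ?_ (map_neg (in₀ _ _ _ _ _) _))
    exact (Units.neg_smul 1 _).trans (congrArg Neg.neg (one_smul ℤˣ _))
  · change -(dualMap j (dualMap z.γ (dualMap (adj z.μ) (evalDual z.G x)))) = _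
    rw [e, colam_apply, mul_neg, mul_one, Units.neg_smul, neg_neg, smul_neg, smul_smul,
      Int.units_mul_self, one_smul]
  · replace hφ : -(dualMap j (dualMap z.γ φ)) = 0 := hφ
    rw [neg_eq_zero] at hφ
    obtain ⟨u, hu⟩ := hL.exact_μ φ (DFunLike.congr_fun hφ)
    exact ⟨u, by rw [e, hu]⟩
  · obtain ⟨φ, h⟩ := hL.surjective_γ (-η)
    refine ⟨φ, ?_⟩
    change -(dualMap j (dualMap z.γ φ)) = η
    rw [show dualMap j (dualMap z.γ φ) = -η from StarDual.ext h, neg_neg]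
  · exact hL.injective_μ u (by rwa [e] at hu)

end

section

variable {q : ℕ} {z : RegSplitPreformation Λ ((-1) ^ q)}

theorem isCobordantToHCobordism_of_isElementary (θ : z.G →ₗ[Λ] StarDual Λ z.G)
    (hθ : z.IsRepresentative θ) (hz : z.IsElementary) :
    QuadPair.IsCobordantToHCobordism (pairX z θ hθ) := by
  obtain ⟨U, hU⟩ := hz
  have := hU.free
  have := hU.finite
  have hL := hU.isLagrangianMap
  have hlam := hL.lam_eq_zero
  obtain ⟨χ, hχ⟩ := exists_eq_add_star ((-1) ^ q : ℤˣ) (dualMap U.subtype ∘ₗ θ ∘ₗ U.subtype)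
    (fun x y => by
      have h := DFunLike.congr_fun (LinearMap.congr_fun hθ.add_transpose (U.subtype x)) (U.subtype y)
      replace h : θ x y + (-(-1) ^ q : ℤˣ) • star (θ y x) = z.μ x (z.γ y) := h
      rw [show z.μ x (z.γ y) = 0 from hlam x y, Units.neg_smul, ← sub_eq_add_neg, sub_eq_zero] at h
      exact h)
    (fun x => (hθ.mk_apply x).trans (hU.quad_eq_zero x x.2))
  have hj : ∀ x, colam U.subtype (U.subtype x) = 0 := fun x => by
    rw [colam_apply, show dualMap U.subtype (dualMap z.γ (z.μ (U.subtype x))) = 0 from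
      StarDual.ext fun y => hlam x y, smul_zero, neg_zero]
  have hρ : ∀ x y : U, star ((-(((-1) ^ q : ℤˣ) • χ)) x y) +
      ((-1) ^ q : ℤˣ) • (-(((-1) ^ q : ℤˣ) • χ)) y x + θ (U.subtype y) (U.subtype x) = 0 := by
    intro x y
    change star (-(((-1) ^ q : ℤˣ) • χ x y)) + ((-1) ^ q : ℤˣ) • -(((-1) ^ q : ℤˣ) • χ y x) +
      (dualMap U.subtype ∘ₗ θ ∘ₗ U.subtype) y x = 0
    rw [hχ, star_neg, star_units_smul, smul_neg, smul_smul, Int.units_mul_self,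
      one_smul]
    abel
  refine ⟨lagPair hj hθ _ hρ, ⟨isPoincare_pairC'' hθ, isPoincare_pairC hθ, isPoincare_lagPair hj _ hρ,
    isChainEquivalence_endLeft hj _ hρ hL, isChainEquivalence_endRight hj _ hρ hL⟩,
    isPoincare_pairX z θ hθ, isPoincare_lagPair hj _ hρ, tracePair hj hθ _ hρ,
    isPoincare_tracePair hj hlam _ hρ⟩

end

end RegSplitPreformation

end EndEquivalence

end AlgSurgery

end

theorem theorem2p9 {Λ : Type*} [Ring Λ] [StarRing Λ] [IsStablyFiniteRing Λ] (q : ℕ) (hq : 2 ≤ q)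
    (z : AlgSurgery.RegSplitPreformation Λ ((-1) ^ q))
    (θ : z.G →ₗ[Λ] AlgSurgery.StarDual Λ z.G) (hθ : z.IsRepresentative θ) :
    (AlgSurgery.RegSplitPreformation.pairX z θ hθ).IsPoincare ∧
    (z.IsElementary →
      AlgSurgery.QuadPair.IsCobordantToHCobordism
        (AlgSurgery.RegSplitPreformation.pairX z θ hθ)) ∧
    (AlgSurgery.QuadPair.IsCobordantToHCobordism
        (AlgSurgery.RegSplitPreformation.pairX z θ hθ) →
      AlgSurgery.LMonoid.IsElementary (AlgSurgery.LMonoid.mk z)) :=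
  ⟨AlgSurgery.RegSplitPreformation.isPoincare_pairX z θ hθ,
    AlgSurgery.RegSplitPreformation.isCobordantToHCobordism_of_isElementary θ hθ,
    fun ⟨_, hx, _, _, e, he⟩ =>
      AlgSurgery.RegSplitPreformation.isElementary_of_isPoincare hx e he⟩
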